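/- **Model.** Let $T,N\ge 1$, $H\in[0,\tfrac12)$, $c,v_0\in\mathbb R$, $K(t)=ct^H$, and let $\Theta\subset\mathbb R^d$. Let $b_\theta(v),\sigma_\theta(v)$ be measurable in $(\theta,v)\in\Theta\times\mathbb R$ with $|b_\theta(v)|+|\sigma_\theta(v)|\le B(1+|v|)$ for all $\theta,v$. For every $\theta\in\Theta$ let $V=V^\theta$ be a continuous adapted solution on $[0,T]$ of $$V_t=v_0+\int_0^tK(t-s)\{b_\theta(V_s)\,ds+\sigma_\theta(V_s)\,dW_s\},$$ with $W$ a Brownian motion (e.g. $b_\theta(v)=\kappa-\lambda v$, $\sigma_\theta(v)=\nu\sqrt{|v|}$ with $\theta=(\kappa,\lambda,\nu)$ in a bounded set). Put $\Delta_l=2^{-l}$, and let $V^l$ be the Euler scheme driven by the increments $\overline W_{(k+1)\Delta_l}=W_{(k+1)\Delta_l}-W_{k\Delta_l}$: $$V^l_{(k+1)\Delta_l}=v_0+\sum_{j=0}^kK((k+1-j)\Delta_l)\{b_\theta(V^l_{j\Delta_l})\Delta_l+\sigma_\theta(V^l_{j\Delta_l})\overline W_{(j+1)\Delta_l}\}.$$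 Given data $y_0,\dots,y_T$, the likelihood is $\prod_{t=1}^T\overline g(y_t;y_{t-1},\int_{t-1}^t\overline f(V_s)ds,\int_{t-1}^t\overline h(V_s)dW_s)$; at level $l$ it is $\prod_t\kappa_{t,l}$, where $$\kappa_{t,l}=\overline g\Big(y_t;y_{t-1},\Delta_l\sum_{k=0}^{\Delta_l^{-1}-1}\overline f(V^l_{t-1+k\Delta_l}),\sum_{k=0}^{\Delta_l^{-1}-1}\overline h(V^l_{t-1+k\Delta_l})\overline W_{t-1+(k+1)\Delta_l}\Big).$$ Let $d\theta$ be a $\sigma$-finite measure on $\Theta$ and $\pi(\theta)$ a prior probability density with respect to it; $\mathbb E_{\pi}$ and $\mathbb E_{\pi^l}$ denote the posterior expectations of the continuous-time model and of the model discretized at level $l$. **Algorithms.** Fix proposal densities $q_l(\theta'|\theta)$. Level-$l$ *PMCMC* is the Metropolis–Hastings chain that draws $\theta'\sim q_l(\cdot|\theta)$, runs with $\theta'$ an $N$-particle filter with potentials $\kappa_{t,l}$ (multinomial resampling, one trajectory selected at the end, normalizing constant estimate $\hat p_{\theta'}=\prod_t\frac1N\sum_i\kappa^i_{t,l}$), and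 accepts with probability $\min\{1,\hat p_{\theta'}\pi(\theta')q_l(\theta|\theta')/(\hat p_\theta\pi(\theta)q_l(\theta'|\theta))\}$; the state of the chain consists of the parameter and all variables of the particle filter. The *coupled* chain at level $l\ge1$ is the same with potentials $\max\{\kappa_{t,l},\kappa_{t,l-1}\}$, where the level $l-1$ increments are sums of adjacent level $l$ increments. For $\varphi:\Theta\times\mathbb R^T\to\mathbb R$, PMCMC run for $M$ iterations gives the average $\frac1{M+1}\sum_{k=0}^M\varphi(\theta_k,v^l_{k,1:T})$. The coupled chain gives the estimate $$\frac{\sum_{k=0}^M\varphi(\theta_k,v^l_{k,1:T})H_{1,l}}{\sum_{k=0}^MH_{1,l}}-\frac{\sum_{k=0}^M\varphi(\theta_k,v^{l-1}_{k,1:T})H_{2,l}}{\sum_{k=0}^MH_{2,l}}$$ of $\mathbb E_{\pi^l}[\varphi]-\mathbb E_{\pi^{l-1}}[\varphi]$, with $H_{1,l}=\prod_t\kappa_{t,l}/\max\{\kappa_{t,l},\kappa_{t,l-1}\}$ and $H_{2,l}=\prod_t\kappa_{t,l-1}/\max\{\kappa_{t,l},\kappa_{t,l-1}\}$ evaluated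 at the $k$-th state. The multilevel estimator $\widehat E^{L,M_{0:L}}$ is the PMCMC average at level $0$ with $M_0$ iterations plus the sum over $l=1,\dots,L$ of the coupled estimates with $M_l$ iterations, all chains independent and started in stationarity. Cost is the number of elementary operations: random draws, summands of the Euler scheme and of the likelihood, density and test function evaluations, copied scalars, inspected weights. **Assumptions.** (1) $\overline f,\overline h$ are bounded and Lipschitz; for all $y,y'$ the function $\overline g(y;y',\cdot,\cdot)$ is Lipschitz and takes values in some $[\underline C,\overline C]$ with $0<\underline C<\overline C<\infty$. (2) For every $r\in[1,2]$ there is $C<\infty$ with $\sup_{\theta\in\Theta}\mathbb E[|V^l_t-V_t|^r]^{1/r}\le C\Delta_l^\beta$ for all $l\ge0$ and $t\in\{\Delta_l,2\Delta_l,\dots,T\}$, where $0<\beta\le H+\frac12$. (3) There is $\xi\in(0,1)$, the same for all levels, such that the kernel of level-$0$ PMCMC and that of the coupled chain at each level $l\ge1$ satisfy $K_l(w,\cdot)\ge\xi\nu_l$ for all states $w$ and some probability measure $\nu_l$. (3') The same for the PMCMC kernels of all levels $l\ge0$. **Statement.** Let $\varphi$ be bounded and Lipschitz (for the $L_1$-distance).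 (a) Under (1), (2), (3) there is $C<\infty$ such that for all $L\ge0$ and $M_0,\dots,M_L\ge1$ $$\mathbb E\big[(\widehat E^{L,M_{0:L}}-\mathbb E_{\pi^L}[\varphi])^2\big]\le C\,R,\qquad R=\sum_{l=0}^L\frac{\Delta_l^{2\beta}}{M_l}+\sum_{l=0}^L\sum_{q\ne l}\frac{\Delta_l^\beta}{M_l}\frac{\Delta_q^\beta}{M_q},$$ the cost is at most $C\sum_{l=0}^L\Delta_l^{-2}M_l$, $(\mathbb E_{\pi^L}[\varphi]-\mathbb E_\pi[\varphi])^2\le C\Delta_L^{2\beta}$, and $\mathbb E[(\widehat E^{L,M_{0:L}}-\mathbb E_\pi[\varphi])^2]\le C(R+\Delta_L^{2\beta})$. (b) If moreover $\beta=H+\frac12$, then $C$ can be chosen such that for every $\varepsilon\in(0,1)$, with $L=\lceil2\log_2(1/\varepsilon)/(2H+1)\rceil$ and $M_l=\lceil\varepsilon^{-2}\Delta_l^{(2H+3)/2}\Delta_L^{H-1/2}\rceil$, the mean square error $\mathbb E[(\widehat E^{L,M_{0:L}}-\mathbb E_\pi[\varphi])^2]$ is at most $C\varepsilon^2$ and the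 cost is at most $C\varepsilon^{-4/(2H+1)}$. (c) Under (1), (2), (3') with $\beta=H+\frac12$ there is $C<\infty$ such that for every $\varepsilon\in(0,1)$ the single-level PMCMC average at level $L=\lceil2\log_2(1/\varepsilon)/(2H+1)\rceil$ with $M=\lceil\varepsilon^{-2}\rceil$ iterations, started in stationarity, has mean square error at most $C\varepsilon^2$ with respect to $\mathbb E_\pi[\varphi]$, at a cost of at most $C\varepsilon^{-2(2H+3)/(2H+1)}$. For $H=0.4$ the two cost exponents are $-20/9$ and $-38/9$. -/

import Mathlib

open MeasureTheory ProbabilityTheory Filter Topology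
open scoped ENNReal NNReal BigOperators

namespace VolterraPMCMC

noncomputable section

/-! ## Itô integrals of square integrable integrands -/

/-- A bounded adapted step process `∑ i < n, ξ i · 1_{(t i, t (i+1)]}`. -/
structure StepProcess {Ω : Type*} {mΩ : MeasurableSpace Ω} (ℱ : Filtration ℝ≥0 mΩ) where
  n : ℕ
  t : ℕ → ℝ≥0
  mono : Monotone t
  ξ : ℕ → Ω → ℝ
  meas : ∀ i, Measurable[ℱ (t i)] (ξ i)
  bdd : ∃ B : ℝ, ∀ i ω, |ξ i ω| ≤ B

/-- The value of the step process at time `s`. -/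
def StepProcess.value {Ω : Type*} {mΩ : MeasurableSpace Ω} {ℱ : Filtration ℝ≥0 mΩ}
    (S : StepProcess ℱ) (s : ℝ≥0) (ω : Ω) : ℝ :=
  ∑ i ∈ Finset.range S.n, (Set.Ioc (S.t i) (S.t (i + 1))).indicator (fun _ => S.ξ i ω) s

/-- The elementary stochastic integral of a step process with respect to `W`. -/
def StepProcess.integral {Ω : Type*} {mΩ : MeasurableSpace Ω} {ℱ : Filtration ℝ≥0 mΩ}
    (S : StepProcess ℱ) (W : ℝ≥0 → Ω → ℝ) (ω : Ω) : ℝ :=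
  ∑ i ∈ Finset.range S.n, S.ξ i ω * (W (S.t (i + 1)) ω - W (S.t i) ω)

/-- `X` is (a version of) the Itô integral `∫_a^b F_s dW_s`: the `L²(P)`-limit of the elementary
integrals of adapted step processes on `(a, b]` that converge to `F` in `L²(ds ⊗ P)`. -/
def IsItoIntegral {Ω : Type*} {mΩ : MeasurableSpace Ω} (P : Measure Ω) (ℱ : Filtration ℝ≥0 mΩ)
    (W : ℝ≥0 → Ω → ℝ) (F : ℝ≥0 → Ω → ℝ) (a b : ℝ≥0) (X : Ω → ℝ) : Prop :=
  Measurable X ∧ ∃ S : ℕ → StepProcess ℱ,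
    (∀ n, a ≤ (S n).t 0 ∧ (S n).t (S n).n ≤ b) ∧
    Tendsto (fun n => ∫⁻ ω, (∫⁻ s in Set.Ioc (a : ℝ) b,
      ENNReal.ofReal (((S n).value s.toNNReal ω - F s.toNNReal ω) ^ 2)) ∂P) atTop (𝓝 0) ∧
    Tendsto (fun n => ∫⁻ ω, ENNReal.ofReal (((S n).integral W ω - X ω) ^ 2) ∂P) atTop (𝓝 0)

open Classical in
/-- A chosen version of the Itô integral `∫_a^b F_s dW_s` (and `0` if there is none). -/
def itoIntegral {Ω : Type*} {mΩ : MeasurableSpace Ω} (P : Measure Ω) (ℱ : Filtration ℝ≥0 mΩ)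
    (W : ℝ≥0 → Ω → ℝ) (F : ℝ≥0 → Ω → ℝ) (a b : ℝ≥0) : Ω → ℝ :=
  if hX : ∃ X, IsItoIntegral P ℱ W F a b X then hX.choose else 0

/-- `W` is a Brownian motion with respect to the filtration `ℱ`. -/
structure IsFilteredBrownian {Ω : Type*} {mΩ : MeasurableSpace Ω} (P : Measure Ω)
    (ℱ : Filtration ℝ≥0 mΩ) (W : ℝ≥0 → Ω → ℝ) : Prop where
  brownian : IsBrownianReal W P
  adapted : Adapted ℱ W
  indep : ∀ s t : ℝ≥0, s ≤ t →
    Indep (MeasurableSpace.comap (fun ω => W t ω - W s ω) inferInstance) (ℱ s) P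

/-! ## Discretization -/

/-- The step size `Δ_l = 2^{-l}`. -/
def stepSize (l : ℕ) : ℝ≥0 := (2 ^ l)⁻¹

/-- Brownian increments on `[0, T]` at level `l`: `w t k` is the increment over
`[t + k Δ_l, t + (k + 1) Δ_l]`, for `t = 0, …, T - 1`. -/
abbrev Path (T l : ℕ) : Type := Fin T → Fin (2 ^ l) → ℝ

/-- The increments in chronological order. -/
def Path.incr {T l : ℕ} (w : Path T l) (k : ℕ) : ℝ :=
  if hk : k / 2 ^ l < T then
    w ⟨k / 2 ^ l, hk⟩ ⟨k % 2 ^ l, Nat.mod_lt _ (Nat.two_pow_pos l)⟩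
  else 0

/-- Level `l` increments as sums of adjacent level `l + 1` increments. -/
def Path.coarsen {T l : ℕ} (w : Path T (l + 1)) : Path T l := fun t k =>
  w t ⟨2 * k, by have := k.2; rw [pow_succ]; omega⟩ +
    w t ⟨2 * k + 1, by have := k.2; rw [pow_succ]; omega⟩

/-- The law of the increments over one unit time interval: `2^l` independent `N(0, Δ_l)`. -/
def blockLaw (l : ℕ) : Measure (Fin (2 ^ l) → ℝ) :=
  Measure.pi fun _ => gaussianReal 0 (stepSize l)

/-- The law of all increments on `[0, T]`. -/
def pathLaw (T l : ℕ) : Measure (Path T l) := Measure.pi fun _ => blockLaw l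

/-- The Euler scheme for `V_t = v₀ + ∫_0^t K(t - s) (b(V_s) ds + σ(V_s) dW_s)` with step `Δ`,
where `w j` is the increment of `W` over `[j Δ, (j + 1) Δ]`. -/
def euler (K b σ : ℝ → ℝ) (v₀ Δ : ℝ) (w : ℕ → ℝ) : ℕ → ℝ
  | 0 => v₀
  | k + 1 => v₀ + ∑ j : Fin (k + 1),
      (K (((k : ℝ) + 1 - (j : ℕ)) * Δ) * b (euler K b σ v₀ Δ w j) * Δ +
        K (((k : ℝ) + 1 - (j : ℕ)) * Δ) * σ (euler K b σ v₀ Δ w j) * w j)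
  decreasing_by all_goals exact j.2

/-! ## Particle filters with a general potential -/

/-- All random variables generated by a run of a particle filter with `N` particles: the increments
of each particle over each unit time interval, the ancestor indices of the `T - 1` resampling steps,
and the index of the trajectory selected at the end. -/
abbrev PFVars (N T l : ℕ) : Type :=
  (Fin T → Fin N → Fin (2 ^ l) → ℝ) × (Fin (T - 1) → Fin N → Fin N) × Fin N

/-- The trajectory of particle `i` before the `t`-th weighting (`t = 0, …, T - 1`); only its entries
with time index at most `t` are meaningful. -/
def pfPath {N T l : ℕ} (u : PFVars N T l) : ℕ → Fin N → Path T l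
  | 0, i, s => u.1 s i
  | t + 1, i, s =>
      if hs : (s : ℕ) ≤ t ∧ t < T - 1 then pfPath u t (u.2.1 ⟨t, hs.2⟩ i) s else u.1 s i

/-- The normalized weight of particle `i` at time `t`. -/
def pfWeight {N T l : ℕ} (G : Fin T → Path T l → ℝ) (u : PFVars N T l) (t : Fin T) (i : Fin N) :
    ℝ :=
  G t (pfPath u t i) / ∑ j, G t (pfPath u t j)

/-- The normalizing constant estimate `∏_t N⁻¹ ∑_i G_t`. -/
def pfNormConst {N T l : ℕ} (G : Fin T → Path T l → ℝ) (u : PFVars N T l) : ℝ :=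
  ∏ t : Fin T, (N : ℝ)⁻¹ * ∑ i, G t (pfPath u t i)

/-- The trajectory selected at the end. -/
def pfOutput {N T l : ℕ} (u : PFVars N T l) : Path T l := pfPath u (T - 1) u.2.2

/-- Gaussian law for the increments, counting measure for all indices. -/
def pfBase (N T l : ℕ) : Measure (PFVars N T l) :=
  (Measure.pi fun _ : Fin T => Measure.pi fun _ : Fin N => blockLaw l).prod
    (Measure.count.prod Measure.count)

open Classical in
/-- The density with respect to `pfBase` of the law of the particle filter: the product of the
probabilities of all the selected indices (multinomial resampling, then the final selection). -/
def pfDensity {N T l : ℕ} (G : Fin T → Path T l → ℝ) (u : PFVars N T l) : ℝ :=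
  (∏ t : Fin (T - 1), ∏ i : Fin N,
      pfWeight G u ⟨t, lt_of_lt_of_le t.2 (Nat.sub_le T 1)⟩ (u.2.1 t i)) *
    (if hT : 0 < T then pfWeight G u ⟨T - 1, Nat.sub_lt hT one_pos⟩ u.2.2 else 1)

/-! ## The model -/

/-- The data of the inference problem and of the algorithms. -/
structure Model (d T : ℕ) (Y : Type*) where
  /-- the parameter space -/
  Θ : Set (Fin d → ℝ)
  /-- the Hurst parameter -/
  H : ℝ
  /-- the constant of the Volterra kernel `K(t) = c t^H` -/
  c : ℝ
  /-- the starting point -/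
  v₀ : ℝ
  /-- the drift coefficient -/
  b : Θ → ℝ → ℝ
  /-- the diffusion coefficient -/
  σ : Θ → ℝ → ℝ
  /-- the function `f̄` of the observation density -/
  f : ℝ → ℝ
  /-- the function `h̄` of the observation density -/
  h : ℝ → ℝ
  /-- the observation density `ḡ(y; y', x₁, x₂)` -/
  g : Y → Y → ℝ → ℝ → ℝ
  /-- the data `y_0, …, y_T` -/
  y : ℕ → Y
  /-- the dominating measure `dθ` on the parameter space -/
  dθ : Measure Θ
  /-- the prior density -/
  prior : Θ → ℝ
  /-- the proposal density: `q l θ θ'` is `q_l(θ' | θ)` -/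
  q : ℕ → Θ → Θ → ℝ
  /-- the number of particles -/
  N : ℕ

namespace Model

variable {d T : ℕ} {Y : Type*} (m : Model d T Y)

/-- Standing assumptions: measurability, probability densities, `H ∈ [0, 1/2)`, and linear growth of
the coefficients of the Volterra equation, uniformly in the parameter. -/
structure Standing : Prop where
  T_pos : 0 < T
  N_pos : 0 < m.N
  H_nonneg : 0 ≤ m.H
  H_lt : m.H < 1 / 2
  b_meas : Measurable (Function.uncurry m.b)
  σ_meas : Measurable (Function.uncurry m.σ)
  growth : ∃ B : ℝ, ∀ θ v, |m.b θ v| ≤ B * (1 + |v|) ∧ |m.σ θ v| ≤ B * (1 + |v|)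
  sigmaFinite : SigmaFinite m.dθ
  prior_meas : Measurable m.prior
  prior_nonneg : ∀ θ, 0 ≤ m.prior θ
  prior_total : ∫⁻ θ, ENNReal.ofReal (m.prior θ) ∂m.dθ = 1
  q_meas : ∀ l, Measurable (Function.uncurry (m.q l))
  q_nonneg : ∀ l θ θ', 0 ≤ m.q l θ θ'
  q_total : ∀ l θ, ∫⁻ θ', ENNReal.ofReal (m.q l θ θ') ∂m.dθ = 1

/-- The prior distribution. -/
def priorLaw : Measure m.Θ := m.dθ.withDensity fun θ => ENNReal.ofReal (m.prior θ)

/-- The Volterra kernel `K(t) = c t^H`. -/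
def kernel (t : ℝ) : ℝ := m.c * t ^ m.H

/-- The Euler scheme at level `l`, driven by the increments `w`. -/
def scheme (l : ℕ) (θ : m.Θ) (w : ℕ → ℝ) : ℕ → ℝ :=
  euler m.kernel (m.b θ) (m.σ θ) m.v₀ (stepSize l) w

/-- The values of the Euler scheme at the times `1, …, T`. -/
def skeleton (l : ℕ) (θ : m.Θ) (w : Path T l) : Fin T → ℝ :=
  fun t => m.scheme l θ w.incr (((t : ℕ) + 1) * 2 ^ l)

/-- The discretized likelihood of the observation at time `t + 1`. -/
def obsLik (l : ℕ) (θ : m.Θ) (t : Fin T) (w : Path T l) : ℝ :=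
  m.g (m.y (t + 1)) (m.y t)
    ((stepSize l : ℝ) * ∑ k ∈ Finset.range (2 ^ l), m.f (m.scheme l θ w.incr (t * 2 ^ l + k)))
    (∑ k ∈ Finset.range (2 ^ l),
      m.h (m.scheme l θ w.incr (t * 2 ^ l + k)) * w.incr (t * 2 ^ l + k))

/-- The expectation of `φ(θ, V_{1:T})` under the posterior discretized at level `l`. -/
def postExp (l : ℕ) (φ : m.Θ → (Fin T → ℝ) → ℝ) : ℝ :=
  (∫ x : m.Θ × Path T l, φ x.1 (m.skeleton l x.1 x.2) * ∏ t, m.obsLik l x.1 t x.2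
      ∂(m.priorLaw.prod (pathLaw T l))) /
    (∫ x : m.Θ × Path T l, ∏ t, m.obsLik l x.1 t x.2 ∂(m.priorLaw.prod (pathLaw T l)))

/-! ### The continuous-time model -/

/-- For every parameter `θ`, `V θ` is a continuous adapted solution on `[0, T]` of
`V_t = v₀ + ∫_0^t K(t - s) (b_θ(V_s) ds + σ_θ(V_s) dW_s)`. -/
structure IsSolution {Ω : Type*} {mΩ : MeasurableSpace Ω} (P : Measure Ω) (ℱ : Filtration ℝ≥0 mΩ)
    (W : ℝ≥0 → Ω → ℝ) (V : m.Θ → ℝ≥0 → Ω → ℝ) : Prop where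
  adapted : ∀ θ, Adapted ℱ (V θ)
  continuous : ∀ θ ω, Continuous fun t => V θ t ω
  equation : ∀ θ, ∀ t : ℝ≥0, t ≤ T → ∃ I : Ω → ℝ,
    IsItoIntegral P ℱ W (fun s ω => m.kernel ((t : ℝ) - s) * m.σ θ (V θ s ω)) 0 t I ∧
    ∀ᵐ ω ∂P, V θ t ω =
      m.v₀ + (∫ s in Set.Ioc (0 : ℝ) t, m.kernel ((t : ℝ) - s) * m.b θ (V θ s.toNNReal ω)) + I ω

/-- The likelihood of the observation at time `t + 1` given the path of `V θ`. -/
def exactLik {Ω : Type*} {mΩ : MeasurableSpace Ω} (P : Measure Ω) (ℱ : Filtration ℝ≥0 mΩ)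
    (W : ℝ≥0 → Ω → ℝ) (V : m.Θ → ℝ≥0 → Ω → ℝ) (θ : m.Θ) (t : Fin T) (ω : Ω) : ℝ :=
  m.g (m.y (t + 1)) (m.y t)
    (∫ s in Set.Ioc ((t : ℕ) : ℝ) ((t : ℕ) + 1), m.f (V θ s.toNNReal ω))
    (itoIntegral P ℱ W (fun s ω => m.h (V θ s ω)) ((t : ℕ) : ℝ≥0) ((t : ℕ) + 1) ω)

/-- The expectation of `φ(θ, V_{1:T})` under the posterior of the continuous-time model. -/
def exactPostExp {Ω : Type*} {mΩ : MeasurableSpace Ω} (P : Measure Ω) (ℱ : Filtration ℝ≥0 mΩ)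
    (W : ℝ≥0 → Ω → ℝ) (V : m.Θ → ℝ≥0 → Ω → ℝ) (φ : m.Θ → (Fin T → ℝ) → ℝ) : ℝ :=
  (∫ θ, ∫ ω, φ θ (fun t => V θ ((t : ℕ) + 1) ω) * ∏ t, m.exactLik P ℱ W V θ t ω ∂P ∂m.priorLaw) /
    (∫ θ, ∫ ω, ∏ t, m.exactLik P ℱ W V θ t ω ∂P ∂m.priorLaw)

/-! ### Particle MCMC -/

/-- The state space of the Markov chains: the parameter and all the variables of the particle
filter. -/
abbrev State (l : ℕ) : Type := m.Θ × PFVars m.N T l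

/-- The potentials of the particle filter at level `l`. -/
def pfPotential (l : ℕ) (θ : m.Θ) : Fin T → Path T l → ℝ := fun t w => m.obsLik l θ t w

/-- The potentials of the delta particle filter for the levels `l + 1` and `l`. -/
def dpfPotential (l : ℕ) (θ : m.Θ) : Fin T → Path T (l + 1) → ℝ :=
  fun t w => max (m.obsLik (l + 1) θ t w) (m.obsLik l θ t w.coarsen)

open Classical in
/-- The acceptance probability of the move from `x` to `x'`. -/
def accept {l : ℕ} (G : m.Θ → Fin T → Path T l → ℝ) (x x' : m.State l) : ℝ :=
  if pfNormConst (G x.1) x.2 * m.prior x.1 * m.q l x.1 x'.1 = 0 then 1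
  else min 1 ((pfNormConst (G x'.1) x'.2 * m.prior x'.1 * m.q l x'.1 x.1) /
    (pfNormConst (G x.1) x.2 * m.prior x.1 * m.q l x.1 x'.1))

/-- The proposal: `θ' ∼ q_l(· | θ)`, followed by a run of the particle filter with `θ'`. -/
def proposal {l : ℕ} (G : m.Θ → Fin T → Path T l → ℝ) (x : m.State l) : Measure (m.State l) :=
  (m.dθ.prod (pfBase m.N T l)).withDensity
    fun x' => ENNReal.ofReal (m.q l x.1 x'.1 * pfDensity (G x'.1) x'.2)

/-- The transition kernel of the iterate step: accept the proposal, or stay. -/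
def mcmcKernel {l : ℕ} (G : m.Θ → Fin T → Path T l → ℝ) (x : m.State l) : Measure (m.State l) :=
  (m.proposal G x).withDensity (fun x' => ENNReal.ofReal (m.accept G x x')) +
    (∫⁻ x', ENNReal.ofReal (1 - m.accept G x x') ∂(m.proposal G x)) • Measure.dirac x

/-- The Markov kernel of particle MCMC at level `l`. -/
def pmcmcKernel (l : ℕ) : m.State l → Measure (m.State l) := m.mcmcKernel (m.pfPotential l)

/-- The Markov kernel of the coupled MCMC for the levels `l + 1` and `l`. -/
def coupledKernel (l : ℕ) : m.State (l + 1) → Measure (m.State (l + 1)) :=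
  m.mcmcKernel (m.dpfPotential l)

/-! ### Estimators -/

/-- The particle MCMC estimate at level `l` from the states `z_0, …, z_M`. -/
def pmcmcEst (φ : m.Θ → (Fin T → ℝ) → ℝ) (l M : ℕ) (z : ℕ → m.State l) : ℝ :=
  ((M : ℝ) + 1)⁻¹ *
    ∑ k ∈ Finset.range (M + 1), φ (z k).1 (m.skeleton l (z k).1 (pfOutput (z k).2))

/-- The weight `H_{1, l+1}`. -/
def weightFine (l : ℕ) (θ : m.Θ) (w : Path T (l + 1)) : ℝ :=
  ∏ t, m.obsLik (l + 1) θ t w / m.dpfPotential l θ t w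

/-- The weight `H_{2, l+1}`. -/
def weightCoarse (l : ℕ) (θ : m.Θ) (w : Path T (l + 1)) : ℝ :=
  ∏ t, m.obsLik l θ t w.coarsen / m.dpfPotential l θ t w

/-- The coupled estimate of the difference of the posterior expectations at the levels `l + 1` and
`l`, from the states `x_0, …, x_M`. -/
def incrEst (φ : m.Θ → (Fin T → ℝ) → ℝ) (l M : ℕ) (x : ℕ → m.State (l + 1)) : ℝ :=
  (((M : ℝ) + 1)⁻¹ * ∑ k ∈ Finset.range (M + 1),
      φ (x k).1 (m.skeleton (l + 1) (x k).1 (pfOutput (x k).2)) *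
        m.weightFine l (x k).1 (pfOutput (x k).2)) /
    (((M : ℝ) + 1)⁻¹ * ∑ k ∈ Finset.range (M + 1), m.weightFine l (x k).1 (pfOutput (x k).2)) -
  (((M : ℝ) + 1)⁻¹ * ∑ k ∈ Finset.range (M + 1),
      φ (x k).1 (m.skeleton l (x k).1 (pfOutput (x k).2).coarsen) *
        m.weightCoarse l (x k).1 (pfOutput (x k).2)) /
    (((M : ℝ) + 1)⁻¹ * ∑ k ∈ Finset.range (M + 1), m.weightCoarse l (x k).1 (pfOutput (x k).2))

/-- The multilevel particle MCMC estimate, from a chain `z` at level `0` and, for every `l < L`, a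
coupled chain `x l` for the levels `l + 1` and `l`. -/
def mlEst (φ : m.Θ → (Fin T → ℝ) → ℝ) (L : ℕ) (M : ℕ → ℕ) (z : ℕ → m.State 0)
    (x : ∀ l, ℕ → m.State (l + 1)) : ℝ :=
  m.pmcmcEst φ 0 (M 0) z + ∑ l ∈ Finset.range L, m.incrEst φ l (M (l + 1)) (x l)

/-! ### Assumptions -/

/-- Regularity of the observation density. -/
structure Assumption1 : Prop where
  f_lip : ∃ B : ℝ≥0, LipschitzWith B m.f
  f_bdd : ∃ B : ℝ, ∀ x, |m.f x| ≤ B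
  h_lip : ∃ B : ℝ≥0, LipschitzWith B m.h
  h_bdd : ∃ B : ℝ, ∀ x, |m.h x| ≤ B
  g_lip : ∀ y y' : Y, ∃ B : ℝ, ∀ x₁ x₂ x₁' x₂' : ℝ,
    |m.g y y' x₁ x₂ - m.g y y' x₁' x₂'| ≤ B * (|x₁ - x₁'| + |x₂ - x₂'|)
  g_bdd : ∀ y y' : Y, ∃ B₁ B₂ : ℝ, 0 < B₁ ∧ B₁ < B₂ ∧
    ∀ x₁ x₂ : ℝ, B₁ ≤ m.g y y' x₁ x₂ ∧ m.g y y' x₁ x₂ ≤ B₂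

/-- Strong convergence with rate `β`, uniformly in the parameter: the Euler scheme is driven by the
increments of the Brownian motion of the solution. -/
def Assumption2 {Ω : Type*} {mΩ : MeasurableSpace Ω} (P : Measure Ω) (W : ℝ≥0 → Ω → ℝ)
    (V : m.Θ → ℝ≥0 → Ω → ℝ) (β : ℝ) : Prop :=
  ∀ r : ℝ, 1 ≤ r → r ≤ 2 → ∃ B : ℝ, ∀ (l k : ℕ), 1 ≤ k → k ≤ T * 2 ^ l → ∀ θ,
    eLpNorm (fun ω =>
      m.scheme l θ (fun j => W ((j + 1) * stepSize l) ω - W (j * stepSize l) ω) k -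
        V θ (k * stepSize l) ω) (ENNReal.ofReal r) P ≤ ENNReal.ofReal (B * (stepSize l : ℝ) ^ β)

end Model

/-- The minorization `K(x, ·) ≥ ξ ν` for some probability measure `ν` and all `x`. -/
def Minorized {S : Type*} [MeasurableSpace S] (K : S → Measure S) (ξ : ℝ) : Prop :=
  ∃ ν : Measure S, IsProbabilityMeasure ν ∧ ∀ x, ENNReal.ofReal ξ • ν ≤ K x

/-- The minorization of the kernels used by the multilevel algorithm, with one constant for all
levels. -/
def Model.Assumption3 {d T : ℕ} {Y : Type*} (m : Model d T Y) : Prop :=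
  ∃ ξ : ℝ, 0 < ξ ∧ ξ < 1 ∧ Minorized (m.pmcmcKernel 0) ξ ∧ ∀ l, Minorized (m.coupledKernel l) ξ

/-- The minorization of the kernels of single-level particle MCMC, with one constant for all
levels. -/
def Model.Assumption3Single {d T : ℕ} {Y : Type*} (m : Model d T Y) : Prop :=
  ∃ ξ : ℝ, 0 < ξ ∧ ξ < 1 ∧ ∀ l, Minorized (m.pmcmcKernel l) ξ

/-- Functions `φ(θ, v_{1:T})` that are bounded and Lipschitz for the `L₁`-distance. -/
def Model.IsTestFunction {d T : ℕ} {Y : Type*} (m : Model d T Y) (φ : m.Θ → (Fin T → ℝ) → ℝ) :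
    Prop :=
  (∃ B : ℝ, ∀ θ v, |φ θ v| ≤ B) ∧
  ∃ B : ℝ, ∀ θ θ' v v', |φ θ v - φ θ' v'| ≤
    B * ((∑ i, |(θ : Fin d → ℝ) i - (θ' : Fin d → ℝ) i|) + ∑ t, |v t - v' t|)

/-! ## Stationary chains and mean square errors -/

/-- `X` is a Markov chain with transition kernel `K`, started from an invariant distribution. -/
structure IsStationaryChain {Ω S : Type*} [MeasurableSpace Ω] [MeasurableSpace S] (μ : Measure Ω)
    (K : S → Measure S) (X : ℕ → Ω → S) : Prop where
  meas : ∀ k, Measurable (X k)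
  invariant : ∀ B, MeasurableSet B → ∫⁻ x, K x B ∂(μ.map (X 0)) = μ.map (X 0) B
  markov : ∀ (n : ℕ) (A : Set (Fin (n + 1) → S)) (B : Set S), MeasurableSet A → MeasurableSet B →
    μ {ω | (fun i : Fin (n + 1) => X i ω) ∈ A ∧ X (n + 1) ω ∈ B} =
      ∫⁻ ω in {ω | (fun i : Fin (n + 1) => X i ω) ∈ A}, K (X n ω) B ∂μ

/-- The σ-algebras generated by the chain at level `0` and by the coupled chains. -/
@[reducible] def levelSigma {Ω : Type*} {S₀ : Type*} {S : ℕ → Type*} [MeasurableSpace S₀]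
    [∀ l, MeasurableSpace (S l)] (Z : ℕ → Ω → S₀) (X : ∀ l, ℕ → Ω → S l) : ℕ → MeasurableSpace Ω
  | 0 => ⨆ k, MeasurableSpace.comap (Z k) inferInstance
  | l + 1 => ⨆ k, MeasurableSpace.comap (X l k) inferInstance

/-- The mean square error `E[(X - a)²]`. -/
def mse {Ω : Type*} [MeasurableSpace Ω] (μ : Measure Ω) (X : Ω → ℝ) (a : ℝ) : ℝ≥0∞ :=
  ∫⁻ ω, ENNReal.ofReal ((X ω - a) ^ 2) ∂μ

/-- `∑_{l ≤ L} Δ_l^{2β} / M_l + ∑_{l ≤ L} ∑_{q ≤ L, q ≠ l} (Δ_l^β / M_l) (Δ_q^β / M_q)`. -/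
def mseRate (β : ℝ) (L : ℕ) (M : ℕ → ℕ) : ℝ :=
  (∑ l ∈ Finset.range (L + 1), (stepSize l : ℝ) ^ (2 * β) / M l) +
    ∑ l ∈ Finset.range (L + 1), ∑ q ∈ (Finset.range (L + 1)).erase l,
      ((stepSize l : ℝ) ^ β / M l) * ((stepSize q : ℝ) ^ β / M q)

/-! ## Cost

Every random draw, every summand of the Euler scheme and of the sums in the likelihood, every
evaluation of a density or of the test function, every scalar that is copied, and every weight that
is inspected counts as one operation. -/

/-- One particle over the unit time interval from `t` to `t + 1` at level `l`: the Euler scheme (the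
value with index `j + 1` is a sum over all of `0, …, j`) and the likelihood (two sums and one
density). -/
def stepCost (l t : ℕ) : ℕ :=
  (∑ k ∈ Finset.range (2 ^ l), (t * 2 ^ l + k + 1)) + 2 * 2 ^ l + 1

/-- A run of the particle filter at level `l`: for each time `t`, each of the `N` particles draws its
increments and is propagated and weighted; the weights are summed and normalized; then each particle
draws an ancestor by inspecting the weights and copies its increments. The final selection is counted
as one such resampling of all particles. -/
def pfCost (N T l : ℕ) : ℕ :=
  ∑ t ∈ Finset.range T,
    (N * (2 ^ l + stepCost l t) + 2 * N + N * (1 + N + (t + 1) * 2 ^ l))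

/-- A run of the delta particle filter for the levels `l + 1` and `l`: the coarse increments are
computed from the fine ones, both levels are propagated, and a maximum is taken. -/
def dpfCost (N T l : ℕ) : ℕ :=
  ∑ t ∈ Finset.range T,
    (N * (2 ^ (l + 1) + 2 ^ l + stepCost (l + 1) t + stepCost l t + 1) + 2 * N +
      N * (1 + N + (t + 1) * (2 ^ (l + 1) + 2 ^ l)))

/-- `M` iterations of particle MCMC at level `l` after the initialization; each of the `M + 1` steps
draws a parameter, runs the particle filter, evaluates the acceptance probability (four densities,
one uniform draw), stores the state, and evaluates the test function. -/
def pmcmcCost (d N T l M : ℕ) : ℕ :=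
  (M + 1) * (1 + pfCost N T l + 5 + (d + T * 2 ^ l) + 1)

/-- `M` iterations of the coupled MCMC for the levels `l + 1` and `l` after the initialization; in
addition to the above, the two weights, of `T` factors each, are evaluated. -/
def coupledCost (d N T l M : ℕ) : ℕ :=
  (M + 1) * (1 + dpfCost N T l + 5 + (d + T * (2 ^ (l + 1) + 2 ^ l)) + 2 + 2 * T)

/-- The cost of the multilevel estimate. -/
def mlCost (d N T L : ℕ) (M : ℕ → ℕ) : ℕ :=
  pmcmcCost d N T 0 (M 0) + ∑ l ∈ Finset.range L, coupledCost d N T l (M (l + 1))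

/-! ## Choice of the finest level and of the numbers of iterations -/

/-- The least `L` with `Δ_L^{2H+1} ≤ ε²`. -/
def levelChoice (H ε : ℝ) : ℕ := ⌈2 * Real.logb 2 (1 / ε) / (2 * H + 1)⌉₊

/-- `M_l = ⌈ε^{-2} Δ_l^{(2H+3)/2} Δ_L^{H-1/2}⌉`. -/
def iterChoice (H ε : ℝ) (l : ℕ) : ℕ :=
  ⌈ε ^ (-2 : ℝ) * (stepSize l : ℝ) ^ ((2 * H + 3) / 2) *
    (stepSize (levelChoice H ε) : ℝ) ^ (H - 1 / 2)⌉₊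

/-- `M = ⌈ε^{-2}⌉`, for a single level. -/
def iterChoiceSingle (ε : ℝ) : ℕ := ⌈ε ^ (-2 : ℝ)⌉₊

end

end VolterraPMCMC

namespace VolterraPMCMC

/-! ## Bounded measurable functions and Cauchy–Schwarz -/

section Bounded

variable {S : Type*} {mS : MeasurableSpace S}

/-! The proof rests on four ingredients: a strong error analysis of the discretized likelihood, the
identification of the stationary laws of the particle chains, a variance bound for uniformly ergodic
chains, and a bias and variance analysis of self-normalized ratios.

Strong error. The squared increments of `i ↦ i ^ H` over `n` steps sum to order `n ^ (2H+1)` when `H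
< 1/2` (`sum_sq_rpow_incr_le`). Together with the Itô isometry and a discrete Gronwall bound on
second moments, this makes the Euler scheme mean square Hölder of order `H + 1/2`, uniformly in
level and parameter (`exists_regularity_bound`). The assumed rate holds only at grid points. Between
them, a coarse scheme is compared with a finer one at a nearby fine grid point, and Fatou's lemma is
applied as the fine level tends to infinity (`exists_strong_bound`). The likelihood sums are
integrals of step processes, so the isometry yields the existence of the exact Itô integral and the
rate `Δ_l ^ β` for every factor of the likelihood (`exists_obsLik_bound`). As all factors lie in a
fixed interval `[A, B]` with `A > 0`, products and quotients inherit the rate, which bounds the bias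
of the posterior (`exists_bias_bound`).

Stationary laws. Particle MCMC is Metropolis–Hastings on the space of the parameter and all filter
variables. It is reversible for the measure with density `p̂ · prior · (filter density)`, because
the filter densities form a symmetric factor of the flow (`stepKernel_isReversible`). The filter is
unbiased jointly with its selected trajectory (`lintegral_pfNormConst_mul`), so the marginal of
parameter and trajectory is the posterior defined by the potentials (`map_target`). Unbiasedness
comes from exchanging the fresh increments of two particles at each resampling step (`pfFlow_succ`).
A minorization makes the invariant law unique (`invariant_unique`), so any stationary chain has this
law.

Variance. After subtracting the minorizing part, Jensen's inequality shows that the Markov operator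
contracts centred functions in `L²` of the invariant law by `√(1 - ξ)` (`integral_sq_markovOp_le`).
Hence covariances decay geometrically and averages over `M + 1` states have variance `O(1 / M)`
times the second moment (`integral_sq_average_le`).

Ratios. Once the test functions are centred, the error of a coupled estimate is a difference of two
ratios of averages. Numerators and denominators of the two levels differ by `δ = O(Δ_l ^ β)` in
`L²`, and fluctuations have size `s = O(M ^ (-1/2))`. The mean square is therefore `O(δ² s²)`. The
linear part has mean zero, so the bias is only `O(δ s²)` (`ratio_difference_bounds`). Different
levels are independent, hence the cross terms of the squared sum are products of biases; this
produces the two sums in `mseRate` (`exists_mlEst_bound`).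

Complexity. The Volterra convolution makes one step cost `Δ_l ^ (-2)`. For the prescribed numbers of
iterations the sums over the levels are geometric and dominated by the finest level, since `1/2 - H
> 0` (`mseRate_iterChoice_le`, `cost_iterChoice_le`). -/

lemma memLp_of_bounded (μ : Measure S) [IsFiniteMeasure μ] {f : S → ℝ} (hf : Measurable f) {B : ℝ}
    (hB : ∀ x, |f x| ≤ B) (p : ℝ≥0∞) : MemLp f p μ :=
  MemLp.of_bound hf.aestronglyMeasurable B (ae_of_all _ hB)

lemma integrable_of_bounded (μ : Measure S) [IsFiniteMeasure μ] {f : S → ℝ} (hf : Measurable f)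
    {B : ℝ} (hB : ∀ x, |f x| ≤ B) : Integrable f μ :=
  Integrable.of_bound hf.aestronglyMeasurable B (ae_of_all _ hB)

lemma sq_le_sq_of_abs_le {a B : ℝ} (h : |a| ≤ B) : |a ^ 2| ≤ B ^ 2 := by
  rw [abs_pow]; exact pow_le_pow_left₀ (abs_nonneg a) h 2

lemma abs_mul_le_of_abs_le {a b A B : ℝ} (ha : |a| ≤ A) (hb : |b| ≤ B) : |a * b| ≤ A * B := by
  rw [abs_mul]; exact mul_le_mul ha hb (abs_nonneg b) ((abs_nonneg a).trans ha)

lemma integral_linear_combination {μ : Measure S} {f g k : S → ℝ} (hf : Integrable f μ)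
    (hg : Integrable g μ) (hk : Integrable k μ) (a b c : ℝ) :
    ∫ x, (a * f x + b * g x + c * k x) ∂μ =
      a * ∫ x, f x ∂μ + b * ∫ x, g x ∂μ + c * ∫ x, k x ∂μ := by
  have h1 : Integrable (fun x => a * f x + b * g x) μ := (hf.const_mul a).add (hg.const_mul b)
  rw [integral_add h1 (hk.const_mul c), integral_add (hf.const_mul a) (hg.const_mul b),
    integral_const_mul, integral_const_mul, integral_const_mul]

lemma sq_integral_mul_le {μ : Measure S} {f g : S → ℝ} (hf : MemLp f 2 μ) (hg : MemLp g 2 μ) :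
    (∫ x, f x * g x ∂μ) ^ 2 ≤ (∫ x, f x ^ 2 ∂μ) * ∫ x, g x ^ 2 ∂μ := by
  have hfg : Integrable (fun x => f x * g x) μ := hf.integrable_mul hg
  -- The integral of `(f + t g) ^ 2` is a quadratic polynomial in `t` that is never negative; that
  -- its discriminant is at most zero is the inequality.
  have key : ∀ t : ℝ, 0 ≤ (∫ x, g x ^ 2 ∂μ) * (t * t) + (2 * ∫ x, f x * g x ∂μ) * t +
      ∫ x, f x ^ 2 ∂μ := by
    intro t
    have h : 0 ≤ ∫ x, (f x + t * g x) ^ 2 ∂μ := integral_nonneg fun x => sq_nonneg _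
    have e : ∫ x, (f x + t * g x) ^ 2 ∂μ = (∫ x, g x ^ 2 ∂μ) * (t * t) +
        (2 * ∫ x, f x * g x ∂μ) * t + ∫ x, f x ^ 2 ∂μ := by
      have : (fun x => (f x + t * g x) ^ 2) =
          fun x => (t * t) * g x ^ 2 + (2 * t) * (f x * g x) + 1 * f x ^ 2 := by ext x; ring
      rw [this, integral_linear_combination hg.integrable_sq hfg hf.integrable_sq]
      ring
    linarith
  have := discrim_le_zero key
  rw [discrim] at this
  linarith

lemma sq_integral_le {μ : Measure S} [IsFiniteMeasure μ] {f : S → ℝ} (hf : MemLp f 2 μ) :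
    (∫ x, f x ∂μ) ^ 2 ≤ μ.real Set.univ * ∫ x, f x ^ 2 ∂μ := by
  simpa using sq_integral_mul_le (memLp_const (1 : ℝ)) hf

lemma abs_integral_mul_le {μ : Measure S} {f g : S → ℝ} (hf : MemLp f 2 μ) (hg : MemLp g 2 μ) :
    |∫ x, f x * g x ∂μ| ≤ √(∫ x, f x ^ 2 ∂μ) * √(∫ x, g x ^ 2 ∂μ) := by
  rw [← Real.sqrt_mul (integral_nonneg fun x => sq_nonneg _)]
  exact Real.abs_le_sqrt (sq_integral_mul_le hf hg)

end Bounded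

/-! ## Uniformly ergodic Markov chains -/

section Chains

variable {S : Type*} [MeasurableSpace S] {κ : Kernel S S}

section

variable {Ω : Type*} [MeasurableSpace Ω] {μ : Measure Ω} {X : ℕ → Ω → S}

lemma IsStationaryChain.invariant' (hX : IsStationaryChain μ (fun x => κ x) X) :
    Kernel.Invariant κ (μ.map (X 0)) := by
  refine Measure.ext fun s hs => ?_
  rw [Measure.bind_apply hs κ.aemeasurable]
  exact hX.invariant s hs

/-- The Markov property is assumed for events of the whole past; events of the single time `i` are
enough for all covariances below, and for them it says that one more step pushes the restricted law
through the kernel. -/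
lemma IsStationaryChain.map_restrict_succ (hX : IsStationaryChain μ (fun x => κ x) X) {i n : ℕ}
    (hin : i ≤ n) {A : Set S} (hA : MeasurableSet A) :
    (μ.restrict (X i ⁻¹' A)).map (X (n + 1)) = ((μ.restrict (X i ⁻¹' A)).map (X n)).bind κ := by
  refine Measure.ext fun s hs => ?_
  rw [Measure.bind_apply hs κ.aemeasurable, Measure.map_apply (hX.meas _) hs,
    lintegral_map (κ.measurable_coe hs) (hX.meas n), Measure.restrict_apply (hX.meas _ hs)]
  have := hX.markov n ((fun v : Fin (n + 1) → S => v ⟨i, Nat.lt_succ_of_le hin⟩) ⁻¹' A) s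
    (measurable_pi_apply _ hA) hs
  rw [Set.inter_comm]
  exact this

lemma IsStationaryChain.map_eq (hX : IsStationaryChain μ (fun x => κ x) X) (n : ℕ) :
    μ.map (X n) = μ.map (X 0) := by
  induction n with
  | zero => rfl
  | succ n ih =>
    have := hX.map_restrict_succ (zero_le : 0 ≤ n) MeasurableSet.univ
    simp only [Set.preimage_univ, Measure.restrict_univ] at this
    rw [this, ih, hX.invariant'.def]

lemma IsStationaryChain.integral_eq (hX : IsStationaryChain μ (fun x => κ x) X) {f : S → ℝ}
    (hf : Measurable f) (n : ℕ) : ∫ ω, f (X n ω) ∂μ = ∫ x, f x ∂(μ.map (X 0)) := by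
  rw [← hX.map_eq n, integral_map (hX.meas n).aemeasurable hf.aestronglyMeasurable]

end

/-- The Markov operator on functions. -/
noncomputable def markovOp (κ : Kernel S S) (f : S → ℝ) (x : S) : ℝ := ∫ y, f y ∂κ x

lemma measurable_markovOp {f : S → ℝ} (hf : Measurable f) : Measurable (markovOp κ f) :=
  (hf.stronglyMeasurable.integral_kernel (κ := κ)).measurable

lemma measurable_iterate_markovOp {f : S → ℝ} (hf : Measurable f) (k : ℕ) :
    Measurable ((markovOp κ)^[k] f) := by
  induction k with
  | zero => exact hf
  | succ k ih => rw [Function.iterate_succ_apply']; exact measurable_markovOp ih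

variable [IsMarkovKernel κ]

lemma abs_markovOp_le {f : S → ℝ} {B : ℝ} (hB : ∀ x, |f x| ≤ B) (x : S) :
    |markovOp κ f x| ≤ B := by
  have := norm_integral_le_of_norm_le_const (μ := κ x) (f := f) (C := B) (ae_of_all _ hB)
  simpa [markovOp] using this

lemma integral_bind_kernel {η : Measure S} [IsFiniteMeasure η] {f : S → ℝ} (hf : Measurable f) {B : ℝ}
    (hB : ∀ x, |f x| ≤ B) : ∫ x, f x ∂(η.bind κ) = ∫ x, markovOp κ f x ∂η := by
  -- A measure is a kernel from the one-point space, so the Fubini formula for compositions of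
  -- kernels applies.
  have e : (κ ∘ₖ Kernel.const Unit η) () = η.bind κ := by
    rw [Kernel.comp_apply, Kernel.const_apply]
  have := Kernel.integral_comp (η := κ) (κ := Kernel.const Unit η) (a := ()) (f := f)
    (integrable_of_bounded _ hf hB)
  rw [e] at this
  simpa [markovOp] using this

lemma integral_markovOp {η : Measure S} [IsFiniteMeasure η] (hη : Kernel.Invariant κ η) {f : S → ℝ}
    (hf : Measurable f) {B : ℝ} (hB : ∀ x, |f x| ≤ B) :
    ∫ x, markovOp κ f x ∂η = ∫ x, f x ∂η := by
  rw [← integral_bind_kernel hf hB, hη.def]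

lemma abs_iterate_markovOp_le {f : S → ℝ} {B : ℝ} (hB : ∀ x, |f x| ≤ B) (k : ℕ) (x : S) :
    |(markovOp κ)^[k] f x| ≤ B := by
  induction k generalizing x with
  | zero => exact hB x
  | succ k ih => rw [Function.iterate_succ_apply']; exact abs_markovOp_le ih x

lemma integral_iterate_markovOp {η : Measure S} [IsFiniteMeasure η] (hη : Kernel.Invariant κ η)
    {f : S → ℝ} (hf : Measurable f) {B : ℝ} (hB : ∀ x, |f x| ≤ B) (k : ℕ) :
    ∫ x, (markovOp κ)^[k] f x ∂η = ∫ x, f x ∂η := by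
  induction k with
  | zero => rfl
  | succ k ih =>
    rw [Function.iterate_succ_apply', integral_markovOp hη (measurable_iterate_markovOp hf k)
      (abs_iterate_markovOp_le hB k), ih]

/-- The one-step contraction in `L²(η)` on centred functions given by a minorization. -/
lemma integral_sq_markovOp_le {ξ : ℝ} (hξ₀ : 0 < ξ) (hκ : Minorized (fun x => κ x) ξ)
    {η : Measure S} [IsProbabilityMeasure η] (hη : Kernel.Invariant κ η) {f : S → ℝ}
    (hf : Measurable f) {B : ℝ} (hB : ∀ x, |f x| ≤ B) (h0 : ∫ x, f x ∂η = 0) :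
    ∫ x, markovOp κ f x ^ 2 ∂η ≤ (1 - ξ) * ∫ x, f x ^ 2 ∂η := by
  obtain ⟨ν, hν, hle⟩ := hκ
  -- The residual `κ x - ξ ν` is a positive measure of mass `1 - ξ`, and Cauchy–Schwarz for it gives
  -- the pointwise bound. Subtracting the constant `ξ ν(f)` is harmless after integration because
  -- `f` is centred.
  have hpt : ∀ x, (markovOp κ f x - ξ * ∫ y, f y ∂ν) ^ 2 ≤
      (1 - ξ) * (markovOp κ (fun y => f y ^ 2) x - ξ * ∫ y, f y ^ 2 ∂ν) := by
    intro x
    set ρ := κ x - ENNReal.ofReal ξ • ν with hρ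
    have hfin : IsFiniteMeasure (ENNReal.ofReal ξ • ν) := ⟨by simp⟩
    have hadd : ρ + ENNReal.ofReal ξ • ν = κ x := Measure.sub_add_cancel_of_le (hle x)
    have hint : ∀ {g : S → ℝ} {A : ℝ}, Measurable g → (∀ x, |g x| ≤ A) →
        ∫ y, g y ∂ρ = markovOp κ g x - ξ * ∫ y, g y ∂ν := by
      intro g A hg hA
      rw [markovOp, ← hadd, integral_add_measure (integrable_of_bounded _ hg hA)
        (integrable_of_bounded _ hg hA), integral_smul_measure, ENNReal.toReal_ofReal hξ₀.le,
        smul_eq_mul]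
      ring
    have hmass : ρ.real Set.univ = 1 - ξ := by
      have h1 := hint (g := fun _ => 1) (A := 1) measurable_const (by simp)
      simpa [markovOp] using h1
    rw [← hint hf hB, ← hint (hf.pow_const 2) (fun x => sq_le_sq_of_abs_le (hB x)), ← hmass]
    exact sq_integral_le (memLp_of_bounded _ hf hB 2)
  have hT := measurable_markovOp (κ := κ) hf
  have hT2 := measurable_markovOp (κ := κ) (hf.pow_const 2)
  have hTB := abs_markovOp_le (κ := κ) hB
  have hTB2 := abs_markovOp_le (κ := κ) (fun x => sq_le_sq_of_abs_le (hB x))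
  have i1 : Integrable (fun x => markovOp κ f x ^ 2) η :=
    integrable_of_bounded _ (hT.pow_const 2) (fun x => sq_le_sq_of_abs_le (hTB x))
  have i2 : Integrable (fun x => markovOp κ f x) η := integrable_of_bounded _ hT hTB
  have i3 : Integrable (fun x => markovOp κ (fun y => f y ^ 2) x) η := integrable_of_bounded _ hT2 hTB2
  set a := ∫ y, f y ∂ν
  set s := ∫ y, f y ^ 2 ∂ν with hs
  have hmono : ∫ x, (markovOp κ f x - ξ * a) ^ 2 ∂η ≤
      ∫ x, (1 - ξ) * (markovOp κ (fun y => f y ^ 2) x - ξ * s) ∂η := by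
    refine integral_mono ?_ ((i3.sub (integrable_const _)).const_mul _) hpt
    have : (fun x => (markovOp κ f x - ξ * a) ^ 2) =
      fun x => markovOp κ f x ^ 2 - 2 * ξ * a * markovOp κ f x + (ξ * a) ^ 2 := by ext x; ring
    rw [this]
    exact (i1.sub (i2.const_mul _)).add (integrable_const _)
  have e1 : ∫ x, (markovOp κ f x - ξ * a) ^ 2 ∂η = ∫ x, markovOp κ f x ^ 2 ∂η + (ξ * a) ^ 2 := by
    have : (fun x => (markovOp κ f x - ξ * a) ^ 2) =
      fun x => 1 * markovOp κ f x ^ 2 + (-(2 * ξ * a)) * markovOp κ f x + (ξ * a) ^ 2 * 1 := by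
      ext x; ring
    rw [this, integral_linear_combination i1 i2 (integrable_const 1), integral_markovOp hη hf hB, h0]
    simp
  have e2 : ∫ x, (1 - ξ) * (markovOp κ (fun y => f y ^ 2) x - ξ * s) ∂η =
      (1 - ξ) * (∫ x, f x ^ 2 ∂η - ξ * s) := by
    rw [integral_const_mul, integral_sub i3 (integrable_const _),
      integral_markovOp hη (hf.pow_const 2) (fun x => sq_le_sq_of_abs_le (hB x))]
    simp
  -- Comparing total masses at any point; the space is nonempty because it carries the probability
  -- measure `ν`.
  have hξ1 : ξ ≤ 1 := by
    have hne : Nonempty S := by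
      by_contra h
      rw [not_nonempty_iff] at h
      have : ν Set.univ = 0 := by rw [Set.eq_empty_of_isEmpty Set.univ]; simp
      simp at this
    have := hle hne.some Set.univ
    simpa using this
  have hs0 : 0 ≤ s := integral_nonneg fun x => sq_nonneg _
  rw [e1, e2] at hmono
  nlinarith [mul_nonneg (mul_nonneg (sub_nonneg.2 hξ1) hξ₀.le) hs0, sq_nonneg (ξ * a)]

lemma integral_sq_iterate_markovOp_le {ξ : ℝ} (hξ₀ : 0 < ξ) (hξ₁ : ξ < 1)
    (hκ : Minorized (fun x => κ x) ξ) {η : Measure S} [IsProbabilityMeasure η]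
    (hη : Kernel.Invariant κ η) {f : S → ℝ} (hf : Measurable f) {B : ℝ} (hB : ∀ x, |f x| ≤ B)
    (h0 : ∫ x, f x ∂η = 0) (k : ℕ) :
    ∫ x, (markovOp κ)^[k] f x ^ 2 ∂η ≤ (1 - ξ) ^ k * ∫ x, f x ^ 2 ∂η := by
  induction k with
  | zero => simp
  | succ k ih =>
    rw [Function.iterate_succ_apply']
    refine (integral_sq_markovOp_le hξ₀ hκ hη (measurable_iterate_markovOp hf k)
      (abs_iterate_markovOp_le hB k) ?_).trans ?_
    · rw [integral_iterate_markovOp hη hf hB, h0]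
    · rw [pow_succ', mul_assoc]
      exact mul_le_mul_of_nonneg_left ih (by linarith)

/-- A minorized kernel has at most one invariant probability measure. -/
lemma invariant_unique {ξ : ℝ} (hξ₀ : 0 < ξ) (hξ₁ : ξ < 1)
    (hκ : Minorized (fun x => κ x) ξ) {η₁ η₂ : Measure S} [IsProbabilityMeasure η₁]
    [IsProbabilityMeasure η₂] (h₁ : Kernel.Invariant κ η₁) (h₂ : Kernel.Invariant κ η₂) :
    η₁ = η₂ := by
  -- Contraction holds in `L²` of an invariant law. The midpoint of the two candidates is invariant
  -- and dominates both up to a factor two, so one contraction controls them simultaneously.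
  set η : Measure S := (2⁻¹ : ℝ≥0∞) • η₁ + (2⁻¹ : ℝ≥0∞) • η₂ with hηdef
  have hηp : IsProbabilityMeasure η := ⟨by simp [hηdef, ENNReal.inv_two_add_inv_two]⟩
  have hη : Kernel.Invariant κ η := by
    refine Measure.ext fun s hs => ?_
    rw [Measure.bind_apply hs κ.aemeasurable, hηdef, lintegral_add_measure, lintegral_smul_measure,
      lintegral_smul_measure, ← Measure.bind_apply hs κ.aemeasurable,
      ← Measure.bind_apply hs κ.aemeasurable, h₁.def, h₂.def]
    rfl
  -- The iterates of `f` tend to zero in `L²(η)`, hence in `L²(η')`, while their `η'`-mean does not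
  -- change; so this mean is zero.
  have key : ∀ {f : S → ℝ} {B : ℝ}, Measurable f → (∀ x, |f x| ≤ B) → ∫ x, f x ∂η = 0 →
      ∀ {η' : Measure S} [IsProbabilityMeasure η'], Kernel.Invariant κ η' →
      η' ≤ (2 : ℝ≥0∞) • η → ∫ x, f x ∂η' = 0 := by
    intro f B hf hB h0 η' _ hη' hle
    have hlim : Tendsto (fun k : ℕ => 2 * ((1 - ξ) ^ k * ∫ x, f x ^ 2 ∂η)) atTop (𝓝 0) := by
      have := ((tendsto_pow_atTop_nhds_zero_of_lt_one (r := 1 - ξ) (by linarith)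
        (by linarith)).mul_const (∫ x, f x ^ 2 ∂η)).const_mul 2
      simpa using this
    have hle' : ∀ k : ℕ, (∫ x, f x ∂η') ^ 2 ≤ 2 * ((1 - ξ) ^ k * ∫ x, f x ^ 2 ∂η) := by
      intro k
      have hm := measurable_iterate_markovOp (κ := κ) hf k
      have hb := abs_iterate_markovOp_le (κ := κ) hB k
      calc (∫ x, f x ∂η') ^ 2 = (∫ x, (markovOp κ)^[k] f x ∂η') ^ 2 := by
            rw [integral_iterate_markovOp hη' hf hB]
        _ ≤ ∫ x, (markovOp κ)^[k] f x ^ 2 ∂η' := by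
            simpa using sq_integral_le (memLp_of_bounded η' hm hb 2)
        _ ≤ ∫ x, (markovOp κ)^[k] f x ^ 2 ∂((2 : ℝ≥0∞) • η) := by
            refine integral_mono_measure hle (ae_of_all _ fun x => sq_nonneg _) ?_
            exact (integrable_of_bounded η (hm.pow_const 2)
              (fun x => sq_le_sq_of_abs_le (hb x))).smul_measure (by simp)
        _ ≤ _ := by
            rw [integral_smul_measure]
            simp only [ENNReal.toReal_ofNat, smul_eq_mul]
            exact mul_le_mul_of_nonneg_left
              (integral_sq_iterate_markovOp_le hξ₀ hξ₁ hκ hη hf hB h0 k) zero_le_two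
    have : (∫ x, f x ∂η') ^ 2 ≤ 0 := ge_of_tendsto' hlim hle'
    exact pow_eq_zero_iff (two_ne_zero) |>.1 (le_antisymm this (sq_nonneg _))
  have two_inv : ∀ ζ : Measure S, (2 : ℝ≥0∞) • (2⁻¹ : ℝ≥0∞) • ζ = ζ := by
    intro ζ
    rw [smul_smul, ENNReal.mul_inv_cancel (by simp) (by simp), one_smul]
  have hle₁ : η₁ ≤ (2 : ℝ≥0∞) • η := by
    rw [hηdef, smul_add, two_inv, two_inv]; exact Measure.le_add_right le_rfl
  have hle₂ : η₂ ≤ (2 : ℝ≥0∞) • η := by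
    rw [hηdef, smul_add, two_inv, two_inv]; exact Measure.le_add_left le_rfl
  refine Measure.ext fun s hs => ?_
  -- Testing with the indicator of `s` minus its `η`-mean: both candidates give `s` the mass `a`.
  set a : ℝ := ∫ x, s.indicator 1 x ∂η
  have hm : Measurable fun x => s.indicator (1 : S → ℝ) x - a :=
    (measurable_one.indicator hs).sub_const a
  have hb : ∀ x, |s.indicator (1 : S → ℝ) x - a| ≤ 1 + |a| := by
    intro x
    refine (abs_sub _ _).trans (add_le_add_left ?_ _)
    by_cases hx : x ∈ s <;> simp [hx]
  have hi : ∀ (ζ : Measure S) [IsProbabilityMeasure ζ],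
      ∫ x, (s.indicator (1 : S → ℝ) x - a) ∂ζ = ζ.real s - a := by
    intro ζ _
    have hi1 : Integrable (s.indicator (1 : S → ℝ)) ζ := (integrable_const (1 : ℝ)).indicator hs
    rw [integral_sub hi1 (integrable_const _), integral_indicator_one hs]
    simp
  have h0 : ∫ x, (s.indicator (1 : S → ℝ) x - a) ∂η = 0 := by
    rw [hi, ← integral_indicator_one hs, sub_self]
  have r1 := key hm hb h0 h₁ hle₁
  have r2 := key hm hb h0 h₂ hle₂
  rw [hi] at r1 r2
  have : η₁.real s = η₂.real s := by linarith
  exact (measureReal_eq_measureReal_iff).1 this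

variable {Ω : Type*} [MeasurableSpace Ω] {μ : Measure Ω} [IsProbabilityMeasure μ] {X : ℕ → Ω → S}

lemma IsStationaryChain.setIntegral_eq (hX : IsStationaryChain μ (fun x => κ x) X) {g : S → ℝ}
    (hg : Measurable g) {B : ℝ} (hB : ∀ x, |g x| ≤ B) (i k : ℕ) {A : Set S} (hA : MeasurableSet A) :
    ∫ ω in X i ⁻¹' A, g (X (i + k) ω) ∂μ = ∫ ω in X i ⁻¹' A, (markovOp κ)^[k] g (X i ω) ∂μ := by
  induction k generalizing g with
  | zero => rfl
  | succ k ih =>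
    rw [Function.iterate_succ_apply, ← ih (measurable_markovOp hg) (abs_markovOp_le hB),
      ← integral_map (hX.meas _).aemeasurable hg.aestronglyMeasurable, ← add_assoc,
      hX.map_restrict_succ (Nat.le_add_right i k) hA, integral_bind_kernel hg hB,
      integral_map (hX.meas _).aemeasurable (measurable_markovOp hg).aestronglyMeasurable]

/-- By the Markov property, the `k`-th iterate of `g` at `X i` is the conditional expectation of `g
(X (i + k))` given `X i`; the factor `f (X i)` is then pulled out. -/
lemma IsStationaryChain.integral_mul (hX : IsStationaryChain μ (fun x => κ x) X) {f g : S → ℝ}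
    (hf : Measurable f) (hg : Measurable g) {A B : ℝ} (hA : ∀ x, |f x| ≤ A) (hB : ∀ x, |g x| ≤ B)
    (i k : ℕ) :
    ∫ ω, f (X i ω) * g (X (i + k) ω) ∂μ =
      ∫ x, f x * (markovOp κ)^[k] g x ∂(μ.map (X 0)) := by
  have hm : MeasurableSpace.comap (X i) inferInstance ≤ (inferInstance : MeasurableSpace Ω) :=
    (hX.meas i).comap_le
  have hTm := measurable_iterate_markovOp (κ := κ) hg k
  have hTb := abs_iterate_markovOp_le (κ := κ) hB k
  have hgi : Integrable (fun ω => g (X (i + k) ω)) μ :=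
    integrable_of_bounded _ (hg.comp (hX.meas _)) fun ω => hB _
  have hfm : StronglyMeasurable[MeasurableSpace.comap (X i) inferInstance] fun ω => f (X i ω) :=
    (hf.comp (comap_measurable (X i))).stronglyMeasurable
  have hce : (fun ω => (markovOp κ)^[k] g (X i ω)) =ᵐ[μ]
      μ[fun ω => g (X (i + k) ω) | MeasurableSpace.comap (X i) inferInstance] := by
    refine ae_eq_condExp_of_forall_setIntegral_eq hm hgi (fun s _ _ => ?_) (fun s hs _ => ?_) ?_
    · exact (integrable_of_bounded _ (hTm.comp (hX.meas _)) fun ω => hTb _).integrableOn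
    · obtain ⟨A', hA', rfl⟩ := hs
      exact (hX.setIntegral_eq hg hB i k hA').symm
    · exact (hTm.comp (comap_measurable (X i))).stronglyMeasurable.aestronglyMeasurable
  have hpull := condExp_stronglyMeasurable_mul_of_bound hm hfm hgi A (ae_of_all μ fun ω => hA (X i ω))
  have he := hX.integral_eq (hf.mul hTm) i
  simp only [Pi.mul_apply] at he
  rw [← he]
  calc ∫ ω, f (X i ω) * g (X (i + k) ω) ∂μ
      = ∫ ω, (μ[(fun ω => f (X i ω)) * (fun ω => g (X (i + k) ω)) |
          MeasurableSpace.comap (X i) inferInstance]) ω ∂μ := (integral_condExp hm).symm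
    _ = _ := by
        refine integral_congr_ae ?_
        filter_upwards [hpull, hce] with ω h1 h2
        rw [h1, Pi.mul_apply, ← h2]

/-- With truncated subtraction, `(i - j) + (j - i)` is the distance of `i` and `j`. Each row
consists of two geometric series, one on each side of the diagonal. -/
lemma sum_geometric_dist_le {q : ℝ} (hq₀ : 0 ≤ q) (hq₁ : q < 1) (n : ℕ) :
    ∑ i ∈ Finset.range n, ∑ j ∈ Finset.range n, q ^ ((i - j) + (j - i)) ≤ n * (2 / (1 - q)) := by
  have hgeo : ∀ m : ℕ, ∑ k ∈ Finset.range m, q ^ k ≤ 1 / (1 - q) := by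
    intro m
    have := (summable_geometric_of_lt_one hq₀ hq₁).sum_le_tsum (Finset.range m)
      (fun k _ => pow_nonneg hq₀ k)
    rwa [tsum_geometric_of_lt_one hq₀ hq₁, ← one_div] at this
  have : ∀ i ∈ Finset.range n, ∑ j ∈ Finset.range n, q ^ ((i - j) + (j - i)) ≤ 2 / (1 - q) := by
    intro i hi
    have hi' := Finset.mem_range.1 hi
    rw [← Finset.sum_range_add_sum_Ico _ (Finset.mem_range.1 hi).le, Finset.sum_Ico_eq_sum_range]
    have h1 : ∑ j ∈ Finset.range i, q ^ ((i - j) + (j - i)) ≤ 1 / (1 - q) := by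
      rw [← Finset.sum_range_reflect]
      refine (Finset.sum_le_sum fun j hj => ?_).trans (hgeo i)
      have := Finset.mem_range.1 hj
      exact pow_le_pow_of_le_one hq₀ hq₁.le (by omega)
    have h2 : ∑ k ∈ Finset.range (n - i), q ^ ((i - (i + k)) + (i + k - i)) ≤ 1 / (1 - q) := by
      refine (Finset.sum_le_sum fun j hj => ?_).trans (hgeo (n - i))
      exact pow_le_pow_of_le_one hq₀ hq₁.le (by omega)
    calc _ ≤ 1 / (1 - q) + 1 / (1 - q) := add_le_add h1 h2
      _ = _ := by ring
  calc _ ≤ ∑ i ∈ Finset.range n, 2 / (1 - q) := Finset.sum_le_sum this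
    _ = _ := by simp

/-- The mean square error of ergodic averages of centred functions. -/
lemma IsStationaryChain.integral_sq_average_le {ξ : ℝ} (hξ₀ : 0 < ξ) (hξ₁ : ξ < 1)
    (hκ : Minorized (fun x => κ x) ξ) (hX : IsStationaryChain μ (fun x => κ x) X) {f : S → ℝ}
    (hf : Measurable f) {B : ℝ} (hB : ∀ x, |f x| ≤ B) (h0 : ∫ x, f x ∂(μ.map (X 0)) = 0) (M : ℕ) :
    ∫ ω, (((M : ℝ) + 1)⁻¹ * ∑ k ∈ Finset.range (M + 1), f (X k ω)) ^ 2 ∂μ ≤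
      2 / (1 - √(1 - ξ)) / (M + 1) * ∫ x, f x ^ 2 ∂(μ.map (X 0)) := by
  have : IsProbabilityMeasure (μ.map (X 0)) := Measure.isProbabilityMeasure_map (hX.meas 0).aemeasurable
  set η := μ.map (X 0)
  set v := ∫ x, f x ^ 2 ∂η with hv
  have hv0 : 0 ≤ v := integral_nonneg fun x => sq_nonneg _
  set q := √(1 - ξ) with hq
  have hq₀ : 0 ≤ q := Real.sqrt_nonneg _
  have hq₁ : q < 1 := by
    rw [hq, Real.sqrt_lt' one_pos]; linarith
  -- Cauchy–Schwarz under the invariant law; the contraction by `1 - ξ` of second moments becomes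
  -- the factor `q = √(1 - ξ)` per step.
  have hcov : ∀ i k : ℕ, ∫ ω, f (X i ω) * f (X (i + k) ω) ∂μ ≤ q ^ k * v := by
    intro i k
    rw [hX.integral_mul hf hf hB hB]
    refine (le_abs_self _).trans ((abs_integral_mul_le (memLp_of_bounded _ hf hB 2)
      (memLp_of_bounded _ (measurable_iterate_markovOp hf k) (abs_iterate_markovOp_le hB k) 2)).trans ?_)
    have h1 := integral_sq_iterate_markovOp_le hξ₀ hξ₁ hκ hX.invariant' hf hB h0 k
    calc √v * √(∫ x, (markovOp κ)^[k] f x ^ 2 ∂η) ≤ √v * √((1 - ξ) ^ k * v) :=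
          mul_le_mul_of_nonneg_left (Real.sqrt_le_sqrt h1) (Real.sqrt_nonneg _)
      _ = q ^ k * v := by
          have e : √((1 - ξ) ^ k) = q ^ k := by
            rw [Real.sqrt_eq_iff_mul_self_eq (pow_nonneg (by linarith) _) (pow_nonneg hq₀ _),
              ← mul_pow, hq, Real.mul_self_sqrt (by linarith)]
          rw [Real.sqrt_mul (pow_nonneg (by linarith) _), e, mul_left_comm, Real.mul_self_sqrt hv0]
  have hcov' : ∀ i j : ℕ, ∫ ω, f (X i ω) * f (X j ω) ∂μ ≤ q ^ ((i - j) + (j - i)) * v := by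
    intro i j
    rcases le_total i j with h | h
    · obtain ⟨k, rfl⟩ := Nat.exists_eq_add_of_le h
      simpa using hcov i k
    · obtain ⟨k, rfl⟩ := Nat.exists_eq_add_of_le h
      simpa [mul_comm] using hcov j k
  have hint : ∀ i j : ℕ, Integrable (fun ω => f (X i ω) * f (X j ω)) μ := fun i j =>
    integrable_of_bounded _ ((hf.comp (hX.meas i)).mul (hf.comp (hX.meas j)))
      fun ω => abs_mul_le_of_abs_le (hB _) (hB _)
  have hsq : ∫ ω, (∑ k ∈ Finset.range (M + 1), f (X k ω)) ^ 2 ∂μ ≤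
      ((M + 1 : ℕ) : ℝ) * (2 / (1 - q)) * v := by
    have : (fun ω => (∑ k ∈ Finset.range (M + 1), f (X k ω)) ^ 2) = fun ω =>
        ∑ i ∈ Finset.range (M + 1), ∑ j ∈ Finset.range (M + 1), f (X i ω) * f (X j ω) := by
      ext ω; rw [sq, Finset.sum_mul_sum]
    rw [this, integral_finsetSum _ fun i _ => integrable_finsetSum _ fun j _ => hint i j]
    simp_rw [integral_finsetSum _ fun j _ => hint _ j]
    calc _ ≤ ∑ i ∈ Finset.range (M + 1), ∑ j ∈ Finset.range (M + 1), q ^ ((i - j) + (j - i)) * v :=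
          Finset.sum_le_sum fun i _ => Finset.sum_le_sum fun j _ => hcov' i j
      _ = (∑ i ∈ Finset.range (M + 1), ∑ j ∈ Finset.range (M + 1), q ^ ((i - j) + (j - i))) * v := by
          simp_rw [Finset.sum_mul]
      _ ≤ _ := mul_le_mul_of_nonneg_right (sum_geometric_dist_le hq₀ hq₁ _) hv0
  simp_rw [mul_pow]
  rw [integral_const_mul]
  calc _ ≤ (((M : ℝ) + 1)⁻¹) ^ 2 * (((M + 1 : ℕ) : ℝ) * (2 / (1 - q)) * v) :=
        mul_le_mul_of_nonneg_left hsq (sq_nonneg _)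
    _ = _ := by
        have : (M : ℝ) + 1 ≠ 0 := by positivity
        push_cast
        field_simp

end Chains

/-! ## The Metropolis–Hastings kernel -/

section MetropolisHastings

variable {S : Type*} [MeasurableSpace S] {lam : Measure S} {r a : S → S → ℝ}

/-- The Metropolis–Hastings transition measure with proposal density `r` with respect to `lam` and
acceptance probability `a`. -/
noncomputable def mhMeasure (lam : Measure S) (r a : S → S → ℝ) (x : S) : Measure S :=
  (lam.withDensity fun x' => ENNReal.ofReal (r x x')).withDensity
      (fun x' => ENNReal.ofReal (a x x')) +
    (∫⁻ x', ENNReal.ofReal (1 - a x x') ∂(lam.withDensity fun x' => ENNReal.ofReal (r x x'))) •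
      Measure.dirac x

lemma mhMeasure_apply (hr : Measurable (Function.uncurry r)) (ha : Measurable (Function.uncurry a))
    (x : S) {B : Set S} (hB : MeasurableSet B) :
    mhMeasure lam r a x B =
      ∫⁻ x', B.indicator (fun x' => ENNReal.ofReal (r x x') * ENNReal.ofReal (a x x')) x' ∂lam +
      (∫⁻ x', ENNReal.ofReal (r x x') * ENNReal.ofReal (1 - a x x') ∂lam) * B.indicator 1 x := by
  have hr' : Measurable fun x' => ENNReal.ofReal (r x x') := hr.of_uncurry_left.ennreal_ofReal
  have ha' : Measurable fun x' => ENNReal.ofReal (a x x') := ha.of_uncurry_left.ennreal_ofReal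
  have ha'' : Measurable fun x' => ENNReal.ofReal (1 - a x x') :=
    (measurable_const.sub ha.of_uncurry_left).ennreal_ofReal
  rw [mhMeasure, Measure.add_apply, Measure.smul_apply, Measure.dirac_apply' _ hB,
    withDensity_apply _ hB, lintegral_withDensity_eq_lintegral_mul _ hr' ha'',
    ← lintegral_indicator hB, lintegral_withDensity_eq_lintegral_mul _ hr' (ha'.indicator hB)]
  congr 1
  refine lintegral_congr fun x' => ?_
  by_cases h : x' ∈ B <;> simp [h]

lemma mhMeasure_univ (hr : Measurable (Function.uncurry r)) (ha : Measurable (Function.uncurry a))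
    (ha₀ : ∀ x x', 0 ≤ a x x') (ha₁ : ∀ x x', a x x' ≤ 1) (x : S) :
    mhMeasure lam r a x Set.univ = ∫⁻ x', ENNReal.ofReal (r x x') ∂lam := by
  have hr' : Measurable fun x' => ENNReal.ofReal (r x x') := hr.of_uncurry_left.ennreal_ofReal
  have ha' : Measurable fun x' => ENNReal.ofReal (a x x') := ha.of_uncurry_left.ennreal_ofReal
  rw [mhMeasure_apply hr ha x MeasurableSet.univ]
  simp only [Set.indicator_univ, Pi.one_apply, mul_one]
  have hm : Measurable fun x' => ENNReal.ofReal (r x x') * ENNReal.ofReal (a x x') := hr'.mul ha'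
  rw [← lintegral_add_left hm]
  refine lintegral_congr fun x' => ?_
  rw [← mul_add, ← ENNReal.ofReal_add (ha₀ x x') (by linarith [ha₁ x x'])]
  simp

variable [SFinite lam]

lemma measurable_mhMeasure (hr : Measurable (Function.uncurry r))
    (ha : Measurable (Function.uncurry a)) : Measurable (mhMeasure lam r a) := by
  refine Measure.measurable_of_measurable_coe _ fun B hB => ?_
  simp_rw [mhMeasure_apply hr ha _ hB]
  refine Measurable.add ?_ (Measurable.mul ?_ (measurable_one.indicator hB))
  · have : Measurable fun p : S × S =>
        (Prod.snd ⁻¹' B).indicator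
          (fun p => ENNReal.ofReal (r p.1 p.2) * ENNReal.ofReal (a p.1 p.2)) p :=
      (hr.ennreal_ofReal.mul ha.ennreal_ofReal).indicator (measurable_snd hB)
    exact this.lintegral_prod_right'
  · have : Measurable fun p : S × S =>
        ENNReal.ofReal (r p.1 p.2) * ENNReal.ofReal (1 - a p.1 p.2) :=
      hr.ennreal_ofReal.mul (measurable_const.sub ha).ennreal_ofReal
    exact this.lintegral_prod_right'

/-- The Metropolis–Hastings kernel. -/
noncomputable def mhKernel (lam : Measure S) [SFinite lam] (hr : Measurable (Function.uncurry r))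
    (ha : Measurable (Function.uncurry a)) : Kernel S S where
  toFun := mhMeasure lam r a
  measurable' := measurable_mhMeasure hr ha

/-- Detailed balance. -/
lemma mhKernel_isReversible (hr : Measurable (Function.uncurry r))
    (ha : Measurable (Function.uncurry a)) {p : S → ℝ≥0∞} (hp : Measurable p)
    (hbal : ∀ x x', p x * (ENNReal.ofReal (r x x') * ENNReal.ofReal (a x x')) =
      p x' * (ENNReal.ofReal (r x' x) * ENNReal.ofReal (a x' x))) :
    Kernel.IsReversible (mhKernel lam hr ha) (lam.withDensity p) := by
  -- The flow from `A` to `B` splits into accepted moves, whose density is symmetric by `hbal`, and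
  -- rejections, which stay in place and hence only charge `A ∩ B`. Each part is symmetric in `A`
  -- and `B`.
  have key : ∀ A B : Set S, MeasurableSet A → MeasurableSet B →
      ∫⁻ x in A, mhMeasure lam r a x B ∂(lam.withDensity p) =
      (∫⁻ x, ∫⁻ x', A.indicator 1 x * B.indicator 1 x' *
        (p x * (ENNReal.ofReal (r x x') * ENNReal.ofReal (a x x'))) ∂lam ∂lam) +
      ∫⁻ x, (A ∩ B).indicator (fun x => p x *
        ∫⁻ x', ENNReal.ofReal (r x x') * ENNReal.ofReal (1 - a x x') ∂lam) x ∂lam := by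
    intro A B hA hB
    have hK : Measurable fun x => mhMeasure lam r a x B :=
      (Measure.measurable_coe hB).comp (measurable_mhMeasure hr ha)
    rw [← lintegral_indicator hA, lintegral_withDensity_eq_lintegral_mul _ hp (hK.indicator hA),
      ← lintegral_add_left]
    · refine lintegral_congr fun x => ?_
      have hm : Measurable fun x' => ENNReal.ofReal (r x x') * ENNReal.ofReal (a x x') :=
        hr.of_uncurry_left.ennreal_ofReal.mul ha.of_uncurry_left.ennreal_ofReal
      by_cases hx : x ∈ A
      · simp only [Pi.mul_apply, Set.indicator_of_mem hx, Pi.one_apply, one_mul]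
        rw [mhMeasure_apply hr ha x hB, mul_add]
        congr 1
        · rw [← lintegral_const_mul _ (hm.indicator hB)]
          refine lintegral_congr fun x' => ?_
          by_cases hx' : x' ∈ B <;> simp [hx']
        · by_cases hx' : x ∈ B <;> simp [hx, hx']
      · simp [hx]
    · have : Measurable fun z : S × S => A.indicator (1 : S → ℝ≥0∞) z.1 * B.indicator 1 z.2 *
          (p z.1 * (ENNReal.ofReal (r z.1 z.2) * ENNReal.ofReal (a z.1 z.2))) :=
        (((measurable_one.indicator hA).comp measurable_fst).mul
          ((measurable_one.indicator hB).comp measurable_snd)).mul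
          ((hp.comp measurable_fst).mul (hr.ennreal_ofReal.mul ha.ennreal_ofReal))
      exact this.lintegral_prod_right'
  intro A B hA hB
  change ∫⁻ x in A, mhMeasure lam r a x B ∂_ = ∫⁻ x in B, mhMeasure lam r a x A ∂_
  rw [key A B hA hB, key B A hB hA, Set.inter_comm B A]
  congr 1
  rw [lintegral_lintegral_swap]
  · refine lintegral_congr fun x' => lintegral_congr fun x => ?_
    rw [hbal x x', mul_comm (A.indicator 1 x)]
  · exact ((((measurable_one.indicator hA).comp measurable_fst).mul
          ((measurable_one.indicator hB).comp measurable_snd)).mul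
          ((hp.comp measurable_fst).mul (hr.ennreal_ofReal.mul ha.ennreal_ofReal))).aemeasurable

end MetropolisHastings

/-! ## Sums over ancestor indices -/

section Ancestors

/-- Exchanging the new value with the overwritten coordinate is an involution of the pairs `(a, b)`.
-/
lemma sum_sum_update {ι β : Type*} [Fintype ι] [DecidableEq ι] [Fintype β]
    (t : ι) (F : (ι → β) → ℝ) :
    ∑ a, ∑ b, F (Function.update a t b) = Fintype.card β * ∑ a, F a := by
  have e : ∑ p : (ι → β) × β, F (Function.update p.1 t p.2) = ∑ p : (ι → β) × β, F p.1 := by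
    refine Fintype.sum_equiv (Function.Involutive.toPerm
      (fun p : (ι → β) × β => (Function.update p.1 t p.2, p.1 t)) ?_) _ _ (fun p => rfl)
    intro p
    simp
  rw [Fintype.sum_prod_type, Fintype.sum_prod_type] at e
  rw [e, Finset.mul_sum]
  simp

/-- Multinomial resampling: product weights on ancestor vectors marginalize to the weights. -/
lemma sum_prod_weight_mul {N : ℕ} {w : Fin N → ℝ} (hw : ∑ j, w j = 1) (f : Fin N → ℝ) (i : Fin N) :
    ∑ b : Fin N → Fin N, (∏ k, w (b k)) * f (b i) = ∑ j, w j * f j := by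
  -- The function of the `i`-th ancestor is written as a product over all coordinates, so the sum
  -- factorizes; every coordinate other than `i` contributes one.
  have h1 : ∀ b : Fin N → Fin N, (∏ k, w (b k)) * f (b i) =
      ∏ k, (w (b k) * if k = i then f (b k) else 1) := by
    intro b
    rw [Finset.prod_mul_distrib]
    simp
  simp_rw [h1]
  have h2 := Finset.prod_univ_sum (fun _ : Fin N => (Finset.univ : Finset (Fin N)))
    (fun k j => w j * if k = i then f j else 1)
  rw [Fintype.piFinset_univ] at h2
  rw [← h2, Finset.prod_eq_single i]
  · simp
  · intro k _ hk
    simp [hk, hw]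
  · simp

lemma sum_prod_weight {N : ℕ} {w : Fin N → ℝ} (hw : ∑ j, w j = 1) :
    ∑ b : Fin N → Fin N, ∏ k, w (b k) = 1 := by
  have h2 := Finset.prod_univ_sum (fun _ : Fin N => (Finset.univ : Finset (Fin N)))
    (fun _ j => w j)
  rw [Fintype.piFinset_univ] at h2
  rw [← h2]
  simp [hw]

/-- The density of a partial sequence of selections with conditional densities `A`; the
coordinates from `t` on are uniform. -/
noncomputable def partialDensity {n : ℕ} {β : Type*} [Fintype β] (A : Fin n → (Fin n → β) → β → ℝ)
    (t : ℕ) (a : Fin n → β) : ℝ :=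
  ∏ r : Fin n, if (r : ℕ) < t then A r a (a r) else (Fintype.card β : ℝ)⁻¹

lemma sum_partialDensity_zero {n : ℕ} {β : Type*} [Fintype β] [Nonempty β]
    (A : Fin n → (Fin n → β) → β → ℝ) :
    ∑ a, partialDensity A 0 a = 1 := by
  have : (Fintype.card β : ℝ) ≠ 0 := by simp
  simp [partialDensity, this]

/-- The coordinate `t` is uniform under the density at stage `t`. Redrawing it from `A t`, which
sees earlier coordinates only, gives the density at stage `t + 1`. Keeping unused coordinates
uniform lets an induction on time run over one fixed index set. -/
lemma sum_partialDensity_succ {n : ℕ} {β : Type*} [Fintype β] [Nonempty β]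
    {A : Fin n → (Fin n → β) → β → ℝ}
    (hA : ∀ r a a' b, (∀ s < r, a s = a' s) → A r a b = A r a' b) (t : Fin n)
    (Q : (Fin n → β) → ℝ) :
    ∑ a, partialDensity A (t + 1) a * Q a =
      ∑ a, partialDensity A t a * ∑ b, A t a b * Q (Function.update a t b) := by
  have hc : (Fintype.card β : ℝ) ≠ 0 := by simp
  -- The cardinality compensates for the uniform weight of the coordinate that is replaced; the
  -- factors before `t` do not see the change by `hA`, those after `t` are constant.
  have key : ∀ a b, partialDensity A (t + 1) (Function.update a t b) =
      Fintype.card β * (partialDensity A t a * A t a b) := by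
    intro a b
    rw [partialDensity, partialDensity, Fintype.prod_eq_mul_prod_compl t,
      Fintype.prod_eq_mul_prod_compl t (fun r : Fin n => if (r : ℕ) < (t : ℕ) then _ else _)]
    have h1 : ∀ r ∈ ({t} : Finset (Fin n))ᶜ,
        (if (r : ℕ) < t + 1 then A r (Function.update a t b) (Function.update a t b r)
          else (Fintype.card β : ℝ)⁻¹) =
        if (r : ℕ) < t then A r a (a r) else (Fintype.card β : ℝ)⁻¹ := by
      intro r hr
      have hrt : r ≠ t := by simpa using hr
      have hrt' : (r : ℕ) ≠ t := fun h => hrt (Fin.ext h)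
      rcases lt_or_ge (r : ℕ) t with h | h
      · rw [if_pos (by omega), if_pos h, Function.update_of_ne hrt]
        refine hA r _ _ _ fun s hs => Function.update_of_ne ?_ _ _
        rintro rfl
        exact absurd (Fin.lt_def.1 hs) (by omega)
      · rw [if_neg (by omega), if_neg (by omega)]
    rw [Finset.prod_congr rfl h1, if_pos (Nat.lt_succ_self _), if_neg (lt_irrefl _),
      Function.update_self, hA t (Function.update a t b) a b
        (fun s hs => Function.update_of_ne hs.ne _ _)]
    field_simp
  have h2 := sum_sum_update t (fun a => partialDensity A (t + 1) a * Q a)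
  rw [← mul_right_inj' hc, ← h2, Finset.mul_sum]
  refine Finset.sum_congr rfl fun a _ => ?_
  rw [Finset.mul_sum, Finset.mul_sum]
  refine Finset.sum_congr rfl fun b _ => ?_
  rw [key]
  ring

end Ancestors

/-! ## Particle filters -/

section ParticleFilter

variable {N T l : ℕ}

lemma pfPath_succ (u : PFVars N T l) {t : ℕ} (ht : t < T - 1) (i : Fin N) (s : Fin T) :
    pfPath u (t + 1) i s = if (s : ℕ) ≤ t then pfPath u t (u.2.1 ⟨t, ht⟩ i) s else u.1 s i := by
  rw [pfPath]
  by_cases h : (s : ℕ) ≤ t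
  · rw [dif_pos ⟨h, ht⟩, if_pos h]
  · rw [dif_neg (fun h' => h h'.1), if_neg h]

lemma pfPath_of_ge (u : PFVars N T l) {t : ℕ} (i : Fin N) {s : Fin T} (hs : t ≤ s) :
    pfPath u t i s = u.1 s i := by
  cases t with
  | zero => rfl
  | succ t => rw [pfPath, dif_neg (by omega)]

/-- Only the resampling steps before time `t` enter the paths at time `t`. This is the adaptedness
hypothesis needed for the recursion on partial densities, and it shows that the finally selected
index is irrelevant for the paths. -/
lemma pfPath_congr_ancestors {u u' : PFVars N T l} {t : ℕ} (h₁ : u.1 = u'.1)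
    (h₂ : ∀ r : Fin (T - 1), (r : ℕ) < t → u.2.1 r = u'.2.1 r) (i : Fin N) :
    pfPath u t i = pfPath u' t i := by
  induction t generalizing i with
  | zero => ext s; simp [pfPath, h₁]
  | succ t ih =>
    ext s : 1
    rw [pfPath, pfPath]
    split_ifs with h
    · rw [h₂ ⟨t, h.2⟩ (Nat.lt_succ_self t), ih fun r hr => h₂ r (hr.trans (Nat.lt_succ_self t))]
    · rw [h₁]

lemma pfPath_congr_increments {u u' : PFVars N T l} {t : ℕ} (h₂ : u.2.1 = u'.2.1)
    (h₁ : ∀ r : Fin T, (r : ℕ) ≤ t → u.1 r = u'.1 r) (i : Fin N) {s : Fin T} (hs : (s : ℕ) ≤ t) :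
    pfPath u t i s = pfPath u' t i s := by
  induction t generalizing i with
  | zero => simp [pfPath, h₁ s hs]
  | succ t ih =>
    rw [pfPath, pfPath]
    split_ifs with h
    · rw [h₂, ih (fun r hr => h₁ r (by omega)) _ h.1]
    · rw [h₁ s hs]

/-- The potential at time `t` depends on the path up to time `t` only. -/
def Nonanticipating (G : Fin T → Path T l → ℝ) : Prop :=
  ∀ t w w', (∀ s ≤ t, w s = w' s) → G t w = G t w'

/-- The conditional density of the ancestors selected at time `r`. -/
noncomputable def selectionDensity (G : Fin T → Path T l → ℝ) (c : ℝ → ℝ)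
    (ε : Fin T → Fin N → Fin (2 ^ l) → ℝ) (κ : Fin N) (r : Fin (T - 1))
    (a : Fin (T - 1) → Fin N → Fin N) (b : Fin N → Fin N) : ℝ :=
  c (∑ j, G ⟨r, lt_of_lt_of_le r.2 (Nat.sub_le T 1)⟩ (pfPath (ε, a, κ) r j)) *
    ∏ i, pfWeight G (ε, a, κ) ⟨r, lt_of_lt_of_le r.2 (Nat.sub_le T 1)⟩ (b i)

lemma selectionDensity_congr (G : Fin T → Path T l → ℝ) (c : ℝ → ℝ)
    (ε : Fin T → Fin N → Fin (2 ^ l) → ℝ) (κ : Fin N) (r : Fin (T - 1))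
    (a a' : Fin (T - 1) → Fin N → Fin N) (b : Fin N → Fin N) (h : ∀ s < r, a s = a' s) :
    selectionDensity G c ε κ r a b = selectionDensity G c ε κ r a' b := by
  have : ∀ i, pfPath (ε, a, κ) r i = pfPath (ε, a', κ) r i := fun i =>
    pfPath_congr_ancestors (u := (ε, a, κ)) (u' := (ε, a', κ)) rfl
      (fun s hs => h s (Fin.lt_def.2 hs)) i
  simp only [selectionDensity, pfWeight, this]

lemma sum_pfWeight {G : Fin T → Path T l → ℝ} (hG : ∀ t w, 0 < G t w) (u : PFVars N T l)
    (t : Fin T) : ∑ i, pfWeight G u t i = 1 := by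
  have hpos : 0 < ∑ j, G t (pfPath u t j) :=
    Finset.sum_pos (fun j _ => hG _ _) ⟨u.2.2, Finset.mem_univ _⟩
  simp only [pfWeight]
  rw [← Finset.sum_div, div_self hpos.ne']

/-- With `c = 1` the ancestors of each step form a probability distribution given the earlier ones.
The other choice, `c x = N⁻¹ x`, includes the factors of the normalizing constant estimate and is
used for unbiasedness. -/
lemma sum_partialDensity_selection {G : Fin T → Path T l → ℝ} (hG : ∀ t w, 0 < G t w)
    (ε : Fin T → Fin N → Fin (2 ^ l) → ℝ) (κ : Fin N) (t : ℕ) (ht : t ≤ T - 1) :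
    ∑ a, partialDensity (selectionDensity G (fun _ => 1) ε κ) t a = 1 := by
  have : Nonempty (Fin N) := ⟨κ⟩
  induction t with
  | zero => exact sum_partialDensity_zero _
  | succ t ih =>
    have h := sum_partialDensity_succ (selectionDensity_congr G (fun _ => 1) ε κ) ⟨t, ht⟩
      (fun _ => 1)
    simp only [mul_one] at h
    rw [h]
    refine (Finset.sum_congr rfl fun a _ => ?_).trans (ih (by omega))
    simp only [selectionDensity, one_mul]
    rw [sum_prod_weight (sum_pfWeight hG _ _), mul_one]

/-- The path that follows `w` up to time `t` and `w'` afterwards. -/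
def splice (t : ℕ) (w w' : Path T l) : Path T l := fun s => if (s : ℕ) ≤ t then w s else w' s

/-- One resampling step, averaged over the ancestors. -/
lemma sum_partialDensity_resample {G : Fin T → Path T l → ℝ} (hG : ∀ t w, 0 < G t w)
    (ε : Fin T → Fin N → Fin (2 ^ l) → ℝ) (κ : Fin N) (t : ℕ) (ht : t < T - 1) (Ψ : Path T l → ℝ) :
    ∑ a, partialDensity (selectionDensity G (fun x => (N : ℝ)⁻¹ * x) ε κ) (t + 1) a *
        ((N : ℝ)⁻¹ * ∑ i, Ψ (pfPath (ε, a, κ) (t + 1) i)) =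
      ∑ i, ∑ j, (N : ℝ)⁻¹ * ((N : ℝ)⁻¹ *
        ∑ a, partialDensity (selectionDensity G (fun x => (N : ℝ)⁻¹ * x) ε κ) t a *
          (G ⟨t, lt_of_lt_of_le ht (Nat.sub_le T 1)⟩ (pfPath (ε, a, κ) t j) *
            Ψ (splice t (pfPath (ε, a, κ) t j) fun s => ε s i))) := by
  have : Nonempty (Fin N) := ⟨κ⟩
  rw [sum_partialDensity_succ (selectionDensity_congr G _ ε κ) ⟨t, ht⟩]
  -- A resampled particle has the past of its ancestor and its own fresh increments afterwards.
  have hsucc : ∀ a b i, pfPath (ε, Function.update a ⟨t, ht⟩ b, κ) (t + 1) i =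
      splice t (pfPath (ε, a, κ) t (b i)) fun s => ε s i := by
    intro a b i
    ext s : 1
    rw [pfPath_succ _ ht, splice]
    split_ifs with h
    · have e : (ε, Function.update a ⟨t, ht⟩ b, κ).2.1 ⟨t, ht⟩ = b := Function.update_self _ _ _
      have e' := pfPath_congr_ancestors (u := (ε, Function.update a ⟨t, ht⟩ b, κ)) (u' := (ε, a, κ))
        (t := t) rfl (fun r hr => Function.update_of_ne
          (fun h => by subst h; exact lt_irrefl _ hr) _ _) (b i)
      rw [e, e']
    · rfl
  simp_rw [hsucc]
  -- The factor `N⁻¹ ∑ G` cancels the denominator of the resampling weight, so a ratio of sums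
  -- becomes a plain double sum over pairs of offspring and ancestor.
  have inner : ∀ a, ∑ b, selectionDensity G (fun x => (N : ℝ)⁻¹ * x) ε κ ⟨t, ht⟩ a b *
      ((N : ℝ)⁻¹ * ∑ i, Ψ (splice t (pfPath (ε, a, κ) t (b i)) fun s => ε s i)) =
      ∑ i, ∑ j, (N : ℝ)⁻¹ * ((N : ℝ)⁻¹ *
        (G ⟨t, lt_of_lt_of_le ht (Nat.sub_le T 1)⟩ (pfPath (ε, a, κ) t j) *
            Ψ (splice t (pfPath (ε, a, κ) t j) fun s => ε s i))) := by
    intro a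
    have hpos : 0 < ∑ j, G ⟨t, lt_of_lt_of_le ht (Nat.sub_le T 1)⟩ (pfPath (ε, a, κ) t j) :=
      Finset.sum_pos (fun j _ => hG _ _) Finset.univ_nonempty
    simp_rw [Finset.mul_sum]
    rw [Finset.sum_comm]
    refine Finset.sum_congr rfl fun i _ => ?_
    have h := sum_prod_weight_mul (sum_pfWeight hG (ε, a, κ) ⟨t, lt_of_lt_of_le ht (Nat.sub_le T 1)⟩)
      (fun j => Ψ (splice t (pfPath (ε, a, κ) t j) fun s => ε s i)) i
    simp only [selectionDensity]
    set sg := ∑ j, G ⟨t, lt_of_lt_of_le ht (Nat.sub_le T 1)⟩ (pfPath (ε, a, κ) t j) with hsg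
    have e1 : ∀ b : Fin N → Fin N, (N : ℝ)⁻¹ * sg *
        (∏ i, pfWeight G (ε, a, κ) ⟨t, lt_of_lt_of_le ht (Nat.sub_le T 1)⟩ (b i)) *
        ((N : ℝ)⁻¹ * Ψ (splice t (pfPath (ε, a, κ) t (b i)) fun s => ε s i)) =
        (N : ℝ)⁻¹ * (N : ℝ)⁻¹ * sg *
        ((∏ i, pfWeight G (ε, a, κ) ⟨t, lt_of_lt_of_le ht (Nat.sub_le T 1)⟩ (b i)) *
          Ψ (splice t (pfPath (ε, a, κ) t (b i)) fun s => ε s i)) := fun b => by ring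
    rw [Finset.sum_congr rfl fun b _ => e1 b, ← Finset.mul_sum, h, Finset.mul_sum]
    refine Finset.sum_congr rfl fun j _ => ?_
    simp only [pfWeight]
    rw [← hsg]
    field_simp
  simp_rw [inner, Finset.mul_sum]
  rw [Finset.sum_comm]
  refine Finset.sum_congr rfl fun i _ => ?_
  rw [Finset.sum_comm]
  refine Finset.sum_congr rfl fun j _ => Finset.sum_congr rfl fun a _ => ?_
  ring

end ParticleFilter

/-! ### Measurability of the particle filter -/

section ParticleFilterMeasurability

variable {N T l : ℕ} {α : Type*} [MeasurableSpace α]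

/-- Ancestor indices select among countably many measurable functions; measurability of resampled
paths and of products of selected weights reduces to this. -/
lemma measurable_indexed {ι X β : Type*} [Countable ι] [MeasurableSpace ι]
    [MeasurableSingletonClass ι] [MeasurableSpace X] [MeasurableSpace β] {f : ι → X → β}
    (hf : ∀ i, Measurable (f i)) {g : X → ι} (hg : Measurable g) : Measurable fun x => f (g x) x :=
  (measurable_from_prod_countable_right (f := fun p : ι × X => f p.1 p.2) hf).comp
    (hg.prodMk measurable_id)

lemma measurable_pfPath (t : ℕ) (i : Fin N) :
    Measurable fun u : PFVars N T l => pfPath u t i := by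
  induction t generalizing i with
  | zero =>
    refine measurable_pi_lambda _ fun s => ?_
    simp only [pfPath]
    fun_prop
  | succ t ih =>
    refine measurable_pi_lambda _ fun s => ?_
    by_cases h : (s : ℕ) ≤ t ∧ t < T - 1
    · simp only [pfPath, dif_pos h]
      refine measurable_indexed (f := fun (j : Fin N) (u : PFVars N T l) => pfPath u t j s)
        (fun j => (measurable_pi_apply s).comp (ih j)) ?_
      fun_prop
    · simp only [pfPath, dif_neg h]
      fun_prop

lemma measurable_pfOutput : Measurable fun u : PFVars N T l => pfOutput u :=
  measurable_indexed (f := fun (j : Fin N) (u : PFVars N T l) => pfPath u (T - 1) j)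
    (fun j => measurable_pfPath _ j) (by fun_prop)

lemma measurable_potential {G : α → Fin T → Path T l → ℝ}
    (hG : ∀ t, Measurable fun p : α × Path T l => G p.1 t p.2) (r : Fin T) (t : ℕ) (i : Fin N) :
    Measurable fun p : α × PFVars N T l => G p.1 r (pfPath p.2 t i) :=
  (hG r).comp (measurable_fst.prodMk ((measurable_pfPath t i).comp measurable_snd))

lemma measurable_pfWeight {G : α → Fin T → Path T l → ℝ}
    (hG : ∀ t, Measurable fun p : α × Path T l => G p.1 t p.2) (t : Fin T) (i : Fin N) :
    Measurable fun p : α × PFVars N T l => pfWeight (G p.1) p.2 t i :=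
  (measurable_potential hG t t i).div
    (Finset.measurable_sum _ fun j _ => measurable_potential hG t t j)

lemma measurable_pfNormConst {G : α → Fin T → Path T l → ℝ}
    (hG : ∀ t, Measurable fun p : α × Path T l => G p.1 t p.2) :
    Measurable fun p : α × PFVars N T l => pfNormConst (G p.1) p.2 := by
  simp only [pfNormConst]
  exact Finset.measurable_prod _ fun t _ => measurable_const.mul
    (Finset.measurable_sum _ fun j _ => measurable_potential hG t t j)

lemma measurable_pfDensity {G : α → Fin T → Path T l → ℝ}
    (hG : ∀ t, Measurable fun p : α × Path T l => G p.1 t p.2) :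
    Measurable fun p : α × PFVars N T l => pfDensity (G p.1) p.2 := by
  simp only [pfDensity]
  refine Measurable.mul (Finset.measurable_prod _ fun t _ => Finset.measurable_prod _ fun i _ => ?_) ?_
  · refine measurable_indexed (f := fun (j : Fin N) (p : α × PFVars N T l) =>
      pfWeight (G p.1) p.2 ⟨t, lt_of_lt_of_le t.2 (Nat.sub_le T 1)⟩ j)
      (fun j => measurable_pfWeight hG _ j) (by fun_prop)
  · by_cases hT : 0 < T
    · simp only [dif_pos hT]
      exact measurable_indexed (f := fun (j : Fin N) (p : α × PFVars N T l) =>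
        pfWeight (G p.1) p.2 ⟨T - 1, Nat.sub_lt hT one_pos⟩ j)
        (fun j => measurable_pfWeight hG _ j) (by fun_prop)
    · simp only [dif_neg hT]
      exact measurable_const

variable {G : Fin T → Path T l → ℝ}

lemma measurable_partialDensity_selection (hG : ∀ t, Measurable (G t)) {c : ℝ → ℝ}
    (hc : Measurable c) (κ : Fin N) (t : ℕ) (a : Fin (T - 1) → Fin N → Fin N) :
    Measurable fun ε => partialDensity (selectionDensity G c ε κ) t a := by
  have hG' : ∀ t, Measurable fun p : Unit × Path T l => (fun _ : Unit => G) p.1 t p.2 :=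
    fun t => (hG t).comp measurable_snd
  have hε : Measurable fun ε : Fin T → Fin N → Fin (2 ^ l) → ℝ =>
      (((), (ε, a, κ)) : Unit × PFVars N T l) := by fun_prop
  refine Finset.measurable_prod _ fun r _ => ?_
  by_cases h : (r : ℕ) < t
  · simp only [if_pos h, selectionDensity]
    refine (hc.comp (Finset.measurable_sum _ fun j _ => ?_)).mul
      (Finset.measurable_prod _ fun i _ => ?_)
    · exact (measurable_potential (α := Unit) (G := fun _ => G) hG' _ _ j).comp hε
    · refine measurable_indexed (f := fun (j : Fin N) (ε : Fin T → Fin N → Fin (2 ^ l) → ℝ) =>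
        pfWeight G (ε, a, κ) _ j) (fun j => ?_) measurable_const
      exact (measurable_pfWeight (α := Unit) (G := fun _ => G) hG' _ j).comp hε
  · simp only [if_neg h]
    exact measurable_const

end ParticleFilterMeasurability

/-! ### Unbiasedness of the particle filter -/

section Unbiasedness

variable {N T l : ℕ}

instance (l : ℕ) : IsProbabilityMeasure (blockLaw l) := by unfold blockLaw; infer_instance

instance (T l : ℕ) : IsProbabilityMeasure (pathLaw T l) := by unfold pathLaw; infer_instance

/-- The law of the increments of all the particles. -/
noncomputable def particleLaw (N T l : ℕ) : Measure (Fin T → Fin N → Fin (2 ^ l) → ℝ) :=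
  Measure.pi fun _ => Measure.pi fun _ => blockLaw l

instance (N T l : ℕ) : IsProbabilityMeasure (particleLaw N T l) := by
  unfold particleLaw; infer_instance

instance (N T l : ℕ) : SigmaFinite (pfBase N T l) := by
  unfold pfBase; infer_instance

lemma measurePreserving_comp_perm (e : Equiv.Perm (Fin N)) :
    MeasurePreserving (fun x : Fin N → Fin (2 ^ l) → ℝ => fun k => x (e k))
      (Measure.pi fun _ => blockLaw l) (Measure.pi fun _ => blockLaw l) := by
  refine ⟨by fun_prop, ?_⟩
  refine (Measure.pi_eq fun s hs => ?_).symm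
  rw [Measure.map_apply (by fun_prop) (MeasurableSet.univ_pi hs)]
  have : (fun x : Fin N → Fin (2 ^ l) → ℝ => fun k => x (e k)) ⁻¹' Set.univ.pi s =
      Set.univ.pi fun k => s (e.symm k) := by
    ext x
    simp only [Set.mem_preimage, Set.mem_univ_pi]
    exact ⟨fun h k => by simpa using h (e.symm k), fun h k => by simpa using h (e k)⟩
  rw [this, Measure.pi_pi]
  exact Equiv.prod_comp e.symm fun k => blockLaw l (s k)

lemma measurePreserving_particle (i : Fin N) :
    MeasurePreserving (fun (ε : Fin T → Fin N → Fin (2 ^ l) → ℝ) s => ε s i)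
      (particleLaw N T l) (pathLaw T l) :=
  measurePreserving_pi _ _ fun _ => measurePreserving_eval _ i

/-- Exchanging the future increments of the particles `i` and `j` preserves the law. -/
lemma measurePreserving_swap_future (t : ℕ) (i j : Fin N) :
    MeasurePreserving (fun (ε : Fin T → Fin N → Fin (2 ^ l) → ℝ) (s : Fin T) (k : Fin N) =>
      ε s (if (s : ℕ) ≤ t then k else Equiv.swap i j k))
      (particleLaw N T l) (particleLaw N T l) := by
  refine measurePreserving_pi (f := fun (s : Fin T) (x : Fin N → Fin (2 ^ l) → ℝ) (k : Fin N) =>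
    x (if (s : ℕ) ≤ t then k else Equiv.swap i j k)) _ _ fun s => ?_
  by_cases h : (s : ℕ) ≤ t
  · simp only [if_pos h]
    exact MeasurePreserving.id _
  · simp only [if_neg h]
    exact measurePreserving_comp_perm _

variable {G : Fin T → Path T l → ℝ}

/-- The selections before time `t` use potentials at earlier times only, which do not look ahead;
increments after time `t` may therefore be changed freely. -/
lemma partialDensity_congr_increments (hGn : Nonanticipating G) {c : ℝ → ℝ}
    {ε ε' : Fin T → Fin N → Fin (2 ^ l) → ℝ} (κ : Fin N) (t : ℕ)
    (h : ∀ r : Fin T, (r : ℕ) ≤ t → ε r = ε' r) (a : Fin (T - 1) → Fin N → Fin N) :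
    partialDensity (selectionDensity G c ε κ) t a = partialDensity (selectionDensity G c ε' κ) t a := by
  refine Finset.prod_congr rfl fun r _ => ?_
  split_ifs with hr
  · have : ∀ i, G ⟨r, lt_of_lt_of_le r.2 (Nat.sub_le T 1)⟩ (pfPath (ε, a, κ) r i) =
        G ⟨r, lt_of_lt_of_le r.2 (Nat.sub_le T 1)⟩ (pfPath (ε', a, κ) r i) := fun i =>
      hGn _ _ _ fun s hs => pfPath_congr_increments (u := (ε, a, κ)) (u' := (ε', a, κ)) rfl
        (fun r' hr' => h r' (by omega)) i (Fin.le_def.1 hs)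
    simp only [selectionDensity, pfWeight, this]
  · rfl

/-- The unnormalized law of the particles before the `t`-th weighting. -/
noncomputable def pfFlow (G : Fin T → Path T l → ℝ) (κ : Fin N) (t : ℕ) (Ψ : Path T l → ℝ) : ℝ≥0∞ :=
  ∫⁻ ε, ENNReal.ofReal (∑ a,
    partialDensity (selectionDensity G (fun x => (N : ℝ)⁻¹ * x) ε κ) t a *
      ((N : ℝ)⁻¹ * ∑ i, Ψ (pfPath (ε, a, κ) t i))) ∂particleLaw N T l

lemma pfFlow_zero (κ : Fin N) {Ψ : Path T l → ℝ} (hΨ : Measurable Ψ) (hΨ₀ : ∀ w, 0 ≤ Ψ w) :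
    pfFlow G κ 0 Ψ = ∫⁻ w, ENNReal.ofReal (Ψ w) ∂pathLaw T l := by
  have : Nonempty (Fin N) := ⟨κ⟩
  have hN : (N : ℝ) ≠ 0 := by have := κ.pos; positivity
  have h0 : ∀ ε a i, pfPath (ε, a, κ) 0 i = fun s => (ε : Fin T → Fin N → Fin (2 ^ l) → ℝ) s i :=
    fun _ _ _ => rfl
  simp only [pfFlow, h0]
  simp_rw [← Finset.sum_mul, sum_partialDensity_zero, one_mul]
  have e : ∀ ε : Fin T → Fin N → Fin (2 ^ l) → ℝ,
      ENNReal.ofReal ((N : ℝ)⁻¹ * ∑ i, Ψ fun s => ε s i) =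
      ENNReal.ofReal (N : ℝ)⁻¹ * ∑ i, ENNReal.ofReal (Ψ fun s => ε s i) := by
    intro ε
    rw [ENNReal.ofReal_mul (by positivity), ENNReal.ofReal_sum_of_nonneg fun i _ => hΨ₀ _]
  simp_rw [e]
  have hm : ∀ i, Measurable fun ε : Fin T → Fin N → Fin (2 ^ l) → ℝ =>
      ENNReal.ofReal (Ψ fun s => ε s i) := fun i =>
    (hΨ.comp (measurePreserving_particle i).measurable).ennreal_ofReal
  rw [lintegral_const_mul _ (Finset.measurable_sum _ fun i _ => hm i),
    lintegral_finsetSum _ fun i _ => hm i]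
  have hi : ∀ i : Fin N, ∫⁻ ε, ENNReal.ofReal (Ψ fun s => ε s i) ∂particleLaw N T l =
      ∫⁻ w, ENNReal.ofReal (Ψ w) ∂pathLaw T l := fun i =>
    (measurePreserving_particle i).lintegral_comp hΨ.ennreal_ofReal
  simp_rw [hi]
  rw [Finset.sum_const, Finset.card_univ, Fintype.card_fin, nsmul_eq_mul, ← mul_assoc,
    ENNReal.ofReal_inv_of_pos (by have := κ.pos; positivity), ENNReal.ofReal_natCast,
    ENNReal.inv_mul_cancel (by have := κ.pos; positivity) (by simp), one_mul]

/-- After a resampling step the flow is an average over pairs: the past of an ancestor `j` continued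
by the future increments of an offspring `i`. These futures are exchangeable given the past, so the
future of `i` may be replaced by that of `j`. The average over `i` then disappears, and what is left
is the flow at time `t` of `G t` times the test function. -/
lemma pfFlow_succ (hG : ∀ t w, 0 < G t w) (hGm : ∀ t, Measurable (G t)) (hGn : Nonanticipating G)
    (κ : Fin N) {t : ℕ} (ht : t < T - 1) {Ψ : Path T l → ℝ} (hΨ : Measurable Ψ)
    (hΨ₀ : ∀ w, 0 ≤ Ψ w) :
    pfFlow G κ (t + 1) Ψ =
      pfFlow G κ t fun w => G ⟨t, lt_of_lt_of_le ht (Nat.sub_le T 1)⟩ w * Ψ w := by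
  have : Nonempty (Fin N) := ⟨κ⟩
  have hNpos : 0 < (N : ℝ) := by have := κ.pos; positivity
  set g := G ⟨t, lt_of_lt_of_le ht (Nat.sub_le T 1)⟩ with hg
  set D := fun (ε : Fin T → Fin N → Fin (2 ^ l) → ℝ) (a : Fin (T - 1) → Fin N → Fin N) =>
    partialDensity (selectionDensity G (fun x => (N : ℝ)⁻¹ * x) ε κ) t a with hD
  have hD0 : ∀ ε a, 0 ≤ D ε a := by
    intro ε a
    refine Finset.prod_nonneg fun r _ => ?_
    split_ifs
    · refine mul_nonneg (mul_nonneg (by positivity) (Finset.sum_nonneg fun j _ => (hG _ _).le))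
        (Finset.prod_nonneg fun i _ => div_nonneg (hG _ _).le
          (Finset.sum_nonneg fun j _ => (hG _ _).le))
    · positivity
  have hDm : ∀ a, Measurable fun ε => D ε a := fun a =>
    measurable_partialDensity_selection hGm (by fun_prop) κ t a
  -- the summand for the pair of particles `i`, `j`
  set J := fun (i j : Fin N) (ε : Fin T → Fin N → Fin (2 ^ l) → ℝ) => ∑ a, D ε a *
    (g (pfPath (ε, a, κ) t j) * Ψ (splice t (pfPath (ε, a, κ) t j) fun s => ε s i)) with hJ
  have hpath : ∀ a j, Measurable fun ε : Fin T → Fin N → Fin (2 ^ l) → ℝ =>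
      pfPath (ε, a, κ) t j := fun a j => (measurable_pfPath t j).comp (by fun_prop)
  have hJm : ∀ i j, Measurable (J i j) := by
    intro i j
    refine Finset.measurable_sum _ fun a _ => (hDm a).mul
      (((hGm _).comp (hpath a j)).mul (hΨ.comp ?_))
    refine measurable_pi_lambda _ fun s => ?_
    simp only [splice]
    split_ifs
    · exact (measurable_pi_apply s).comp (hpath a j)
    · fun_prop
  have hJ0 : ∀ i j ε, 0 ≤ J i j ε := fun i j ε =>
    Finset.sum_nonneg fun a _ => mul_nonneg (hD0 _ _) (mul_nonneg (hG _ _).le (hΨ₀ _))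
  -- Swapping the futures of `i` and `j` preserves the law and leaves unchanged everything
  -- determined up to time `t`: the selection density, the potential, and the past of the path.
  have hJswap : ∀ i j, ∫⁻ ε, ENNReal.ofReal (J i j ε) ∂particleLaw N T l =
      ∫⁻ ε, ENNReal.ofReal (J j j ε) ∂particleLaw N T l := by
    intro i j
    rw [← (measurePreserving_swap_future t i j).lintegral_comp (hJm i j).ennreal_ofReal]
    refine lintegral_congr fun ε => ?_
    congr 1
    refine Finset.sum_congr rfl fun a _ => ?_
    set ε' : Fin T → Fin N → Fin (2 ^ l) → ℝ :=
      fun s k => ε s (if (s : ℕ) ≤ t then k else Equiv.swap i j k) with hε'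
    have hpast : ∀ r : Fin T, (r : ℕ) ≤ t → ε' r = ε r := by
      intro r hr; ext k : 1; simp only [hε', if_pos hr]
    have hp : ∀ (k : Fin N) (s : Fin T), (s : ℕ) ≤ t →
        pfPath (ε', a, κ) t k s = pfPath (ε, a, κ) t k s := fun k s hs =>
      pfPath_congr_increments (u := (ε', a, κ)) (u' := (ε, a, κ)) rfl hpast k hs
    have e1 : D ε' a = D ε a := partialDensity_congr_increments hGn κ t hpast a
    have e2 : g (pfPath (ε', a, κ) t j) = g (pfPath (ε, a, κ) t j) :=
      hGn _ _ _ fun s hs => hp j s (Fin.le_def.1 hs)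
    have e3 : splice t (pfPath (ε', a, κ) t j) (fun s => ε' s i) =
        splice t (pfPath (ε, a, κ) t j) fun s => ε s j := by
      ext s : 1
      simp only [splice]
      split_ifs with hs
      · exact hp j s hs
      · simp only [hε', if_neg hs, Equiv.swap_apply_left]
    rw [e1, e2, e3]
  -- Before being resampled at time `t`, particle `j` already carries its own future increments, so
  -- splicing them on again changes nothing.
  have hdiag : ∀ j ε, J j j ε = ∑ a, D ε a * (g (pfPath (ε, a, κ) t j) * Ψ (pfPath (ε, a, κ) t j)) := by
    intro j ε
    refine Finset.sum_congr rfl fun a _ => ?_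
    have : splice t (pfPath (ε, a, κ) t j) (fun s => ε s j) = pfPath (ε, a, κ) t j := by
      ext s : 1
      simp only [splice]
      split_ifs with hs
      · rfl
      · rw [pfPath_of_ge _ _ (not_le.1 hs).le]
    rw [this]
  have hrhs : ∀ ε, ∑ a, D ε a * ((N : ℝ)⁻¹ * ∑ i, g (pfPath (ε, a, κ) t i) * Ψ (pfPath (ε, a, κ) t i)) =
      ∑ j, (N : ℝ)⁻¹ * J j j ε := by
    intro ε
    simp_rw [hdiag, Finset.mul_sum]
    rw [Finset.sum_comm]
    exact Finset.sum_congr rfl fun j _ => Finset.sum_congr rfl fun a _ => by ring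
  have hpull : ∀ (ι : Type) [Fintype ι] (c : ℝ) (_ : 0 ≤ c)
      (f : ι → (Fin T → Fin N → Fin (2 ^ l) → ℝ) → ℝ) (_ : ∀ i, Measurable (f i))
      (_ : ∀ i ε, 0 ≤ f i ε),
      ∫⁻ ε, ENNReal.ofReal (∑ i, c * f i ε) ∂particleLaw N T l =
        ∑ i, ENNReal.ofReal c * ∫⁻ ε, ENNReal.ofReal (f i ε) ∂particleLaw N T l := by
    intro ι _ c hc f hfm hf0
    have : ∀ ε, ENNReal.ofReal (∑ i, c * f i ε) =
        ∑ i, ENNReal.ofReal c * ENNReal.ofReal (f i ε) := by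
      intro ε
      rw [ENNReal.ofReal_sum_of_nonneg fun i _ => mul_nonneg hc (hf0 i ε)]
      exact Finset.sum_congr rfl fun i _ => ENNReal.ofReal_mul hc
    simp_rw [this]
    rw [lintegral_finsetSum _ fun i _ => (hfm i).ennreal_ofReal.const_mul _]
    exact Finset.sum_congr rfl fun i _ => lintegral_const_mul _ (hfm i).ennreal_ofReal
  have hlhs : ∀ ε, ∑ a, partialDensity (selectionDensity G (fun x => (N : ℝ)⁻¹ * x) ε κ) (t + 1) a *
      ((N : ℝ)⁻¹ * ∑ i, Ψ (pfPath (ε, a, κ) (t + 1) i)) =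
      ∑ p : Fin N × Fin N, ((N : ℝ)⁻¹ * (N : ℝ)⁻¹) * J p.1 p.2 ε := by
    intro ε
    rw [sum_partialDensity_resample hG ε κ t ht Ψ, Fintype.sum_prod_type]
    exact Finset.sum_congr rfl fun i _ => Finset.sum_congr rfl fun j _ => by rw [← mul_assoc]
  simp only [pfFlow]
  simp_rw [hlhs]
  refine (hpull (Fin N × Fin N) _ (by positivity) (fun p => J p.1 p.2) (fun p => hJm _ _)
    (fun p => hJ0 _ _)).trans ?_
  rw [Fintype.sum_prod_type]
  rw [Finset.sum_congr rfl fun i _ => Finset.sum_congr rfl fun j _ => by rw [hJswap i j]]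
  rw [Finset.sum_const, Finset.card_univ, Fintype.card_fin, nsmul_eq_mul]
  have hr := hpull _ (N : ℝ)⁻¹ (by positivity) (fun j => J j j) (fun j => hJm _ _) (fun j => hJ0 _ _)
  refine Eq.trans ?_ (hr.symm.trans (lintegral_congr fun ε => by rw [← hrhs]))
  rw [Finset.mul_sum]
  refine Finset.sum_congr rfl fun j _ => ?_
  rw [← mul_assoc, ← ENNReal.ofReal_natCast, ← ENNReal.ofReal_mul (by positivity)]
  congr 2
  field_simp

/-- Each time step moves one potential from the particle system into the test function, until only
independent trajectories are left. -/
lemma pfFlow_eq (hG : ∀ t w, 0 < G t w) (hGm : ∀ t, Measurable (G t)) (hGn : Nonanticipating G)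
    (κ : Fin N) {t : ℕ} (ht : t ≤ T - 1) {Ψ : Path T l → ℝ} (hΨ : Measurable Ψ)
    (hΨ₀ : ∀ w, 0 ≤ Ψ w) :
    pfFlow G κ t Ψ = ∫⁻ w, ENNReal.ofReal
      ((∏ r : Fin T, if (r : ℕ) < t then G r w else 1) * Ψ w) ∂pathLaw T l := by
  induction t generalizing Ψ with
  | zero => simp [pfFlow_zero κ hΨ hΨ₀]
  | succ t ih =>
    have htT : t < T := by omega
    rw [pfFlow_succ hG hGm hGn κ ht hΨ hΨ₀, ih (by omega) (Ψ := fun w => G ⟨t, htT⟩ w * Ψ w) ((hGm _).mul hΨ)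
      (fun w => mul_nonneg (hG _ _).le (hΨ₀ w))]
    refine lintegral_congr fun w => ?_
    congr 1
    rw [← mul_assoc]
    congr 1
    rw [Fintype.prod_eq_mul_prod_compl ⟨t, htT⟩,
      Fintype.prod_eq_mul_prod_compl ⟨t, htT⟩ fun r : Fin T => if (r : ℕ) < t + 1 then G r w else 1,
      if_neg (lt_irrefl _), if_pos (Nat.lt_succ_self _), one_mul, mul_comm]
    congr 1
    refine Finset.prod_congr rfl fun r hr => ?_
    have hrt : (r : ℕ) ≠ t := fun h => by
      have : r ≠ ⟨t, htT⟩ := by simpa using hr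
      exact this (Fin.ext h)
    by_cases h : (r : ℕ) < t
    · rw [if_pos h, if_pos (by omega)]
    · rw [if_neg h, if_neg (by omega)]

lemma lintegral_pfBase {F : PFVars N T l → ℝ≥0∞} (hF : Measurable F) :
    ∫⁻ u, F u ∂pfBase N T l = ∫⁻ ε, ∑ a, ∑ κ, F (ε, a, κ) ∂particleLaw N T l := by
  rw [pfBase, lintegral_prod _ hF.aemeasurable]
  refine lintegral_congr fun ε => ?_
  rw [lintegral_prod (fun z => F (ε, z))
    (hF.comp (by fun_prop : Measurable fun z => (ε, z))).aemeasurable, lintegral_count, tsum_fintype]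
  refine Finset.sum_congr rfl fun a _ => ?_
  rw [lintegral_count, tsum_fintype]

lemma sum_sum_ofReal {ι ι' : Type*} [Fintype ι] [Fintype ι'] {f : ι → ι' → ℝ}
    (hf : ∀ i j, 0 ≤ f i j) :
    ∑ i, ∑ j, ENNReal.ofReal (f i j) = ENNReal.ofReal (∑ i, ∑ j, f i j) := by
  rw [ENNReal.ofReal_sum_of_nonneg fun i _ => Finset.sum_nonneg fun j _ => hf i j]
  exact Finset.sum_congr rfl fun i _ => (ENNReal.ofReal_sum_of_nonneg fun j _ => hf i j).symm

lemma prod_univ_eq_mul_last (hT : 0 < T) (f : Fin T → ℝ) :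
    ∏ t, f t = (∏ r : Fin (T - 1), f ⟨r, lt_of_lt_of_le r.2 (Nat.sub_le T 1)⟩) *
      f ⟨T - 1, Nat.sub_lt hT one_pos⟩ := by
  obtain ⟨n, rfl⟩ : ∃ n, T = n + 1 := ⟨T - 1, by omega⟩
  exact Fin.prod_univ_castSucc f

lemma pfDensity_eq (hT : 0 < T) {G : Fin T → Path T l → ℝ} (u : PFVars N T l) :
    pfDensity G u = (∏ r : Fin (T - 1), ∏ i,
      pfWeight G u ⟨r, lt_of_lt_of_le r.2 (Nat.sub_le T 1)⟩ (u.2.1 r i)) *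
      pfWeight G u ⟨T - 1, Nat.sub_lt hT one_pos⟩ u.2.2 := by
  rw [pfDensity, dif_pos hT]

/-- No weight depends on the selected index; a dummy index can therefore be fixed in the flow while
the actual one is summed over. -/
lemma pfWeight_congr_selected (G : Fin T → Path T l → ℝ) (ε : Fin T → Fin N → Fin (2 ^ l) → ℝ)
    (a : Fin (T - 1) → Fin N → Fin N) (κ κ' : Fin N) (t : Fin T) (i : Fin N) :
    pfWeight G (ε, a, κ) t i = pfWeight G (ε, a, κ') t i := by
  have hp : ∀ i, pfPath (ε, a, κ) t i = pfPath (ε, a, κ') t i := fun i =>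
    pfPath_congr_ancestors (u := (ε, a, κ)) (u' := (ε, a, κ')) rfl (fun _ _ => rfl) i
  simp only [pfWeight, hp]

lemma partialDensity_selection_eq (G : Fin T → Path T l → ℝ) (c : ℝ → ℝ)
    (ε : Fin T → Fin N → Fin (2 ^ l) → ℝ) (a : Fin (T - 1) → Fin N → Fin N) (κ κ' : Fin N) :
    partialDensity (selectionDensity G c ε κ') (T - 1) a =
      ∏ r : Fin (T - 1), (c (∑ j, G ⟨r, lt_of_lt_of_le r.2 (Nat.sub_le T 1)⟩
        (pfPath (ε, a, κ) r j)) *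
        ∏ i, pfWeight G (ε, a, κ) ⟨r, lt_of_lt_of_le r.2 (Nat.sub_le T 1)⟩ (a r i)) := by
  have hp : ∀ t i, pfPath (ε, a, κ') t i = pfPath (ε, a, κ) t i := fun t i =>
    pfPath_congr_ancestors (u := (ε, a, κ')) (u' := (ε, a, κ)) rfl (fun _ _ => rfl) i
  refine Finset.prod_congr rfl fun r _ => ?_
  rw [if_pos r.2]
  simp only [selectionDensity, pfWeight, hp]

lemma pfWeight_nonneg {G : Fin T → Path T l → ℝ} (hG : ∀ t w, 0 < G t w) (u : PFVars N T l)
    (t : Fin T) (i : Fin N) : 0 ≤ pfWeight G u t i :=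
  div_nonneg (hG _ _).le (Finset.sum_nonneg fun _ _ => (hG _ _).le)

lemma pfDensity_nonneg {G : Fin T → Path T l → ℝ} (hG : ∀ t w, 0 < G t w) (u : PFVars N T l) :
    0 ≤ pfDensity G u := by
  refine mul_nonneg (Finset.prod_nonneg fun r _ => Finset.prod_nonneg fun i _ =>
    pfWeight_nonneg hG _ _ _) ?_
  split_ifs
  · exact pfWeight_nonneg hG _ _ _
  · exact zero_le_one

lemma pfNormConst_nonneg {G : Fin T → Path T l → ℝ} (hG : ∀ t w, 0 < G t w) (u : PFVars N T l) :
    0 ≤ pfNormConst G u :=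
  Finset.prod_nonneg fun t _ => mul_nonneg (by positivity)
    (Finset.sum_nonneg fun _ _ => (hG _ _).le)

lemma measurable_section {α β : Type*} [MeasurableSpace α] [MeasurableSpace β] (a : α)
    {F : α × β → ℝ} (hF : Measurable F) : Measurable fun b => F (a, b) :=
  hF.comp measurable_prodMk_left

lemma measurable_pfDensity_of_fixed (hGm : ∀ t, Measurable (G t)) :
    Measurable fun u : PFVars N T l => pfDensity G u := by
  have h := measurable_pfDensity (N := N) (α := Unit) (G := fun _ => G)
    (fun t => (hGm t).comp measurable_snd)
  exact measurable_section () h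

lemma measurable_pfNormConst_of_fixed (hGm : ∀ t, Measurable (G t)) :
    Measurable fun u : PFVars N T l => pfNormConst G u := by
  have h := measurable_pfNormConst (N := N) (α := Unit) (G := fun _ => G)
    (fun t => (hGm t).comp measurable_snd)
  exact measurable_section () h

/-- The density of the particle filter integrates to one. -/
lemma lintegral_pfDensity (hT : 0 < T) (hN : 0 < N) (hG : ∀ t w, 0 < G t w)
    (hGm : ∀ t, Measurable (G t)) :
    ∫⁻ u, ENNReal.ofReal (pfDensity G u) ∂pfBase N T l = 1 := by
  have hm : Measurable fun u : PFVars N T l => pfDensity G u :=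
    measurable_pfDensity_of_fixed hGm
  rw [lintegral_pfBase hm.ennreal_ofReal]
  -- For fixed increments the final selection is summed first, then the ancestors, each conditional
  -- distribution having mass one.
  have key : ∀ ε, ∑ a, ∑ κ : Fin N, ENNReal.ofReal (pfDensity G (ε, a, κ)) = 1 := by
    intro ε
    rw [sum_sum_ofReal fun a κ => pfDensity_nonneg hG _, ← ENNReal.ofReal_one, ← sum_partialDensity_selection hG ε ⟨0, hN⟩ (T - 1) le_rfl]
    congr 1
    refine Finset.sum_congr rfl fun a _ => ?_
    have e : ∀ κ : Fin N, pfDensity G (ε, a, κ) =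
        partialDensity (selectionDensity G (fun _ => 1) ε ⟨0, hN⟩) (T - 1) a *
          pfWeight G (ε, a, ⟨0, hN⟩) ⟨T - 1, Nat.sub_lt hT one_pos⟩ κ := by
      intro κ
      rw [pfDensity_eq hT, partialDensity_selection_eq G _ ε a κ ⟨0, hN⟩,
        pfWeight_congr_selected G ε a ⟨0, hN⟩ κ]
      simp only [one_mul]
    simp_rw [e]
    rw [← Finset.mul_sum, sum_pfWeight hG, mul_one]
  simp_rw [key]
  simp

/-- The particle filter is unbiased: the normalizing constant estimate times a function of the
selected trajectory. -/
lemma lintegral_pfNormConst_mul (hT : 0 < T) (hN : 0 < N) (hG : ∀ t w, 0 < G t w)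
    (hGm : ∀ t, Measurable (G t)) (hGn : Nonanticipating G) {Ψ : Path T l → ℝ} (hΨ : Measurable Ψ)
    (hΨ₀ : ∀ w, 0 ≤ Ψ w) :
    ∫⁻ u, ENNReal.ofReal (pfNormConst G u * pfDensity G u * Ψ (pfOutput u)) ∂pfBase N T l =
      ∫⁻ w, ENNReal.ofReal ((∏ t, G t w) * Ψ w) ∂pathLaw T l := by
  have hm : Measurable fun u : PFVars N T l => pfDensity G u :=
    measurable_pfDensity_of_fixed hGm
  have hm' : Measurable fun u : PFVars N T l => pfNormConst G u :=
    measurable_pfNormConst_of_fixed hGm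
  have h0 : ∀ u : PFVars N T l, 0 ≤ pfNormConst G u * pfDensity G u * Ψ (pfOutput u) :=
    fun u => mul_nonneg (mul_nonneg (pfNormConst_nonneg hG u) (pfDensity_nonneg hG u)) (hΨ₀ _)
  have hmF : Measurable fun u : PFVars N T l =>
      ENNReal.ofReal (pfNormConst G u * pfDensity G u * Ψ (pfOutput u)) :=
    ((hm'.mul hm).mul (hΨ.comp measurable_pfOutput)).ennreal_ofReal
  rw [lintegral_pfBase hmF]
  set last : Fin T := ⟨T - 1, Nat.sub_lt hT one_pos⟩ with hlast
  -- The last weighting is followed by the final selection instead of a resampling step, so the flow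
  -- is stopped at `T - 1` and the last potential is part of the test function.
  have hflow := pfFlow_eq hG hGm hGn ⟨0, hN⟩ (t := T - 1) le_rfl
    (Ψ := fun w => G last w * Ψ w) ((hGm last).mul hΨ)
    (fun w => mul_nonneg (hG _ _).le (hΨ₀ w))
  have hprod : ∀ w, (∏ r : Fin T, if (r : ℕ) < T - 1 then G r w else 1) *
      (G last w * Ψ w) = (∏ t, G t w) * Ψ w := by
    intro w
    rw [prod_univ_eq_mul_last hT, prod_univ_eq_mul_last hT (fun t => G t w),
      Finset.prod_congr rfl fun (r : Fin (T - 1)) _ => if_pos r.2]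
    simp only [lt_irrefl, if_false, mul_one, ← hlast]
    ring
  simp_rw [hprod] at hflow
  rw [← hflow, pfFlow]
  refine lintegral_congr fun ε => ?_
  rw [sum_sum_ofReal fun a κ => h0 _]
  congr 1
  refine Finset.sum_congr rfl fun a _ => ?_
  rw [Finset.mul_sum, Finset.mul_sum]
  refine Finset.sum_congr rfl fun κ _ => ?_
  rw [partialDensity_selection_eq G _ ε a κ ⟨0, hN⟩, pfDensity_eq hT, pfNormConst,
    prod_univ_eq_mul_last hT, ← hlast]
  have hpos : 0 < ∑ j, G last (pfPath (ε, a, κ) last j) :=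
    Finset.sum_pos (fun j _ => hG _ _) ⟨κ, Finset.mem_univ _⟩
  have hp : pfPath (ε, a, (⟨0, hN⟩ : Fin N)) (T - 1) κ = pfPath (ε, a, κ) last κ :=
    pfPath_congr_ancestors (u := (ε, a, ⟨0, hN⟩)) (u' := (ε, a, κ)) rfl (fun _ _ => rfl) κ
  have hout : pfOutput (ε, a, κ) = pfPath (ε, a, κ) last κ := rfl
  have hwt : pfWeight G (ε, a, κ) last κ =
    G last (pfPath (ε, a, κ) last κ) / ∑ j, G last (pfPath (ε, a, κ) last j) := rfl
  rw [hp, hout, hwt]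
  -- Once averages and weights are separated, the sum of the potentials at the last time cancels the
  -- denominator of the weight of the selected trajectory.
  simp only [Finset.prod_mul_distrib]
  field_simp

end Unbiasedness

/-! ### The Metropolis–Hastings chain of particle MCMC and its stationary law -/

lemma measurable_comp_fst {α β : Type*} [MeasurableSpace α] [MeasurableSpace β]
    {F : α → ℝ} (hF : Measurable F) : Measurable fun p : α × β => F p.1 :=
  hF.comp measurable_fst

lemma measurable_comp_snd {α β : Type*} [MeasurableSpace α] [MeasurableSpace β]
    {F : β → ℝ} (hF : Measurable F) : Measurable fun p : α × β => F p.2 :=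
  hF.comp measurable_snd

namespace Model

variable {d T : ℕ} {Y : Type*} {m : Model d T Y} {l : ℕ}

/-- Potentials that are measurable, nonanticipating, and bounded from above and below. -/
structure GoodPotential (m : Model d T Y) (G : m.Θ → Fin T → Path T l → ℝ) : Prop where
  meas : ∀ t, Measurable fun p : m.Θ × Path T l => G p.1 t p.2
  nonanticipating : ∀ θ, Nonanticipating (G θ)
  bounds : ∃ A B : ℝ, 0 < A ∧ ∀ θ t w, A ≤ G θ t w ∧ G θ t w ≤ B

namespace GoodPotential

variable {G : m.Θ → Fin T → Path T l → ℝ} (hG : m.GoodPotential G)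

include hG

lemma pos (θ : m.Θ) (t : Fin T) (w : Path T l) : 0 < G θ t w := by
  obtain ⟨A, B, hA, h⟩ := hG.bounds
  exact hA.trans_le (h θ t w).1

lemma measurable_prod : Measurable fun p : m.Θ × Path T l => ∏ t, G p.1 t p.2 :=
  Finset.measurable_prod _ fun t _ => hG.meas t

lemma prod_pos (p : m.Θ × Path T l) : 0 < ∏ t, G p.1 t p.2 :=
  Finset.prod_pos fun _ _ => hG.pos _ _ _

lemma prod_bounds : ∃ A B : ℝ, 0 < A ∧ ∀ p : m.Θ × Path T l,
    A ≤ ∏ t, G p.1 t p.2 ∧ ∏ t, G p.1 t p.2 ≤ B := by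
  obtain ⟨A, B, hA, h⟩ := hG.bounds
  refine ⟨∏ _t : Fin T, A, ∏ _t : Fin T, B, Finset.prod_pos fun _ _ => hA, fun p => ⟨?_, ?_⟩⟩
  · exact Finset.prod_le_prod (fun _ _ => hA.le) fun _ _ => (h _ _ _).1
  · exact Finset.prod_le_prod (fun _ _ => (hG.pos _ _ _).le) fun _ _ => (h _ _ _).2

lemma meas_fixed (θ : m.Θ) (t : Fin T) : Measurable (G θ t) :=
  measurable_section θ (hG.meas t)

end GoodPotential

lemma Standing.priorLaw_isProbability (hm : m.Standing) : IsProbabilityMeasure m.priorLaw :=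
  ⟨by rw [priorLaw, withDensity_apply _ MeasurableSet.univ, Measure.restrict_univ, hm.prior_total]⟩

section Accept

variable (hm : m.Standing) {G : m.Θ → Fin T → Path T l → ℝ} (hG : m.GoodPotential G)

include hm hG

/-- The minimum is symmetric in the two states, which is the source of detailed balance. The
convention of accepting when the denominator vanishes is harmless, as both sides are then zero. -/
lemma mul_accept_eq_min (x x' : m.State l) :
    pfNormConst (G x.1) x.2 * m.prior x.1 * m.q l x.1 x'.1 * m.accept G x x' =
      min (pfNormConst (G x.1) x.2 * m.prior x.1 * m.q l x.1 x'.1)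
        (pfNormConst (G x'.1) x'.2 * m.prior x'.1 * m.q l x'.1 x.1) := by
  have h0 : ∀ y y' : m.State l, 0 ≤ pfNormConst (G y.1) y.2 * m.prior y.1 * m.q l y.1 y'.1 :=
    fun y y' => mul_nonneg (mul_nonneg (pfNormConst_nonneg (hG.pos _) _) (hm.prior_nonneg _))
      (hm.q_nonneg _ _ _)
  rw [accept]
  have hA := h0 x x'
  have hA' := h0 x' x
  set A := pfNormConst (G x.1) x.2 * m.prior x.1 * m.q l x.1 x'.1
  set A' := pfNormConst (G x'.1) x'.2 * m.prior x'.1 * m.q l x'.1 x.1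
  split_ifs with h
  · rw [h, zero_mul, min_eq_left hA']
  · rw [mul_min_of_nonneg _ _ hA, mul_one, mul_div_cancel₀ _ h]

lemma accept_nonneg (x x' : m.State l) : 0 ≤ m.accept G x x' := by
  have h0 : ∀ y y' : m.State l, 0 ≤ pfNormConst (G y.1) y.2 * m.prior y.1 * m.q l y.1 y'.1 :=
    fun y y' => mul_nonneg (mul_nonneg (pfNormConst_nonneg (hG.pos _) _) (hm.prior_nonneg _))
      (hm.q_nonneg _ _ _)
  rw [accept]
  split_ifs
  · exact zero_le_one
  · exact le_min zero_le_one (div_nonneg (h0 _ _) (h0 _ _))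

omit hm hG in
lemma accept_le_one (x x' : m.State l) : m.accept G x x' ≤ 1 := by
  rw [accept]
  split_ifs
  · exact le_rfl
  · exact min_le_left _ _

omit hm in
lemma measurable_normConst : Measurable fun x : m.State l => pfNormConst (G x.1) x.2 :=
  measurable_pfNormConst hG.meas

lemma measurable_accept : Measurable (Function.uncurry (m.accept G)) := by
  have hA : Measurable fun p : m.State l × m.State l =>
      pfNormConst (G p.1.1) p.1.2 * m.prior p.1.1 * m.q l p.1.1 p.2.1 :=
    ((measurable_comp_fst (measurable_normConst hG)).mul
      (hm.prior_meas.comp (measurable_fst.comp measurable_fst))).mul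
      ((hm.q_meas l).comp ((measurable_fst.comp measurable_fst).prodMk
        (measurable_fst.comp measurable_snd)))
  have hA' : Measurable fun p : m.State l × m.State l =>
      pfNormConst (G p.2.1) p.2.2 * m.prior p.2.1 * m.q l p.2.1 p.1.1 :=
    ((measurable_comp_snd (measurable_normConst hG)).mul
      (hm.prior_meas.comp (measurable_fst.comp measurable_snd))).mul
      ((hm.q_meas l).comp ((measurable_fst.comp measurable_snd).prodMk
        (measurable_fst.comp measurable_fst)))
  have : Function.uncurry (m.accept G) = fun p : m.State l × m.State l =>
      if pfNormConst (G p.1.1) p.1.2 * m.prior p.1.1 * m.q l p.1.1 p.2.1 = 0 then (1 : ℝ) else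
        min 1 ((pfNormConst (G p.2.1) p.2.2 * m.prior p.2.1 * m.q l p.2.1 p.1.1) /
          (pfNormConst (G p.1.1) p.1.2 * m.prior p.1.1 * m.q l p.1.1 p.2.1)) := by
    ext p
    simp only [Function.uncurry, accept]
  rw [this]
  exact Measurable.ite (measurableSet_eq_fun hA measurable_const) measurable_const
    (measurable_const.min (hA'.div hA))

/-- The proposal density with respect to the base measure. -/
lemma measurable_proposalDensity : Measurable (Function.uncurry
    fun x x' : m.State l => m.q l x.1 x'.1 * pfDensity (G x'.1) x'.2) :=
  ((hm.q_meas l).comp ((measurable_fst.comp measurable_fst).prodMk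
    (measurable_fst.comp measurable_snd))).mul (measurable_comp_snd (measurable_pfDensity hG.meas))

lemma lintegral_proposalDensity (x : m.State l) :
    ∫⁻ x', ENNReal.ofReal (m.q l x.1 x'.1 * pfDensity (G x'.1) x'.2) ∂(m.dθ.prod (pfBase m.N T l)) =
      1 := by
  have := hm.sigmaFinite
  have hmeas : Measurable fun x' : m.State l =>
      ENNReal.ofReal (m.q l x.1 x'.1 * pfDensity (G x'.1) x'.2) :=
    ((measurable_proposalDensity hm hG).of_uncurry_left (x := x)).ennreal_ofReal
  rw [lintegral_prod _ hmeas.aemeasurable, ← hm.q_total l x.1]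
  refine lintegral_congr fun θ' => ?_
  have h := lintegral_pfDensity (N := m.N) hm.T_pos hm.N_pos (hG.pos θ') (hG.meas_fixed θ')
  simp_rw [ENNReal.ofReal_mul (hm.q_nonneg l x.1 θ')]
  rw [lintegral_const_mul _ (measurable_pfDensity_of_fixed (hG.meas_fixed θ')).ennreal_ofReal, h,
    mul_one]

end Accept

/-- The kernel of the iterate step. -/
noncomputable def stepKernel (hm : m.Standing) {G : m.Θ → Fin T → Path T l → ℝ}
    (hG : m.GoodPotential G) : Kernel (m.State l) (m.State l) :=
  haveI := hm.sigmaFinite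
  mhKernel (m.dθ.prod (pfBase m.N T l)) (measurable_proposalDensity hm hG) (measurable_accept hm hG)

section Target

variable (hm : m.Standing) {G : m.Θ → Fin T → Path T l → ℝ} (hG : m.GoodPotential G)

lemma stepKernel_isMarkov : IsMarkovKernel (stepKernel hm hG) := by
  have := hm.sigmaFinite
  refine ⟨fun x => ⟨?_⟩⟩
  exact (mhMeasure_univ (measurable_proposalDensity hm hG) (measurable_accept hm hG)
    (accept_nonneg hm hG) accept_le_one x).trans
    (lintegral_proposalDensity hm hG x)

/-- The unnormalized invariant density. -/
noncomputable def targetDensity (G : m.Θ → Fin T → Path T l → ℝ) (x : m.State l) : ℝ≥0∞ :=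
  ENNReal.ofReal (pfNormConst (G x.1) x.2 * m.prior x.1 * pfDensity (G x.1) x.2)

include hm hG

lemma measurable_targetDensity : Measurable (targetDensity G) :=
  (((measurable_normConst hG).mul (hm.prior_meas.comp measurable_fst)).mul
    (measurable_pfDensity hG.meas)).ennreal_ofReal

/-- The unnormalized invariant measure. -/
noncomputable def target (m : Model d T Y) (G : m.Θ → Fin T → Path T l → ℝ) :
    Measure (m.State l) :=
  (m.dθ.prod (pfBase m.N T l)).withDensity (targetDensity G)

/-- In the flow between two states the filter densities of both appear as a symmetric factor: one
belongs to the target, the other to the proposal. What remains is the symmetric minimum. -/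
lemma stepKernel_isReversible : (stepKernel hm hG).IsReversible (target m G) := by
  have := hm.sigmaFinite
  refine mhKernel_isReversible _ _ (measurable_targetDensity hm hG) fun x x' => ?_
  have hD : ∀ y : m.State l, 0 ≤ pfDensity (G y.1) y.2 := fun y => pfDensity_nonneg (hG.pos _) _
  have hp : ∀ y : m.State l, 0 ≤ pfNormConst (G y.1) y.2 * m.prior y.1 := fun y =>
    mul_nonneg (pfNormConst_nonneg (hG.pos _) _) (hm.prior_nonneg _)
  have key : ∀ y y' : m.State l, targetDensity G y *
      (ENNReal.ofReal (m.q l y.1 y'.1 * pfDensity (G y'.1) y'.2) *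
        ENNReal.ofReal (m.accept G y y')) =
      ENNReal.ofReal (pfDensity (G y.1) y.2 * pfDensity (G y'.1) y'.2 *
        (pfNormConst (G y.1) y.2 * m.prior y.1 * m.q l y.1 y'.1 * m.accept G y y')) := by
    intro y y'
    rw [targetDensity, ← ENNReal.ofReal_mul (mul_nonneg (hm.q_nonneg _ _ _) (hD _)),
      ← ENNReal.ofReal_mul (mul_nonneg (hp y) (hD _))]
    congr 1
    ring
  rw [key, key, mul_accept_eq_min hm hG, mul_accept_eq_min hm hG, min_comm,
    mul_comm (pfDensity (G x.1) x.2)]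

/-- The law of the parameter and the selected trajectory under the unnormalized target. -/
lemma map_target : (target m G).map (fun x => (x.1, pfOutput x.2)) =
    (m.priorLaw.prod (pathLaw T l)).withDensity fun p => ENNReal.ofReal (∏ t, G p.1 t p.2) := by
  have := hm.sigmaFinite
  have := hm.priorLaw_isProbability
  have hout : Measurable fun x : m.State l => (x.1, pfOutput x.2) :=
    measurable_fst.prodMk (measurable_pfOutput.comp measurable_snd)
  refine Measure.ext fun A hA => ?_
  have hind : Measurable (A.indicator (1 : m.Θ × Path T l → ℝ)) := measurable_one.indicator hA
  have hPm : Measurable fun p : m.Θ × Path T l =>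
      A.indicator (fun p => ENNReal.ofReal (∏ t, G p.1 t p.2)) p :=
    hG.measurable_prod.ennreal_ofReal.indicator hA
  rw [Measure.map_apply hout hA, target, withDensity_apply _ (hout hA), withDensity_apply _ hA,
    ← lintegral_indicator (hout hA), ← lintegral_indicator hA,
    lintegral_prod _ ((measurable_targetDensity hm hG).indicator (hout hA)).aemeasurable,
    lintegral_prod _ hPm.aemeasurable, priorLaw,
    lintegral_withDensity_eq_lintegral_mul _ hm.prior_meas.ennreal_ofReal hPm.lintegral_prod_right']
  refine lintegral_congr fun θ => ?_
  -- For a fixed parameter all filter variables are integrated out by unbiasedness, with the section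
  -- of the indicator of `A` as test function of the selected trajectory.
  have h := lintegral_pfNormConst_mul (N := m.N) hm.T_pos hm.N_pos (hG.pos θ) (hG.meas_fixed θ)
    (hG.nonanticipating θ) (Ψ := fun w => A.indicator (1 : m.Θ × Path T l → ℝ) (θ, w))
    (measurable_section θ hind) (fun w => Set.indicator_nonneg (fun _ _ => zero_le_one) _)
  have e1 : ∀ w, A.indicator (fun p => ENNReal.ofReal (∏ t, G p.1 t p.2)) (θ, w) =
      ENNReal.ofReal ((∏ t, G θ t w) * A.indicator (1 : m.Θ × Path T l → ℝ) (θ, w)) := by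
    intro w
    by_cases hw : (θ, w) ∈ A <;> simp [hw]
  have e2 : ∀ u : PFVars m.N T l, ((fun x : m.State l => (x.1, pfOutput x.2)) ⁻¹' A).indicator
      (targetDensity G) (θ, u) = ENNReal.ofReal (m.prior θ) *
      ENNReal.ofReal (pfNormConst (G θ) u * pfDensity (G θ) u *
        A.indicator (1 : m.Θ × Path T l → ℝ) (θ, pfOutput u)) := by
    intro u
    by_cases hw : (θ, pfOutput u) ∈ A
    · rw [Set.indicator_of_mem (by exact hw), Set.indicator_of_mem hw, targetDensity,
        ← ENNReal.ofReal_mul (hm.prior_nonneg θ)]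
      congr 1
      simp only [Pi.one_apply]
      ring
    · rw [Set.indicator_of_notMem (by exact hw), Set.indicator_of_notMem hw]
      simp
  have hmu : Measurable fun u : PFVars m.N T l => ENNReal.ofReal (pfNormConst (G θ) u *
      pfDensity (G θ) u * A.indicator (1 : m.Θ × Path T l → ℝ) (θ, pfOutput u)) :=
    (((measurable_pfNormConst_of_fixed (hG.meas_fixed θ)).mul
      (measurable_pfDensity_of_fixed (hG.meas_fixed θ))).mul
      ((measurable_section θ hind).comp measurable_pfOutput)).ennreal_ofReal
  simp_rw [e2, Pi.mul_apply, e1]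
  rw [lintegral_const_mul _ hmu, h]

/-- The law of the parameter and the selected trajectory for a stationary chain. -/
lemma integral_stationary_output {ξ : ℝ} (hξ₀ : 0 < ξ) (hξ₁ : ξ < 1)
    (hmin : Minorized (m.mcmcKernel G) ξ) {Ω : Type*} [MeasurableSpace Ω] {μ : Measure Ω}
    [IsProbabilityMeasure μ] {X : ℕ → Ω → m.State l} (hX : IsStationaryChain μ (m.mcmcKernel G) X)
    {F : m.Θ × Path T l → ℝ} (hF : Measurable F) :
    ∫ x, F (x.1, pfOutput x.2) ∂(μ.map (X 0)) =
      (∫ p, F p * ∏ t, G p.1 t p.2 ∂(m.priorLaw.prod (pathLaw T l))) /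
        ∫ p, ∏ t, G p.1 t p.2 ∂(m.priorLaw.prod (pathLaw T l)) := by
  have := hm.sigmaFinite
  have := hm.priorLaw_isProbability
  have := stepKernel_isMarkov hm hG
  obtain ⟨A, B, hA, hAB⟩ := hG.prod_bounds
  have hout : Measurable fun x : m.State l => (x.1, pfOutput x.2) :=
    measurable_fst.prodMk (measurable_pfOutput.comp measurable_snd)
  set Q := m.priorLaw.prod (pathLaw T l) with hQ
  set Z := ∫ p, ∏ t, G p.1 t p.2 ∂Q with hZ
  have hint : Integrable (fun p => ∏ t, G p.1 t p.2) Q :=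
    integrable_of_bounded _ hG.measurable_prod (B := B)
      fun p => by rw [abs_of_pos (hG.prod_pos p)]; exact (hAB p).2
  have hZpos : 0 < Z := by
    refine hA.trans_le ?_
    have := integral_mono (integrable_const A) hint fun p => (hAB p).1
    simpa using this
  have hmass : target m G Set.univ = ENNReal.ofReal Z := by
    have h := congrArg (fun ν : Measure (m.Θ × Path T l) => ν Set.univ) (map_target hm hG)
    rw [Measure.map_apply hout MeasurableSet.univ, Set.preimage_univ,
      withDensity_apply _ MeasurableSet.univ, Measure.restrict_univ,
      ← ofReal_integral_eq_lintegral_ofReal hint (ae_of_all _ fun p => (hG.prod_pos p).le)] at h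
    exact h
  set ν := (ENNReal.ofReal Z)⁻¹ • target m G with hν
  have hZ0 : ENNReal.ofReal Z ≠ 0 := by simpa using hZpos
  have hνp : IsProbabilityMeasure ν :=
    ⟨by rw [hν, Measure.smul_apply, hmass, smul_eq_mul,
      ENNReal.inv_mul_cancel hZ0 ENNReal.ofReal_ne_top]⟩
  have hinv : (stepKernel hm hG).Invariant ν := by
    have h := (stepKernel_isReversible hm hG).invariant
    refine Measure.ext fun s hs => ?_
    rw [Measure.bind_apply hs (Kernel.aemeasurable _), hν, lintegral_smul_measure,
      ← Measure.bind_apply hs (Kernel.aemeasurable _), h.def]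
    rfl
  have hη : IsProbabilityMeasure (μ.map (X 0)) :=
    Measure.isProbabilityMeasure_map (hX.meas 0).aemeasurable
  have hX' : IsStationaryChain μ (fun x => stepKernel hm hG x) X := hX
  have hmin' : Minorized (fun x => stepKernel hm hG x) ξ := hmin
  -- The chain is only assumed to start in some invariant law; the minorization forces it to be the
  -- normalized target.
  have heq : μ.map (X 0) = ν := invariant_unique hξ₀ hξ₁ hmin' hX'.invariant' hinv
  rw [heq, hν, integral_smul_measure,
    ← integral_map (φ := fun x : m.State l => (x.1, pfOutput x.2)) hout.aemeasurable
      hF.aestronglyMeasurable, map_target hm hG,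
    integral_withDensity_eq_integral_toReal_smul hG.measurable_prod.ennreal_ofReal
      (ae_of_all _ fun _ => ENNReal.ofReal_lt_top), ENNReal.toReal_inv,
    ENNReal.toReal_ofReal hZpos.le, smul_eq_mul, div_eq_inv_mul]
  congr 1
  refine integral_congr_ae (ae_of_all _ fun p => ?_)
  simp only
  rw [ENNReal.toReal_ofReal (hG.prod_pos p).le, smul_eq_mul, mul_comm]

end Target

end Model

/-! ## Brownian increments and the Itô isometry -/

section Brownian

variable {Ω : Type*} {mΩ : MeasurableSpace Ω} {P : Measure Ω}
  {ℱ : Filtration ℝ≥0 mΩ} {W : ℝ≥0 → Ω → ℝ}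

namespace IsFilteredBrownian

lemma measurable_incr (hW : IsFilteredBrownian P ℱ W) {s t u : ℝ≥0} (hs : s ≤ u) (ht : t ≤ u) :
    Measurable[ℱ u] fun ω => W t ω - W s ω :=
  Measurable.sub ((hW.adapted t).mono (ℱ.mono ht) le_rfl) ((hW.adapted s).mono (ℱ.mono hs) le_rfl)

lemma measurable (hW : IsFilteredBrownian P ℱ W) (t : ℝ≥0) : Measurable (W t) :=
  (hW.adapted t).mono (ℱ.le t) le_rfl

lemma memLp_incr (hW : IsFilteredBrownian P ℱ W) (s t : ℝ≥0) :
    MemLp (fun ω => W t ω - W s ω) 2 P := by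
  have h : ∀ t, MemLp (W t) 2 P := fun t =>
    (hW.brownian.isGaussianProcess.hasGaussianLaw_eval t).memLp_two
  exact (h t).sub (h s)

lemma integral_incr (hW : IsFilteredBrownian P ℱ W) (s t : ℝ≥0) :
    ∫ ω, (W t ω - W s ω) ∂P = 0 := by
  rw [integral_sub (hW.brownian.integrable_eval t) (hW.brownian.integrable_eval s),
    hW.brownian.integral_eval, hW.brownian.integral_eval, sub_zero]

lemma indepFun (hW : IsFilteredBrownian P ℱ W) {s t : ℝ≥0} (hst : s ≤ t) {Z : Ω → ℝ}
    (hZ : Measurable[ℱ s] Z) : IndepFun Z (fun ω => W t ω - W s ω) P :=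
  indep_of_indep_of_le_left (hW.indep s t hst).symm hZ.comap_le

lemma integral_incr_sq (hW : IsFilteredBrownian P ℱ W) {s t : ℝ≥0} (hst : s ≤ t) :
    ∫ ω, (W t ω - W s ω) ^ 2 ∂P = t - s := by
  have hlaw := hW.brownian.hasLaw_sub t s
  have hv := hlaw.variance_eq
  rw [variance_id_gaussianReal, variance_of_integral_eq_zero hlaw.aemeasurable
    (hW.integral_incr s t)] at hv
  simp only [Pi.sub_apply] at hv
  rw [hv]
  have : ((nndist (t : ℝ) s : ℝ≥0) : ℝ) = t - s := by
    rw [coe_nndist, Real.dist_eq, abs_of_nonneg (sub_nonneg.2 (NNReal.coe_le_coe.2 hst))]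
  exact this

lemma integrable_mul_incr (hW : IsFilteredBrownian P ℱ W) {s t : ℝ≥0} (hst : s ≤ t) {Z : Ω → ℝ}
    (hZ : Measurable[ℱ s] Z) (hZi : Integrable Z P) :
    Integrable (fun ω => Z ω * (W t ω - W s ω)) P :=
  (hW.indepFun hst hZ).integrable_mul hZi
    ((hW.brownian.integrable_eval t).sub (hW.brownian.integrable_eval s))

lemma integral_mul_incr (hW : IsFilteredBrownian P ℱ W) {s t : ℝ≥0} (hst : s ≤ t) {Z : Ω → ℝ}
    (hZ : Measurable[ℱ s] Z) : ∫ ω, Z ω * (W t ω - W s ω) ∂P = 0 := by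
  rw [(hW.indepFun hst hZ).integral_fun_mul_eq_mul_integral
    (hZ.mono (ℱ.le s) le_rfl).aestronglyMeasurable (hW.memLp_incr s t).aestronglyMeasurable,
    hW.integral_incr, mul_zero]

lemma indepFun_sq (hW : IsFilteredBrownian P ℱ W) {s t : ℝ≥0} (hst : s ≤ t) {Z : Ω → ℝ}
    (hZ : Measurable[ℱ s] Z) : IndepFun Z (fun ω => (W t ω - W s ω) ^ 2) P :=
  (hW.indepFun hst hZ).comp measurable_id (measurable_id.pow_const 2)

lemma integrable_mul_incr_sq (hW : IsFilteredBrownian P ℱ W) {s t : ℝ≥0} (hst : s ≤ t) {Z : Ω → ℝ}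
    (hZ : Measurable[ℱ s] Z) (hZi : Integrable Z P) :
    Integrable (fun ω => Z ω * (W t ω - W s ω) ^ 2) P :=
  (hW.indepFun_sq hst hZ).integrable_mul hZi (hW.memLp_incr s t).integrable_sq

lemma integral_mul_incr_sq (hW : IsFilteredBrownian P ℱ W) {s t : ℝ≥0} (hst : s ≤ t) {Z : Ω → ℝ}
    (hZ : Measurable[ℱ s] Z) :
    ∫ ω, Z ω * (W t ω - W s ω) ^ 2 ∂P = (t - s) * ∫ ω, Z ω ∂P := by
  rw [(hW.indepFun_sq hst hZ).integral_fun_mul_eq_mul_integral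
    (hZ.mono (ℱ.le s) le_rfl).aestronglyMeasurable
    (hW.memLp_incr s t).integrable_sq.aestronglyMeasurable, hW.integral_incr_sq hst, mul_comm]

lemma memLp_mul_incr (hW : IsFilteredBrownian P ℱ W) {s t : ℝ≥0} (hst : s ≤ t) {Z : Ω → ℝ}
    (hZ : Measurable[ℱ s] Z) (hZi : MemLp Z 2 P) :
    MemLp (fun ω => Z ω * (W t ω - W s ω)) 2 P := by
  have hZm := (hZ.mono (ℱ.le s) le_rfl).aestronglyMeasurable (μ := P)
  refine (memLp_two_iff_integrable_sq (hZm.mul (hW.memLp_incr s t).aestronglyMeasurable)).2 ?_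
  simp_rw [Pi.mul_apply, mul_pow]
  exact hW.integrable_mul_incr_sq hst (hZ.pow_const 2) hZi.integrable_sq

/-- The isometry for sums over a grid with square integrable coefficients. -/
lemma memLp_sum_mul_incr (hW : IsFilteredBrownian P ℱ W) {τ : ℕ → ℝ≥0} (hτ : Monotone τ)
    {Z : ℕ → Ω → ℝ} (n : ℕ) (hZ : ∀ j < n, Measurable[ℱ (τ j)] (Z j)) (hZi : ∀ j < n, MemLp (Z j) 2 P) :
    MemLp (fun ω => ∑ j ∈ Finset.range n, Z j ω * (W (τ (j + 1)) ω - W (τ j) ω)) 2 P :=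
  memLp_finsetSum _ fun j hj => hW.memLp_mul_incr (hτ (Nat.le_succ j))
    (hZ j (Finset.mem_range.1 hj)) (hZi j (Finset.mem_range.1 hj))

/-- The last increment is independent of the past and centred, so the cross term with the preceding
partial sum vanishes in the induction. -/
lemma integral_sum_mul_incr_sq (hW : IsFilteredBrownian P ℱ W) {τ : ℕ → ℝ≥0} (hτ : Monotone τ)
    {Z : ℕ → Ω → ℝ} (n : ℕ) (hZ : ∀ j < n, Measurable[ℱ (τ j)] (Z j)) (hZi : ∀ j < n, MemLp (Z j) 2 P) :
    ∫ ω, (∑ j ∈ Finset.range n, Z j ω * (W (τ (j + 1)) ω - W (τ j) ω)) ^ 2 ∂P =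
      ∑ j ∈ Finset.range n, (τ (j + 1) - τ j : ℝ) * ∫ ω, Z j ω ^ 2 ∂P := by
  induction n with
  | zero => simp
  | succ n ih =>
    have hZ' : ∀ j < n, Measurable[ℱ (τ j)] (Z j) := fun j hj => hZ j (hj.trans n.lt_succ_self)
    have hZi' : ∀ j < n, MemLp (Z j) 2 P := fun j hj => hZi j (hj.trans n.lt_succ_self)
    have hn := n.lt_succ_self
    rw [Finset.sum_range_succ, ← ih hZ' hZi']
    set Sn := fun ω => ∑ j ∈ Finset.range n, Z j ω * (W (τ (j + 1)) ω - W (τ j) ω) with hS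
    have hSm : Measurable[ℱ (τ n)] Sn := by
      refine Finset.measurable_sum _ fun j hj => ?_
      have hj' := Finset.mem_range.1 hj
      exact ((hZ j (hj'.trans hn)).mono (ℱ.mono (hτ hj'.le)) le_rfl).mul
        (hW.measurable_incr (hτ hj'.le) (hτ hj'))
    have hSL : MemLp Sn 2 P := hW.memLp_sum_mul_incr hτ n hZ' hZi'
    have hcross : Measurable[ℱ (τ n)] fun ω => Sn ω * Z n ω := hSm.mul (hZ n hn)
    have hcrossi : Integrable (fun ω => Sn ω * Z n ω) P := hSL.integrable_mul (hZi n hn)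
    have e : (fun ω => (∑ j ∈ Finset.range (n + 1), Z j ω * (W (τ (j + 1)) ω - W (τ j) ω)) ^ 2) =
        fun ω => 1 * Sn ω ^ 2 + 2 * (Sn ω * Z n ω * (W (τ (n + 1)) ω - W (τ n) ω)) +
          1 * (Z n ω ^ 2 * (W (τ (n + 1)) ω - W (τ n) ω) ^ 2) := by
      ext ω
      rw [Finset.sum_range_succ]
      simp only [hS]
      ring
    rw [e, integral_linear_combination hSL.integrable_sq
      (hW.integrable_mul_incr (hτ n.le_succ) hcross hcrossi)
      (hW.integrable_mul_incr_sq (hτ n.le_succ) ((hZ n hn).pow_const 2) (hZi n hn).integrable_sq),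
      hW.integral_mul_incr (hτ n.le_succ) hcross,
      hW.integral_mul_incr_sq (hτ n.le_succ) ((hZ n hn).pow_const 2)]
    ring

variable [IsProbabilityMeasure P]

/-- The covariance of two elementary integrals. -/
lemma integral_elementary_mul (hW : IsFilteredBrownian P ℱ W) {a b a' b' : ℝ≥0} (hab : a ≤ b)
    (hab' : a' ≤ b') {ξ ξ' : Ω → ℝ} (hξ : Measurable[ℱ a] ξ) (hξ' : Measurable[ℱ a'] ξ') {B B' : ℝ}
    (hB : ∀ ω, |ξ ω| ≤ B) (hB' : ∀ ω, |ξ' ω| ≤ B') :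
    ∫ ω, (ξ ω * (W b ω - W a ω)) * (ξ' ω * (W b' ω - W a' ω)) ∂P =
      volume.real (Set.Ioc (a : ℝ) b ∩ Set.Ioc (a' : ℝ) b') * ∫ ω, ξ ω * ξ' ω ∂P := by
  wlog haa : a ≤ a' generalizing a b a' b' ξ ξ' B B'
  · have h := this hab' hab hξ' hξ hB' hB (not_le.1 haa).le
    rw [Set.inter_comm] at h
    simp_rw [mul_comm (ξ _) (ξ' _), ← h]
    exact integral_congr_ae (ae_of_all _ fun ω => mul_comm _ _)
  have hξa' : Measurable[ℱ a'] ξ := hξ.mono (ℱ.mono haa) le_rfl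
  have hprod : Measurable[ℱ a'] fun ω => ξ ω * ξ' ω := hξa'.mul hξ'
  have hprodb : ∀ ω, |ξ ω * ξ' ω| ≤ B * B' := fun ω => abs_mul_le_of_abs_le (hB ω) (hB' ω)
  have hbdd : ∀ (s t : ℝ≥0), Integrable (fun ω => ξ ω * ξ' ω * (W t ω - W s ω)) P := fun s t =>
    ((hW.brownian.integrable_eval t).sub (hW.brownian.integrable_eval s)).bdd_mul
      (hprod.mono (ℱ.le a') le_rfl).aestronglyMeasurable (ae_of_all _ hprodb)
  rw [Set.Ioc_inter_Ioc, Real.volume_real_Ioc]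
  have haaR : (a : ℝ) ≤ a' := NNReal.coe_le_coe.2 haa
  rcases le_or_gt b a' with hba | hba
  · have hm : Measurable[ℱ a'] fun ω => ξ ω * ξ' ω * (W b ω - W a ω) :=
      hprod.mul (hW.measurable_incr haa hba)
    have h0 := hW.integral_mul_incr hab' hm
    have hbaR : (b : ℝ) ≤ a' := NNReal.coe_le_coe.2 hba
    rw [max_eq_right (sub_nonpos.2 ((min_le_left _ _).trans (hbaR.trans (le_max_right _ _)))),
      zero_mul, ← h0]
    exact integral_congr_ae (ae_of_all _ fun ω => by ring)
  · -- the common part of the intervals is `(a', c]`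
    set c := min b b' with hc
    have hac : a' ≤ c := le_min hba.le hab'
    have hlen : max (((min (b : ℝ) b') - max (a : ℝ) a')) 0 = (c : ℝ) - a' := by
      rw [max_eq_right haaR, hc, NNReal.coe_min,
        max_eq_left (sub_nonneg.2 (le_min (NNReal.coe_le_coe.2 hba.le) (NNReal.coe_le_coe.2 hab')))]
    have hm1 : Measurable[ℱ a'] fun ω => ξ ω * ξ' ω * (W a' ω - W a ω) :=
      hprod.mul (hW.measurable_incr haa le_rfl)
    have hm2 : Measurable[ℱ c] fun ω => ξ ω * ξ' ω * (W c ω - W a' ω) :=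
      (hprod.mono (ℱ.mono hac) le_rfl).mul (hW.measurable_incr hac le_rfl)
    have i1 := hW.integrable_mul_incr hab' hm1 (hbdd _ _)
    have i2 := hW.integrable_mul_incr_sq hac hprod
      (integrable_of_bounded P (hprod.mono (ℱ.le a') le_rfl) hprodb)
    -- Beyond the common end `c` only one of the two increments continues, and its remainder up to
    -- `t` is centred and independent of what happened before `c`.
    have hrest : ∃ t, c ≤ t ∧ ∀ ω, (W b ω - W a' ω) * (W b' ω - W a' ω) =
        (W c ω - W a' ω) ^ 2 + (W c ω - W a' ω) * (W t ω - W c ω) := by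
      rcases le_total b b' with h | h
      · refine ⟨b', min_le_right _ _, fun ω => ?_⟩
        rw [hc, min_eq_left h]; ring
      · refine ⟨b, min_le_left _ _, fun ω => ?_⟩
        rw [hc, min_eq_right h]; ring
    obtain ⟨t, hct, ht⟩ := hrest
    have i3 := hW.integrable_mul_incr hct hm2 (hbdd _ _)
    have e : (fun ω => (ξ ω * (W b ω - W a ω)) * (ξ' ω * (W b' ω - W a' ω))) = fun ω =>
        1 * (ξ ω * ξ' ω * (W a' ω - W a ω) * (W b' ω - W a' ω)) +
        1 * (ξ ω * ξ' ω * (W c ω - W a' ω) ^ 2) +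
        1 * (ξ ω * ξ' ω * (W c ω - W a' ω) * (W t ω - W c ω)) := by
      ext ω
      have h := ht ω
      calc _ = ξ ω * ξ' ω * (W a' ω - W a ω) * (W b' ω - W a' ω) +
            ξ ω * ξ' ω * ((W b ω - W a' ω) * (W b' ω - W a' ω)) := by ring
        _ = _ := by rw [h]; ring
    rw [e, integral_linear_combination i1 i2 i3, hW.integral_mul_incr hab' hm1,
      hW.integral_mul_incr_sq hac hprod, hW.integral_mul_incr hct hm2, hlen]
    ring

/-- The isometry for finite families of elementary integrands. -/
lemma integral_sum_elementary_sq (hW : IsFilteredBrownian P ℱ W) {ι : Type*} [Fintype ι]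
    {lo hi : ι → ℝ≥0} (hlh : ∀ i, lo i ≤ hi i) {ξ : ι → Ω → ℝ} (hξ : ∀ i, Measurable[ℱ (lo i)] (ξ i))
    {B : ℝ} (hB : ∀ i ω, |ξ i ω| ≤ B) :
    ∫⁻ ω, ENNReal.ofReal ((∑ i, ξ i ω * (W (hi i) ω - W (lo i) ω)) ^ 2) ∂P =
      ∫⁻ ω, (∫⁻ s : ℝ, ENNReal.ofReal
        ((∑ i, (Set.Ioc (lo i : ℝ) (hi i)).indicator (fun _ => ξ i ω) s) ^ 2)) ∂P := by
  have hξm : ∀ i, Measurable (ξ i) := fun i => (hξ i).mono (ℱ.le _) le_rfl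
  have hi1 : ∀ ω i j, Integrable ((Set.Ioc (lo i : ℝ) (hi i) ∩ Set.Ioc (lo j : ℝ) (hi j)).indicator
      (fun _ : ℝ => ξ i ω * ξ j ω)) := by
    intro ω i j
    rw [integrable_indicator_iff (measurableSet_Ioc.inter measurableSet_Ioc)]
    refine integrableOn_const ?_ enorm_ne_top
    exact (measure_mono Set.inter_subset_left).trans_lt (by simp) |>.ne
  -- A product of indicators is the indicator of the intersection; both sides of the isometry thus
  -- become the same double sum of overlap lengths times mixed moments.
  have hexp : ∀ ω, (fun s : ℝ =>
      (∑ i, (Set.Ioc (lo i : ℝ) (hi i)).indicator (fun _ => ξ i ω) s) ^ 2) =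
      fun s => ∑ i, ∑ j, (Set.Ioc (lo i : ℝ) (hi i) ∩ Set.Ioc (lo j : ℝ) (hi j)).indicator
        (fun _ => ξ i ω * ξ j ω) s := by
    intro ω
    ext s
    rw [sq, Finset.sum_mul_sum]
    refine Finset.sum_congr rfl fun i _ => Finset.sum_congr rfl fun j _ => ?_
    by_cases h1 : s ∈ Set.Ioc (lo i : ℝ) (hi i) <;> by_cases h2 : s ∈ Set.Ioc (lo j : ℝ) (hi j) <;>
      simp only [Set.indicator, Set.mem_inter_iff, h1, h2, if_true, if_false, and_true, and_false,
        mul_zero, zero_mul]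
  have hreal : ∀ ω, ∫ s : ℝ, (∑ i, (Set.Ioc (lo i : ℝ) (hi i)).indicator (fun _ => ξ i ω) s) ^ 2 =
      ∑ i, ∑ j, volume.real (Set.Ioc (lo i : ℝ) (hi i) ∩ Set.Ioc (lo j : ℝ) (hi j)) *
        (ξ i ω * ξ j ω) := by
    intro ω
    rw [hexp, integral_finsetSum _ fun i _ => integrable_finsetSum _ fun j _ => hi1 ω i j]
    refine Finset.sum_congr rfl fun i _ => ?_
    rw [integral_finsetSum _ fun j _ => hi1 ω i j]
    refine Finset.sum_congr rfl fun j _ => ?_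
    rw [integral_indicator_const _ (measurableSet_Ioc.inter measurableSet_Ioc), smul_eq_mul]
  have hinner : ∀ ω, ∫⁻ s : ℝ, ENNReal.ofReal
      ((∑ i, (Set.Ioc (lo i : ℝ) (hi i)).indicator (fun _ => ξ i ω) s) ^ 2) =
      ENNReal.ofReal (∑ i, ∑ j, volume.real (Set.Ioc (lo i : ℝ) (hi i) ∩ Set.Ioc (lo j : ℝ) (hi j)) *
        (ξ i ω * ξ j ω)) := by
    intro ω
    rw [← hreal, ofReal_integral_eq_lintegral_ofReal]
    · rw [hexp]
      exact integrable_finsetSum _ fun i _ => integrable_finsetSum _ fun j _ => hi1 ω i j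
    · exact ae_of_all _ fun s => sq_nonneg _
  simp_rw [hinner]
  have hL : ∀ i, MemLp (fun ω => ξ i ω * (W (hi i) ω - W (lo i) ω)) 2 P := fun i =>
    hW.memLp_mul_incr (hlh i) (hξ i) (memLp_of_bounded P (hξm i) (hB i) 2)
  have hi2 : ∀ i j, Integrable (fun ω => volume.real (Set.Ioc (lo i : ℝ) (hi i) ∩
      Set.Ioc (lo j : ℝ) (hi j)) * (ξ i ω * ξ j ω)) P := fun i j =>
    (integrable_of_bounded P ((hξm i).mul (hξm j))
      (fun ω => abs_mul_le_of_abs_le (hB i ω) (hB j ω))).const_mul _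
  have hi3 : ∀ i j, Integrable (fun ω => (ξ i ω * (W (hi i) ω - W (lo i) ω)) *
      (ξ j ω * (W (hi j) ω - W (lo j) ω))) P := fun i j => (hL i).integrable_mul (hL j)
  rw [← ofReal_integral_eq_lintegral_ofReal (memLp_finsetSum _ fun i _ => hL i).integrable_sq
    (ae_of_all _ fun ω => sq_nonneg _)]
  have hnn : ∀ ω, 0 ≤ ∑ i, ∑ j, volume.real (Set.Ioc (lo i : ℝ) (hi i) ∩ Set.Ioc (lo j : ℝ) (hi j)) *
      (ξ i ω * ξ j ω) := by
    intro ω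
    rw [← hreal]
    exact integral_nonneg fun s => sq_nonneg _
  rw [← ofReal_integral_eq_lintegral_ofReal (integrable_finsetSum _ fun i _ =>
    integrable_finsetSum _ fun j _ => hi2 i j) (ae_of_all _ hnn)]
  congr 1
  have e : (fun ω => (∑ i, ξ i ω * (W (hi i) ω - W (lo i) ω)) ^ 2) = fun ω =>
      ∑ i, ∑ j, (ξ i ω * (W (hi i) ω - W (lo i) ω)) * (ξ j ω * (W (hi j) ω - W (lo j) ω)) := by
    ext ω; rw [sq, Finset.sum_mul_sum]
  rw [e, integral_finsetSum _ fun i _ => integrable_finsetSum _ fun j _ => hi3 i j,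
    integral_finsetSum _ fun i _ => integrable_finsetSum _ fun j _ => hi2 i j]
  refine Finset.sum_congr rfl fun i _ => ?_
  rw [integral_finsetSum _ fun j _ => hi3 i j, integral_finsetSum _ fun j _ => hi2 i j]
  refine Finset.sum_congr rfl fun j _ => ?_
  rw [hW.integral_elementary_mul (hlh i) (hlh j) (hξ i) (hξ j) (hB i) (hB j), integral_const_mul]

end IsFilteredBrownian

end Brownian

/-! ## Itô integrals as limits of elementary integrals -/

lemma lintegral_ofReal_sq_eq_eLpNorm {α : Type*} {mα : MeasurableSpace α} (μ : Measure α)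
    (f : α → ℝ) : ∫⁻ x, ENNReal.ofReal (f x ^ 2) ∂μ = eLpNorm f 2 μ ^ 2 := by
  have h := eLpNorm_nnreal_pow_eq_lintegral (μ := μ) (f := f) (p := 2) two_ne_zero
  simp only [NNReal.coe_ofNat, ENNReal.coe_ofNat, ENNReal.rpow_ofNat] at h
  rw [h]
  refine lintegral_congr fun x => ?_
  rw [← sq_abs, ENNReal.ofReal_pow (abs_nonneg _), ← Real.enorm_eq_ofReal_abs]

lemma lintegral_ofReal_add_sq_le {α : Type*} {mα : MeasurableSpace α} (μ : Measure α) {f g : α → ℝ}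
    (hf : Measurable f) :
    ∫⁻ x, ENNReal.ofReal ((f x + g x) ^ 2) ∂μ ≤
      2 * ∫⁻ x, ENNReal.ofReal (f x ^ 2) ∂μ + 2 * ∫⁻ x, ENNReal.ofReal (g x ^ 2) ∂μ := by
  rw [← lintegral_const_mul' _ _ ENNReal.ofNat_ne_top, ← lintegral_const_mul' _ _ ENNReal.ofNat_ne_top,
    ← lintegral_add_left ((hf.pow_const 2).ennreal_ofReal.const_mul 2)]
  refine lintegral_mono fun x => ?_
  have h2 : (2 : ℝ≥0∞) = ENNReal.ofReal 2 := by simp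
  simp only
  rw [h2, ← ENNReal.ofReal_mul zero_le_two, ← ENNReal.ofReal_mul zero_le_two,
    ← ENNReal.ofReal_add (by positivity) (by positivity)]
  exact ENNReal.ofReal_le_ofReal (by nlinarith [sq_nonneg (f x - g x)])

section Step

variable {Ω : Type*} {mΩ : MeasurableSpace Ω} {P : Measure Ω}
  {ℱ : Filtration ℝ≥0 mΩ} {W : ℝ≥0 → Ω → ℝ}

namespace StepProcess

lemma measurable_coeff (S : StepProcess ℱ) (i : ℕ) : Measurable (S.ξ i) :=
  (S.meas i).mono (ℱ.le _) le_rfl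

lemma measurable_value (S : StepProcess ℱ) :
    Measurable fun p : Ω × ℝ => S.value p.2.toNNReal p.1 := by
  unfold StepProcess.value
  refine Finset.measurable_sum _ fun i _ => ?_
  have e : (fun p : Ω × ℝ => (Set.Ioc (S.t i) (S.t (i + 1))).indicator (fun _ => S.ξ i p.1)
      p.2.toNNReal) = ((fun p : Ω × ℝ => p.2.toNNReal) ⁻¹' Set.Ioc (S.t i) (S.t (i + 1))).indicator
        fun p => S.ξ i p.1 := by
    ext p; rfl
  rw [e]
  exact ((S.measurable_coeff i).comp measurable_fst).indicator
    ((measurable_real_toNNReal.comp measurable_snd) measurableSet_Ioc)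

lemma measurable_integral (hW : IsFilteredBrownian P ℱ W) (S : StepProcess ℱ) :
    Measurable (S.integral W) :=
  Finset.measurable_sum _ fun i _ =>
    (S.measurable_coeff i).mul ((hW.measurable _).sub (hW.measurable _))

lemma memLp_integral [IsFiniteMeasure P] (hW : IsFilteredBrownian P ℱ W) (S : StepProcess ℱ) :
    MemLp (S.integral W) 2 P := by
  obtain ⟨B, hB⟩ := S.bdd
  exact hW.memLp_sum_mul_incr S.mono S.n (fun j _ => S.meas j)
    fun j _ => memLp_of_bounded P (S.measurable_coeff j) (hB j) 2

lemma value_toNNReal (S : StepProcess ℱ) (s : ℝ) (ω : Ω) :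
    S.value s.toNNReal ω = ∑ i : Fin S.n,
      (Set.Ioc (S.t i : ℝ) (S.t (i + 1))).indicator (fun _ => S.ξ i ω) s := by
  rw [StepProcess.value, ← Fin.sum_univ_eq_sum_range
    (fun i => (Set.Ioc (S.t i) (S.t (i + 1))).indicator (fun _ => S.ξ i ω) s.toNNReal)]
  refine Finset.sum_congr rfl fun i _ => ?_
  simp only [Set.indicator, Set.mem_Ioc, Real.lt_toNNReal_iff_coe_lt, Real.toNNReal_le_iff_le_coe]

lemma integral_eq_sum_fin (S : StepProcess ℱ) (ω : Ω) :
    S.integral W ω = ∑ i : Fin S.n, S.ξ i ω * (W (S.t (i + 1)) ω - W (S.t i) ω) := by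
  rw [StepProcess.integral, ← Fin.sum_univ_eq_sum_range
    (fun i => S.ξ i ω * (W (S.t (i + 1)) ω - W (S.t i) ω))]

lemma value_eq_zero (S : StepProcess ℱ) {a b : ℝ≥0} (ha : a ≤ S.t 0) (hb : S.t S.n ≤ b) {s : ℝ}
    (hs : s ∉ Set.Ioc (a : ℝ) b) (ω : Ω) : S.value s.toNNReal ω = 0 := by
  rw [value_toNNReal]
  refine Finset.sum_eq_zero fun i _ => Set.indicator_of_notMem (fun h => hs ?_) _
  have h1 : a ≤ S.t i := ha.trans (S.mono (Nat.zero_le _))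
  have h2 : S.t (i + 1) ≤ b := (S.mono i.2).trans hb
  exact ⟨(NNReal.coe_le_coe.2 h1).trans_lt h.1, h.2.trans (NNReal.coe_le_coe.2 h2)⟩

/-- The isometry for the difference of two step processes. -/
lemma lintegral_integral_sub_sq [IsProbabilityMeasure P] (hW : IsFilteredBrownian P ℱ W)
    (S S' : StepProcess ℱ) {a b : ℝ≥0} (ha : a ≤ S.t 0) (hb : S.t S.n ≤ b) (ha' : a ≤ S'.t 0)
    (hb' : S'.t S'.n ≤ b) :
    ∫⁻ ω, ENNReal.ofReal ((S.integral W ω - S'.integral W ω) ^ 2) ∂P =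
      ∫⁻ ω, (∫⁻ s in Set.Ioc (a : ℝ) b,
        ENNReal.ofReal ((S.value s.toNNReal ω - S'.value s.toNNReal ω) ^ 2)) ∂P := by
  obtain ⟨B, hB⟩ := S.bdd
  obtain ⟨B', hB'⟩ := S'.bdd
  -- The two step processes are treated as one family with possibly overlapping intervals, the
  -- second with opposite sign, so no common refinement of their grids is needed.
  have key := hW.integral_sum_elementary_sq (ι := Fin S.n ⊕ Fin S'.n)
    (lo := Sum.elim (fun i => S.t i) fun i => S'.t i)
    (hi := Sum.elim (fun i => S.t (i + 1)) fun i => S'.t (i + 1))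
    (ξ := Sum.elim (fun i => S.ξ i) fun i ω => -S'.ξ i ω) (B := max B B')
    (by rintro (i | i); exacts [S.mono (Nat.le_succ _), S'.mono (Nat.le_succ _)])
    (by rintro (i | i); exacts [S.meas i, (S'.meas i).neg])
    (by
      rintro (i | i) ω
      · exact (hB i ω).trans (le_max_left _ _)
      · simp only [Sum.elim_inr, abs_neg]
        exact (hB' i ω).trans (le_max_right _ _))
  simp only [Fintype.sum_sum_type, Sum.elim_inl, Sum.elim_inr, neg_mul, Finset.sum_neg_distrib,
    ← integral_eq_sum_fin, ← sub_eq_add_neg] at key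
  rw [key]
  refine lintegral_congr fun ω => ?_
  have e : ∀ s : ℝ, ((∑ i : Fin S.n, (Set.Ioc (S.t i : ℝ) (S.t (i + 1))).indicator
      (fun _ => S.ξ i ω) s) + ∑ i : Fin S'.n, (Set.Ioc (S'.t i : ℝ) (S'.t (i + 1))).indicator
      (fun _ => -S'.ξ i ω) s) = S.value s.toNNReal ω - S'.value s.toNNReal ω := by
    intro s
    rw [value_toNNReal, value_toNNReal, sub_eq_add_neg, ← Finset.sum_neg_distrib]
    congr 1
    refine Finset.sum_congr rfl fun i _ => ?_
    by_cases h : s ∈ Set.Ioc (S'.t i : ℝ) (S'.t (i + 1)) <;> simp [Set.indicator, h]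
  simp_rw [e]
  rw [← lintegral_indicator measurableSet_Ioc]
  refine lintegral_congr fun s => ?_
  by_cases hs : s ∈ Set.Ioc (a : ℝ) b
  · rw [Set.indicator_of_mem hs]
  · rw [Set.indicator_of_notMem hs, S.value_eq_zero ha hb hs, S'.value_eq_zero ha' hb' hs]
    simp

end StepProcess

/-- The squared `L²(P ⊗ ds)`-distance of two processes on `(a, b]`. -/
noncomputable def processDist (P : Measure Ω) (a b : ℝ≥0) (F G : ℝ≥0 → Ω → ℝ) : ℝ≥0∞ :=
  ∫⁻ ω, (∫⁻ s in Set.Ioc (a : ℝ) b, ENNReal.ofReal ((F s.toNNReal ω - G s.toNNReal ω) ^ 2)) ∂P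

lemma processDist_eq_prod [SFinite P] {a b : ℝ≥0} {F G : ℝ≥0 → Ω → ℝ}
    (hF : Measurable fun p : Ω × ℝ => F p.2.toNNReal p.1)
    (hG : Measurable fun p : Ω × ℝ => G p.2.toNNReal p.1) :
    processDist P a b F G = ∫⁻ p : Ω × ℝ, ENNReal.ofReal ((F p.2.toNNReal p.1 -
      G p.2.toNNReal p.1) ^ 2) ∂(P.prod (volume.restrict (Set.Ioc (a : ℝ) b))) := by
  rw [lintegral_prod]
  · rfl
  · exact ((hF.sub hG).pow_const 2).ennreal_ofReal.aemeasurable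

lemma processDist_eq_lintegral [SFinite P] {a b : ℝ≥0} {F G : ℝ≥0 → Ω → ℝ}
    (hF : Measurable fun p : Ω × ℝ => F p.2.toNNReal p.1)
    (hG : Measurable fun p : Ω × ℝ => G p.2.toNNReal p.1) :
    processDist P a b F G = ∫⁻ s in Set.Ioc (a : ℝ) b, (∫⁻ ω, ENNReal.ofReal ((F s.toNNReal ω -
      G s.toNNReal ω) ^ 2) ∂P) := by
  rw [processDist_eq_prod hF hG, lintegral_prod_symm]
  exact ((hF.sub hG).pow_const 2).ennreal_ofReal.aemeasurable

lemma processDist_triangle [SFinite P] {a b : ℝ≥0} {F G K : ℝ≥0 → Ω → ℝ}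
    (hF : Measurable fun p : Ω × ℝ => F p.2.toNNReal p.1)
    (hG : Measurable fun p : Ω × ℝ => G p.2.toNNReal p.1)
    (hK : Measurable fun p : Ω × ℝ => K p.2.toNNReal p.1) :
    processDist P a b F K ≤ 2 * processDist P a b F G + 2 * processDist P a b K G := by
  rw [processDist_eq_prod hF hG, processDist_eq_prod hF hK, processDist_eq_prod hK hG]
  have h := lintegral_ofReal_add_sq_le (P.prod (volume.restrict (Set.Ioc (a : ℝ) b)))
    (g := fun p : Ω × ℝ => G p.2.toNNReal p.1 - K p.2.toNNReal p.1) (hF.sub hG)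
  simp only [Pi.sub_apply, sub_add_sub_cancel] at h
  refine h.trans_eq ?_
  congr 2
  exact lintegral_congr fun p => by rw [sub_sq_comm]

lemma isItoIntegral_itoIntegral {F : ℝ≥0 → Ω → ℝ} {a b : ℝ≥0}
    (h : ∃ X, IsItoIntegral P ℱ W F a b X) :
    IsItoIntegral P ℱ W F a b (itoIntegral P ℱ W F a b) := by
  unfold itoIntegral
  rw [dif_pos h]
  exact h.choose_spec

variable [IsProbabilityMeasure P]

/-- Processes approximated by step processes at a geometric rate have an Itô integral. -/
lemma exists_isItoIntegral (hW : IsFilteredBrownian P ℱ W) {F : ℝ≥0 → Ω → ℝ}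
    (hF : Measurable fun p : Ω × ℝ => F p.2.toNNReal p.1) {a b : ℝ≥0} {S : ℕ → StepProcess ℱ}
    (hS : ∀ n, a ≤ (S n).t 0 ∧ (S n).t (S n).n ≤ b) {A r : ℝ} (hA : 0 < A) (hr₀ : 0 < r) (hr₁ : r < 1)
    (hSF : ∀ n, processDist P a b (S n).value F ≤ ENNReal.ofReal ((A * r ^ n) ^ 2)) :
    ∃ X, IsItoIntegral P ℱ W F a b X := by
  -- The isometry and the triangle inequality bound the squared distance by `4 (A r ^ N) ^ 2`; the
  -- constant `3` instead of `2` provides the strict inequality.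
  have hcau : ∀ N n m : ℕ, N ≤ n → N ≤ m →
      eLpNorm ((S n).integral W - (S m).integral W) 2 P < ENNReal.ofReal (3 * (A * r ^ N)) := by
    intro N n m hn hm
    have hAN : 0 < A * r ^ N := by positivity
    have hle : ∀ k, N ≤ k → processDist P a b (S k).value F ≤ ENNReal.ofReal ((A * r ^ N) ^ 2) := by
      intro k hk
      refine (hSF k).trans (ENNReal.ofReal_le_ofReal ?_)
      have := pow_le_pow_of_le_one hr₀.le hr₁.le hk
      gcongr
    have h := (StepProcess.lintegral_integral_sub_sq hW (S n) (S m) (hS n).1 (hS n).2 (hS m).1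
      (hS m).2).trans_le (processDist_triangle (S n).measurable_value hF (S m).measurable_value)
    rw [lintegral_ofReal_sq_eq_eLpNorm] at h
    by_contra! hcon
    have h1 : ENNReal.ofReal (3 * (A * r ^ N)) ^ 2 ≤
        2 * ENNReal.ofReal ((A * r ^ N) ^ 2) + 2 * ENNReal.ofReal ((A * r ^ N) ^ 2) := by
      refine (pow_le_pow_left' hcon 2).trans (h.trans ?_)
      gcongr
      exacts [hle n hn, hle m hm]
    have h2 : (2 : ℝ≥0∞) = ENNReal.ofReal 2 := by simp
    rw [h2, ← ENNReal.ofReal_mul zero_le_two, ← ENNReal.ofReal_add (by positivity) (by positivity),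
      ← ENNReal.ofReal_pow (by positivity), ENNReal.ofReal_le_ofReal_iff (by positivity)] at h1
    nlinarith [pow_pos hAN 2]
  have hsum : ∑' N, ENNReal.ofReal (3 * (A * r ^ N)) ≠ ∞ := by
    rw [← ENNReal.ofReal_tsum_of_nonneg (fun N => by positivity)]
    · exact ENNReal.ofReal_ne_top
    · exact ((summable_geometric_of_lt_one hr₀.le hr₁).mul_left A).mul_left 3
  obtain ⟨X, hX, hlim⟩ := Lp.cauchy_complete_eLpNorm one_le_two
    (fun n => (S n).memLp_integral hW) hsum hcau
  -- An Itô integral is required to be measurable, so the `L²` limit is replaced by a strongly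
  -- measurable version.
  refine ⟨hX.1.mk X, hX.1.stronglyMeasurable_mk.measurable, S, hS, ?_, ?_⟩
  · refine tendsto_of_tendsto_of_tendsto_of_le_of_le tendsto_const_nhds ?_ (fun _ => zero_le)
      hSF
    have h0 : Tendsto (fun n => (A * r ^ n) ^ 2) atTop (𝓝 0) := by
      simpa using ((tendsto_pow_atTop_nhds_zero_of_lt_one hr₀.le hr₁).const_mul A).pow 2
    simpa using ENNReal.tendsto_ofReal h0
  · have h0 := ENNReal.Tendsto.pow (n := 2) hlim
    rw [zero_pow two_ne_zero] at h0
    refine h0.congr fun n => ?_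
    rw [← lintegral_ofReal_sq_eq_eLpNorm]
    refine lintegral_congr_ae ?_
    filter_upwards [hX.1.ae_eq_mk] with ω hω
    rw [Pi.sub_apply, hω]

/-- The distance of an elementary integral to an Itô integral. -/
lemma IsItoIntegral.lintegral_sub_sq_le (hW : IsFilteredBrownian P ℱ W) {F : ℝ≥0 → Ω → ℝ}
    (hF : Measurable fun p : Ω × ℝ => F p.2.toNNReal p.1) {a b : ℝ≥0} {X : Ω → ℝ}
    (hX : IsItoIntegral P ℱ W F a b X) (S : StepProcess ℱ) (ha : a ≤ S.t 0) (hb : S.t S.n ≤ b) :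
    ∫⁻ ω, ENNReal.ofReal ((S.integral W ω - X ω) ^ 2) ∂P ≤ 4 * processDist P a b S.value F := by
  obtain ⟨-, R, hR, h1, h2⟩ := hX
  have key : ∀ n, ∫⁻ ω, ENNReal.ofReal ((S.integral W ω - X ω) ^ 2) ∂P ≤
      2 * (2 * processDist P a b S.value F + 2 * processDist P a b (R n).value F) +
        2 * ∫⁻ ω, ENNReal.ofReal (((R n).integral W ω - X ω) ^ 2) ∂P := by
    intro n
    have h := lintegral_ofReal_add_sq_le P (g := fun ω => (R n).integral W ω - X ω)
      ((S.measurable_integral hW).sub ((R n).measurable_integral hW))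
    simp only [Pi.sub_apply, sub_add_sub_cancel] at h
    refine h.trans ?_
    gcongr
    exact (StepProcess.lintegral_integral_sub_sq hW S (R n) ha hb (hR n).1 (hR n).2).trans_le
      (processDist_triangle S.measurable_value hF (R n).measurable_value)
  -- Along the sequence defining the Itô integral both error terms vanish. The two applications of
  -- `(x + y) ^ 2 ≤ 2 x ^ 2 + 2 y ^ 2` leave the factor four, which does not affect rates.
  have hlim := ((ENNReal.Tendsto.const_mul ((tendsto_const_nhds (x := 2 * processDist P a b S.value F)).add
    (ENNReal.Tendsto.const_mul h1 (Or.inr (ENNReal.ofNat_ne_top (n := 2)))))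
    (Or.inr (ENNReal.ofNat_ne_top (n := 2)))).add
    (ENNReal.Tendsto.const_mul h2 (Or.inr (ENNReal.ofNat_ne_top (n := 2)))))
  refine (ge_of_tendsto' hlim key).trans_eq ?_
  rw [mul_zero, add_zero, add_zero, ← mul_assoc]
  norm_num

end Step

/-! ## The Euler scheme driven by the Brownian motion -/

/-- Bernoulli's inequality `(1 + s) ^ H ≤ 1 + H s` with `s = y / x`; the factor `H ≤ 1` is dropped.
-/
lemma rpow_add_sub_rpow_le {H x y : ℝ} (h₀ : 0 ≤ H) (h₁ : H ≤ 1) (hx : 0 < x) (hy : 0 ≤ y) :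
    (x + y) ^ H - x ^ H ≤ y * x ^ (H - 1) := by
  have h := rpow_one_add_le_one_add_mul_self (s := y / x) (p := H)
    (by have := div_nonneg hy hx.le; linarith) h₀ h₁
  have e : (x + y) ^ H = x ^ H * (1 + y / x) ^ H := by
    rw [← Real.mul_rpow hx.le (by positivity), mul_add, mul_one, mul_div_cancel₀ _ hx.ne']
  rw [e, Real.rpow_sub_one hx.ne']
  have hxH := Real.rpow_nonneg hx.le H
  have h2 : x ^ H * (1 + y / x) ^ H ≤ x ^ H * (1 + 1 * (y / x)) := by
    gcongr
    refine h.trans ?_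
    gcongr
  have e2 : y * (x ^ H / x) = x ^ H * (1 + 1 * (y / x)) - x ^ H := by ring
  rw [e2]
  linarith

/-- Bernoulli's inequality at `s = -1 / (x + 1)`. It dominates the terms `(i + 1) ^ (-p - 1)` by
differences, so their sum can be bounded by telescoping instead of by an integral. -/
lemma mul_rpow_le_rpow_sub_rpow {p x : ℝ} (h₀ : 0 ≤ p) (h₁ : p ≤ 1) (hx : 0 < x) :
    p * (x + 1) ^ (-p - 1) ≤ x ^ (-p) - (x + 1) ^ (-p) := by
  have hx1 : 0 < x + 1 := by linarith
  set s := 1 / (x + 1) with hs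
  have hs0 : 0 < s := by positivity
  have hs1 : s < 1 := by rw [hs, div_lt_one hx1]; linarith
  have hB := rpow_one_add_le_one_add_mul_self (s := -s) (p := p) (by linarith) h₀ h₁
  have hpos : 0 < (1 + -s) ^ p := Real.rpow_pos_of_pos (by linarith) p
  have e : x = (x + 1) * (1 + -s) := by rw [hs]; field_simp; ring
  have hinv : 1 + p * s ≤ (1 + -s) ^ (-p) := by
    rw [Real.rpow_neg (by linarith), le_inv_comm₀ (by positivity) hpos]
    refine hB.trans ?_
    rw [← one_div, le_div_iff₀ (by positivity)]
    nlinarith [sq_nonneg (p * s)]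
  have e1 : x ^ (-p) = (x + 1) ^ (-p) * (1 + -s) ^ (-p) := by
    conv_lhs => rw [e]
    rw [Real.mul_rpow hx1.le (by linarith)]
  have e2 : (x + 1) ^ (-p - 1) = (x + 1) ^ (-p) * s := by
    rw [Real.rpow_sub_one hx1.ne', hs, div_eq_mul_one_div]
  rw [e1, e2]
  have := mul_le_mul_of_nonneg_left hinv (Real.rpow_nonneg hx1.le (-p))
  linarith

/-- The increments of `i ↦ i ^ H` over `n` steps are square summable with the expected rate. -/
lemma sum_sq_rpow_incr_le {H : ℝ} (h₀ : 0 ≤ H) (h₁ : H < 1 / 2) {n : ℕ} (hn : 1 ≤ n) (k : ℕ) :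
    ∑ i ∈ Finset.range k, (((i : ℝ) + 1 + n) ^ H - ((i : ℝ) + 1) ^ H) ^ 2 ≤
      (1 + 1 / (1 - 2 * H)) * (n : ℝ) ^ (2 * H + 1) := by
  set p := 1 - 2 * H with hp
  have hp0 : 0 < p := by linarith
  have hn0 : (0 : ℝ) < n := by exact_mod_cast hn
  have hnn : ∀ i : ℕ, 0 ≤ ((i : ℝ) + 1 + n) ^ H - ((i : ℝ) + 1) ^ H := fun i =>
    sub_nonneg.2 (Real.rpow_le_rpow (by positivity) (by linarith) h₀)
  -- Subadditivity of the power `H`; used for the first `n` terms, which together already have the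
  -- order claimed.
  have hsmall : ∀ i : ℕ, (((i : ℝ) + 1 + n) ^ H - ((i : ℝ) + 1) ^ H) ^ 2 ≤ (n : ℝ) ^ (2 * H) := by
    intro i
    have h : ((i : ℝ) + 1 + n) ^ H ≤ ((i : ℝ) + 1) ^ H + (n : ℝ) ^ H :=
      Real.rpow_add_le_add_rpow (by positivity) hn0.le h₀ (by linarith)
    rw [mul_comm 2 H, Real.rpow_mul hn0.le, Real.rpow_two]
    exact pow_le_pow_left₀ (hnn i) (by linarith) 2
  -- The derivative bound gives `n ^ 2 (i + 1) ^ (2H - 2)`, and `2H - 2 = -p - 1` with `p = 1 - 2H >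
  -- 0`, so the tail telescopes.
  have hlarge : ∀ i : ℕ, n ≤ i → (((i : ℝ) + 1 + n) ^ H - ((i : ℝ) + 1) ^ H) ^ 2 ≤
      (n : ℝ) ^ 2 / p * ((i : ℝ) ^ (-p) - ((i : ℝ) + 1) ^ (-p)) := by
    intro i hi
    have hi0 : (0 : ℝ) < i := by exact_mod_cast lt_of_lt_of_le hn hi
    have hi1 : (0 : ℝ) < (i : ℝ) + 1 := by linarith
    have h := pow_le_pow_left₀ (hnn i)
      (rpow_add_sub_rpow_le h₀ (by linarith : H ≤ 1) hi1 hn0.le) 2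
    have h2 := mul_rpow_le_rpow_sub_rpow hp0.le (by linarith) hi0
    refine h.trans ?_
    rw [mul_pow, ← Real.rpow_two (((i : ℝ) + 1) ^ (H - 1)), ← Real.rpow_mul hi1.le, div_mul_eq_mul_div,
      le_div_iff₀ hp0, mul_assoc]
    have e : (H - 1) * 2 = -p - 1 := by rw [hp]; ring
    rw [e, mul_comm _ p]
    gcongr
  have hfirst : ∀ k : ℕ, ∑ i ∈ Finset.range k, (((i : ℝ) + 1 + n) ^ H - ((i : ℝ) + 1) ^ H) ^ 2 ≤
      k * (n : ℝ) ^ (2 * H) := by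
    intro k
    refine (Finset.sum_le_sum fun i _ => hsmall i).trans ?_
    simp
  have e1 : (n : ℝ) * (n : ℝ) ^ (2 * H) = (n : ℝ) ^ (2 * H + 1) := by
    rw [Real.rpow_add_one hn0.ne', mul_comm]
  have e2 : (n : ℝ) ^ 2 / p * (n : ℝ) ^ (-p) = 1 / p * (n : ℝ) ^ (2 * H + 1) := by
    have : (2 * H + 1 : ℝ) = 2 + -p := by rw [hp]; ring
    rw [this, Real.rpow_add hn0, Real.rpow_two]
    ring
  rcases le_total k n with hkn | hkn
  · refine (hfirst k).trans ?_
    have : (k : ℝ) * (n : ℝ) ^ (2 * H) ≤ n * (n : ℝ) ^ (2 * H) := by gcongr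
    rw [e1] at this
    refine this.trans (le_mul_of_one_le_left (by positivity) ?_)
    have : 0 < 1 / p := by positivity
    linarith
  · have hind : ∑ i ∈ Finset.range k, (((i : ℝ) + 1 + n) ^ H - ((i : ℝ) + 1) ^ H) ^ 2 ≤
        n * (n : ℝ) ^ (2 * H) + (n : ℝ) ^ 2 / p * ((n : ℝ) ^ (-p) - (k : ℝ) ^ (-p)) := by
      induction k, hkn using Nat.le_induction with
      | base => simpa using hfirst n
      | succ k hk ih =>
        rw [Finset.sum_range_succ]
        have := hlarge k hk
        push_cast
        linarith
    refine hind.trans ?_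
    rw [mul_sub, e1, e2]
    have : 0 ≤ (n : ℝ) ^ 2 / p * (k : ℝ) ^ (-p) := by positivity
    linarith

lemma stepSize_pos (l : ℕ) : 0 < stepSize l := by unfold stepSize; positivity

lemma coe_stepSize (l : ℕ) : (stepSize l : ℝ) = (2 ^ l)⁻¹ := by simp [stepSize]

lemma coe_stepSize_pos (l : ℕ) : (0 : ℝ) < stepSize l := stepSize_pos l

lemma stepSize_le_one (l : ℕ) : (stepSize l : ℝ) ≤ 1 := by
  rw [coe_stepSize]
  exact inv_le_one_of_one_le₀ (one_le_pow₀ one_le_two)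

lemma mul_stepSize_le_iff {l k n : ℕ} : (k : ℝ) * stepSize l ≤ n ↔ k ≤ n * 2 ^ l := by
  rw [coe_stepSize, ← div_eq_mul_inv, div_le_iff₀ (by positivity)]
  exact_mod_cast Iff.rfl

/-- The increments of `W` over the grid with step `Δ_l`. -/
noncomputable def gridIncr {Ω : Type*} (W : ℝ≥0 → Ω → ℝ) (l : ℕ) (ω : Ω) (j : ℕ) : ℝ :=
  W ((j + 1) * stepSize l) ω - W (j * stepSize l) ω

namespace Model

variable {d T : ℕ} {Y : Type*} {m : Model d T Y}

/-- A form valid for `k = 0` as well, with a sum over `Finset.range`; all inductions on the scheme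
start from it. -/
lemma scheme_eq (l : ℕ) (θ : m.Θ) (w : ℕ → ℝ) (k : ℕ) :
    m.scheme l θ w k = m.v₀ + ∑ j ∈ Finset.range k,
      (m.kernel (((k : ℝ) - j) * stepSize l) * m.b θ (m.scheme l θ w j) * stepSize l +
        m.kernel (((k : ℝ) - j) * stepSize l) * m.σ θ (m.scheme l θ w j) * w j) := by
  unfold scheme
  cases k with
  | zero => simp [euler]
  | succ k =>
    rw [euler, ← Fin.sum_univ_eq_sum_range (fun j => 
      m.kernel ((((k + 1 : ℕ) : ℝ) - j) * stepSize l) * m.b θ (euler m.kernel (m.b θ) (m.σ θ) m.v₀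
        (stepSize l) w j) * stepSize l + m.kernel ((((k + 1 : ℕ) : ℝ) - j) * stepSize l) *
        m.σ θ (euler m.kernel (m.b θ) (m.σ θ) m.v₀ (stepSize l) w j) * w j)]
    push_cast
    rfl

lemma scheme_zero (l : ℕ) (θ : m.Θ) (w : ℕ → ℝ) : m.scheme l θ w 0 = m.v₀ := by
  rw [scheme_eq]; simp

lemma scheme_congr (l : ℕ) (θ : m.Θ) {w w' : ℕ → ℝ} {k : ℕ} (h : ∀ j < k, w j = w' j) :
    m.scheme l θ w k = m.scheme l θ w' k := by
  induction k using Nat.strong_induction_on with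
  | _ k ih =>
    rw [scheme_eq, scheme_eq l θ w']
    congr 1
    refine Finset.sum_congr rfl fun j hj => ?_
    have hj := Finset.mem_range.1 hj
    rw [ih j hj fun i hi => h i (hi.trans hj), h j hj]

lemma Standing.measurable_b (hm : m.Standing) (θ : m.Θ) : Measurable (m.b θ) :=
  hm.b_meas.of_uncurry_left

lemma Standing.measurable_σ (hm : m.Standing) (θ : m.Θ) : Measurable (m.σ θ) :=
  hm.σ_meas.of_uncurry_left

lemma measurable_scheme (hm : m.Standing) {α : Type*} [MeasurableSpace α] (l : ℕ) {θ : α → m.Θ}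
    (hθ : Measurable θ) {w : α → ℕ → ℝ} {k : ℕ} (hw : ∀ j < k, Measurable fun a => w a j) :
    Measurable fun a => m.scheme l (θ a) (w a) k := by
  induction k using Nat.strong_induction_on with
  | _ k ih =>
    simp_rw [scheme_eq l _ _ k]
    refine (Finset.measurable_sum _ fun j hj => ?_).const_add _
    have hj := Finset.mem_range.1 hj
    have hX := ih j hj fun i hi => hw i (hi.trans hj)
    exact (((hm.b_meas.comp (hθ.prodMk hX)).const_mul _).mul_const _).add
      (((hm.σ_meas.comp (hθ.prodMk hX)).const_mul _).mul (hw j hj))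

section Brownian

variable {Ω : Type*} {mΩ : MeasurableSpace Ω} {P : Measure Ω}
  {ℱ : Filtration ℝ≥0 mΩ} {W : ℝ≥0 → Ω → ℝ}

/-- The Euler scheme driven by the increments of `W`. -/
noncomputable def bmScheme (m : Model d T Y) (W : ℝ≥0 → Ω → ℝ) (l : ℕ) (θ : m.Θ) (k : ℕ) (ω : Ω) : ℝ :=
  m.scheme l θ (gridIncr W l ω) k

lemma gridIncr_eq (l : ℕ) (ω : Ω) (j : ℕ) : gridIncr W l ω j =
    W (((j + 1 : ℕ) : ℝ≥0) * stepSize l) ω - W ((j : ℝ≥0) * stepSize l) ω := by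
  simp [gridIncr]

lemma monotone_grid (l : ℕ) : Monotone fun j : ℕ => (j : ℝ≥0) * stepSize l := fun i j hij => by
  have : (i : ℝ≥0) ≤ j := by exact_mod_cast hij
  simp only
  gcongr

lemma adapted_bmScheme (hm : m.Standing) (hW : IsFilteredBrownian P ℱ W) (l : ℕ) (θ : m.Θ) (k : ℕ) :
    Measurable[ℱ ((k : ℝ≥0) * stepSize l)] (m.bmScheme W l θ k) := by
  refine @measurable_scheme d T Y m hm Ω (ℱ ((k : ℝ≥0) * stepSize l)) l (fun _ => θ)
    measurable_const (fun ω => gridIncr W l ω) k fun j hj => ?_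
  simp_rw [gridIncr_eq]
  exact hW.measurable_incr (monotone_grid l hj.le) (monotone_grid l hj)

lemma measurable_bmScheme (hm : m.Standing) (hW : IsFilteredBrownian P ℱ W) (l : ℕ) (θ : m.Θ)
    (k : ℕ) : Measurable (m.bmScheme W l θ k) :=
  (adapted_bmScheme hm hW l θ k).mono (ℱ.le _) le_rfl

lemma Standing.exists_growth (hm : m.Standing) : ∃ B : ℝ, 0 ≤ B ∧ ∀ θ v,
    m.b θ v ^ 2 ≤ B * (1 + v ^ 2) ∧ m.σ θ v ^ 2 ≤ B * (1 + v ^ 2) := by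
  obtain ⟨B, hB⟩ := hm.growth
  have key : ∀ x v : ℝ, |x| ≤ B * (1 + |v|) → x ^ 2 ≤ 2 * B ^ 2 * (1 + v ^ 2) := by
    intro x v h
    have h1 := (le_abs_self _).trans (sq_le_sq_of_abs_le h)
    have h2 := sq_abs v
    have : (B * (1 + |v|)) ^ 2 ≤ 2 * B ^ 2 * (1 + v ^ 2) := by
      rw [mul_pow, ← h2]
      nlinarith [sq_nonneg (B * (1 - |v|))]
    linarith
  exact ⟨2 * B ^ 2, by positivity, fun θ v => ⟨key _ _ (hB θ v).1, key _ _ (hB θ v).2⟩⟩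

lemma Standing.abs_kernel_le (hm : m.Standing) {t : ℝ} (h0 : 0 ≤ t) (ht : t ≤ T) :
    |m.kernel t| ≤ |m.c| * (T : ℝ) ^ m.H := by
  rw [kernel, abs_mul, abs_of_nonneg (Real.rpow_nonneg h0 _)]
  gcongr
  exact hm.H_nonneg

variable [IsProbabilityMeasure P]

lemma memLp_coeff (hm : m.Standing) {θ : m.Θ} {X : Ω → ℝ} (hXm : Measurable X) (hX : MemLp X 2 P) :
    MemLp (fun ω => m.b θ (X ω)) 2 P ∧ MemLp (fun ω => m.σ θ (X ω)) 2 P := by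
  obtain ⟨B, hB0, hB⟩ := hm.exists_growth
  have hi : Integrable (fun ω => B * (1 + X ω ^ 2)) P :=
    ((integrable_const _).add hX.integrable_sq).const_mul _
  constructor
  · refine (memLp_two_iff_integrable_sq ((hm.measurable_b θ).comp hXm).aestronglyMeasurable).2
      (hi.mono' (((hm.measurable_b θ).comp hXm).pow_const 2).aestronglyMeasurable
        (ae_of_all _ fun ω => ?_))
    rw [Real.norm_eq_abs, abs_of_nonneg (sq_nonneg _)]
    exact (hB θ _).1
  · refine (memLp_two_iff_integrable_sq ((hm.measurable_σ θ).comp hXm).aestronglyMeasurable).2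
      (hi.mono' (((hm.measurable_σ θ).comp hXm).pow_const 2).aestronglyMeasurable
        (ae_of_all _ fun ω => ?_))
    rw [Real.norm_eq_abs, abs_of_nonneg (sq_nonneg _)]
    exact (hB θ _).2

lemma integral_coeff_sq_le (hm : m.Standing) : ∃ B : ℝ, 0 ≤ B ∧ ∀ (θ : m.Θ) (X : Ω → ℝ), Measurable X →
    MemLp X 2 P → ∫ ω, m.b θ (X ω) ^ 2 ∂P ≤ B * (1 + ∫ ω, X ω ^ 2 ∂P) ∧
      ∫ ω, m.σ θ (X ω) ^ 2 ∂P ≤ B * (1 + ∫ ω, X ω ^ 2 ∂P) := by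
  obtain ⟨B, hB0, hB⟩ := hm.exists_growth
  refine ⟨B, hB0, fun θ X hXm hX => ?_⟩
  have hi : Integrable (fun ω => B * (1 + X ω ^ 2)) P :=
    ((integrable_const _).add hX.integrable_sq).const_mul _
  have e : ∫ ω, B * (1 + X ω ^ 2) ∂P = B * (1 + ∫ ω, X ω ^ 2 ∂P) := by
    rw [integral_const_mul, integral_add (integrable_const _) hX.integrable_sq]
    simp
  rw [← e]
  have h := memLp_coeff hm (θ := θ) hXm hX
  exact ⟨integral_mono h.1.integrable_sq hi fun ω => (hB θ _).1,
    integral_mono h.2.integrable_sq hi fun ω => (hB θ _).2⟩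

lemma memLp_bmScheme (hm : m.Standing) (hW : IsFilteredBrownian P ℱ W) (l : ℕ) (θ : m.Θ) (k : ℕ) :
    MemLp (m.bmScheme W l θ k) 2 P := by
  induction k using Nat.strong_induction_on with
  | _ k ih =>
    have e : m.bmScheme W l θ k = fun ω => m.v₀ + ∑ j ∈ Finset.range k,
        (m.kernel (((k : ℝ) - j) * stepSize l) * m.b θ (m.bmScheme W l θ j ω) * stepSize l +
        m.kernel (((k : ℝ) - j) * stepSize l) * m.σ θ (m.bmScheme W l θ j ω) * gridIncr W l ω j) := by
      ext ω
      exact scheme_eq l θ _ k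
    have hterm : ∀ j ∈ Finset.range k, MemLp (fun ω =>
        m.kernel (((k : ℝ) - j) * stepSize l) * m.b θ (m.bmScheme W l θ j ω) * stepSize l +
        m.kernel (((k : ℝ) - j) * stepSize l) * m.σ θ (m.bmScheme W l θ j ω) * gridIncr W l ω j)
        2 P := by
      intro j hj
      have h := memLp_coeff hm (θ := θ) (measurable_bmScheme hm hW l θ j) (ih j (Finset.mem_range.1 hj))
      refine ((h.1.const_mul _).mul_const _).add ?_
      simp_rw [gridIncr_eq]
      refine hW.memLp_mul_incr (s := (j : ℝ≥0) * stepSize l)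
        (t := ((j + 1 : ℕ) : ℝ≥0) * stepSize l)
        (Z := fun ω => m.kernel (((k : ℝ) - j) * stepSize l) * m.σ θ (m.bmScheme W l θ j ω))
        (monotone_grid l j.le_succ) ?_ (h.2.const_mul _)
      exact ((hm.measurable_σ θ).comp (adapted_bmScheme hm hW l θ j)).const_mul _
    rw [e]
    exact (memLp_const m.v₀).add (memLp_finsetSum (Finset.range k) hterm)

/-- The basic second moment bound for sums of the form occurring in the Euler scheme. -/
lemma integral_sq_eulerSum_le (hm : m.Standing) (hW : IsFilteredBrownian P ℱ W) (l : ℕ) (θ : m.Θ)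
    (n : ℕ) (hn : n ≤ T * 2 ^ l) (α q : ℕ → ℝ)
    (hq : ∀ j < n, ∫ ω, m.b θ (m.bmScheme W l θ j ω) ^ 2 ∂P ≤ q j ∧
      ∫ ω, m.σ θ (m.bmScheme W l θ j ω) ^ 2 ∂P ≤ q j) :
    ∫ ω, (∑ j ∈ Finset.range n, (α j * m.b θ (m.bmScheme W l θ j ω) * stepSize l +
        α j * m.σ θ (m.bmScheme W l θ j ω) * gridIncr W l ω j)) ^ 2 ∂P ≤
      2 * (T + 1) * stepSize l * ∑ j ∈ Finset.range n, α j ^ 2 * q j := by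
  have hΔ := coe_stepSize_pos l
  have hL := fun j => memLp_coeff hm (θ := θ) (measurable_bmScheme hm hW l θ j)
    (memLp_bmScheme hm hW l θ j)
  have hZ : ∀ j : ℕ, Measurable[ℱ ((j : ℝ≥0) * stepSize l)] fun ω =>
      α j * m.σ θ (m.bmScheme W l θ j ω) := fun j =>
    ((hm.measurable_σ θ).comp (adapted_bmScheme hm hW l θ j)).const_mul _
  have hM := hW.memLp_sum_mul_incr (monotone_grid l) n (fun j _ => hZ j)
    fun j _ => (hL j).2.const_mul (α j)
  have hMI := hW.integral_sum_mul_incr_sq (monotone_grid l) n (fun j _ => hZ j)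
    fun j _ => (hL j).2.const_mul (α j)
  simp_rw [← gridIncr_eq] at hM hMI
  have hD : ∀ j, MemLp (fun ω => α j * m.b θ (m.bmScheme W l θ j ω) * stepSize l) 2 P :=
    fun j => ((hL j).1.const_mul _).mul_const _
  have hDs := memLp_finsetSum (Finset.range n) fun j _ => hD j
  have hDi : Integrable (fun ω => ∑ j ∈ Finset.range n,
      (α j * m.b θ (m.bmScheme W l θ j ω) * stepSize l) ^ 2) P :=
    integrable_finsetSum _ fun j _ => (hD j).integrable_sq
  calc ∫ ω, (∑ j ∈ Finset.range n, (α j * m.b θ (m.bmScheme W l θ j ω) * stepSize l +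
        α j * m.σ θ (m.bmScheme W l θ j ω) * gridIncr W l ω j)) ^ 2 ∂P
      ≤ ∫ ω, 2 * n * (∑ j ∈ Finset.range n, (α j * m.b θ (m.bmScheme W l θ j ω) * stepSize l) ^ 2) +
        2 * (∑ j ∈ Finset.range n,
          α j * m.σ θ (m.bmScheme W l θ j ω) * gridIncr W l ω j) ^ 2 ∂P := by
        refine integral_mono_of_nonneg (ae_of_all _ fun ω => sq_nonneg _)
          ((hDi.const_mul _).add (hM.integrable_sq.const_mul _)) (ae_of_all _ fun ω => ?_)
        simp only
        rw [Finset.sum_add_distrib]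
        -- The drift is estimated by Cauchy–Schwarz, at the price of a factor `n`. It is compensated
        -- by the additional step size in the drift, as `n Δ_l ≤ T`; the martingale part needs only
        -- the isometry.
        have h1 := sq_sum_le_card_mul_sum_sq (s := Finset.range n)
          (f := fun j => α j * m.b θ (m.bmScheme W l θ j ω) * stepSize l)
        rw [Finset.card_range] at h1
        set x := ∑ j ∈ Finset.range n, α j * m.b θ (m.bmScheme W l θ j ω) * stepSize l
        set y := ∑ j ∈ Finset.range n, α j * m.σ θ (m.bmScheme W l θ j ω) * gridIncr W l ω j
        nlinarith [sq_nonneg (x - y)]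
    _ = 2 * n * (∑ j ∈ Finset.range n, α j ^ 2 * (stepSize l) ^ 2 *
          ∫ ω, m.b θ (m.bmScheme W l θ j ω) ^ 2 ∂P) +
        2 * ∑ j ∈ Finset.range n, stepSize l * (α j ^ 2 *
          ∫ ω, m.σ θ (m.bmScheme W l θ j ω) ^ 2 ∂P) := by
        rw [integral_add (hDi.const_mul _) (hM.integrable_sq.const_mul _), integral_const_mul,
          integral_const_mul, hMI, integral_finsetSum _ fun j _ => (hD j).integrable_sq]
        congr 2
        · refine Finset.sum_congr rfl fun j _ => ?_
          rw [← integral_const_mul]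
          exact integral_congr_ae (ae_of_all _ fun ω => by ring)
        · refine Finset.sum_congr rfl fun j _ => ?_
          rw [← integral_const_mul (α j ^ 2)]
          congr 1
          · push_cast; ring
          · exact integral_congr_ae (ae_of_all _ fun ω => by ring)
    _ ≤ 2 * n * (∑ j ∈ Finset.range n, α j ^ 2 * (stepSize l) ^ 2 * q j) +
        2 * ∑ j ∈ Finset.range n, stepSize l * (α j ^ 2 * q j) := by
        gcongr with j hj j hj
        · exact (hq j (Finset.mem_range.1 hj)).1
        · exact (hq j (Finset.mem_range.1 hj)).2
    _ = 2 * (n * stepSize l + 1) * stepSize l * ∑ j ∈ Finset.range n, α j ^ 2 * q j := by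
        rw [Finset.mul_sum, Finset.mul_sum, Finset.mul_sum, ← Finset.sum_add_distrib]
        exact Finset.sum_congr rfl fun j _ => by ring
    _ ≤ _ := by
        have hs : 0 ≤ ∑ j ∈ Finset.range n, α j ^ 2 * q j := Finset.sum_nonneg fun j hj =>
          mul_nonneg (sq_nonneg _) ((integral_nonneg fun ω => sq_nonneg _).trans
            (hq j (Finset.mem_range.1 hj)).1)
        gcongr
        exact mul_stepSize_le_iff.2 hn

/-- The second moments of the Euler scheme are bounded uniformly in the level and the parameter. -/
lemma exists_moment_bound (hm : m.Standing) (hW : IsFilteredBrownian P ℱ W) : ∃ C : ℝ, 0 ≤ C ∧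
    ∀ l θ k, k ≤ T * 2 ^ l → ∫ ω, m.bmScheme W l θ k ω ^ 2 ∂P ≤ C := by
  obtain ⟨B, hB0, hB⟩ := integral_coeff_sq_le (P := P) hm
  set κ := |m.c| * (T : ℝ) ^ m.H
  have hκ0 : 0 ≤ κ := by positivity
  -- `A` and `D` are the constants for which the majorant `A (1 + D Δ_l) ^ k` reproduces itself in
  -- the recursion: `D` collects the Euler sum bound, the bound of the kernel, the growth constant,
  -- and a factor two from splitting off `v₀`.
  set A := 1 + 2 * m.v₀ ^ 2
  set D := 4 * (T + 1) * κ ^ 2 * B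
  have hD0 : 0 ≤ D := by positivity
  refine ⟨A * Real.exp (D * T), by positivity, fun l θ k hk => ?_⟩
  have hΔ := coe_stepSize_pos l
  have hrec : ∀ k, k ≤ T * 2 ^ l → 1 + ∫ ω, m.bmScheme W l θ k ω ^ 2 ∂P ≤ A *
      (1 + D * stepSize l) ^ k := by
    intro k
    induction k using Nat.strong_induction_on with
    | _ k ih =>
      intro hk
      have hs := integral_sq_eulerSum_le hm hW l θ k hk
        (fun j => m.kernel (((k : ℝ) - j) * stepSize l)) (fun j => B * (A * (1 + D * stepSize l) ^ j))
        (fun j hj => by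
          have h1 := hB θ _ (measurable_bmScheme hm hW l θ j) (memLp_bmScheme hm hW l θ j)
          have h2 := ih j hj (hj.le.trans hk)
          exact ⟨h1.1.trans (by gcongr), h1.2.trans (by gcongr)⟩)
      have hker : ∑ j ∈ Finset.range k, m.kernel (((k : ℝ) - j) * stepSize l) ^ 2 *
          (B * (A * (1 + D * stepSize l) ^ j)) ≤ ∑ j ∈ Finset.range k, κ ^ 2 *
          (B * (A * (1 + D * stepSize l) ^ j)) := by
        refine Finset.sum_le_sum fun j hj => ?_
        have hj := Finset.mem_range.1 hj
        have hjk : (j : ℝ) ≤ k := by exact_mod_cast hj.le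
        have h0 : 0 ≤ ((k : ℝ) - j) * stepSize l := mul_nonneg (sub_nonneg.2 hjk) hΔ.le
        have h1 : ((k : ℝ) - j) * stepSize l ≤ T := by
          refine le_trans ?_ (mul_stepSize_le_iff.2 hk)
          gcongr
          linarith [Nat.cast_nonneg (α := ℝ) j]
        exact mul_le_mul_of_nonneg_right ((le_abs_self _).trans
          (sq_le_sq_of_abs_le (hm.abs_kernel_le h0 h1))) (by positivity)
      -- The geometric sum closes the discrete Gronwall induction with equality, so no constant
      -- deteriorates with the number of steps.
      have hgeom : D * stepSize l * ∑ j ∈ Finset.range k, (1 + D * stepSize l) ^ j =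
          (1 + D * stepSize l) ^ k - 1 := by
        have := mul_geom_sum (1 + D * stepSize l) k
        rw [← this]; ring
      have hmem : MemLp (fun ω => ∑ j ∈ Finset.range k,
          (m.kernel (((k : ℝ) - j) * stepSize l) * m.b θ (m.bmScheme W l θ j ω) * stepSize l +
          m.kernel (((k : ℝ) - j) * stepSize l) * m.σ θ (m.bmScheme W l θ j ω) *
            gridIncr W l ω j)) 2 P := by
        have := (memLp_bmScheme hm hW l θ k).sub (memLp_const m.v₀)
        refine this.congr_norm this.1 ?_ |>.ae_eq ?_
        · exact ae_of_all _ fun ω => rfl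
        · refine ae_of_all _ fun ω => ?_
          simp only [Pi.sub_apply, bmScheme]
          rw [scheme_eq l θ _ k, add_sub_cancel_left]
      have hX : ∫ ω, m.bmScheme W l θ k ω ^ 2 ∂P ≤ 2 * m.v₀ ^ 2 + 2 * ∫ ω, (∑ j ∈ Finset.range k,
          (m.kernel (((k : ℝ) - j) * stepSize l) * m.b θ (m.bmScheme W l θ j ω) * stepSize l +
          m.kernel (((k : ℝ) - j) * stepSize l) * m.σ θ (m.bmScheme W l θ j ω) *
            gridIncr W l ω j)) ^ 2 ∂P := by
        have e : 2 * m.v₀ ^ 2 = ∫ _ω, 2 * m.v₀ ^ 2 ∂P := by simp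
        rw [← integral_const_mul, e, ← integral_add (integrable_const _)
          (hmem.integrable_sq.const_mul _)]
        refine integral_mono (memLp_bmScheme hm hW l θ k).integrable_sq
          ((integrable_const _).add (hmem.integrable_sq.const_mul _)) fun ω => ?_
        simp only [bmScheme]
        rw [scheme_eq l θ _ k]
        have hsq : ∀ x y : ℝ, (x + y) ^ 2 ≤ 2 * x ^ 2 + 2 * y ^ 2 := fun x y => by
          nlinarith [sq_nonneg (x - y)]
        exact hsq _ _
      calc 1 + ∫ ω, m.bmScheme W l θ k ω ^ 2 ∂P
          ≤ 1 + (2 * m.v₀ ^ 2 + 2 * (2 * (T + 1) * stepSize l * ∑ j ∈ Finset.range k, κ ^ 2 *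
            (B * (A * (1 + D * stepSize l) ^ j)))) := by
            have : (0 : ℝ) ≤ 2 * (T + 1) * stepSize l := by positivity
            have := mul_le_mul_of_nonneg_left hker this
            linarith
        _ = A + A * (D * stepSize l * ∑ j ∈ Finset.range k, (1 + D * stepSize l) ^ j) := by
            simp only [← Finset.mul_sum]
            simp only [A, D]
            ring
        _ = _ := by rw [hgeom]; ring
  have h := hrec k hk
  have h2 : (1 + D * stepSize l) ^ k ≤ Real.exp (D * T) := by
    have h3 : 1 + D * stepSize l ≤ Real.exp (D * stepSize l) := by
      linarith [Real.add_one_le_exp (D * stepSize l)]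
    refine (pow_le_pow_left₀ (by positivity) h3 k).trans ?_
    rw [← Real.exp_nat_mul]
    refine Real.exp_le_exp.2 ?_
    have := mul_le_mul_of_nonneg_left (mul_stepSize_le_iff.2 hk) hD0
    linarith
  have h4 : A * (1 + D * stepSize l) ^ k ≤ A * Real.exp (D * T) := by
    have : 0 ≤ A := by positivity
    gcongr
  linarith

end Brownian

end Model

/-! ## Strong convergence between the grid points -/

section Norms

variable {Ω : Type*} {mΩ : MeasurableSpace Ω} {P : Measure Ω}

lemma eLpNorm_two_le_of_integral_sq_le {f : Ω → ℝ} (hf : MemLp f 2 P) {c : ℝ} (hc : 0 ≤ c)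
    (h : ∫ ω, f ω ^ 2 ∂P ≤ c ^ 2) : eLpNorm f 2 P ≤ ENNReal.ofReal c := by
  have h2 : eLpNorm f 2 P ^ 2 ≤ ENNReal.ofReal c ^ 2 := by
    rw [← lintegral_ofReal_sq_eq_eLpNorm, ← ofReal_integral_eq_lintegral_ofReal hf.integrable_sq
      (ae_of_all _ fun ω => sq_nonneg _), ← ENNReal.ofReal_pow hc]
    exact ENNReal.ofReal_le_ofReal h
  exact (ENNReal.pow_right_strictMono two_ne_zero).le_iff_le.1 h2

lemma integral_sq_le_of_eLpNorm_two_le {f : Ω → ℝ} (hf : AEStronglyMeasurable f P) {c : ℝ}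
    (hc : 0 ≤ c) (h : eLpNorm f 2 P ≤ ENNReal.ofReal c) : ∫ ω, f ω ^ 2 ∂P ≤ c ^ 2 := by
  have hL : MemLp f 2 P := ⟨hf, h.trans_lt ENNReal.ofReal_lt_top⟩
  rw [← ENNReal.ofReal_le_ofReal_iff (by positivity), ofReal_integral_eq_lintegral_ofReal
    hL.integrable_sq (ae_of_all _ fun ω => sq_nonneg _), lintegral_ofReal_sq_eq_eLpNorm,
    ENNReal.ofReal_pow hc]
  exact pow_le_pow_left' h 2

lemma eLpNorm_sub_le_ofReal {f g h : Ω → ℝ} (hf : AEStronglyMeasurable f P)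
    (hg : AEStronglyMeasurable g P) (hh : AEStronglyMeasurable h P) {a b : ℝ} (ha : 0 ≤ a) (hb : 0 ≤ b)
    (hfg : eLpNorm (fun ω => f ω - g ω) 2 P ≤ ENNReal.ofReal a)
    (hgh : eLpNorm (fun ω => g ω - h ω) 2 P ≤ ENNReal.ofReal b) :
    eLpNorm (fun ω => f ω - h ω) 2 P ≤ ENNReal.ofReal (a + b) := by
  have h1 := eLpNorm_add_le (p := 2) (hf.sub hg) (hg.sub hh) one_le_two
  rw [sub_add_sub_cancel] at h1
  rw [ENNReal.ofReal_add ha hb]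
  exact h1.trans (add_le_add hfg hgh)

lemma eLpNorm_sub_symm (f g : Ω → ℝ) :
    eLpNorm (fun ω => f ω - g ω) 2 P = eLpNorm (fun ω => g ω - f ω) 2 P :=
  eLpNorm_sub_comm f g 2 P

end Norms

lemma stepSize_add_mul (l i : ℕ) : (2 ^ i : ℝ≥0) * stepSize (l + i) = stepSize l := by
  unfold stepSize
  rw [pow_add, mul_inv, mul_comm (2 ^ l : ℝ≥0)⁻¹, ← mul_assoc, mul_inv_cancel₀ (by positivity), one_mul]

lemma stepSize_antitone (l i : ℕ) : stepSize (l + i) ≤ stepSize l := by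
  rw [← stepSize_add_mul l i]
  exact le_mul_of_one_le_left zero_le (one_le_pow₀ one_le_two)

lemma stepSize_rpow_antitone {β : ℝ} (hβ : 0 ≤ β) (l i : ℕ) :
    (stepSize (l + i) : ℝ) ^ β ≤ (stepSize l : ℝ) ^ β :=
  Real.rpow_le_rpow (coe_stepSize_pos _).le (by exact_mod_cast stepSize_antitone l i) hβ

lemma tendsto_stepSize : Tendsto stepSize atTop (𝓝 0) := by
  have h : stepSize = fun l => (2⁻¹ : ℝ≥0) ^ l := by
    ext l; simp [stepSize]
  rw [h]
  exact tendsto_pow_atTop_nhds_zero_of_lt_one zero_le (by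
    rw [← NNReal.coe_lt_coe]; norm_num)

namespace Model

variable {d T : ℕ} {Y : Type*} {m : Model d T Y} {Ω : Type*} {mΩ : MeasurableSpace Ω}
  {P : Measure Ω} {ℱ : Filtration ℝ≥0 mΩ} {W : ℝ≥0 → Ω → ℝ}

lemma kernel_mul_stepSize (m : Model d T Y) {x : ℝ} (hx : 0 ≤ x) (l : ℕ) :
    m.kernel (x * stepSize l) = m.c * (stepSize l : ℝ) ^ m.H * x ^ m.H := by
  rw [kernel, Real.mul_rpow hx (coe_stepSize_pos l).le]
  ring

/-- The first `k` terms are, in reverse order, increments of `i ↦ i ^ H` over `n` steps. In the last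
`n` terms only one kernel value is present, at most of size `c (n Δ_l) ^ H`. Both groups have order
`Δ_l ^ (2H) n ^ (2H + 1)`. -/
lemma sum_sq_kernel_incr_le (hm : m.Standing) (l k n : ℕ) (hn : 1 ≤ n) :
    ∑ j ∈ Finset.range (k + n), (m.kernel ((((k + n : ℕ) : ℝ) - j) * stepSize l) -
      if j < k then m.kernel (((k : ℝ) - j) * stepSize l) else 0) ^ 2 ≤
      m.c ^ 2 * (2 + 1 / (1 - 2 * m.H)) * (stepSize l : ℝ) ^ (2 * m.H) * (n : ℝ) ^ (2 * m.H + 1) := by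
  have hΔ := coe_stepSize_pos l
  have hn0 : (0 : ℝ) < n := by exact_mod_cast hn
  set δ := (stepSize l : ℝ) ^ m.H
  have eδ : δ ^ 2 = (stepSize l : ℝ) ^ (2 * m.H) := by
    rw [mul_comm, Real.rpow_mul hΔ.le, Real.rpow_two]
  rw [Finset.sum_range_add]
  have h1 : ∑ j ∈ Finset.range k, (m.kernel ((((k + n : ℕ) : ℝ) - j) * stepSize l) -
      if j < k then m.kernel (((k : ℝ) - j) * stepSize l) else 0) ^ 2 =
      m.c ^ 2 * δ ^ 2 * ∑ i ∈ Finset.range k, (((i : ℝ) + 1 + n) ^ m.H - ((i : ℝ) + 1) ^ m.H) ^ 2 := by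
    rw [← Finset.sum_range_reflect (fun i : ℕ => (((i : ℝ) + 1 + n) ^ m.H -
      ((i : ℝ) + 1) ^ m.H) ^ 2), Finset.mul_sum]
    refine Finset.sum_congr rfl fun j hj => ?_
    have hj := Finset.mem_range.1 hj
    have hj' : (j : ℝ) < k := by exact_mod_cast hj
    have e : ((k - 1 - j : ℕ) : ℝ) + 1 = k - j := by
      rw [Nat.sub_sub, Nat.cast_sub (by omega)]
      push_cast; ring
    rw [if_pos hj, kernel_mul_stepSize m (by push_cast; linarith), kernel_mul_stepSize m (by linarith),
      e]
    push_cast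
    rw [show (k : ℝ) + n - j = k - j + n by ring]
    ring
  have h2 : ∑ x ∈ Finset.range n, (m.kernel ((((k + n : ℕ) : ℝ) - (k + x : ℕ)) * stepSize l) -
      if k + x < k then m.kernel (((k : ℝ) - (k + x : ℕ)) * stepSize l) else 0) ^ 2 ≤
      m.c ^ 2 * δ ^ 2 * (n : ℝ) ^ (2 * m.H + 1) := by
    have hterm : ∀ x ∈ Finset.range n,
        (m.kernel ((((k + n : ℕ) : ℝ) - (k + x : ℕ)) * stepSize l) -
        if k + x < k then m.kernel (((k : ℝ) - (k + x : ℕ)) * stepSize l) else 0) ^ 2 ≤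
        m.c ^ 2 * δ ^ 2 * (n : ℝ) ^ (2 * m.H) := by
      intro x hx
      have hx : (x : ℝ) ≤ n := by exact_mod_cast (Finset.mem_range.1 hx).le
      rw [if_neg (by omega), sub_zero]
      push_cast
      rw [show (k : ℝ) + n - (k + x) = n - x by ring, kernel_mul_stepSize m (by linarith), mul_pow,
        mul_pow, mul_comm 2 m.H, Real.rpow_mul hn0.le, Real.rpow_two]
      have : ((n : ℝ) - x) ^ m.H ≤ (n : ℝ) ^ m.H :=
        Real.rpow_le_rpow (by linarith) (by linarith [Nat.cast_nonneg (α := ℝ) x]) hm.H_nonneg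
      have h0 : 0 ≤ ((n : ℝ) - x) ^ m.H := Real.rpow_nonneg (by linarith) _
      gcongr
    refine (Finset.sum_le_sum hterm).trans_eq ?_
    rw [Finset.sum_const, Finset.card_range, nsmul_eq_mul, Real.rpow_add_one hn0.ne']
    ring
  rw [h1, ← eδ]
  have h3 := sum_sq_rpow_incr_le hm.H_nonneg hm.H_lt hn k
  have h4 := mul_le_mul_of_nonneg_left h3 (by positivity : 0 ≤ m.c ^ 2 * δ ^ 2)
  refine (add_le_add h4 h2).trans_eq ?_
  ring

variable [IsProbabilityMeasure P]

/-- Regularity of the Euler scheme in time, uniformly in the level and the parameter. -/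
lemma exists_regularity_bound (hm : m.Standing) (hW : IsFilteredBrownian P ℱ W) : ∃ C : ℝ, 0 ≤ C ∧
    ∀ l θ k n, k + n ≤ T * 2 ^ l →
      ∫ ω, (m.bmScheme W l θ (k + n) ω - m.bmScheme W l θ k ω) ^ 2 ∂P ≤
        C * ((n : ℝ) * stepSize l) ^ (2 * m.H + 1) := by
  obtain ⟨B, hB0, hB⟩ := integral_coeff_sq_le (P := P) hm
  obtain ⟨C, hC0, hC⟩ := exists_moment_bound hm hW
  have hp : 0 < 1 - 2 * m.H := by linarith [hm.H_lt]
  refine ⟨2 * (T + 1) * (B * (1 + C)) * (m.c ^ 2 * (2 + 1 / (1 - 2 * m.H))), by positivity,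
    fun l θ k n hkn => ?_⟩
  have hΔ := coe_stepSize_pos l
  rcases Nat.eq_zero_or_pos n with rfl | hn
  · simp only [add_zero, sub_self, ne_eq, OfNat.ofNat_ne_zero, not_false_eq_true, zero_pow,
      integral_zero]
    positivity
  -- The increment of the scheme is again a sum of Euler type, with differences of kernel values as
  -- weights; the moment bound for such sums applies directly.
  set α : ℕ → ℝ := fun j => m.kernel ((((k + n : ℕ) : ℝ) - j) * stepSize l) -
      if j < k then m.kernel (((k : ℝ) - j) * stepSize l) else 0 with hα
  have e : ∀ ω, m.bmScheme W l θ (k + n) ω - m.bmScheme W l θ k ω =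
      ∑ j ∈ Finset.range (k + n), (α j * m.b θ (m.bmScheme W l θ j ω) * stepSize l +
        α j * m.σ θ (m.bmScheme W l θ j ω) * gridIncr W l ω j) := by
    intro ω
    simp only [bmScheme]
    rw [scheme_eq l θ _ (k + n), scheme_eq l θ _ k, Finset.sum_range_add, Finset.sum_range_add,
      add_sub_add_left_eq_sub, add_sub_right_comm, ← Finset.sum_sub_distrib]
    congr 1
    · refine Finset.sum_congr rfl fun j hj => ?_
      simp only [hα, if_pos (Finset.mem_range.1 hj)]
      ring
    · refine Finset.sum_congr rfl fun j _ => ?_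
      simp only [hα]
      rw [if_neg (by omega), sub_zero]
  simp_rw [e]
  refine (integral_sq_eulerSum_le hm hW l θ (k + n) hkn α (fun _ => B * (1 + C)) fun j hj => ?_).trans
    ?_
  · have h1 := hB θ _ (measurable_bmScheme hm hW l θ j) (memLp_bmScheme hm hW l θ j)
    have h2 := hC l θ j (hj.le.trans hkn)
    exact ⟨h1.1.trans (by gcongr), h1.2.trans (by gcongr)⟩
  · rw [← Finset.sum_mul]
    have h := sum_sq_kernel_incr_le hm l k n hn
    have e2 : ((n : ℝ) * stepSize l) ^ (2 * m.H + 1) =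
        stepSize l * ((stepSize l : ℝ) ^ (2 * m.H) * (n : ℝ) ^ (2 * m.H + 1)) := by
      rw [Real.mul_rpow (by positivity) hΔ.le, Real.rpow_add_one hΔ.ne']
      ring
    rw [e2]
    calc _ ≤ 2 * (T + 1) * (stepSize l : ℝ) * (m.c ^ 2 * (2 + 1 / (1 - 2 * m.H)) *
          (stepSize l : ℝ) ^ (2 * m.H) * (n : ℝ) ^ (2 * m.H + 1) * (B * (1 + C))) := by
          gcongr
      _ = _ := by ring

variable {V : m.Θ → ℝ≥0 → Ω → ℝ} {β : ℝ}

omit [IsProbabilityMeasure P] in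
lemma Assumption2.exists_two (h₂ : m.Assumption2 P W V β) : ∃ B : ℝ, 0 ≤ B ∧ ∀ l k : ℕ, 1 ≤ k →
    k ≤ T * 2 ^ l → ∀ θ, eLpNorm (fun ω => m.bmScheme W l θ k ω - V θ (k * stepSize l) ω) 2 P ≤
      ENNReal.ofReal (B * (stepSize l : ℝ) ^ β) := by
  obtain ⟨B, hB⟩ := h₂ 2 one_le_two le_rfl
  refine ⟨max B 0, le_max_right _ _, fun l k hk1 hk θ => ?_⟩
  have h := hB l k hk1 hk θ
  rw [ENNReal.ofReal_ofNat] at h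
  refine h.trans (ENNReal.ofReal_le_ofReal ?_)
  have := Real.rpow_nonneg (coe_stepSize_pos l).le β
  gcongr
  exact le_max_left _ _

omit [IsProbabilityMeasure P] in
lemma IsSolution.measurable (hV : m.IsSolution P ℱ W V) (θ : m.Θ) (t : ℝ≥0) : Measurable (V θ t) :=
  (hV.adapted θ t).mono (ℱ.le t) le_rfl

/-- Strong convergence of the piecewise constant interpolation of the Euler scheme. -/
lemma exists_strong_bound (hm : m.Standing) (hW : IsFilteredBrownian P ℱ W)
    (hV : m.IsSolution P ℱ W V) (hβ₀ : 0 < β) (hβ : β ≤ m.H + 1 / 2) (h₂ : m.Assumption2 P W V β) :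
    ∃ C : ℝ, 0 ≤ C ∧ ∀ (l k : ℕ) (θ : m.Θ) (s : ℝ≥0), k < T * 2 ^ l → k * stepSize l < s →
      s ≤ (k + 1) * stepSize l → eLpNorm (fun ω => m.bmScheme W l θ k ω - V θ s ω) 2 P ≤
        ENNReal.ofReal (C * (stepSize l : ℝ) ^ β) := by
  obtain ⟨B, hB0, hB⟩ := h₂.exists_two
  obtain ⟨R, hR0, hR⟩ := exists_regularity_bound hm hW
  refine ⟨(B + B + √R) + B, by positivity, fun l k θ s hk hs1 hs2 => ?_⟩
  have hΔ := coe_stepSize_pos l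
  have hΔβ : 0 ≤ (stepSize l : ℝ) ^ β := Real.rpow_nonneg hΔ.le β
  have hXm := fun l k => (measurable_bmScheme hm hW l θ k).aestronglyMeasurable (μ := P)
  have hVm := fun t => (hV.measurable θ t).aestronglyMeasurable (μ := P)
  have hBanti : ∀ i, ENNReal.ofReal (B * (stepSize (l + i) : ℝ) ^ β) ≤
      ENNReal.ofReal (B * (stepSize l : ℝ) ^ β) := fun i => by
    have := stepSize_rpow_antitone hβ₀.le l i
    exact ENNReal.ofReal_le_ofReal (by gcongr)
  -- comparison of the levels on the coarse grid
  have hgrid : ∀ i, eLpNorm (fun ω => m.bmScheme W l θ k ω - m.bmScheme W (l + i) θ (k * 2 ^ i) ω) 2 P ≤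
      ENNReal.ofReal (B * (stepSize l : ℝ) ^ β + B * (stepSize l : ℝ) ^ β) := by
    intro i
    -- At time zero both schemes equal `v₀`; the assumed convergence starts with the first grid
    -- point.
    rcases Nat.eq_zero_or_pos k with rfl | hk0
    · simp [bmScheme, scheme_zero]
    · refine eLpNorm_sub_le_ofReal (hXm _ _) (hVm (k * stepSize l)) (hXm _ _) (by positivity)
        (by positivity) (hB l k hk0 hk.le θ) ?_
      rw [eLpNorm_sub_symm]
      have h := hB (l + i) (k * 2 ^ i) (Nat.mul_pos hk0 (by positivity))
        (by rw [pow_add, ← mul_assoc]; exact Nat.mul_le_mul_right _ hk.le) θ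
      have e : ((k * 2 ^ i : ℕ) : ℝ≥0) * stepSize (l + i) = k * stepSize l := by
        push_cast
        rw [mul_assoc, stepSize_add_mul]
      rw [e] at h
      exact h.trans (hBanti i)
  -- `κ i` is the index of the first point of the grid of level `l + i` that is not before `s`. It
  -- lies within one coarse step after `k Δ_l`, and its time tends to `s`.
  set κ : ℕ → ℕ := fun i => ⌈s * 2 ^ (l + i)⌉₊ with hκ
  have hinv : ∀ n, (2 ^ n : ℝ≥0) * stepSize n = 1 := fun n => by
    unfold stepSize; exact mul_inv_cancel₀ (by positivity)
  have hlow : ∀ i, s ≤ κ i * stepSize (l + i) := fun i => by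
    have h := mul_le_mul_left (Nat.le_ceil (s * 2 ^ (l + i))) (stepSize (l + i))
    rwa [mul_assoc, hinv, mul_one] at h
  have hupp : ∀ i, κ i * stepSize (l + i) ≤ s + stepSize (l + i) := fun i => by
    have h := mul_le_mul_left (Nat.ceil_lt_add_one (zero_le (a := s * 2 ^ (l + i)))).le
      (stepSize (l + i))
    rwa [add_mul, mul_assoc, hinv, mul_one, one_mul] at h
  have hκ1 : ∀ i, k * 2 ^ i < κ i := fun i => by
    rw [hκ, Nat.lt_ceil]
    push_cast
    have h := mul_lt_mul_of_pos_right hs1 (show (0 : ℝ≥0) < 2 ^ (l + i) by positivity)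
    refine lt_of_eq_of_lt ?_ h
    rw [pow_add, ← mul_assoc, mul_assoc (k : ℝ≥0), mul_comm (stepSize l), hinv, mul_one]
  have hκ2 : ∀ i, κ i ≤ k * 2 ^ i + 2 ^ i := fun i => by
    rw [hκ, Nat.ceil_le]
    push_cast
    refine (mul_le_mul_left hs2 _).trans_eq ?_
    rw [pow_add, ← mul_assoc, mul_assoc _ (stepSize l), mul_comm (stepSize l), hinv, mul_one,
      add_mul, one_mul]
  -- Three comparisons: level `l` with level `l + i` at the time `k Δ_l`; level `l + i` with itself
  -- at the later time, by regularity over at most one coarse step; and level `l + i` with the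
  -- solution at a fine grid point. The bound does not depend on `i`.
  have hbound : ∀ i, eLpNorm (fun ω => m.bmScheme W l θ k ω - V θ (κ i * stepSize (l + i)) ω) 2 P ≤
      ENNReal.ofReal (((B + B + √R) + B) * (stepSize l : ℝ) ^ β) := by
    intro i
    have hκT : κ i ≤ T * 2 ^ (l + i) := by
      refine (hκ2 i).trans ?_
      rw [pow_add, ← mul_assoc, ← Nat.succ_mul]
      exact Nat.mul_le_mul_right _ hk
    obtain ⟨n, hn⟩ := Nat.exists_eq_add_of_lt (hκ1 i)
    rw [add_assoc] at hn
    have hreg := hR (l + i) θ (k * 2 ^ i) (n + 1) (hn ▸ hκT)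
    rw [← hn] at hreg
    have hn2 : ((n + 1 : ℕ) : ℝ) * stepSize (l + i) ≤ stepSize l := by
      have h : ((n + 1 : ℕ) : ℝ≥0) ≤ 2 ^ i := by
        have : n + 1 ≤ 2 ^ i := by have := hκ2 i; omega
        exact_mod_cast this
      have h2 := mul_le_mul_left h (stepSize (l + i))
      rw [stepSize_add_mul] at h2
      exact_mod_cast h2
    have hreg2 : eLpNorm (fun ω => m.bmScheme W (l + i) θ (κ i) ω -
        m.bmScheme W (l + i) θ (k * 2 ^ i) ω) 2 P ≤ ENNReal.ofReal (√R * (stepSize l : ℝ) ^ β) := by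
      refine eLpNorm_two_le_of_integral_sq_le
        ((memLp_bmScheme hm hW _ _ _).sub (memLp_bmScheme hm hW _ _ _)) (by positivity)
        (hreg.trans ?_)
      rw [mul_pow, Real.sq_sqrt hR0, ← Real.rpow_two, ← Real.rpow_mul hΔ.le]
      gcongr
      have hx0 : 0 ≤ ((n + 1 : ℕ) : ℝ) * stepSize (l + i) := by positivity
      refine (Real.rpow_le_rpow hx0 hn2 (by linarith [hm.H_nonneg])).trans ?_
      exact Real.rpow_le_rpow_of_exponent_ge hΔ (stepSize_le_one l) (by linarith)
    rw [eLpNorm_sub_symm] at hreg2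
    have h1 := eLpNorm_sub_le_ofReal (hXm _ _) (hXm _ _) (hXm _ _) (by positivity) (by positivity)
      (hgrid i) hreg2
    have h2 := eLpNorm_sub_le_ofReal (hXm _ _) (hXm _ _) (hVm _) (by positivity) (by positivity)
      h1 ((hB (l + i) (κ i) (by have := hκ1 i; omega) hκT θ).trans (hBanti i))
    refine h2.trans_eq ?_
    congr 1
    ring
  have hlim : Tendsto (fun i => (κ i : ℝ≥0) * stepSize (l + i)) atTop (𝓝 s) := by
    refine tendsto_of_tendsto_of_tendsto_of_le_of_le tendsto_const_nhds ?_ hlow hupp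
    have h := (tendsto_const_nhds (x := s)).add
      (tendsto_stepSize.comp (tendsto_add_atTop_nat l))
    rw [add_zero] at h
    refine h.congr fun i => ?_
    simp [add_comm]
  -- As `i` grows, path continuity and Fatou's lemma transfer the bound to the time `s`. Regularity
  -- of the solution is thus inherited from the schemes.
  refine (Lp.eLpNorm_lim_le_liminf_eLpNorm
    (f := fun i ω => m.bmScheme W l θ k ω - V θ (κ i * stepSize (l + i)) ω)
    (fun i => (hXm l k).sub (hVm _)) _ (ae_of_all _ fun ω => ?_)).trans ?_
  · exact (((hV.continuous θ ω).tendsto s).comp hlim).const_sub _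
  · refine (liminf_le_liminf (Eventually.of_forall hbound)).trans ?_
    simp

end Model

/-! ## The law of the Brownian increments -/

section Law

variable {Ω : Type*} {mΩ : MeasurableSpace Ω} {P : Measure Ω}
  {ℱ : Filtration ℝ≥0 mΩ} {W : ℝ≥0 → Ω → ℝ} {T : ℕ}

/-- The increments of `W` on `[0, T]` at level `l`. -/
noncomputable def bmPath (T : ℕ) (W : ℝ≥0 → Ω → ℝ) (l : ℕ) (ω : Ω) : Path T l :=
  fun t k => gridIncr W l ω (t * 2 ^ l + k)

lemma measurable_gridIncr (hW : IsFilteredBrownian P ℱ W) (l j : ℕ) :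
    Measurable fun ω => gridIncr W l ω j :=
  (hW.measurable _).sub (hW.measurable _)

lemma measurable_bmPath (hW : IsFilteredBrownian P ℱ W) (l : ℕ) : Measurable (bmPath T W l) :=
  measurable_pi_lambda _ fun _ => measurable_pi_lambda _ fun _ => measurable_gridIncr hW l _

lemma map_gridIncr (hW : IsFilteredBrownian P ℱ W) (l j : ℕ) :
    P.map (fun ω => gridIncr W l ω j) = gaussianReal 0 (stepSize l) := by
  have h := (hW.brownian.hasLaw_sub (((j : ℝ≥0) + 1) * stepSize l) (j * stepSize l)).map_eq
  have e : nndist (((((j : ℝ≥0) + 1) * stepSize l : ℝ≥0)) : ℝ) ((j * stepSize l : ℝ≥0) : ℝ) =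
      stepSize l := by
    rw [← NNReal.coe_inj, coe_nndist, Real.dist_eq]
    push_cast
    rw [show ((j : ℝ) + 1) * stepSize l - j * stepSize l = stepSize l by ring,
      abs_of_pos (coe_stepSize_pos l)]
  change P.map _ = gaussianReal 0 (nndist (((((j : ℝ≥0) + 1) * stepSize l : ℝ≥0)) : ℝ)
    ((j * stepSize l : ℝ≥0) : ℝ)) at h
  rw [e] at h
  exact h

/-- The increments over the grid are independent Gaussians, and `(t, k) ↦ t * 2 ^ l + k` is
injective, by quotient and remainder; currying the index turns the product law into the nested one.
-/
lemma map_bmPath [IsProbabilityMeasure P] (hW : IsFilteredBrownian P ℱ W) (l : ℕ) :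
    P.map (bmPath T W l) = pathLaw T l := by
  have hind : iIndepFun (fun (p : Fin T × Fin (2 ^ l)) ω => gridIncr W l ω (p.1 * 2 ^ l + p.2)) P := by
    have h := hW.brownian.hasIndepIncrements.nat (Model.monotone_grid l)
    simp_rw [← Model.gridIncr_eq] at h
    refine h.precomp (g := fun p : Fin T × Fin (2 ^ l) => (p.1 : ℕ) * 2 ^ l + p.2) ?_
    rintro ⟨t, k⟩ ⟨t', k'⟩ heq
    simp only at heq
    have h1 := congrArg (· / 2 ^ l) heq
    have h2 := congrArg (· % 2 ^ l) heq
    simp only [mul_comm _ (2 ^ l), Nat.mul_add_div (Nat.two_pow_pos l), Nat.mul_add_mod,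
      Nat.div_eq_of_lt k.2, Nat.div_eq_of_lt k'.2, Nat.mod_eq_of_lt k.2, Nat.mod_eq_of_lt k'.2,
      add_zero] at h1 h2
    exact Prod.ext (Fin.ext h1) (Fin.ext h2)
  have hm : ∀ p : Fin T × Fin (2 ^ l), Measurable fun ω => gridIncr W l ω (p.1 * 2 ^ l + p.2) :=
    fun p => measurable_gridIncr hW l _
  have h1 := (iIndepFun_iff_map_fun_eq_infinitePi_map hm).1 hind
  simp_rw [map_gridIncr hW] at h1
  have h2 := Measure.infinitePi_map_curry (fun (_ : Fin T) (_ : Fin (2 ^ l)) =>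
    gaussianReal 0 (stepSize l))
  rw [← h1, Measure.map_map (by fun_prop) (measurable_pi_lambda _ hm)] at h2
  simp_rw [Measure.infinitePi_eq_pi] at h2
  exact h2

/-- Adding adjacent increments is exact along a Brownian path. The coupling of consecutive levels
used by the algorithm is therefore the one in which both schemes are driven by the same Brownian
motion. -/
lemma coarsen_bmPath (l : ℕ) (ω : Ω) : (bmPath T W (l + 1) ω).coarsen = bmPath T W l ω := by
  have hs : stepSize l = 2 * stepSize (l + 1) := by
    have := stepSize_add_mul l 1
    rw [← this, pow_one]
  ext t k
  simp only [Path.coarsen, bmPath, gridIncr]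
  have e1 : (((t : ℕ) * 2 ^ (l + 1) + 2 * (k : ℕ) : ℕ) : ℝ≥0) * stepSize (l + 1) =
      (((t : ℕ) * 2 ^ l + (k : ℕ) : ℕ) : ℝ≥0) * stepSize l := by
    rw [hs]; push_cast; ring
  have e2 : ((((t : ℕ) * 2 ^ (l + 1) + (2 * (k : ℕ) + 1) : ℕ) : ℝ≥0) + 1) * stepSize (l + 1) =
      ((((t : ℕ) * 2 ^ l + (k : ℕ) : ℕ) : ℝ≥0) + 1) * stepSize l := by
    rw [hs]; push_cast; ring
  rw [← e1, ← e2]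
  push_cast
  ring_nf

lemma incr_bmPath (l : ℕ) (ω : Ω) {j : ℕ} (hj : j < T * 2 ^ l) :
    (bmPath T W l ω).incr j = gridIncr W l ω j := by
  rw [Path.incr, dif_pos (Nat.div_lt_of_lt_mul (by rwa [mul_comm])), bmPath]
  congr 1
  exact Nat.div_add_mod' j (2 ^ l)

lemma measurable_incr {α : Type*} [MeasurableSpace α] {l : ℕ} {w : α → Path T l} (hw : Measurable w)
    (j : ℕ) : Measurable fun a => (w a).incr j := by
  unfold Path.incr
  split_ifs with h
  · exact (measurable_pi_apply _).comp ((measurable_pi_apply _).comp hw)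
  · exact measurable_const

lemma measurable_coarsen (l : ℕ) : Measurable (Path.coarsen : Path T (l + 1) → Path T l) :=
  measurable_pi_lambda _ fun t => measurable_pi_lambda _ fun k => by
    have h : ∀ j, Measurable fun w : Path T (l + 1) => w t j := fun j =>
      (measurable_pi_apply j).comp (measurable_pi_apply t)
    exact (h _).add (h _)

end Law

namespace Model

variable {d T : ℕ} {Y : Type*} {m : Model d T Y}

/-! ## The discretized likelihoods -/

lemma Assumption1.continuous_g (h₁ : m.Assumption1) (y y' : Y) :
    Continuous fun p : ℝ × ℝ => m.g y y' p.1 p.2 := by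
  obtain ⟨B, hB⟩ := h₁.g_lip y y'
  have h : LipschitzWith (2 * B.toNNReal) fun p : ℝ × ℝ => m.g y y' p.1 p.2 := by
    refine LipschitzWith.of_dist_le_mul fun p q => ?_
    rw [Real.dist_eq]
    refine (hB _ _ _ _).trans ?_
    have h1 : |p.1 - q.1| ≤ dist p q := le_max_left _ _
    have h2 : |p.2 - q.2| ≤ dist p q := le_max_right _ _
    have h3 : B ≤ B.toNNReal := Real.le_coe_toNNReal B
    push_cast
    have h0 : (0 : ℝ) ≤ B.toNNReal := B.toNNReal.2
    have h4 : 0 ≤ |p.1 - q.1| + |p.2 - q.2| := by positivity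
    calc B * (|p.1 - q.1| + |p.2 - q.2|) ≤ B.toNNReal * (|p.1 - q.1| + |p.2 - q.2|) := by gcongr
      _ ≤ B.toNNReal * (dist p q + dist p q) := by gcongr
      _ = _ := by ring
  exact h.continuous

lemma Assumption1.exists_g_lip (h₁ : m.Assumption1) : ∃ B : ℝ, 0 ≤ B ∧ ∀ (t : Fin T)
    (x₁ x₂ x₁' x₂' : ℝ), |m.g (m.y (t + 1)) (m.y t) x₁ x₂ - m.g (m.y (t + 1)) (m.y t) x₁' x₂'| ≤
      B * (|x₁ - x₁'| + |x₂ - x₂'|) := by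
  choose B hB using fun t : Fin T => h₁.g_lip (m.y (t + 1)) (m.y t)
  refine ⟨∑ t, |B t|, by positivity, fun t x₁ x₂ x₁' x₂' => (hB t _ _ _ _).trans ?_⟩
  have : B t ≤ ∑ t, |B t| := (le_abs_self _).trans
    (Finset.single_le_sum (f := fun t => |B t|) (fun i _ => abs_nonneg _) (Finset.mem_univ t))
  gcongr

/-- There are finitely many observations, so sums of the individual constants serve for all of them.
Normalizing to `A ≤ 1 ≤ B` lets powers of these constants be enlarged freely in estimates of
products. -/
lemma Assumption1.exists_g_bounds (h₁ : m.Assumption1) : ∃ A B : ℝ, 0 < A ∧ A ≤ 1 ∧ 1 ≤ B ∧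
    ∀ (t : Fin T) (x₁ x₂ : ℝ), A ≤ m.g (m.y (t + 1)) (m.y t) x₁ x₂ ∧
      m.g (m.y (t + 1)) (m.y t) x₁ x₂ ≤ B := by
  choose B₁ B₂ hB using fun t : Fin T => h₁.g_bdd (m.y (t + 1)) (m.y t)
  have hfin : (Set.range fun t : Fin T => (B₁ t)⁻¹).Finite := Set.finite_range _
  refine ⟨(1 + ∑ t, |(B₁ t)⁻¹|)⁻¹, 1 + ∑ t, |B₂ t|, by positivity,
    inv_le_one_of_one_le₀ (by have : 0 ≤ ∑ t, |(B₁ t)⁻¹| := by positivity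
                              linarith),
    by have : 0 ≤ ∑ t, |B₂ t| := by positivity
       linarith, fun t x₁ x₂ => ⟨?_, ?_⟩⟩
  · refine le_trans ?_ ((hB t).2.2 x₁ x₂).1
    have h := Finset.single_le_sum (f := fun t => |(B₁ t)⁻¹|) (fun i _ => abs_nonneg _)
      (Finset.mem_univ t)
    rw [inv_le_comm₀ (by positivity) (hB t).1]
    have := le_abs_self ((B₁ t)⁻¹)
    linarith
  · have h := Finset.single_le_sum (f := fun t => |B₂ t|) (fun i _ => abs_nonneg _)
      (Finset.mem_univ t)
    have := le_abs_self (B₂ t)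
    have := ((hB t).2.2 x₁ x₂).2
    linarith

lemma measurable_obsLik (hm : m.Standing) (h₁ : m.Assumption1) {α : Type*} [MeasurableSpace α] (l : ℕ)
    (t : Fin T) {θ : α → m.Θ} (hθ : Measurable θ) {w : α → Path T l} (hw : Measurable w) :
    Measurable fun a => m.obsLik l (θ a) t (w a) := by
  have hX : ∀ k, Measurable fun a => m.scheme l (θ a) (w a).incr k := fun k =>
    measurable_scheme hm l hθ fun j _ => measurable_incr hw j
  obtain ⟨Bf, hf⟩ := h₁.f_lip
  obtain ⟨Bh, hh⟩ := h₁.h_lip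
  refine (h₁.continuous_g _ _).measurable.comp (Measurable.prodMk ?_ ?_)
  · exact (Finset.measurable_sum _ fun k _ => hf.continuous.measurable.comp (hX _)).const_mul _
  · refine Finset.measurable_sum (Finset.range (2 ^ l)) fun k _ => ?_
    exact (hh.continuous.measurable.comp (hX _)).mul (measurable_incr hw _)

lemma measurable_skeleton (hm : m.Standing) {α : Type*} [MeasurableSpace α] (l : ℕ)
    {θ : α → m.Θ} (hθ : Measurable θ) {w : α → Path T l} (hw : Measurable w) :
    Measurable fun a => m.skeleton l (θ a) (w a) :=
  measurable_pi_lambda _ fun _ => measurable_scheme hm l hθ fun j _ => measurable_incr hw j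

/-- The likelihood of an observation uses increments with index below `(t + 1) * 2 ^ l`, that is,
those of the time blocks up to `t`; the potentials are therefore nonanticipating. -/
lemma obsLik_congr (l : ℕ) (θ : m.Θ) (t : Fin T) {w w' : Path T l} (h : ∀ s ≤ t, w s = w' s) :
    m.obsLik l θ t w = m.obsLik l θ t w' := by
  have hinc : ∀ j < ((t : ℕ) + 1) * 2 ^ l, w.incr j = w'.incr j := by
    intro j hj
    have hj2 : j / 2 ^ l ≤ t := Nat.lt_succ_iff.1 (Nat.div_lt_of_lt_mul (by rwa [mul_comm] at hj))
    unfold Path.incr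
    split_ifs with hjT
    · rw [h ⟨j / 2 ^ l, hjT⟩ hj2]
    · rfl
  have hX : ∀ k ∈ Finset.range (2 ^ l), m.scheme l θ w.incr (t * 2 ^ l + k) =
      m.scheme l θ w'.incr (t * 2 ^ l + k) ∧ w.incr (t * 2 ^ l + k) = w'.incr (t * 2 ^ l + k) := by
    intro k hk
    have hk := Finset.mem_range.1 hk
    have hk2 : (t : ℕ) * 2 ^ l + k < (t + 1) * 2 ^ l := by rw [add_mul, one_mul]; omega
    exact ⟨scheme_congr l θ fun j hj => hinc j (hj.trans hk2), hinc _ hk2⟩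
  unfold obsLik
  congr 1
  · congr 1
    exact Finset.sum_congr rfl fun k hk => by rw [(hX k hk).1]
  · exact Finset.sum_congr rfl fun k hk => by rw [(hX k hk).1, (hX k hk).2]

lemma goodPotential_pfPotential (hm : m.Standing) (h₁ : m.Assumption1) (l : ℕ) :
    m.GoodPotential (m.pfPotential l) where
  meas t := measurable_obsLik hm h₁ l t measurable_fst measurable_snd
  nonanticipating θ t w w' h := obsLik_congr l θ t h
  bounds := by
    obtain ⟨A, B, hA, -, -, h⟩ := h₁.exists_g_bounds
    exact ⟨A, B, hA, fun θ t w => h t _ _⟩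

lemma goodPotential_dpfPotential (hm : m.Standing) (h₁ : m.Assumption1) (l : ℕ) :
    m.GoodPotential (m.dpfPotential l) where
  meas t := (measurable_obsLik hm h₁ (l + 1) t measurable_fst measurable_snd).max
    (measurable_obsLik hm h₁ l t measurable_fst ((measurable_coarsen l).comp measurable_snd))
  nonanticipating θ t w w' h := by
    unfold dpfPotential
    rw [obsLik_congr (l + 1) θ t h, obsLik_congr l θ t (w := w.coarsen) (w' := w'.coarsen)]
    intro s hs
    ext k
    simp only [Path.coarsen, h s hs]
  bounds := by
    obtain ⟨A, B, hA, -, -, h⟩ := h₁.exists_g_bounds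
    exact ⟨A, B, hA, fun θ t w => ⟨(h t _ _).1.trans (le_max_left _ _),
      max_le (h t _ _).2 (h t _ _).2⟩⟩

section Brownian

variable {Ω : Type*} {mΩ : MeasurableSpace Ω} {P : Measure Ω} {ℱ : Filtration ℝ≥0 mΩ}
  {W : ℝ≥0 → Ω → ℝ}

lemma scheme_bmPath (l : ℕ) (θ : m.Θ) (ω : Ω) {k : ℕ} (hk : k ≤ T * 2 ^ l) :
    m.scheme l θ (bmPath T W l ω).incr k = m.bmScheme W l θ k ω :=
  scheme_congr l θ fun _ hj => incr_bmPath l ω (hj.trans_le hk)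

lemma skeleton_bmPath (l : ℕ) (θ : m.Θ) (ω : Ω) (t : Fin T) :
    m.skeleton l θ (bmPath T W l ω) t = m.bmScheme W l θ ((t + 1) * 2 ^ l) ω :=
  scheme_bmPath l θ ω (Nat.mul_le_mul_right _ t.2)

lemma obsLik_bmPath (l : ℕ) (θ : m.Θ) (t : Fin T) (ω : Ω) :
    m.obsLik l θ t (bmPath T W l ω) = m.g (m.y (t + 1)) (m.y t)
      ((stepSize l : ℝ) * ∑ k ∈ Finset.range (2 ^ l), m.f (m.bmScheme W l θ (t * 2 ^ l + k) ω))
      (∑ k ∈ Finset.range (2 ^ l), m.h (m.bmScheme W l θ (t * 2 ^ l + k) ω) *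
        gridIncr W l ω (t * 2 ^ l + k)) := by
  have hk2 : ∀ k ∈ Finset.range (2 ^ l), (t : ℕ) * 2 ^ l + k < T * 2 ^ l := by
    intro k hk
    have hk := Finset.mem_range.1 hk
    have := Nat.mul_le_mul_right (2 ^ l) t.2
    rw [Nat.succ_eq_add_one, add_mul, one_mul] at this
    omega
  unfold obsLik
  congr 1
  · congr 1
    exact Finset.sum_congr rfl fun k hk => by rw [scheme_bmPath l θ ω (hk2 k hk).le]
  · exact Finset.sum_congr rfl fun k hk => by
      rw [scheme_bmPath l θ ω (hk2 k hk).le, incr_bmPath l ω (hk2 k hk)]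

end Brownian

end Model

/-! ## Convergence of the likelihoods -/

section Step

variable {Ω : Type*} {mΩ : MeasurableSpace Ω} {P : Measure Ω}
  {ℱ : Filtration ℝ≥0 mΩ}

namespace StepProcess

lemma value_eq_of_mem (S : StepProcess ℱ) {i : ℕ} (hi : i < S.n) {s : ℝ≥0}
    (hs : s ∈ Set.Ioc (S.t i) (S.t (i + 1))) (ω : Ω) : S.value s ω = S.ξ i ω := by
  rw [StepProcess.value, Finset.sum_eq_single i]
  · rw [Set.indicator_of_mem hs]
  · intro j _ hj
    refine Set.indicator_of_notMem (fun h => ?_) _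
    rcases lt_or_gt_of_ne hj with hji | hji
    · exact (h.2.trans (S.mono hji)).not_gt hs.1
    · exact (hs.2.trans (S.mono hji)).not_gt h.1
  · exact fun h => absurd (Finset.mem_range.2 hi) h

/-- The time integral of a step process. -/
lemma setIntegral_value (S : StepProcess ℱ) {a b : ℝ≥0} (ha : a ≤ S.t 0) (hb : S.t S.n ≤ b) (ω : Ω) :
    ∫ s in Set.Ioc (a : ℝ) b, S.value s.toNNReal ω =
      ∑ i ∈ Finset.range S.n, (S.t (i + 1) - S.t i : ℝ) * S.ξ i ω := by
  rw [setIntegral_eq_integral_of_forall_compl_eq_zero fun s hs => S.value_eq_zero ha hb hs ω]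
  simp_rw [value_toNNReal]
  rw [integral_finsetSum, ← Fin.sum_univ_eq_sum_range
    (fun i => (S.t (i + 1) - S.t i : ℝ) * S.ξ i ω)]
  · refine Finset.sum_congr rfl fun i _ => ?_
    rw [integral_indicator_const _ measurableSet_Ioc, Real.volume_real_Ioc_of_le
      (NNReal.coe_le_coe.2 (S.mono (Nat.le_succ _))), smul_eq_mul]
  · intro i _
    rw [integrable_indicator_iff measurableSet_Ioc]
    exact integrableOn_const (by simp) enorm_ne_top

lemma exists_value_bound (S : StepProcess ℱ) : ∃ B : ℝ, ∀ s ω, |S.value s ω| ≤ B := by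
  obtain ⟨B, hB⟩ := S.bdd
  refine ⟨S.n * max B 0, fun s ω => (Finset.abs_sum_le_sum_abs _ _).trans ?_⟩
  refine (Finset.sum_le_card_nsmul _ _ (max B 0) fun i _ => ?_).trans_eq (by simp)
  by_cases h : s ∈ Set.Ioc (S.t i) (S.t (i + 1))
  · rw [Set.indicator_of_mem h]
    exact (hB i ω).trans (le_max_left _ _)
  · rw [Set.indicator_of_notMem h, abs_zero]
    exact le_max_right _ _

end StepProcess

end Step

section Norms

variable {Ω : Type*} {mΩ : MeasurableSpace Ω} {P : Measure Ω}

/-- Minkowski's inequality with a common bound for the terms. It turns the pointwise Lipschitz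
estimates below into `L²` rates. -/
lemma eLpNorm_two_le_of_abs_le_sum {ι : Type*} (s : Finset ι) {F : Ω → ℝ} {D : ι → Ω → ℝ} {K c : ℝ}
    (hK : 0 ≤ K) (hD : ∀ i ∈ s, AEStronglyMeasurable (D i) P)
    (hDc : ∀ i ∈ s, eLpNorm (D i) 2 P ≤ ENNReal.ofReal c)
    (hF : ∀ ω, |F ω| ≤ K * ∑ i ∈ s, |D i ω|) : eLpNorm F 2 P ≤ ENNReal.ofReal (K * (s.card * c)) := by
  have h1 : eLpNorm F 2 P ≤ eLpNorm (fun ω => K * ∑ i ∈ s, |D i ω|) 2 P :=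
    eLpNorm_mono_real hF
  have h2 : eLpNorm (∑ i ∈ s, fun ω => |D i ω|) 2 P ≤ s.card * ENNReal.ofReal c := by
    refine (eLpNorm_sum_le (fun i hi => (hD i hi).norm) one_le_two).trans ?_
    rw [← nsmul_eq_mul]
    refine Finset.sum_le_card_nsmul _ _ _ fun i hi => ?_
    exact (eLpNorm_norm (D i)).trans_le (hDc i hi)
  have e : (fun ω => K * ∑ i ∈ s, |D i ω|) = K • ∑ i ∈ s, fun ω => |D i ω| := by
    ext ω; simp
  refine h1.trans ?_
  rw [e, eLpNorm_const_smul, ENNReal.ofReal_mul hK, ENNReal.ofReal_mul (Nat.cast_nonneg _),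
    ENNReal.ofReal_natCast, Real.enorm_eq_ofReal hK]
  gcongr

lemma eLpNorm_two_le_of_abs_le_add {F D₁ D₂ : Ω → ℝ} {K c : ℝ}
    (hK : 0 ≤ K) (hD₁ : AEStronglyMeasurable D₁ P) (hD₂ : AEStronglyMeasurable D₂ P)
    (hDc₁ : eLpNorm D₁ 2 P ≤ ENNReal.ofReal c) (hDc₂ : eLpNorm D₂ 2 P ≤ ENNReal.ofReal c)
    (hF : ∀ ω, |F ω| ≤ K * (|D₁ ω| + |D₂ ω|)) : eLpNorm F 2 P ≤ ENNReal.ofReal (K * (2 * c)) := by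
  have h := eLpNorm_two_le_of_abs_le_sum (P := P) (Finset.univ : Finset Bool) (F := F)
    (D := fun i => cond i D₁ D₂) hK (by rintro (_ | _) -; exacts [hD₂, hD₁])
    (by rintro (_ | _) -; exacts [hDc₂, hDc₁]) (by simpa using hF)
  simpa using h

lemma eLpNorm_two_le_of_lintegral_sq_le {f : Ω → ℝ} {c : ℝ} (hc : 0 ≤ c)
    (h : ∫⁻ ω, ENNReal.ofReal (f ω ^ 2) ∂P ≤ ENNReal.ofReal (c ^ 2)) :
    eLpNorm f 2 P ≤ ENNReal.ofReal c := by
  rw [lintegral_ofReal_sq_eq_eLpNorm, ENNReal.ofReal_pow hc] at h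
  exact (ENNReal.pow_right_strictMono two_ne_zero).le_iff_le.1 h

end Norms

lemma exists_grid_interval {t l : ℕ} {s : ℝ≥0} (h1 : (t : ℝ≥0) < s) (h2 : s ≤ t + 1) :
    ∃ i < 2 ^ l, ((t * 2 ^ l + i : ℕ) : ℝ≥0) * stepSize l < s ∧
      s ≤ ((t * 2 ^ l + i + 1 : ℕ) : ℝ≥0) * stepSize l := by
  have hp : (0 : ℝ≥0) < 2 ^ l := by positivity
  have e : ∀ k : ℕ, (k : ℝ≥0) * stepSize l = k / 2 ^ l := fun k => by
    rw [stepSize, div_eq_mul_inv]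
  simp_rw [e, div_lt_iff₀ hp, le_div_iff₀ hp]
  set n := ⌈s * 2 ^ l⌉₊ with hn
  have hn1 : t * 2 ^ l < n := by
    rw [hn, Nat.lt_ceil]
    push_cast
    gcongr
  have hn2 : n ≤ t * 2 ^ l + 2 ^ l := by
    rw [hn, Nat.ceil_le]
    push_cast
    calc s * 2 ^ l ≤ (t + 1) * 2 ^ l := by gcongr
      _ = _ := by ring
  -- The cells are open on the left and closed on the right, so the index is the ceiling minus one;
  -- a grid point belongs to the cell that ends there.
  refine ⟨n - 1 - t * 2 ^ l, by omega, ?_, ?_⟩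
  · rw [show t * 2 ^ l + (n - 1 - t * 2 ^ l) = n - 1 by omega]
    exact Nat.lt_ceil.1 (by rw [← hn]; omega)
  · rw [show t * 2 ^ l + (n - 1 - t * 2 ^ l) + 1 = n by omega]
    exact Nat.le_ceil _

namespace Model

variable {d T : ℕ} {Y : Type*} {m : Model d T Y} {Ω : Type*} {mΩ : MeasurableSpace Ω}
  {P : Measure Ω} {ℱ : Filtration ℝ≥0 mΩ} {W : ℝ≥0 → Ω → ℝ}

/-- The step process `Φ(V^l)` on `(t, t + 1]`. -/
noncomputable def schemeStep (hm : m.Standing) (hW : IsFilteredBrownian P ℱ W) {Φ : ℝ → ℝ}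
    (hΦ : Measurable Φ) (hb : ∃ B : ℝ, ∀ x, |Φ x| ≤ B) (l : ℕ) (θ : m.Θ) (t : ℕ) :
    StepProcess ℱ where
  n := 2 ^ l
  t i := ((t * 2 ^ l + i : ℕ) : ℝ≥0) * stepSize l
  mono := fun _ _ hij => monotone_grid l (Nat.add_le_add_left hij _)
  ξ i ω := Φ (m.bmScheme W l θ (t * 2 ^ l + i) ω)
  meas _ := hΦ.comp (adapted_bmScheme hm hW l θ _)
  bdd := hb.imp fun _ hB _ _ => hB _

section SchemeStep

variable {hm : m.Standing} {hW : IsFilteredBrownian P ℱ W} {Φ : ℝ → ℝ}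
  {hΦ : Measurable Φ} {hb : ∃ B : ℝ, ∀ x, |Φ x| ≤ B}

lemma schemeStep_t_zero (l : ℕ) (θ : m.Θ) (t : ℕ) : (schemeStep hm hW hΦ hb l θ t).t 0 = t := by
  simp only [schemeStep, add_zero, Nat.cast_mul, Nat.cast_pow, Nat.cast_ofNat, stepSize]
  rw [mul_assoc, mul_inv_cancel₀ (by positivity), mul_one]

lemma schemeStep_t_last (l : ℕ) (θ : m.Θ) (t : ℕ) :
    (schemeStep hm hW hΦ hb l θ t).t (schemeStep hm hW hΦ hb l θ t).n = t + 1 := by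
  simp only [schemeStep, stepSize]
  push_cast
  rw [← add_one_mul, mul_assoc, mul_inv_cancel₀ (by positivity), mul_one]

lemma schemeStep_integral (l : ℕ) (θ : m.Θ) (t : ℕ) (ω : Ω) :
    (schemeStep hm hW hΦ hb l θ t).integral W ω = ∑ k ∈ Finset.range (2 ^ l),
      Φ (m.bmScheme W l θ (t * 2 ^ l + k) ω) * gridIncr W l ω (t * 2 ^ l + k) := by
  simp only [StepProcess.integral, schemeStep, gridIncr_eq]
  rfl

lemma schemeStep_setIntegral (l : ℕ) (θ : m.Θ) (t : ℕ) (ω : Ω) :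
    ∫ s in Set.Ioc (t : ℝ) (t + 1), (schemeStep hm hW hΦ hb l θ t).value s.toNNReal ω =
      (stepSize l : ℝ) * ∑ k ∈ Finset.range (2 ^ l), Φ (m.bmScheme W l θ (t * 2 ^ l + k) ω) := by
  have h := (schemeStep hm hW hΦ hb l θ t).setIntegral_value (schemeStep_t_zero l θ t).ge
    (schemeStep_t_last l θ t).le ω
  push_cast at h
  rw [h, Finset.mul_sum]
  refine Finset.sum_congr rfl fun k _ => ?_
  simp only [schemeStep]
  congr 1
  push_cast
  ring

end SchemeStep

variable {V : m.Θ → ℝ≥0 → Ω → ℝ} {β : ℝ}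

/-- Continuity of the paths upgrades measurability at each fixed time to joint measurability. -/
lemma IsSolution.measurable_comp (hV : m.IsSolution P ℱ W V) {Φ : ℝ → ℝ} (hΦ : Measurable Φ)
    (θ : m.Θ) : Measurable fun p : Ω × ℝ => Φ (V θ p.2.toNNReal p.1) := by
  have h := measurable_uncurry_of_continuous_of_measurable (u := fun t ω => V θ t ω)
    (hV.continuous θ) (hV.measurable θ)
  exact hΦ.comp (h.comp ((measurable_real_toNNReal.comp measurable_snd).prodMk measurable_fst))

variable [IsProbabilityMeasure P]

/-- Convergence of the step processes `Φ(V^l)` to `Φ(V)`. -/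
lemma exists_schemeStep_bound (hm : m.Standing) (hW : IsFilteredBrownian P ℱ W)
    (hV : m.IsSolution P ℱ W V) (hβ₀ : 0 < β) (hβ : β ≤ m.H + 1 / 2) (h₂ : m.Assumption2 P W V β)
    {Φ : ℝ → ℝ} (hL : ∃ B : ℝ≥0, LipschitzWith B Φ) (hΦ : Measurable Φ)
    (hb : ∃ B : ℝ, ∀ x, |Φ x| ≤ B) : ∃ C : ℝ, 0 < C ∧ ∀ (l : ℕ) (θ : m.Θ) (t : Fin T),
      processDist P t (t + 1) (schemeStep hm hW hΦ hb l θ t).value (fun s ω => Φ (V θ s ω)) ≤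
        ENNReal.ofReal ((C * (stepSize l : ℝ) ^ β) ^ 2) := by
  obtain ⟨C, hC0, hC⟩ := exists_strong_bound hm hW hV hβ₀ hβ h₂
  obtain ⟨B, hB⟩ := hL
  -- The summand one makes the constant strictly positive, as the existence criterion for Itô
  -- integrals requires.
  refine ⟨B * C + 1, by positivity, fun l θ t => ?_⟩
  have hΔβ : 0 ≤ (stepSize l : ℝ) ^ β := Real.rpow_nonneg (coe_stepSize_pos l).le β
  set S := schemeStep hm hW hΦ hb l θ t with hS
  -- Integrating over `ω` first, each time lies in one cell of the grid, where the strong error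
  -- bound applies uniformly; the time interval has length one.
  rw [processDist_eq_lintegral S.measurable_value (hV.measurable_comp hΦ θ)]
  have hpt : ∀ s ∈ Set.Ioc (((t : ℕ) : ℝ≥0) : ℝ) (((t : ℕ) + 1 : ℝ≥0) : ℝ),
      ∫⁻ ω, ENNReal.ofReal ((S.value s.toNNReal ω - Φ (V θ s.toNNReal ω)) ^ 2) ∂P ≤
        ENNReal.ofReal (((B * C + 1) * (stepSize l : ℝ) ^ β) ^ 2) := by
    intro s hs
    obtain ⟨i, hi, h1, h2⟩ := exists_grid_interval (l := l) (Real.lt_toNNReal_iff_coe_lt.2 hs.1)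
      (Real.toNNReal_le_iff_le_coe.2 hs.2)
    have hv : ∀ ω, S.value s.toNNReal ω = Φ (m.bmScheme W l θ (t * 2 ^ l + i) ω) := fun ω =>
      S.value_eq_of_mem hi ⟨h1, h2⟩ ω
    have hlt : (t : ℕ) * 2 ^ l + i < T * 2 ^ l := by
      have := Nat.mul_le_mul_right (2 ^ l) t.2
      rw [Nat.succ_eq_add_one, add_mul, one_mul] at this
      omega
    have hstrong := hC l (t * 2 ^ l + i) θ s.toNNReal hlt h1 (by push_cast at h2 ⊢; exact h2)
    calc ∫⁻ ω, ENNReal.ofReal ((S.value s.toNNReal ω - Φ (V θ s.toNNReal ω)) ^ 2) ∂P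
        ≤ ∫⁻ ω, ENNReal.ofReal ((B : ℝ) ^ 2) *
          ENNReal.ofReal ((m.bmScheme W l θ (t * 2 ^ l + i) ω - V θ s.toNNReal ω) ^ 2) ∂P := by
          refine lintegral_mono fun ω => ?_
          simp only
          rw [hv, ← ENNReal.ofReal_mul (by positivity), ← mul_pow]
          refine ENNReal.ofReal_le_ofReal (sq_le_sq.2 ?_)
          have h := hB.dist_le_mul (m.bmScheme W l θ (t * 2 ^ l + i) ω) (V θ s.toNNReal ω)
          rwa [abs_mul, NNReal.abs_eq]
      _ ≤ ENNReal.ofReal ((B : ℝ) ^ 2) * ENNReal.ofReal ((C * (stepSize l : ℝ) ^ β) ^ 2) := by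
          rw [lintegral_const_mul' _ _ ENNReal.ofReal_ne_top, lintegral_ofReal_sq_eq_eLpNorm,
            ENNReal.ofReal_pow (by positivity) 2 (p := C * (stepSize l : ℝ) ^ β)]
          gcongr
      _ ≤ _ := by
          rw [← ENNReal.ofReal_mul (by positivity), ← mul_pow]
          refine ENNReal.ofReal_le_ofReal (pow_le_pow_left₀ (by positivity) ?_ 2)
          nlinarith
  refine (setLIntegral_mono' measurableSet_Ioc hpt).trans_eq ?_
  rw [setLIntegral_const, Real.volume_Ioc]
  simp

/-- The Itô integrals in the exact likelihood exist. -/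
lemma isItoIntegral_of_bounded (hm : m.Standing) (hW : IsFilteredBrownian P ℱ W)
    (hV : m.IsSolution P ℱ W V) (hβ₀ : 0 < β) (hβ : β ≤ m.H + 1 / 2) (h₂ : m.Assumption2 P W V β)
    {Φ : ℝ → ℝ} (hL : ∃ B : ℝ≥0, LipschitzWith B Φ) (hb : ∃ B : ℝ, ∀ x, |Φ x| ≤ B) (θ : m.Θ)
    (t : Fin T) :
    IsItoIntegral P ℱ W (fun s ω => Φ (V θ s ω)) (t : ℕ) ((t : ℕ) + 1)
      (itoIntegral P ℱ W (fun s ω => Φ (V θ s ω)) (t : ℕ) ((t : ℕ) + 1)) := by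
  have hΦ : Measurable Φ := by
    obtain ⟨B, hB⟩ := hL
    exact hB.continuous.measurable
  obtain ⟨C, hC0, hC⟩ := exists_schemeStep_bound hm hW hV hβ₀ hβ h₂ hL hΦ hb
  -- The step processes `Φ(V^l)` converge at the geometric rate `2 ^ (-β)` per level, which makes
  -- their elementary integrals Cauchy.
  refine isItoIntegral_itoIntegral (exists_isItoIntegral hW (hV.measurable_comp hΦ θ)
    (S := fun l => schemeStep hm hW hΦ hb l θ t) (A := C) (r := (2⁻¹ : ℝ) ^ β)
    (fun l => ⟨(schemeStep_t_zero l θ t).ge, (schemeStep_t_last l θ t).le⟩) hC0 (by positivity)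
    (Real.rpow_lt_one (by norm_num) (by norm_num) hβ₀) fun l => ?_)
  refine (hC l θ t).trans_eq ?_
  congr 3
  rw [coe_stepSize, ← inv_pow, ← Real.rpow_natCast, ← Real.rpow_natCast, ← Real.rpow_mul (by norm_num),
    ← Real.rpow_mul (by norm_num), mul_comm]

lemma measurable_exactLik (hm : m.Standing) (h₁ : m.Assumption1) (hW : IsFilteredBrownian P ℱ W)
    (hV : m.IsSolution P ℱ W V) (hβ₀ : 0 < β) (hβ : β ≤ m.H + 1 / 2) (h₂ : m.Assumption2 P W V β)
    (θ : m.Θ) (t : Fin T) : Measurable (m.exactLik P ℱ W V θ t) := by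
  obtain ⟨Bf, hf⟩ := h₁.f_lip
  refine (h₁.continuous_g _ _).measurable.comp (Measurable.prodMk ?_
    (isItoIntegral_of_bounded hm hW hV hβ₀ hβ h₂ h₁.h_lip h₁.h_bdd θ t).1)
  exact ((hV.measurable_comp hf.continuous.measurable θ).stronglyMeasurable.integral_prod_right
    (ν := volume.restrict (Set.Ioc ((t : ℕ) : ℝ) ((t : ℕ) + 1)))).measurable

/-- Strong convergence of the likelihoods of the single observations. -/
lemma exists_obsLik_bound (hm : m.Standing) (h₁ : m.Assumption1) (hW : IsFilteredBrownian P ℱ W)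
    (hV : m.IsSolution P ℱ W V) (hβ₀ : 0 < β) (hβ : β ≤ m.H + 1 / 2) (h₂ : m.Assumption2 P W V β) :
    ∃ C : ℝ, 0 ≤ C ∧ ∀ (l : ℕ) (θ : m.Θ) (t : Fin T),
      eLpNorm (fun ω => m.obsLik l θ t (bmPath T W l ω) - m.exactLik P ℱ W V θ t ω) 2 P ≤
        ENNReal.ofReal (C * (stepSize l : ℝ) ^ β) := by
  have hf : Measurable m.f := by
    obtain ⟨B, hB⟩ := h₁.f_lip
    exact hB.continuous.measurable
  have hh : Measurable m.h := by
    obtain ⟨B, hB⟩ := h₁.h_lip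
    exact hB.continuous.measurable
  obtain ⟨C₁, hC₁0, hC₁⟩ := exists_schemeStep_bound hm hW hV hβ₀ hβ h₂ h₁.f_lip hf h₁.f_bdd
  obtain ⟨C₂, hC₂0, hC₂⟩ := exists_schemeStep_bound hm hW hV hβ₀ hβ h₂ h₁.h_lip hh h₁.h_bdd
  obtain ⟨B, hB0, hB⟩ := h₁.exists_g_lip
  -- `C₁` controls the time integral; `2 * C₂` controls the Itô integral, the two being the square
  -- root of the factor four in its distance bound. Their sum serves for both.
  refine ⟨B * (2 * (C₁ + 2 * C₂)), by positivity, fun l θ t => ?_⟩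
  have hΔβ : 0 ≤ (stepSize l : ℝ) ^ β := Real.rpow_nonneg (coe_stepSize_pos l).le β
  have hVf := hV.measurable_comp hf θ
  set Sf := schemeStep hm hW hf h₁.f_bdd l θ t with hSf
  set Sh := schemeStep hm hW hh h₁.h_bdd l θ t with hSh
  have hIto := isItoIntegral_of_bounded hm hW hV hβ₀ hβ h₂ h₁.h_lip h₁.h_bdd θ t
  set I := itoIntegral P ℱ W (fun s ω => m.h (V θ s ω)) (t : ℕ) ((t : ℕ) + 1) with hI
  set μt : Measure ℝ := volume.restrict (Set.Ioc ((t : ℕ) : ℝ) ((t : ℕ) + 1)) with hμt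
  have hprob : IsProbabilityMeasure μt := ⟨by simp [hμt]⟩
  -- the drift term
  have hDf : eLpNorm (fun ω => ∫ s, (Sf.value s.toNNReal ω - m.f (V θ s.toNNReal ω)) ∂μt) 2 P ≤
      ENNReal.ofReal ((C₁ + 2 * C₂) * (stepSize l : ℝ) ^ β) := by
    refine eLpNorm_two_le_of_lintegral_sq_le (by positivity) (le_trans ?_ ((hC₁ l θ t).trans
      (ENNReal.ofReal_le_ofReal (pow_le_pow_left₀ (by positivity) (by gcongr; linarith) 2))))
    refine lintegral_mono fun ω => ?_
    obtain ⟨B₁, hB₁⟩ := Sf.exists_value_bound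
    obtain ⟨B₂, hB₂⟩ := h₁.f_bdd
    have hmeas : Measurable fun s : ℝ => Sf.value s.toNNReal ω - m.f (V θ s.toNNReal ω) :=
      measurable_section ω (Sf.measurable_value.sub hVf)
    have hL : MemLp (fun s : ℝ => Sf.value s.toNNReal ω - m.f (V θ s.toNNReal ω)) 2 μt :=
      memLp_of_bounded μt (B := B₁ + B₂) hmeas (fun s => (abs_sub _ _).trans (add_le_add (hB₁ _ _) (hB₂ _))) 2
    refine (ENNReal.ofReal_le_ofReal (sq_integral_le hL)).trans_eq ?_
    rw [probReal_univ, one_mul, ofReal_integral_eq_lintegral_ofReal hL.integrable_sq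
      (ae_of_all _ fun s => sq_nonneg _)]
    simp only [hμt, NNReal.coe_natCast, NNReal.coe_add, NNReal.coe_one]
    rfl
  have hDfm : AEStronglyMeasurable
      (fun ω => ∫ s, (Sf.value s.toNNReal ω - m.f (V θ s.toNNReal ω)) ∂μt) P :=
    ((Sf.measurable_value.sub hVf).stronglyMeasurable.integral_prod_right
      (ν := μt)).aestronglyMeasurable
  -- the martingale term
  have hDh : eLpNorm (fun ω => Sh.integral W ω - I ω) 2 P ≤
      ENNReal.ofReal ((C₁ + 2 * C₂) * (stepSize l : ℝ) ^ β) := by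
    refine eLpNorm_two_le_of_lintegral_sq_le (by positivity) ?_
    refine (hIto.lintegral_sub_sq_le hW (hV.measurable_comp hh θ) Sh (schemeStep_t_zero l θ t).ge
      (schemeStep_t_last l θ t).le).trans ?_
    calc 4 * processDist P t (t + 1) Sh.value (fun s ω => m.h (V θ s ω))
        ≤ ENNReal.ofReal 4 * ENNReal.ofReal ((C₂ * (stepSize l : ℝ) ^ β) ^ 2) := by
          rw [ENNReal.ofReal_ofNat]
          gcongr
          exact hC₂ l θ t
      _ = ENNReal.ofReal ((2 * C₂ * (stepSize l : ℝ) ^ β) ^ 2) := by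
          rw [← ENNReal.ofReal_mul (by norm_num)]
          congr 1
          ring
      _ ≤ _ := ENNReal.ofReal_le_ofReal (pow_le_pow_left₀ (by positivity) (by gcongr; linarith) 2)
  have hDhm : AEStronglyMeasurable (fun ω => Sh.integral W ω - I ω) P :=
    ((Sh.measurable_integral hW).sub hIto.1).aestronglyMeasurable
  refine (eLpNorm_two_le_of_abs_le_add hB0 hDfm hDhm hDf hDh fun ω => ?_).trans_eq
    (by congr 1; ring)
  rw [obsLik_bmPath, exactLik, ← schemeStep_setIntegral (hm := hm) (hW := hW) (hΦ := hf)
    (hb := h₁.f_bdd), ← schemeStep_integral (hm := hm) (hΦ := hh) (hb := h₁.h_bdd) (hW := hW)]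
  refine (hB t _ _ _ _).trans_eq ?_
  obtain ⟨B₁, hB₁⟩ := Sf.exists_value_bound
  obtain ⟨B₂, hB₂⟩ := h₁.f_bdd
  rw [integral_sub (integrable_of_bounded μt (measurable_section ω Sf.measurable_value)
    fun s => hB₁ _ _) (integrable_of_bounded μt (measurable_section ω hVf) fun s => hB₂ _)]

end Model

/-! ## The bias of the discretized posterior -/

lemma abs_prod_le_pow {ι : Type*} (s : Finset ι) {a : ι → ℝ} {B : ℝ} (ha : ∀ i, |a i| ≤ B) :
    |∏ i ∈ s, a i| ≤ B ^ s.card := by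
  rw [Finset.abs_prod, ← Finset.prod_const]
  exact Finset.prod_le_prod (fun _ _ => abs_nonneg _) fun i _ => ha i

lemma pow_le_prod {ι : Type*} (s : Finset ι) {a : ι → ℝ} {A : ℝ} (hA : 0 ≤ A) (ha : ∀ i, A ≤ a i) :
    A ^ s.card ≤ ∏ i ∈ s, a i := by
  rw [← Finset.prod_const]
  exact Finset.prod_le_prod (fun _ _ => hA) fun i _ => ha i

lemma abs_integral_le_of_forall {α : Type*} {mα : MeasurableSpace α} (μ : Measure α)
    [IsProbabilityMeasure μ] {f : α → ℝ} {c : ℝ} (h : ∀ x, |f x| ≤ c) : |∫ x, f x ∂μ| ≤ c := by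
  refine (norm_integral_le_of_norm_le_const (f := f) (C := c) (ae_of_all μ h)).trans_eq ?_
  simp

lemma le_integral_of_forall {α : Type*} {mα : MeasurableSpace α} (μ : Measure α)
    [IsProbabilityMeasure μ] {f : α → ℝ} {c : ℝ} (hf : Integrable f μ) (h : ∀ x, c ≤ f x) :
    c ≤ ∫ x, f x ∂μ := by
  have := integral_mono (integrable_const c) hf h
  simpa using this

/-- The factors are exchanged one at a time; since `1 ≤ B`, the power of `B` may be enlarged to the
full cardinality at every step. -/
lemma abs_prod_sub_prod_le {ι : Type*} (s : Finset ι) {a b : ι → ℝ} {B : ℝ} (hB : 1 ≤ B)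
    (ha : ∀ i, |a i| ≤ B) (hb : ∀ i, |b i| ≤ B) :
    |∏ i ∈ s, a i - ∏ i ∈ s, b i| ≤ B ^ s.card * ∑ i ∈ s, |a i - b i| := by
  classical
  have hB0 : 0 ≤ B := zero_le_one.trans hB
  induction s using Finset.induction_on with
  | empty => simp
  | insert i s hi ih =>
    rw [Finset.prod_insert hi, Finset.prod_insert hi, Finset.sum_insert hi, Finset.card_insert_of_notMem hi]
    have hp : |∏ i ∈ s, a i| ≤ B ^ s.card := abs_prod_le_pow s ha
    have e : a i * ∏ i ∈ s, a i - b i * ∏ i ∈ s, b i =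
        (a i - b i) * ∏ i ∈ s, a i + b i * (∏ i ∈ s, a i - ∏ i ∈ s, b i) := by ring
    rw [e]
    refine (abs_add_le _ _).trans ?_
    rw [abs_mul, abs_mul]
    have h1 : |a i - b i| * |∏ i ∈ s, a i| ≤ |a i - b i| * B ^ s.card := by gcongr
    have h2 : |b i| * |∏ i ∈ s, a i - ∏ i ∈ s, b i| ≤ B * (B ^ s.card * ∑ i ∈ s, |a i - b i|) := by
      gcongr
      exact hb i
    have h3 : |a i - b i| * B ^ s.card ≤ |a i - b i| * B ^ (s.card + 1) := by
      gcongr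
      · exact Nat.le_succ _
    rw [pow_succ] at h3 ⊢
    nlinarith

/-- Writing the difference as `((a - c) + (c / d) (d - b)) / b` requires a lower bound for one
denominator only, the other ratio being bounded as a whole. -/
lemma abs_div_sub_div_le {a b c d A R : ℝ} (hA : 0 < A) (hb : A ≤ b) (hd : 0 < d) (hc : |c / d| ≤ R) :
    |a / b - c / d| ≤ (|a - c| + R * |b - d|) / A := by
  have hb0 : 0 < b := hA.trans_le hb
  have e : a / b - c / d = ((a - c) + c / d * (d - b)) / b := by
    field_simp
    ring
  rw [e, abs_div, abs_of_pos hb0]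
  have h : |(a - c) + c / d * (d - b)| ≤ |a - c| + R * |b - d| := by
    refine (abs_add_le _ _).trans ?_
    rw [abs_mul, abs_sub_comm d b]
    gcongr
  have := (abs_nonneg _).trans h
  gcongr

lemma abs_integral_le_of_eLpNorm_two_le {Ω : Type*} {mΩ : MeasurableSpace Ω} {P : Measure Ω}
    [IsProbabilityMeasure P] {F : Ω → ℝ} (hF : AEStronglyMeasurable F P) {c : ℝ} (hc : 0 ≤ c)
    (h : eLpNorm F 2 P ≤ ENNReal.ofReal c) : |∫ ω, F ω ∂P| ≤ c := by
  have hL : MemLp F 2 P := ⟨hF, h.trans_lt ENNReal.ofReal_lt_top⟩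
  have h1 := sq_integral_le hL
  rw [probReal_univ, one_mul] at h1
  exact abs_le_of_sq_le_sq (h1.trans (integral_sq_le_of_eLpNorm_two_le hF hc h)) hc

namespace Model

variable {d T : ℕ} {Y : Type*} {m : Model d T Y}

lemma IsTestFunction.measurable {φ : m.Θ → (Fin T → ℝ) → ℝ} (hφ : m.IsTestFunction φ) :
    Measurable (Function.uncurry φ) := by
  obtain ⟨-, B, hB⟩ := hφ
  have h : LipschitzWith (B.toNNReal * (d + T)) (Function.uncurry φ) := by
    refine LipschitzWith.of_dist_le_mul fun p q => ?_
    rw [Real.dist_eq]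
    refine (hB p.1 q.1 p.2 q.2).trans ?_
    have h1 : ∑ i, |(p.1 : Fin d → ℝ) i - (q.1 : Fin d → ℝ) i| ≤ d * dist p q := by
      refine (Finset.sum_le_card_nsmul _ _ (dist p q) fun i _ => ?_).trans_eq (by simp)
      exact (dist_le_pi_dist (p.1 : Fin d → ℝ) q.1 i).trans (le_max_left _ _)
    have h2 : ∑ t, |p.2 t - q.2 t| ≤ T * dist p q := by
      refine (Finset.sum_le_card_nsmul _ _ (dist p q) fun i _ => ?_).trans_eq (by simp)
      exact (dist_le_pi_dist p.2 q.2 i).trans (le_max_right _ _)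
    have h3 : B ≤ B.toNNReal := Real.le_coe_toNNReal B
    have h0 : (0 : ℝ) ≤ B.toNNReal := B.toNNReal.2
    push_cast
    calc _ ≤ B.toNNReal * ((∑ i, |(p.1 : Fin d → ℝ) i - (q.1 : Fin d → ℝ) i|) +
          ∑ t, |p.2 t - q.2 t|) := by gcongr
      _ ≤ B.toNNReal * (d * dist p q + T * dist p q) := by gcongr
      _ = _ := by ring
  exact h.continuous.measurable

/-- Normalizing constants are numerators for the constant function one, so estimates are proved for
numerators only. -/
lemma isTestFunction_one (m : Model d T Y) : m.IsTestFunction fun _ _ => 1 :=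
  ⟨⟨1, by simp⟩, 0, by simp⟩

lemma IsTestFunction.exists_bounds {φ : m.Θ → (Fin T → ℝ) → ℝ} (hφ : m.IsTestFunction φ) :
    ∃ B : ℝ, 0 ≤ B ∧ (∀ θ v, |φ θ v| ≤ B) ∧ ∀ θ v v', |φ θ v - φ θ v'| ≤ B * ∑ t, |v t - v' t| := by
  obtain ⟨⟨B₁, h1⟩, B₂, h2⟩ := hφ
  refine ⟨max (max B₁ B₂) 0, le_max_right _ _,
    fun θ v => (h1 θ v).trans ((le_max_left _ _).trans (le_max_left _ _)), fun θ v v' => ?_⟩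
  have h := h2 θ θ v v'
  simp only [sub_self, abs_zero, Finset.sum_const_zero, zero_add] at h
  refine h.trans ?_
  gcongr
  exact (le_max_right _ _).trans (le_max_left _ _)

variable {Ω : Type*} {mΩ : MeasurableSpace Ω} {P : Measure Ω} {ℱ : Filtration ℝ≥0 mΩ}
  {W : ℝ≥0 → Ω → ℝ} {V : m.Θ → ℝ≥0 → Ω → ℝ} {β : ℝ}

/-- Strong convergence of the skeletons and the likelihoods, with measurability and bounds. -/
structure StrongApprox (m : Model d T Y) (P : Measure Ω) (W : ℝ≥0 → Ω → ℝ)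
    (v : m.Θ → Ω → Fin T → ℝ) (e : m.Θ → Fin T → Ω → ℝ) (A B C β : ℝ) : Prop where
  A_pos : 0 < A
  A_le : A ≤ 1
  B_ge : 1 ≤ B
  C_nonneg : 0 ≤ C
  lik_bounds : ∀ l θ t (w : Path T l), A ≤ m.obsLik l θ t w ∧ m.obsLik l θ t w ≤ B
  exact_bounds : ∀ θ t ω, A ≤ e θ t ω ∧ e θ t ω ≤ B
  meas_v : ∀ θ, Measurable (v θ)
  meas_e : ∀ θ t, Measurable (e θ t)
  path_meas : ∀ l, Measurable (bmPath T W l)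
  path_law : ∀ l, P.map (bmPath T W l) = pathLaw T l
  skeleton_bound : ∀ l θ t, eLpNorm (fun ω => m.skeleton l θ (bmPath T W l ω) t - v θ ω t) 2 P ≤
    ENNReal.ofReal (C * (stepSize l : ℝ) ^ β)
  lik_bound : ∀ l θ t, eLpNorm (fun ω => m.obsLik l θ t (bmPath T W l ω) - e θ t ω) 2 P ≤
    ENNReal.ofReal (C * (stepSize l : ℝ) ^ β)

lemma exists_strongApprox [IsProbabilityMeasure P] (hm : m.Standing) (h₁ : m.Assumption1)
    (hW : IsFilteredBrownian P ℱ W) (hV : m.IsSolution P ℱ W V) (hβ₀ : 0 < β) (hβ : β ≤ m.H + 1 / 2)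
    (h₂ : m.Assumption2 P W V β) : ∃ A B C : ℝ,
      m.StrongApprox P W (fun θ ω t => V θ ((t : ℕ) + 1) ω) (m.exactLik P ℱ W V) A B C β := by
  obtain ⟨A, B, hA, hA1, hB1, hAB⟩ := h₁.exists_g_bounds
  obtain ⟨C₁, hC₁0, hC₁⟩ := h₂.exists_two
  obtain ⟨C₂, hC₂0, hC₂⟩ := exists_obsLik_bound hm h₁ hW hV hβ₀ hβ h₂
  have hΔβ : ∀ l, 0 ≤ (stepSize l : ℝ) ^ β := fun l => Real.rpow_nonneg (coe_stepSize_pos l).le β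
  refine ⟨A, B, max C₁ C₂, hA, hA1, hB1, hC₁0.trans (le_max_left _ _), fun l θ t w => hAB t _ _,
    fun θ t ω => hAB t _ _, fun θ => measurable_pi_lambda _ fun t => hV.measurable θ _,
    measurable_exactLik hm h₁ hW hV hβ₀ hβ h₂, measurable_bmPath hW, map_bmPath hW,
    fun l θ t => ?_, fun l θ t => (hC₂ l θ t).trans (ENNReal.ofReal_le_ofReal ?_)⟩
  · simp_rw [skeleton_bmPath]
    have h := hC₁ l ((t + 1) * 2 ^ l) (Nat.mul_pos (Nat.succ_pos _) (Nat.two_pow_pos _))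
      (Nat.mul_le_mul_right _ t.2) θ
    have e : (((t + 1) * 2 ^ l : ℕ) : ℝ≥0) * stepSize l = (t : ℕ) + 1 := by
      unfold stepSize
      push_cast
      rw [mul_assoc, mul_inv_cancel₀ (by positivity), mul_one]
    rw [e] at h
    refine h.trans (ENNReal.ofReal_le_ofReal ?_)
    have := hΔβ l
    gcongr
    exact le_max_left _ _
  · have := hΔβ l
    gcongr
    exact le_max_right _ _

namespace StrongApprox

variable [IsProbabilityMeasure P] {v : m.Θ → Ω → Fin T → ℝ} {e : m.Θ → Fin T → Ω → ℝ} {A B C : ℝ}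

omit [IsProbabilityMeasure P] in
lemma integrand_bound (h : m.StrongApprox P W v e A B C β) {φ : m.Θ → (Fin T → ℝ) → ℝ} {R : ℝ}
    (hR : ∀ θ v, |φ θ v| ≤ R) (θ : m.Θ) (x : Fin T → ℝ) {o : Fin T → ℝ}
    (ho : ∀ t, A ≤ o t ∧ o t ≤ B) : |φ θ x * ∏ t, o t| ≤ R * B ^ T := by
  rw [abs_mul]
  have h1 : |∏ t, o t| ≤ B ^ T := by
    have := abs_prod_le_pow (Finset.univ : Finset (Fin T)) (a := o) (B := B)
      fun t => abs_le.2 ⟨by linarith [(ho t).1, h.A_pos, h.B_ge], (ho t).2⟩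
    simpa using this
  exact mul_le_mul (hR _ _) h1 (abs_nonneg _) ((abs_nonneg _).trans (hR θ x))

lemma measurable_scheme_integrand (hm : m.Standing) (h₁ : m.Assumption1)
    {φ : m.Θ → (Fin T → ℝ) → ℝ} (hφ : m.IsTestFunction φ) (l : ℕ) :
    Measurable fun p : m.Θ × Path T l => φ p.1 (m.skeleton l p.1 p.2) * ∏ t, m.obsLik l p.1 t p.2 :=
  (hφ.measurable.comp (measurable_fst.prodMk (measurable_skeleton hm l measurable_fst
    measurable_snd))).mul (Finset.measurable_prod _ fun t _ =>
      measurable_obsLik hm h₁ l t measurable_fst measurable_snd)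

/-- The error for a fixed parameter. -/
lemma exists_section_bound (h : m.StrongApprox P W v e A B C β) (hm : m.Standing) (h₁ : m.Assumption1)
    {φ : m.Θ → (Fin T → ℝ) → ℝ} (hφ : m.IsTestFunction φ) : ∃ D : ℝ, 0 ≤ D ∧ ∀ l θ,
      |(∫ ω, φ θ (m.skeleton l θ (bmPath T W l ω)) * ∏ t, m.obsLik l θ t (bmPath T W l ω) ∂P) -
        ∫ ω, φ θ (v θ ω) * ∏ t, e θ t ω ∂P| ≤ D * (stepSize l : ℝ) ^ β := by
  obtain ⟨R, hR0, hR, hRL⟩ := hφ.exists_bounds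
  have hB0 : 0 ≤ B := zero_le_one.trans h.B_ge
  have hC0 := h.C_nonneg
  refine ⟨R * B ^ T * ((2 * T : ℕ) * C), by positivity, fun l θ => ?_⟩
  have hΔβ : 0 ≤ (stepSize l : ℝ) ^ β := Real.rpow_nonneg (coe_stepSize_pos l).le β
  have hm1 : Measurable fun ω => φ θ (m.skeleton l θ (bmPath T W l ω)) *
      ∏ t, m.obsLik l θ t (bmPath T W l ω) :=
    (measurable_section θ (measurable_scheme_integrand hm h₁ hφ l)).comp (h.path_meas l)
  have hm2 : Measurable fun ω => φ θ (v θ ω) * ∏ t, e θ t ω :=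
    ((measurable_section θ hφ.measurable).comp (h.meas_v θ)).mul
      (Finset.measurable_prod _ fun t _ => h.meas_e θ t)
  rw [← integral_sub
    (integrable_of_bounded P hm1 fun ω => h.integrand_bound hR θ _ fun t => h.lik_bounds l θ t _)
    (integrable_of_bounded P hm2 fun ω => h.integrand_bound hR θ _ fun t => h.exact_bounds θ t ω)]
  refine abs_integral_le_of_eLpNorm_two_le (hm1.sub hm2).aestronglyMeasurable (by positivity) ?_
  have hsk : ∀ t, Measurable fun ω => m.skeleton l θ (bmPath T W l ω) t := fun t =>
    (measurable_pi_apply t).comp (measurable_skeleton hm l measurable_const (h.path_meas l))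
  refine (eLpNorm_two_le_of_abs_le_sum (Finset.univ : Finset (Fin T ⊕ Fin T))
    (D := Sum.elim (fun t ω => m.skeleton l θ (bmPath T W l ω) t - v θ ω t)
      fun t ω => m.obsLik l θ t (bmPath T W l ω) - e θ t ω) (K := R * B ^ T)
    (c := C * (stepSize l : ℝ) ^ β) (by positivity) ?_ ?_ fun ω => ?_).trans_eq ?_
  · rintro (t | t) -
    · exact ((hsk t).sub ((measurable_pi_apply t).comp (h.meas_v θ))).aestronglyMeasurable
    · exact ((measurable_obsLik hm h₁ l t measurable_const (h.path_meas l)).sub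
        (h.meas_e θ t)).aestronglyMeasurable
  · rintro (t | t) -
    exacts [h.skeleton_bound l θ t, h.lik_bound l θ t]
  · simp only [Fintype.sum_sum_type, Sum.elim_inl, Sum.elim_inr]
    set x := m.skeleton l θ (bmPath T W l ω)
    set o : Fin T → ℝ := fun t => m.obsLik l θ t (bmPath T W l ω)
    have habs : ∀ {z}, A ≤ z ∧ z ≤ B → |z| ≤ B := fun {z} hz =>
      abs_le.2 ⟨by linarith [hz.1, h.A_pos, h.B_ge], hz.2⟩
    have hp := abs_prod_sub_prod_le (Finset.univ : Finset (Fin T)) (a := o) (b := fun t => e θ t ω)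
      h.B_ge (fun t => habs (h.lik_bounds l θ t _)) fun t => habs (h.exact_bounds θ t ω)
    rw [Finset.card_univ, Fintype.card_fin] at hp
    have hq : |∏ t, o t| ≤ B ^ T := by
      have := h.integrand_bound (φ := fun _ _ => 1) (R := 1) (by simp) θ x
        (o := o) fun t => h.lik_bounds l θ t _
      simpa using this
    -- One factor changes at a time: first the test function, through the skeleton, then the product
    -- of likelihoods.
    have e1 : φ θ x * ∏ t, o t - φ θ (v θ ω) * ∏ t, e θ t ω =
        (φ θ x - φ θ (v θ ω)) * ∏ t, o t + φ θ (v θ ω) * (∏ t, o t - ∏ t, e θ t ω) := by ring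
    change |φ θ x * ∏ t, o t - φ θ (v θ ω) * ∏ t, e θ t ω| ≤ _
    rw [e1]
    refine (abs_add_le _ _).trans ?_
    rw [abs_mul, abs_mul, mul_add]
    refine add_le_add ?_ ?_
    · calc _ ≤ (R * ∑ t, |x t - v θ ω t|) * B ^ T := by
            gcongr
            exact hRL _ _ _
        _ = _ := by ring
    · calc _ ≤ R * (B ^ T * ∑ t, |o t - e θ t ω|) := by
            gcongr
            exact hR _ _
        _ = _ := by ring
  · congr 1
    simp only [Finset.card_univ, Fintype.card_sum, Fintype.card_fin]
    push_cast
    ring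

/-- Integrals with respect to the discretized prior model. -/
lemma integral_prior_path (h : m.StrongApprox P W v e A B C β) (hm : m.Standing) (l : ℕ)
    {F : m.Θ × Path T l → ℝ} (hF : Measurable F) :
    ∫ p, F p ∂(m.priorLaw.prod (pathLaw T l)) =
      ∫ p : m.Θ × Ω, F (p.1, bmPath T W l p.2) ∂(m.priorLaw.prod P) := by
  have := hm.priorLaw_isProbability
  have e : (m.priorLaw.prod P).map (Prod.map id (bmPath T W l)) = m.priorLaw.prod (pathLaw T l) := by
    rw [← Measure.map_prod_map _ _ measurable_id (h.path_meas l), Measure.map_id, h.path_law]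
  rw [← e, integral_map (measurable_id.prodMap (h.path_meas l)).aemeasurable hF.aestronglyMeasurable]
  rfl

/-- The bias bound. -/
lemma exists_bias_bound (h : m.StrongApprox P W (fun θ ω t => V θ ((t : ℕ) + 1) ω)
    (m.exactLik P ℱ W V) A B C β) (hβ₀ : 0 < β) (hm : m.Standing) (h₁ : m.Assumption1)
    {φ : m.Θ → (Fin T → ℝ) → ℝ} (hφ : m.IsTestFunction φ) : ∃ D : ℝ, 0 ≤ D ∧ ∀ l,
      |m.postExp l φ - m.exactPostExp P ℱ W V φ| ≤ D * (stepSize l : ℝ) ^ β := by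
  have hprior := hm.priorLaw_isProbability
  have hB0 : 0 ≤ B := zero_le_one.trans h.B_ge
  have hlim : Tendsto (fun l => (stepSize l : ℝ) ^ β) atTop (𝓝 0) := by
    have h0 : Tendsto (fun l => (stepSize l : ℝ)) atTop (𝓝 0) :=
      (NNReal.tendsto_coe.2 tendsto_stepSize)
    have := h0.rpow_const (p := β) (Or.inr hβ₀.le)
    rwa [Real.zero_rpow hβ₀.ne'] at this
  -- integration over the parameter
  have key : ∀ {ψ : m.Θ → (Fin T → ℝ) → ℝ}, m.IsTestFunction ψ →
      Measurable (fun θ => ∫ ω, ψ θ (fun t => V θ ((t : ℕ) + 1) ω) *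
        ∏ t, m.exactLik P ℱ W V θ t ω ∂P) ∧ ∃ D : ℝ, 0 ≤ D ∧ ∀ l,
      |(∫ p : m.Θ × Path T l, ψ p.1 (m.skeleton l p.1 p.2) * ∏ t, m.obsLik l p.1 t p.2
          ∂(m.priorLaw.prod (pathLaw T l))) -
        ∫ θ, ∫ ω, ψ θ (fun t => V θ ((t : ℕ) + 1) ω) * ∏ t, m.exactLik P ℱ W V θ t ω ∂P ∂m.priorLaw| ≤
      D * (stepSize l : ℝ) ^ β := by
    intro ψ hψ
    obtain ⟨D, hD0, hD⟩ := h.exists_section_bound hm h₁ hψ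
    obtain ⟨R, hR0, hR, -⟩ := hψ.exists_bounds
    have hjm : ∀ l, Measurable fun p : m.Θ × Ω => ψ p.1 (m.skeleton l p.1 (bmPath T W l p.2)) *
        ∏ t, m.obsLik l p.1 t (bmPath T W l p.2) := fun l =>
      (measurable_scheme_integrand hm h₁ hψ l).comp (measurable_id.prodMap (h.path_meas l))
    have hNm : ∀ l, Measurable fun θ => ∫ ω, ψ θ (m.skeleton l θ (bmPath T W l ω)) *
        ∏ t, m.obsLik l θ t (bmPath T W l ω) ∂P := fun l =>
      ((hjm l).stronglyMeasurable.integral_prod_right (ν := P)).measurable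
    -- The exact solution and the chosen Itô integrals are not known to be jointly measurable in the
    -- parameter. Their integral over `ω` nevertheless is measurable in `θ`, as a pointwise limit of
    -- the discretized ones.
    have hNe : Measurable (fun θ => ∫ ω, ψ θ (fun t => V θ ((t : ℕ) + 1) ω) *
        ∏ t, m.exactLik P ℱ W V θ t ω ∂P) := by
      refine measurable_of_tendsto_metrizable hNm (tendsto_pi_nhds.2 fun θ => ?_)
      rw [tendsto_iff_norm_sub_tendsto_zero]
      refine squeeze_zero (fun _ => norm_nonneg _) (fun l => hD l θ) ?_
      simpa using hlim.const_mul D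
    refine ⟨hNe, D, hD0, fun l => ?_⟩
    have hb1 : ∀ θ, |∫ ω, ψ θ (m.skeleton l θ (bmPath T W l ω)) *
        ∏ t, m.obsLik l θ t (bmPath T W l ω) ∂P| ≤ R * B ^ T := fun θ =>
      abs_integral_le_of_forall P fun ω => h.integrand_bound hR θ _ fun t => h.lik_bounds l θ t _
    have hb2 : ∀ θ, |∫ ω, ψ θ (fun t => V θ ((t : ℕ) + 1) ω) *
        ∏ t, m.exactLik P ℱ W V θ t ω ∂P| ≤ R * B ^ T := fun θ =>
      abs_integral_le_of_forall P fun ω => h.integrand_bound hR θ _ fun t => h.exact_bounds θ t ω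
    rw [h.integral_prior_path hm l (measurable_scheme_integrand hm h₁ hψ l), integral_prod _
      (integrable_of_bounded _ (hjm l) fun p => h.integrand_bound hR p.1 _ fun t =>
        h.lik_bounds l p.1 t _), ← integral_sub (integrable_of_bounded _ (hNm l) hb1)
        (integrable_of_bounded _ hNe hb2)]
    exact abs_integral_le_of_forall m.priorLaw fun θ => hD l θ
  obtain ⟨hNm, D₁, hD₁0, hD₁⟩ := key hφ
  obtain ⟨hZm, D₂, hD₂0, hD₂⟩ := key m.isTestFunction_one
  simp only [one_mul] at hD₂ hZm
  obtain ⟨R, hR0, hR, -⟩ := hφ.exists_bounds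
  have hA0 := h.A_pos
  have hAT : 0 < A ^ T := pow_pos hA0 T
  have hprodA : ∀ {o : Fin T → ℝ}, (∀ t, A ≤ o t ∧ o t ≤ B) → A ^ T ≤ ∏ t, o t := fun ho => by
    simpa using pow_le_prod Finset.univ hA0.le fun t => (ho t).1
  have hprodB : ∀ (θ : m.Θ) {o : Fin T → ℝ}, (∀ t, A ≤ o t ∧ o t ≤ B) → |∏ t, o t| ≤ 1 * B ^ T :=
    fun θ o ho => by
      simpa using h.integrand_bound (φ := fun _ _ => 1) (R := 1) (by simp) θ 0 ho
  have hem : ∀ θ, Measurable fun ω => ∏ t, m.exactLik P ℱ W V θ t ω := fun θ =>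
    Finset.measurable_prod _ fun t _ => h.meas_e θ t
  have hei : ∀ θ, Integrable (fun ω => ∏ t, m.exactLik P ℱ W V θ t ω) P := fun θ =>
    integrable_of_bounded P (hem θ) fun ω => hprodB θ fun t => h.exact_bounds θ t ω
  have hZi : Integrable (fun θ => ∫ ω, ∏ t, m.exactLik P ℱ W V θ t ω ∂P) m.priorLaw :=
    integrable_of_bounded _ hZm fun θ => abs_integral_le_of_forall P fun ω =>
      hprodB θ fun t => h.exact_bounds θ t ω
  have hZpos : 0 < ∫ θ, ∫ ω, ∏ t, m.exactLik P ℱ W V θ t ω ∂P ∂m.priorLaw :=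
    hAT.trans_le (le_integral_of_forall _ hZi fun θ => le_integral_of_forall P (hei θ) fun ω =>
      hprodA fun t => h.exact_bounds θ t ω)
  refine ⟨(D₁ + R * D₂) / A ^ T, by positivity, fun l => ?_⟩
  unfold postExp exactPostExp
  refine (abs_div_sub_div_le (A := A ^ T) (R := R) hAT ?_ hZpos ?_).trans ?_
  · refine le_integral_of_forall _ (integrable_of_bounded _ (Finset.measurable_prod _ fun t _ =>
      measurable_obsLik hm h₁ l t measurable_fst measurable_snd) fun p => hprodB p.1 fun t =>
        h.lik_bounds l p.1 t p.2) fun p => hprodA fun t => h.lik_bounds l p.1 t p.2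
  · rw [abs_div, abs_of_pos hZpos, div_le_iff₀ hZpos, ← integral_const_mul, ← Real.norm_eq_abs]
    refine norm_integral_le_of_norm_le (hZi.const_mul R) (ae_of_all _ fun θ => ?_)
    rw [← integral_const_mul]
    refine norm_integral_le_of_norm_le ((hei θ).const_mul R) (ae_of_all _ fun ω => ?_)
    have hpos := hAT.le.trans (hprodA fun t => h.exact_bounds θ t ω)
    rw [Real.norm_eq_abs, abs_mul, abs_of_nonneg hpos]
    exact mul_le_mul_of_nonneg_right (hR _ _) hpos
  · rw [div_mul_eq_mul_div]
    gcongr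
    have := mul_le_mul_of_nonneg_left (hD₂ l) hR0
    linarith [hD₁ l]

end StrongApprox

end Model

/-! ## Differences of ratio estimators -/

lemma inv_mul_sub_inv_mul_abs_le {B₁ B₂ b₁ b₂ c : ℝ} (hc : 0 < c) (hB₁ : c ≤ B₁) (hB₂ : c ≤ B₂)
    (hB₁' : B₁ ≤ 1) (hb₁ : c ≤ b₁) (hb₂ : c ≤ b₂) (hb₂' : b₂ ≤ 1) :
    |1 / (B₁ * B₂) - 1 / (b₁ * b₂)| ≤ (c ^ 4)⁻¹ * (|B₁ - b₁| + |B₂ - b₂|) := by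
  have h1 : 0 < B₁ := hc.trans_le hB₁
  have h2 : 0 < B₂ := hc.trans_le hB₂
  have h3 : 0 < b₁ := hc.trans_le hb₁
  have h4 : 0 < b₂ := hc.trans_le hb₂
  have e : 1 / (B₁ * B₂) - 1 / (b₁ * b₂) =
      (-(b₂ * (B₁ - b₁) + B₁ * (B₂ - b₂))) / (B₁ * B₂ * (b₁ * b₂)) := by
    field_simp
    ring
  have hden : c ^ 4 ≤ B₁ * B₂ * (b₁ * b₂) := by
    calc c ^ 4 = c * c * (c * c) := by ring
      _ ≤ _ := by gcongr
  rw [e, abs_div, abs_neg, abs_of_pos (by positivity : 0 < B₁ * B₂ * (b₁ * b₂)), inv_mul_eq_div]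
  refine div_le_div₀ (by positivity) ?_ (by positivity) hden
  refine (abs_add_le _ _).trans ?_
  rw [abs_mul, abs_mul, abs_of_pos h4, abs_of_pos h1]
  have := mul_le_mul_of_nonneg_right hb₂' (abs_nonneg (B₁ - b₁))
  have := mul_le_mul_of_nonneg_right hB₁' (abs_nonneg (B₂ - b₂))
  linarith

section Ratio

variable {Ω : Type*} {mΩ : MeasurableSpace Ω} {μ : Measure Ω} [IsProbabilityMeasure μ]

omit [IsProbabilityMeasure μ] in
lemma integral_abs_mul_abs_le {f g : Ω → ℝ} (hf : MemLp f 2 μ) (hg : MemLp g 2 μ) {a b : ℝ}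
    (ha : 0 ≤ a) (hb : 0 ≤ b) (hfa : ∫ ω, f ω ^ 2 ∂μ ≤ a ^ 2) (hgb : ∫ ω, g ω ^ 2 ∂μ ≤ b ^ 2) :
    ∫ ω, |f ω| * |g ω| ∂μ ≤ a * b := by
  have h := abs_integral_mul_le hf.abs hg.abs
  simp only [Pi.abs_apply, sq_abs] at h
  refine (le_abs_self _).trans (h.trans ?_)
  have h1 : √(∫ ω, f ω ^ 2 ∂μ) ≤ a := Real.sqrt_le_left ha |>.2 hfa
  have h2 : √(∫ ω, g ω ^ 2 ∂μ) ≤ b := Real.sqrt_le_left hb |>.2 hgb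
  exact mul_le_mul h1 h2 (Real.sqrt_nonneg _) ha

/-- Mean and mean square of the difference of two ratios with small numerators. -/
lemma ratio_difference_bounds {F₁ F₂ B₁ B₂ : Ω → ℝ} {c R δ s : ℝ} (hc : 0 < c) (hc1 : c ≤ 1)
    (hR : 1 ≤ R) (hδ : 0 ≤ δ) (hs : 0 ≤ s)
    (hF₁m : Measurable F₁) (hF₂m : Measurable F₂) (hB₁m : Measurable B₁) (hB₂m : Measurable B₂)
    (hF₁ : ∀ ω, |F₁ ω| ≤ R) (hF₂ : ∀ ω, |F₂ ω| ≤ R)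
    (hB₁ : ∀ ω, c ≤ B₁ ω ∧ B₁ ω ≤ 1) (hB₂ : ∀ ω, c ≤ B₂ ω ∧ B₂ ω ≤ 1)
    (hF₁0 : ∫ ω, F₁ ω ∂μ = 0) (hF₂0 : ∫ ω, F₂ ω ∂μ = 0)
    {b₁ b₂ : ℝ} (hb₁ : c ≤ b₁ ∧ b₁ ≤ 1) (hb₂ : c ≤ b₂ ∧ b₂ ≤ 1) (hb : |b₂ - b₁| ≤ δ)
    (hF : ∫ ω, (F₁ ω - F₂ ω) ^ 2 ∂μ ≤ (δ * s) ^ 2) (hF₂s : ∫ ω, F₂ ω ^ 2 ∂μ ≤ (R * s) ^ 2)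
    (hB₁s : ∫ ω, (B₁ ω - b₁) ^ 2 ∂μ ≤ s ^ 2) (hB₂s : ∫ ω, (B₂ ω - b₂) ^ 2 ∂μ ≤ s ^ 2)
    (hK : ∫ ω, (B₂ ω - B₁ ω - (b₂ - b₁)) ^ 2 ∂μ ≤ (δ * s) ^ 2) :
    ∫ ω, (F₁ ω / B₁ ω - F₂ ω / B₂ ω) ^ 2 ∂μ ≤ 9 * R ^ 2 / c ^ 4 * (δ * s) ^ 2 ∧
      |∫ ω, (F₁ ω / B₁ ω - F₂ ω / B₂ ω) ∂μ| ≤ 4 * R / c ^ 4 * (δ * s ^ 2) := by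
  have hB₁0 : ∀ ω, 0 < B₁ ω := fun ω => hc.trans_le (hB₁ ω).1
  have hB₂0 : ∀ ω, 0 < B₂ ω := fun ω => hc.trans_le (hB₂ ω).1
  have hb₁0 : 0 < b₁ := hc.trans_le hb₁.1
  have hb₂0 : 0 < b₂ := hc.trans_le hb₂.1
  have hR0 : 0 ≤ R := zero_le_one.trans hR
  have L1 : MemLp F₁ 2 μ := memLp_of_bounded μ hF₁m hF₁ 2
  have L2 : MemLp F₂ 2 μ := memLp_of_bounded μ hF₂m hF₂ 2
  have LB1 : MemLp B₁ 2 μ := memLp_of_bounded μ hB₁m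
    (fun ω => abs_le.2 ⟨by linarith [hB₁0 ω], (hB₁ ω).2⟩) 2
  have LB2 : MemLp B₂ 2 μ := memLp_of_bounded μ hB₂m
    (fun ω => abs_le.2 ⟨by linarith [hB₂0 ω], (hB₂ ω).2⟩) 2
  have LB1c : MemLp (fun ω => B₁ ω - b₁) 2 μ := LB1.sub (memLp_const _)
  have LB2c : MemLp (fun ω => B₂ ω - b₂) 2 μ := LB2.sub (memLp_const _)
  have LX : MemLp (fun ω => F₁ ω - F₂ ω) 2 μ := L1.sub L2
  have LK : MemLp (fun ω => B₂ ω - B₁ ω - (b₂ - b₁)) 2 μ := (LB2.sub LB1).sub (memLp_const _)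
  have hinv1 : ∀ {x : ℝ}, c ≤ x → 1 / x ≤ 1 / c := fun hx => one_div_le_one_div_of_le hc hx
  have hinv2 : ∀ {x y : ℝ}, c ≤ x → c ≤ y → 1 / (x * y) ≤ 1 / c ^ 2 := fun {x y} hx hy => by
    rw [sq]
    exact one_div_le_one_div_of_le (by positivity) (mul_le_mul hx hy hc.le (hc.le.trans hx))
  have hdivb : ∀ {F B : Ω → ℝ} (ω : Ω), |F ω| ≤ R → c ≤ B ω → |F ω / B ω| ≤ R / c := by
    intro F B ω h1 h2
    rw [abs_div, abs_of_pos (hc.trans_le h2)]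
    gcongr
  have hem : Measurable fun ω => F₁ ω / B₁ ω - F₂ ω / B₂ ω := (hF₁m.div hB₁m).sub (hF₂m.div hB₂m)
  have heb : ∀ ω, |F₁ ω / B₁ ω - F₂ ω / B₂ ω| ≤ R / c + R / c := fun ω =>
    (abs_sub _ _).trans (add_le_add (hdivb ω (hF₁ ω) (hB₁ ω).1) (hdivb ω (hF₂ ω) (hB₂ ω).1))
  have hc4 : c ^ 4 ≤ c ^ 2 := pow_le_pow_of_le_one hc.le hc1 (by norm_num)
  constructor
  · have hpt : ∀ ω, (F₁ ω / B₁ ω - F₂ ω / B₂ ω) ^ 2 ≤ (3 / c ^ 4) * (F₁ ω - F₂ ω) ^ 2 +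
        (3 * δ ^ 2 / c ^ 4) * F₂ ω ^ 2 + (3 * R ^ 2 / c ^ 4) * (B₂ ω - B₁ ω - (b₂ - b₁)) ^ 2 := by
      intro ω
      set x := F₁ ω - F₂ ω
      set κ := B₂ ω - B₁ ω - (b₂ - b₁) with hκ
      -- The difference comes from the numerators, from the deterministic difference `b₂ - b₁` of
      -- the mean denominators, and from the fluctuation `κ` of the difference of the denominators.
      -- Each term is of size `δ s`.
      have e : F₁ ω / B₁ ω - F₂ ω / B₂ ω = x / B₁ ω + F₂ ω * (b₂ - b₁) / (B₁ ω * B₂ ω) +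
          F₂ ω * κ / (B₁ ω * B₂ ω) := by
        have := (hB₁0 ω).ne'
        have := (hB₂0 ω).ne'
        simp only [x, hκ]
        field_simp
        ring
      have h3 : ∀ p q r : ℝ, (p + q + r) ^ 2 ≤ 3 * p ^ 2 + 3 * q ^ 2 + 3 * r ^ 2 := fun p q r => by
        nlinarith [sq_nonneg (p - q), sq_nonneg (q - r), sq_nonneg (p - r)]
      have hBB : c ^ 4 ≤ (B₁ ω * B₂ ω) ^ 2 := by
        have : c * c ≤ B₁ ω * B₂ ω := mul_le_mul (hB₁ ω).1 (hB₂ ω).1 hc.le (hB₁0 ω).le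
        calc c ^ 4 = (c * c) ^ 2 := by ring
          _ ≤ _ := by gcongr
      have hB1 : c ^ 4 ≤ B₁ ω ^ 2 := hc4.trans (by gcongr; exact (hB₁ ω).1)
      rw [e]
      refine (h3 _ _ _).trans ?_
      rw [div_pow, div_pow, div_pow, mul_pow (F₂ ω) (b₂ - b₁), mul_pow (F₂ ω) κ]
      have t1 : x ^ 2 / B₁ ω ^ 2 ≤ x ^ 2 / c ^ 4 := by gcongr
      have hb2 : (b₂ - b₁) ^ 2 ≤ δ ^ 2 := sq_le_sq.2 (hb.trans (le_abs_self δ))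
      have hF2 : F₂ ω ^ 2 ≤ R ^ 2 := sq_le_sq.2 ((hF₂ ω).trans (le_abs_self R))
      have t2 : F₂ ω ^ 2 * (b₂ - b₁) ^ 2 / (B₁ ω * B₂ ω) ^ 2 ≤ F₂ ω ^ 2 * δ ^ 2 / c ^ 4 := by gcongr
      have t3 : F₂ ω ^ 2 * κ ^ 2 / (B₁ ω * B₂ ω) ^ 2 ≤ R ^ 2 * κ ^ 2 / c ^ 4 := by gcongr
      calc _ ≤ 3 * (x ^ 2 / c ^ 4) + 3 * (F₂ ω ^ 2 * δ ^ 2 / c ^ 4) + 3 * (R ^ 2 * κ ^ 2 / c ^ 4) := by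
            linarith
        _ = _ := by ring
    have hint := integral_mono (memLp_of_bounded μ hem heb 2).integrable_sq
      (((LX.integrable_sq.const_mul (3 / c ^ 4)).add
        (L2.integrable_sq.const_mul (3 * δ ^ 2 / c ^ 4))).add
        (LK.integrable_sq.const_mul (3 * R ^ 2 / c ^ 4))) hpt
    refine hint.trans ?_
    change ∫ ω, ((3 / c ^ 4) * (F₁ ω - F₂ ω) ^ 2 + (3 * δ ^ 2 / c ^ 4) * F₂ ω ^ 2 +
      (3 * R ^ 2 / c ^ 4) * (B₂ ω - B₁ ω - (b₂ - b₁)) ^ 2) ∂μ ≤ _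
    rw [integral_linear_combination LX.integrable_sq L2.integrable_sq LK.integrable_sq]
    calc _ ≤ (3 / c ^ 4) * (δ * s) ^ 2 + (3 * δ ^ 2 / c ^ 4) * (R * s) ^ 2 +
          (3 * R ^ 2 / c ^ 4) * (δ * s) ^ 2 := by gcongr
      _ = (3 * 1 + 6 * R ^ 2) / c ^ 4 * (δ * s) ^ 2 := by ring
      _ ≤ _ := by
        gcongr
        nlinarith
  -- `lead` replaces the random denominators by their means and is centred. The remainder contains
  -- only products of two fluctuations together with a factor `δ`, hence its mean is of order `δ s ^
  -- 2` instead of `δ s`.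
  · set lead : Ω → ℝ := fun ω => (1 / b₁) * (F₁ ω - F₂ ω) + ((b₂ - b₁) / (b₁ * b₂)) * F₂ ω
    have i1 := L1.integrable one_le_two
    have i2 := L2.integrable one_le_two
    have i12 : Integrable (fun ω => F₁ ω - F₂ ω) μ := i1.sub i2
    have hlead0 : ∫ ω, lead ω ∂μ = 0 := by
      simp only [lead]
      rw [integral_add (i12.const_mul _) (i2.const_mul _), integral_const_mul,
        integral_const_mul, integral_sub i1 i2, hF₁0, hF₂0]
      simp
    have hleadi : Integrable lead μ := (i12.const_mul _).add (i2.const_mul _)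
    have hpt : ∀ ω, |F₁ ω / B₁ ω - F₂ ω / B₂ ω - lead ω| ≤ (c ^ 4)⁻¹ * (|F₁ ω - F₂ ω| * |B₁ ω - b₁| +
        |F₂ ω| * |B₂ ω - B₁ ω - (b₂ - b₁)| + δ * (|F₂ ω| * |B₁ ω - b₁|) +
        δ * (|F₂ ω| * |B₂ ω - b₂|)) := by
      intro ω
      have hB1 := (hB₁0 ω).ne'
      have hB2 := (hB₂0 ω).ne'
      set x := F₁ ω - F₂ ω with hx
      set κ := B₂ ω - B₁ ω - (b₂ - b₁) with hκ
      have e : F₁ ω / B₁ ω - F₂ ω / B₂ ω - lead ω = x * (b₁ - B₁ ω) * (1 / (b₁ * B₁ ω)) +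
          F₂ ω * κ * (1 / (B₁ ω * B₂ ω)) +
          (b₂ - b₁) * (F₂ ω * (1 / (B₁ ω * B₂ ω) - 1 / (b₁ * b₂))) := by
        simp only [lead, hx, hκ]
        field_simp
        ring
      have hcc : ∀ {p q : ℝ}, c ≤ p → c ≤ q → |1 / (p * q)| ≤ (c ^ 4)⁻¹ := fun {p q} hp hq => by
        have hp0 := hc.trans_le hp
        have hq0 := hc.trans_le hq
        rw [abs_of_pos (by positivity)]
        refine (hinv2 hp hq).trans ?_
        rw [one_div]
        gcongr
      have t1 : |x * (b₁ - B₁ ω) * (1 / (b₁ * B₁ ω))| ≤ (c ^ 4)⁻¹ * (|x| * |B₁ ω - b₁|) := by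
        rw [abs_mul, abs_mul, abs_sub_comm b₁, mul_comm]
        gcongr
        exact hcc hb₁.1 (hB₁ ω).1
      have t2 : |F₂ ω * κ * (1 / (B₁ ω * B₂ ω))| ≤ (c ^ 4)⁻¹ * (|F₂ ω| * |κ|) := by
        rw [abs_mul, abs_mul, mul_comm]
        gcongr
        exact hcc (hB₁ ω).1 (hB₂ ω).1
      have t3 : |(b₂ - b₁) * (F₂ ω * (1 / (B₁ ω * B₂ ω) - 1 / (b₁ * b₂)))| ≤
          δ * (|F₂ ω| * ((c ^ 4)⁻¹ * (|B₁ ω - b₁| + |B₂ ω - b₂|))) := by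
        rw [abs_mul, abs_mul]
        gcongr
        exact inv_mul_sub_inv_mul_abs_le hc (hB₁ ω).1 (hB₂ ω).1 (hB₁ ω).2 hb₁.1 hb₂.1 hb₂.2
      rw [e]
      refine (abs_add_three _ _ _).trans ((add_le_add (add_le_add t1 t2) t3).trans_eq ?_)
      ring
    have p1 := integral_abs_mul_abs_le LX LB1c (by positivity) hs hF hB₁s
    have p2 := integral_abs_mul_abs_le L2 LK (by positivity) (by positivity) hF₂s hK
    have p3 := integral_abs_mul_abs_le L2 LB1c (by positivity) hs hF₂s hB₁s
    have p4 := integral_abs_mul_abs_le L2 LB2c (by positivity) hs hF₂s hB₂s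
    have j1 : Integrable (fun ω => |F₁ ω - F₂ ω| * |B₁ ω - b₁|) μ := LX.abs.integrable_mul LB1c.abs
    have j2 : Integrable (fun ω => |F₂ ω| * |B₂ ω - B₁ ω - (b₂ - b₁)|) μ :=
      L2.abs.integrable_mul LK.abs
    have j3 : Integrable (fun ω => |F₂ ω| * |B₁ ω - b₁|) μ := L2.abs.integrable_mul LB1c.abs
    have j4 : Integrable (fun ω => |F₂ ω| * |B₂ ω - b₂|) μ := L2.abs.integrable_mul LB2c.abs
    have ie := integrable_of_bounded μ hem heb
    have e0 : ∫ ω, (F₁ ω / B₁ ω - F₂ ω / B₂ ω) ∂μ =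
        ∫ ω, (F₁ ω / B₁ ω - F₂ ω / B₂ ω - lead ω) ∂μ := by
      rw [integral_sub ie hleadi, hlead0, sub_zero]
    rw [e0]
    have jsum : Integrable (fun ω => (c ^ 4)⁻¹ * (|F₁ ω - F₂ ω| * |B₁ ω - b₁| +
        |F₂ ω| * |B₂ ω - B₁ ω - (b₂ - b₁)| + δ * (|F₂ ω| * |B₁ ω - b₁|) +
        δ * (|F₂ ω| * |B₂ ω - b₂|))) μ :=
      (((j1.add j2).add (j3.const_mul δ)).add (j4.const_mul δ)).const_mul _
    have h := norm_integral_le_of_norm_le (f := fun ω => F₁ ω / B₁ ω - F₂ ω / B₂ ω - lead ω) jsum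
      (ae_of_all _ hpt)
    refine h.trans ?_
    have esum : ∫ ω, (c ^ 4)⁻¹ * (|F₁ ω - F₂ ω| * |B₁ ω - b₁| +
        |F₂ ω| * |B₂ ω - B₁ ω - (b₂ - b₁)| + δ * (|F₂ ω| * |B₁ ω - b₁|) +
        δ * (|F₂ ω| * |B₂ ω - b₂|)) ∂μ = (c ^ 4)⁻¹ * ((∫ ω, |F₁ ω - F₂ ω| * |B₁ ω - b₁| ∂μ) +
        (∫ ω, |F₂ ω| * |B₂ ω - B₁ ω - (b₂ - b₁)| ∂μ) + δ * (∫ ω, |F₂ ω| * |B₁ ω - b₁| ∂μ) +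
        δ * ∫ ω, |F₂ ω| * |B₂ ω - b₂| ∂μ) := by
      have j12 : Integrable (fun ω => |F₁ ω - F₂ ω| * |B₁ ω - b₁| +
        |F₂ ω| * |B₂ ω - B₁ ω - (b₂ - b₁)|) μ := j1.add j2
      have j123 : Integrable (fun ω => |F₁ ω - F₂ ω| * |B₁ ω - b₁| +
        |F₂ ω| * |B₂ ω - B₁ ω - (b₂ - b₁)| + δ * (|F₂ ω| * |B₁ ω - b₁|)) μ :=
        j12.add (j3.const_mul δ)
      rw [integral_const_mul, integral_add j123 (j4.const_mul δ), integral_add j12 (j3.const_mul δ),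
        integral_add j1 j2, integral_const_mul, integral_const_mul]
    rw [esum]
    calc _ ≤ (c ^ 4)⁻¹ * (δ * s * s + R * s * (δ * s) + δ * (R * s * s) + δ * (R * s * s)) := by gcongr
      _ = (c ^ 4)⁻¹ * ((1 + 3 * R) * (δ * s ^ 2)) := by ring
      _ ≤ (c ^ 4)⁻¹ * ((4 * R) * (δ * s ^ 2)) := by
        gcongr
        linarith
      _ = _ := by ring

end Ratio

/-! ## Ratio estimators along a chain -/

/-- The ergodic average of `f` over the first `M + 1` states. -/
noncomputable def chainAvg {Ω S : Type*} (X : ℕ → Ω → S) (f : S → ℝ) (M : ℕ) (ω : Ω) : ℝ :=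
  ((M : ℝ) + 1)⁻¹ * ∑ k ∈ Finset.range (M + 1), f (X k ω)

section ChainAvg

variable {Ω S : Type*} {X : ℕ → Ω → S}

lemma chainAvg_sub (f g : S → ℝ) (M : ℕ) (ω : Ω) :
    chainAvg X (fun x => f x - g x) M ω = chainAvg X f M ω - chainAvg X g M ω := by
  simp only [chainAvg, Finset.sum_sub_distrib, mul_sub]

lemma chainAvg_const_mul (a : ℝ) (f : S → ℝ) (M : ℕ) (ω : Ω) :
    chainAvg X (fun x => a * f x) M ω = a * chainAvg X f M ω := by
  simp only [chainAvg, ← Finset.mul_sum]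
  ring

lemma chainAvg_const (a : ℝ) (M : ℕ) (ω : Ω) : chainAvg X (fun _ => a) M ω = a := by
  have : (M : ℝ) + 1 ≠ 0 := by positivity
  simp [chainAvg, this]

lemma chainAvg_mono {f g : S → ℝ} (h : ∀ x, f x ≤ g x) (M : ℕ) (ω : Ω) :
    chainAvg X f M ω ≤ chainAvg X g M ω := by
  unfold chainAvg
  gcongr
  exact h _

lemma abs_chainAvg_le {f : S → ℝ} {R : ℝ} (h : ∀ x, |f x| ≤ R) (M : ℕ) (ω : Ω) :
    |chainAvg X f M ω| ≤ R := by
  rw [abs_le]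
  constructor
  · have := chainAvg_mono (X := X) (f := fun _ => -R) (g := f) (fun x => (abs_le.1 (h x)).1) M ω
    rwa [chainAvg_const] at this
  · have := chainAvg_mono (X := X) (f := f) (g := fun _ => R) (fun x => (abs_le.1 (h x)).2) M ω
    rwa [chainAvg_const] at this

variable [MeasurableSpace Ω] [MeasurableSpace S] {μ : Measure Ω} [IsProbabilityMeasure μ]
  {κ : Kernel S S}

lemma measurable_chainAvg (hX : ∀ k, Measurable (X k)) {f : S → ℝ} (hf : Measurable f) (M : ℕ) :
    Measurable (chainAvg X f M) :=
  (Finset.measurable_sum _ fun k _ => hf.comp (hX k)).const_mul _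

lemma IsStationaryChain.integral_chainAvg (hX : IsStationaryChain μ (fun x => κ x) X) {f : S → ℝ}
    (hf : Measurable f) {R : ℝ} (hR : ∀ x, |f x| ≤ R) (M : ℕ) :
    ∫ ω, chainAvg X f M ω ∂μ = ∫ x, f x ∂(μ.map (X 0)) := by
  have hM : (M : ℝ) + 1 ≠ 0 := by positivity
  have hi : ∀ k ∈ Finset.range (M + 1), Integrable (fun ω => f (X k ω)) μ := fun k _ =>
    integrable_of_bounded μ (hf.comp (hX.meas k)) fun ω => hR _
  unfold chainAvg
  rw [integral_const_mul, integral_finsetSum _ hi]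
  simp only [hX.integral_eq hf, Finset.sum_const, Finset.card_range,
    nsmul_eq_mul]
  push_cast
  rw [inv_mul_cancel_left₀ hM]

/-- The constant in the mean square error of ergodic averages. -/
noncomputable def mixConst (ξ : ℝ) : ℝ := 2 / (1 - √(1 - ξ))

lemma mixConst_pos {ξ : ℝ} (h₀ : 0 < ξ) : 0 < mixConst ξ := by
  have : √(1 - ξ) < 1 := by rw [Real.sqrt_lt' one_pos]; linarith
  unfold mixConst
  have : 0 < 1 - √(1 - ξ) := by linarith
  positivity

variable [IsMarkovKernel κ] {ξ : ℝ}

/-- The difference of two ratio estimators along a stationary chain. -/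
lemma IsStationaryChain.ratio_bounds (hξ₀ : 0 < ξ) (hξ₁ : ξ < 1)
    (hκ : Minorized (fun x => κ x) ξ) (hX : IsStationaryChain μ (fun x => κ x) X)
    {f₁ f₂ h₁ h₂ : S → ℝ} (hf₁ : Measurable f₁) (hf₂ : Measurable f₂) (hh₁ : Measurable h₁)
    (hh₂ : Measurable h₂) {c R δ : ℝ} (hc : 0 < c) (hc1 : c ≤ 1) (hR : 1 ≤ R) (hδ : 0 ≤ δ)
    (hf₁R : ∀ x, |f₁ x| ≤ R) (hf₂R : ∀ x, |f₂ x| ≤ R) (hh₁c : ∀ x, c ≤ h₁ x ∧ h₁ x ≤ 1)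
    (hh₂c : ∀ x, c ≤ h₂ x ∧ h₂ x ≤ 1) (hf₁0 : ∫ x, f₁ x ∂(μ.map (X 0)) = 0)
    (hf₂0 : ∫ x, f₂ x ∂(μ.map (X 0)) = 0) (hfδ : ∫ x, (f₁ x - f₂ x) ^ 2 ∂(μ.map (X 0)) ≤ δ ^ 2)
    (hhδ : ∫ x, (h₂ x - h₁ x) ^ 2 ∂(μ.map (X 0)) ≤ δ ^ 2) (M : ℕ) :
    ∫ ω, (chainAvg X f₁ M ω / chainAvg X h₁ M ω - chainAvg X f₂ M ω / chainAvg X h₂ M ω) ^ 2 ∂μ ≤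
        9 * R ^ 2 / c ^ 4 * (δ ^ 2 * (mixConst ξ / (M + 1))) ∧
      |∫ ω, (chainAvg X f₁ M ω / chainAvg X h₁ M ω - chainAvg X f₂ M ω / chainAvg X h₂ M ω) ∂μ| ≤
        4 * R / c ^ 4 * (δ * (mixConst ξ / (M + 1))) := by
  have hη : IsProbabilityMeasure (μ.map (X 0)) :=
    Measure.isProbabilityMeasure_map (hX.meas 0).aemeasurable
  set η := μ.map (X 0)
  -- An average of a centred function has variance at most `Γ` times its second moment, so the
  -- fluctuation parameter `s` of the ratio estimate is `√Γ`.
  set Γ := mixConst ξ / (M + 1) with hΓ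
  have hΓ0 : 0 < Γ := div_pos (mixConst_pos hξ₀) (by positivity)
  have hsq : √Γ ^ 2 = Γ := Real.sq_sqrt hΓ0.le
  have hvar : ∀ {f : S → ℝ} {B v : ℝ}, Measurable f → (∀ x, |f x| ≤ B) → ∫ x, f x ∂η = 0 →
      ∫ x, f x ^ 2 ∂η ≤ v ^ 2 → ∫ ω, chainAvg X f M ω ^ 2 ∂μ ≤ (v * √Γ) ^ 2 := by
    intro f B v hf hB h0 hv
    refine (hX.integral_sq_average_le hξ₀ hξ₁ hκ hf hB h0 M).trans ?_
    rw [mul_pow, hsq, mul_comm (v ^ 2)]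
    exact mul_le_mul_of_nonneg_left hv hΓ0.le
  have habs : ∀ {h : S → ℝ}, (∀ x, c ≤ h x ∧ h x ≤ 1) → ∀ x, |h x| ≤ 1 := fun hh x =>
    abs_le.2 ⟨by linarith [(hh x).1], (hh x).2⟩
  have ih₁ := integrable_of_bounded η hh₁ (habs hh₁c)
  have ih₂ := integrable_of_bounded η hh₂ (habs hh₂c)
  set b₁ := ∫ x, h₁ x ∂η with hb₁
  set b₂ := ∫ x, h₂ x ∂η with hb₂
  have hmean : ∀ {h : S → ℝ}, Integrable h η → (∀ x, c ≤ h x ∧ h x ≤ 1) →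
      c ≤ ∫ x, h x ∂η ∧ ∫ x, h x ∂η ≤ 1 := fun {h} hi hh =>
    ⟨le_integral_of_forall η hi fun x => (hh x).1, by
      have := integral_mono hi (integrable_const (1 : ℝ)) fun x => (hh x).2
      simpa using this⟩
  have hcent : ∀ {h : S → ℝ}, Measurable h → (∀ x, c ≤ h x ∧ h x ≤ 1) →
      ∫ ω, (chainAvg X h M ω - ∫ x, h x ∂η) ^ 2 ∂μ ≤ √Γ ^ 2 := by
    intro h hh hhc
    have hi := integrable_of_bounded η hh (habs hhc)
    have hmn := hmean hi hhc
    have hb : ∀ x, |h x - ∫ x, h x ∂η| ≤ 1 := fun x =>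
      abs_le.2 ⟨by linarith [(hhc x).1], by linarith [(hhc x).2]⟩
    have h0 : ∫ x, (h x - ∫ x, h x ∂η) ∂η = 0 := by
      rw [integral_sub hi (integrable_const _)]; simp
    have hv : ∫ x, (h x - ∫ x, h x ∂η) ^ 2 ∂η ≤ 1 ^ 2 := by
      refine (le_abs_self _).trans (abs_integral_le_of_forall η fun x => ?_)
      rw [abs_of_nonneg (sq_nonneg _)]
      exact (sq_le_sq.2 (by rw [abs_one]; exact hb x))
    have := hvar (hh.sub_const _) hb h0 hv
    simp_rw [chainAvg_sub, chainAvg_const, one_mul] at this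
    exact this
  have hKm : Measurable fun x => h₂ x - h₁ x := hh₂.sub hh₁
  have hKb : ∀ x, |h₂ x - h₁ x| ≤ 1 := fun x =>
    abs_le.2 ⟨by linarith [(hh₁c x).2, (hh₂c x).1], by linarith [(hh₁c x).1, (hh₂c x).2]⟩
  have hKint : ∫ x, (h₂ x - h₁ x) ∂η = b₂ - b₁ := integral_sub ih₂ ih₁
  have hKL := memLp_of_bounded η hKm hKb 2
  -- Jensen's inequality turns the `L²` distance of the weights into a bound for the difference of
  -- their means.
  have hbδ : |b₂ - b₁| ≤ δ := by
    have h := sq_integral_le hKL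
    rw [probReal_univ, one_mul, hKint] at h
    exact abs_le_of_sq_le_sq (h.trans hhδ) hδ
  have hKvar : ∫ ω, (chainAvg X h₂ M ω - chainAvg X h₁ M ω - (b₂ - b₁)) ^ 2 ∂μ ≤ (δ * √Γ) ^ 2 := by
    have ihK : Integrable (fun x => h₂ x - h₁ x) η := ih₂.sub ih₁
    have h0 : ∫ x, (h₂ x - h₁ x - (b₂ - b₁)) ∂η = 0 := by
      rw [integral_sub ihK (integrable_const _), hKint]; simp
    have hv : ∫ x, (h₂ x - h₁ x - (b₂ - b₁)) ^ 2 ∂η ≤ δ ^ 2 := by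
      have e : ∀ x, (h₂ x - h₁ x - (b₂ - b₁)) ^ 2 = 1 * (h₂ x - h₁ x) ^ 2 +
          (-2 * (b₂ - b₁)) * (h₂ x - h₁ x) + (b₂ - b₁) ^ 2 * 1 := fun x => by ring
      simp_rw [e]
      rw [integral_linear_combination hKL.integrable_sq (hKL.integrable one_le_two)
        (integrable_const _), hKint]
      simp only [integral_const, probReal_univ, smul_eq_mul]
      nlinarith [sq_nonneg (b₂ - b₁)]
    have := hvar (B := 1 + |b₂ - b₁|) (hKm.sub_const (b₂ - b₁))
      (fun x => (abs_sub _ _).trans (add_le_add (hKb x) le_rfl)) h0 hv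
    simp_rw [chainAvg_sub, chainAvg_const] at this
    exact this
  have hFvar : ∫ ω, (chainAvg X f₁ M ω - chainAvg X f₂ M ω) ^ 2 ∂μ ≤ (δ * √Γ) ^ 2 := by
    have h0 : ∫ x, (f₁ x - f₂ x) ∂η = 0 := by
      rw [integral_sub (integrable_of_bounded η hf₁ hf₁R) (integrable_of_bounded η hf₂ hf₂R), hf₁0,
        hf₂0, sub_zero]
    have := hvar (f := fun x => f₁ x - f₂ x) (B := R + R) (hf₁.sub hf₂)
      (fun x => (abs_sub _ _).trans (add_le_add (hf₁R x) (hf₂R x))) h0 hfδ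
    simp_rw [chainAvg_sub] at this
    exact this
  have hF₂v : ∫ x, f₂ x ^ 2 ∂η ≤ R ^ 2 := by
    refine (le_abs_self _).trans (abs_integral_le_of_forall η fun x => ?_)
    rw [abs_of_nonneg (sq_nonneg _)]
    exact sq_le_sq.2 ((hf₂R x).trans (le_abs_self R))
  have hBb : ∀ {h : S → ℝ}, (∀ x, c ≤ h x ∧ h x ≤ 1) → ∀ ω, c ≤ chainAvg X h M ω ∧
      chainAvg X h M ω ≤ 1 := fun {h} hh ω => by
    have h1 := chainAvg_mono (X := X) (f := fun _ => c) (g := h) (fun x => (hh x).1) M ω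
    have h2 := chainAvg_mono (X := X) (f := h) (g := fun _ => 1) (fun x => (hh x).2) M ω
    rw [chainAvg_const] at h1 h2
    exact ⟨h1, h2⟩
  have h := ratio_difference_bounds (μ := μ) hc hc1 hR hδ (Real.sqrt_nonneg Γ)
    (measurable_chainAvg hX.meas hf₁ M) (measurable_chainAvg hX.meas hf₂ M)
    (measurable_chainAvg hX.meas hh₁ M) (measurable_chainAvg hX.meas hh₂ M)
    (abs_chainAvg_le hf₁R M) (abs_chainAvg_le hf₂R M) (hBb hh₁c) (hBb hh₂c)
    (by rw [hX.integral_chainAvg hf₁ hf₁R, hf₁0]) (by rw [hX.integral_chainAvg hf₂ hf₂R, hf₂0])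
    (hmean ih₁ hh₁c) (hmean ih₂ hh₂c) hbδ hFvar (hvar hf₂ hf₂R hf₂0 hF₂v) (hcent hh₁ hh₁c)
    (hcent hh₂ hh₂c) hKvar
  rw [mul_pow, hsq] at h
  exact h

/-- The mean square error of an ergodic average. -/
lemma IsStationaryChain.average_bounds (hξ₀ : 0 < ξ) (hξ₁ : ξ < 1)
    (hκ : Minorized (fun x => κ x) ξ) (hX : IsStationaryChain μ (fun x => κ x) X)
    {f : S → ℝ} (hf : Measurable f) {R : ℝ} (hR : ∀ x, |f x| ≤ R)
    {a : ℝ} (ha : ∫ x, f x ∂(μ.map (X 0)) = a) (M : ℕ) :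
    ∫ ω, (chainAvg X f M ω - a) ^ 2 ∂μ ≤ 4 * R ^ 2 * (mixConst ξ / (M + 1)) ∧
      ∫ ω, (chainAvg X f M ω - a) ∂μ = 0 := by
  have hη : IsProbabilityMeasure (μ.map (X 0)) :=
    Measure.isProbabilityMeasure_map (hX.meas 0).aemeasurable
  set η := μ.map (X 0)
  have haR : |a| ≤ R := by rw [← ha]; exact abs_integral_le_of_forall η hR
  have hb : ∀ x, |f x - a| ≤ R + R := fun x => (abs_sub _ _).trans (add_le_add (hR x) haR)
  have h0 : ∫ x, (f x - a) ∂η = 0 := by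
    rw [integral_sub (integrable_of_bounded η hf hR) (integrable_const _), ha]; simp
  have e : ∀ ω, chainAvg X f M ω - a = chainAvg X (fun x => f x - a) M ω := fun ω => by
    rw [chainAvg_sub, chainAvg_const]
  simp_rw [e]
  refine ⟨?_, by rw [hX.integral_chainAvg (hf.sub_const a) hb, h0]⟩
  refine (hX.integral_sq_average_le hξ₀ hξ₁ hκ (hf.sub_const a) hb h0 M).trans ?_
  rw [mul_comm]
  have hG : 0 ≤ mixConst ξ / ((M : ℝ) + 1) := (div_pos (mixConst_pos hξ₀) (by positivity)).le
  refine mul_le_mul_of_nonneg_right ?_ hG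
  refine (le_abs_self _).trans (abs_integral_le_of_forall η fun x => ?_)
  rw [abs_of_nonneg (sq_nonneg _)]
  have := sq_le_sq_of_abs_le (hb x)
  rw [abs_of_nonneg (sq_nonneg _)] at this
  linarith

end ChainAvg

/-! ## The increments of the multilevel estimator -/

lemma prod_div_max_bounds {T : ℕ} {o₁ o₂ : Fin T → ℝ} {A B : ℝ} (hA : 0 < A)
    (h₁ : ∀ t, A ≤ o₁ t ∧ o₁ t ≤ B) (h₂ : ∀ t, A ≤ o₂ t ∧ o₂ t ≤ B) :
    (A / B) ^ T ≤ ∏ t, o₁ t / max (o₁ t) (o₂ t) ∧ ∏ t, o₁ t / max (o₁ t) (o₂ t) ≤ 1 := by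
  have hpos : ∀ t, 0 < max (o₁ t) (o₂ t) := fun t => hA.trans_le ((h₁ t).1.trans (le_max_left _ _))
  constructor
  · have : ∀ t ∈ (Finset.univ : Finset (Fin T)), A / B ≤ o₁ t / max (o₁ t) (o₂ t) := fun t _ =>
      div_le_div₀ (hA.le.trans (h₁ t).1) (h₁ t).1 (hpos t) (max_le (h₁ t).2 (h₂ t).2)
    rcases isEmpty_or_nonempty (Fin T) with hT | ⟨⟨t⟩⟩
    · obtain rfl : T = 0 := by rw [← Fintype.card_fin T, Fintype.card_eq_zero]
      simp
    · have hB : 0 < B := hA.trans_le ((h₁ t).1.trans (h₁ t).2)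
      have := Finset.prod_le_prod (fun t _ => (div_pos hA hB).le) this
      rwa [Finset.prod_const, Finset.card_univ, Fintype.card_fin] at this
  · exact Finset.prod_le_one (fun t _ => div_nonneg (hA.le.trans (h₁ t).1) (hpos t).le)
      fun t _ => div_le_one_of_le₀ (le_max_left _ _) (hpos t).le

/-- Division by the maximum makes all factors at most one, so exchanging them one by one costs only
the lower bound `A` of the denominators. -/
lemma abs_prod_div_max_sub_le {T : ℕ} {o₁ o₂ : Fin T → ℝ} {A : ℝ} (hA : 0 < A)
    (h₁ : ∀ t, A ≤ o₁ t) (h₂ : ∀ t, A ≤ o₂ t) :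
    |∏ t, o₁ t / max (o₁ t) (o₂ t) - ∏ t, o₂ t / max (o₁ t) (o₂ t)| ≤
      (∑ t, |o₁ t - o₂ t|) / A := by
  have hpos : ∀ t, 0 < max (o₁ t) (o₂ t) := fun t => hA.trans_le ((h₁ t).trans (le_max_left _ _))
  have hab : ∀ {a b : ℝ}, 0 ≤ a → a ≤ b → 0 < b → |a / b| ≤ 1 := fun {a b} ha hb hb' => by
    rw [abs_of_nonneg (div_nonneg ha hb'.le)]
    exact div_le_one_of_le₀ hb hb'.le
  refine (abs_prod_sub_prod_le _ le_rfl
    (fun t => hab (hA.le.trans (h₁ t)) (le_max_left _ _) (hpos t))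
    fun t => hab (hA.le.trans (h₂ t)) (le_max_right _ _) (hpos t)).trans ?_
  rw [one_pow, one_mul, Finset.sum_div]
  refine Finset.sum_le_sum fun t _ => ?_
  rw [← sub_div, abs_div, abs_of_pos (hpos t)]
  exact div_le_div_of_nonneg_left (abs_nonneg _) hA ((h₁ t).trans (le_max_left _ _))

namespace Model

variable {d T : ℕ} {Y : Type*} {m : Model d T Y}

/-- The centred, weighted test function of the finer level. -/
noncomputable def centredFine (m : Model d T Y) (φ : m.Θ → (Fin T → ℝ) → ℝ) (l : ℕ)
    (p : m.Θ × Path T (l + 1)) : ℝ :=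
  (φ p.1 (m.skeleton (l + 1) p.1 p.2) - m.postExp (l + 1) φ) * m.weightFine l p.1 p.2

/-- The centred, weighted test function of the coarser level. -/
noncomputable def centredCoarse (m : Model d T Y) (φ : m.Θ → (Fin T → ℝ) → ℝ) (l : ℕ)
    (p : m.Θ × Path T (l + 1)) : ℝ :=
  (φ p.1 (m.skeleton l p.1 p.2.coarsen) - m.postExp l φ) * m.weightCoarse l p.1 p.2

section Measurability

variable (hm : m.Standing) (h₁ : m.Assumption1) (l : ℕ)
include hm h₁

lemma measurable_weightFine :
    Measurable fun p : m.Θ × Path T (l + 1) => m.weightFine l p.1 p.2 :=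
  Finset.measurable_prod _ fun t _ => (measurable_obsLik hm h₁ (l + 1) t measurable_fst
    measurable_snd).div ((goodPotential_dpfPotential hm h₁ l).meas t)

lemma measurable_weightCoarse :
    Measurable fun p : m.Θ × Path T (l + 1) => m.weightCoarse l p.1 p.2 :=
  Finset.measurable_prod _ fun t _ => (measurable_obsLik hm h₁ l t measurable_fst
    ((measurable_coarsen l).comp measurable_snd)).div ((goodPotential_dpfPotential hm h₁ l).meas t)

lemma measurable_centredFine {φ : m.Θ → (Fin T → ℝ) → ℝ} (hφ : m.IsTestFunction φ) :
    Measurable (m.centredFine φ l) :=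
  ((hφ.measurable.comp (measurable_fst.prodMk (measurable_skeleton hm (l + 1) measurable_fst
    measurable_snd))).sub_const _).mul (measurable_weightFine hm h₁ l)

lemma measurable_centredCoarse {φ : m.Θ → (Fin T → ℝ) → ℝ} (hφ : m.IsTestFunction φ) :
    Measurable (m.centredCoarse φ l) :=
  ((hφ.measurable.comp (measurable_fst.prodMk (measurable_skeleton hm l measurable_fst
    ((measurable_coarsen l).comp measurable_snd)))).sub_const _).mul
      (measurable_weightCoarse hm h₁ l)

end Measurability

variable {Ω : Type*} {mΩ : MeasurableSpace Ω} {P : Measure Ω}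
  {W : ℝ≥0 → Ω → ℝ} {v : m.Θ → Ω → Fin T → ℝ} {e : m.Θ → Fin T → Ω → ℝ} {A B C β : ℝ}
  {φ : m.Θ → (Fin T → ℝ) → ℝ}

namespace StrongApprox

variable (h : m.StrongApprox P W v e A B C β)
include h

lemma lik_pos (l : ℕ) (θ : m.Θ) (t : Fin T) (w : Path T l) : 0 < m.obsLik l θ t w :=
  h.A_pos.trans_le (h.lik_bounds l θ t w).1

lemma weightFine_bounds (l : ℕ) (θ : m.Θ) (w : Path T (l + 1)) :
    (A / B) ^ T ≤ m.weightFine l θ w ∧ m.weightFine l θ w ≤ 1 :=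
  prod_div_max_bounds h.A_pos (fun t => h.lik_bounds (l + 1) θ t w)
    fun t => h.lik_bounds l θ t w.coarsen

lemma weightCoarse_bounds (l : ℕ) (θ : m.Θ) (w : Path T (l + 1)) :
    (A / B) ^ T ≤ m.weightCoarse l θ w ∧ m.weightCoarse l θ w ≤ 1 := by
  have := prod_div_max_bounds h.A_pos (fun t => h.lik_bounds l θ t w.coarsen)
    fun t => h.lik_bounds (l + 1) θ t w
  simp_rw [max_comm (m.obsLik l θ _ w.coarsen)] at this
  exact this

/-- The importance weight converts the coupled potentials into the fine likelihood; the coupled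
chain thereby yields expectations under the fine posterior. -/
lemma weightFine_mul_prod (l : ℕ) (θ : m.Θ) (w : Path T (l + 1)) :
    m.weightFine l θ w * ∏ t, m.dpfPotential l θ t w = ∏ t, m.obsLik (l + 1) θ t w := by
  unfold weightFine
  rw [← Finset.prod_mul_distrib]
  exact Finset.prod_congr rfl fun t _ => div_mul_cancel₀ _
    ((h.lik_pos (l + 1) θ t w).trans_le (le_max_left _ _)).ne'

lemma weightCoarse_mul_prod (l : ℕ) (θ : m.Θ) (w : Path T (l + 1)) :
    m.weightCoarse l θ w * ∏ t, m.dpfPotential l θ t w = ∏ t, m.obsLik l θ t w.coarsen := by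
  unfold weightCoarse
  rw [← Finset.prod_mul_distrib]
  exact Finset.prod_congr rfl fun t _ => div_mul_cancel₀ _
    ((h.lik_pos (l + 1) θ t w).trans_le (le_max_left _ _)).ne'

/-- Under the law of the fine increments the coarsened increments have the coarse law, because both
are read off from the same Brownian path. -/
lemma integral_coarsen [IsProbabilityMeasure P] (hm : m.Standing) (l : ℕ) {F : m.Θ × Path T l → ℝ} (hF : Measurable F) :
    ∫ p : m.Θ × Path T (l + 1), F (p.1, p.2.coarsen) ∂(m.priorLaw.prod (pathLaw T (l + 1))) =
      ∫ p, F p ∂(m.priorLaw.prod (pathLaw T l)) := by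
  have hF' : Measurable fun p : m.Θ × Path T (l + 1) => F (p.1, p.2.coarsen) :=
    hF.comp (measurable_fst.prodMk ((measurable_coarsen l).comp measurable_snd))
  rw [h.integral_prior_path hm l hF, h.integral_prior_path hm (l + 1) hF']
  simp only [coarsen_bmPath]

lemma integral_prior_path_sq_le [IsProbabilityMeasure P] (hm : m.Standing) (l : ℕ) {F : m.Θ × Path T l → ℝ}
    (hF : Measurable F) {R : ℝ} (hR : ∀ p, |F p| ≤ R) {c : ℝ} (hc : 0 ≤ c)
    (hFc : ∀ θ, eLpNorm (fun ω => F (θ, bmPath T W l ω)) 2 P ≤ ENNReal.ofReal c) :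
    ∫ p, F p ^ 2 ∂(m.priorLaw.prod (pathLaw T l)) ≤ c ^ 2 := by
  have := hm.priorLaw_isProbability
  have hG : Measurable fun p : m.Θ × Ω => F (p.1, bmPath T W l p.2) :=
    hF.comp (measurable_id.prodMap (h.path_meas l))
  rw [h.integral_prior_path hm l (hF.pow_const 2), integral_prod _
    (integrable_of_bounded _ (hG.pow_const 2) fun p => sq_le_sq_of_abs_le (hR _))]
  refine (le_abs_self _).trans (abs_integral_le_of_forall m.priorLaw fun θ => ?_)
  rw [abs_of_nonneg (integral_nonneg fun ω => sq_nonneg _)]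
  exact integral_sq_le_of_eLpNorm_two_le (measurable_section θ hG).aestronglyMeasurable hc (hFc θ)

lemma integrable_prod_lik (hm : m.Standing) (h₁ : m.Assumption1) (l : ℕ) :
    Integrable (fun p : m.Θ × Path T l => ∏ t, m.obsLik l p.1 t p.2)
      (m.priorLaw.prod (pathLaw T l)) := by
  have := hm.priorLaw_isProbability
  refine integrable_of_bounded _ (B := 1 * B ^ T) (goodPotential_pfPotential hm h₁ l).measurable_prod
    fun p => ?_
  have := h.integrand_bound (φ := fun _ _ => 1) (R := 1) (by simp) p.1 0
    (o := fun t => m.obsLik l p.1 t p.2) fun t => h.lik_bounds l p.1 t p.2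
  simpa using this

lemma norm_const_pos (hm : m.Standing) (h₁ : m.Assumption1) (l : ℕ) :
    0 < ∫ p : m.Θ × Path T l, ∏ t, m.obsLik l p.1 t p.2 ∂(m.priorLaw.prod (pathLaw T l)) := by
  have := hm.priorLaw_isProbability
  refine (pow_pos h.A_pos T).trans_le (le_integral_of_forall _ (h.integrable_prod_lik hm h₁ l)
    fun p => ?_)
  simpa using pow_le_prod Finset.univ h.A_pos.le fun t => (h.lik_bounds l p.1 t p.2).1

/-- The posterior expectation is precisely the constant that centres the test function under the
unnormalized posterior. -/
lemma integral_centred (hm : m.Standing) (h₁ : m.Assumption1) (hφ : m.IsTestFunction φ) (l : ℕ) :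
    ∫ p : m.Θ × Path T l, (φ p.1 (m.skeleton l p.1 p.2) - m.postExp l φ) *
      ∏ t, m.obsLik l p.1 t p.2 ∂(m.priorLaw.prod (pathLaw T l)) = 0 := by
  have := hm.priorLaw_isProbability
  obtain ⟨R, hR0, hR, -⟩ := hφ.exists_bounds
  have hi : Integrable (fun p : m.Θ × Path T l => φ p.1 (m.skeleton l p.1 p.2) *
      ∏ t, m.obsLik l p.1 t p.2) (m.priorLaw.prod (pathLaw T l)) :=
    integrable_of_bounded _ (measurable_scheme_integrand hm h₁ hφ l) fun p =>
      h.integrand_bound hR p.1 _ fun t => h.lik_bounds l p.1 t p.2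
  have hZ := h.norm_const_pos hm h₁ l
  simp_rw [sub_mul]
  rw [integral_sub hi ((h.integrable_prod_lik hm h₁ l).const_mul _), integral_const_mul]
  unfold postExp
  rw [div_mul_cancel₀ _ hZ.ne', sub_self]

lemma abs_postExp_le (hm : m.Standing) (h₁ : m.Assumption1) {R : ℝ}
    (hR : ∀ θ v, |φ θ v| ≤ R) (l : ℕ) : |m.postExp l φ| ≤ R := by
  have := hm.priorLaw_isProbability
  have hZ := h.norm_const_pos hm h₁ l
  unfold postExp
  rw [abs_div, abs_of_pos hZ, div_le_iff₀ hZ, ← integral_const_mul]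
  rw [← Real.norm_eq_abs]
  refine norm_integral_le_of_norm_le ((h.integrable_prod_lik hm h₁ l).const_mul R)
    (ae_of_all _ fun p => ?_)
  have hp : 0 ≤ ∏ t, m.obsLik l p.1 t p.2 := Finset.prod_nonneg fun t _ => (h.lik_pos l p.1 t p.2).le
  rw [norm_mul, Real.norm_of_nonneg hp]
  exact mul_le_mul_of_nonneg_right (hR _ _) hp

end StrongApprox

end Model

lemma eLpNorm_const_le_of_abs_le {Ω : Type*} {mΩ : MeasurableSpace Ω} {P : Measure Ω}
    [IsProbabilityMeasure P] {a c : ℝ} (h : |a| ≤ c) :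
    eLpNorm (fun _ : Ω => a) 2 P ≤ ENNReal.ofReal c := by
  rw [eLpNorm_const a two_ne_zero (NeZero.ne P), measure_univ, ENNReal.one_rpow, mul_one,
    Real.enorm_eq_ofReal_abs]
  exact ENNReal.ofReal_le_ofReal h

namespace Model

variable {d T : ℕ} {Y : Type*} {m : Model d T Y} {Ω : Type*} {mΩ : MeasurableSpace Ω}
  {P : Measure Ω} {W : ℝ≥0 → Ω → ℝ} {v : m.Θ → Ω → Fin T → ℝ} {e : m.Θ → Fin T → Ω → ℝ}
  {A B C D β : ℝ} {φ : m.Θ → (Fin T → ℝ) → ℝ}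

namespace StrongApprox

variable (h : m.StrongApprox P W v e A B C β)
include h

/-- The `L²` distance of the two levels, for a fixed parameter. -/
lemma eLpNorm_centred_sub_le (hm : m.Standing) (h₁ : m.Assumption1) (hβ₀ : 0 < β) (hD0 : 0 ≤ D)
    [IsProbabilityMeasure P] {R : ℝ} (hR0 : 0 ≤ R) (hR : ∀ θ v, |φ θ v| ≤ R)
    (hRL : ∀ θ v v', |φ θ v - φ θ v'| ≤ R * ∑ t, |v t - v' t|) {l : ℕ}
    (hρ : |m.postExp (l + 1) φ - m.postExp l φ| ≤ D * (stepSize l : ℝ) ^ β) (θ : m.Θ)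
    {F : Path T (l + 1) → ℝ}
    (hF : (∀ w, F w = m.centredFine φ l (θ, w) - m.centredCoarse φ l (θ, w)) ∨
      ∀ w, F w = m.weightCoarse l θ w - m.weightFine l θ w) :
    eLpNorm (fun ω => F (bmPath T W (l + 1) ω)) 2 P ≤
      ENNReal.ofReal ((2 * R + 1) / A * ((2 * T + 1 : ℕ) * (2 * C + D)) * (stepSize l : ℝ) ^ β) := by
  have hA := h.A_pos
  have hC0 := h.C_nonneg
  have hΔβ : 0 ≤ (stepSize l : ℝ) ^ β := Real.rpow_nonneg (coe_stepSize_pos l).le β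
  have hsk : ∀ l t, Measurable fun ω => m.skeleton l θ (bmPath T W l ω) t := fun l t =>
    (measurable_pi_apply t).comp (measurable_skeleton hm l measurable_const (h.path_meas l))
  have hob : ∀ l t, Measurable fun ω => m.obsLik l θ t (bmPath T W l ω) := fun l t =>
    measurable_obsLik hm h₁ l t measurable_const (h.path_meas l)
  have hCD : 2 * (C * (stepSize l : ℝ) ^ β) ≤ (2 * C + D) * (stepSize l : ℝ) ^ β := by
    have : 0 ≤ D * (stepSize l : ℝ) ^ β := by positivity
    linarith
  -- Consecutive levels are compared through the exact quantity, of which both are approximations;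
  -- the coarser level determines the rate.
  have htri : ∀ {f : ∀ l, Path T l → ℝ} {u : Ω → ℝ}, (∀ l, Measurable fun ω => f l (bmPath T W l ω)) →
      Measurable u → (∀ l, eLpNorm (fun ω => f l (bmPath T W l ω) - u ω) 2 P ≤
        ENNReal.ofReal (C * (stepSize l : ℝ) ^ β)) →
      eLpNorm (fun ω => f (l + 1) (bmPath T W (l + 1) ω) - f l (bmPath T W l ω)) 2 P ≤
        ENNReal.ofReal ((2 * C + D) * (stepSize l : ℝ) ^ β) := by
    intro f u hf hu hfu
    refine (eLpNorm_sub_le_ofReal (hf _).aestronglyMeasurable hu.aestronglyMeasurable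
      (hf _).aestronglyMeasurable (by positivity) (by positivity) ((hfu (l + 1)).trans
        (ENNReal.ofReal_le_ofReal (mul_le_mul_of_nonneg_left
          (stepSize_rpow_antitone hβ₀.le l 1) hC0)))
      ((eLpNorm_sub_symm _ _).trans_le (hfu l))).trans (ENNReal.ofReal_le_ofReal ?_)
    linarith
  -- The difference is controlled by the differences of the skeletons, those of the likelihoods, and
  -- one deterministic term, the difference of the posterior expectations, which is the `Unit`
  -- summand. The same list covers the weights, so the two alternatives for `F` share the argument.
  refine (eLpNorm_two_le_of_abs_le_sum (Finset.univ : Finset ((Fin T ⊕ Fin T) ⊕ Unit))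
    (D := Sum.elim (Sum.elim
      (fun t ω => m.skeleton (l + 1) θ (bmPath T W (l + 1) ω) t - m.skeleton l θ (bmPath T W l ω) t)
      fun t ω => m.obsLik (l + 1) θ t (bmPath T W (l + 1) ω) - m.obsLik l θ t (bmPath T W l ω))
      fun _ _ => m.postExp (l + 1) φ - m.postExp l φ) (K := (2 * R + 1) / A)
    (c := (2 * C + D) * (stepSize l : ℝ) ^ β) (by positivity) ?_ ?_ fun ω => ?_).trans_eq ?_
  · rintro ((t | t) | -) -
    · exact ((hsk _ t).sub (hsk _ t)).aestronglyMeasurable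
    · exact ((hob _ t).sub (hob _ t)).aestronglyMeasurable
    · exact aestronglyMeasurable_const
  · rintro ((t | t) | -) -
    · exact htri (f := fun l w => m.skeleton l θ w t) (fun l => hsk l t)
        ((measurable_pi_apply t).comp (h.meas_v θ)) fun l => h.skeleton_bound l θ t
    · exact htri (f := fun l w => m.obsLik l θ t w) (fun l => hob l t) (h.meas_e θ t)
        fun l => h.lik_bound l θ t
    · refine (eLpNorm_const_le_of_abs_le ?_)
      refine hρ.trans ?_
      have : 0 ≤ C * (stepSize l : ℝ) ^ β := by positivity
      linarith
  · simp only [Fintype.sum_sum_type, Sum.elim_inl, Sum.elim_inr, Finset.univ_unique,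
      Finset.sum_const, Finset.card_singleton, one_smul]
    have hw := abs_prod_div_max_sub_le (o₁ := fun t => m.obsLik (l + 1) θ t (bmPath T W (l + 1) ω))
      (o₂ := fun t => m.obsLik l θ t (bmPath T W l ω)) hA (fun t => (h.lik_bounds _ θ t _).1)
      fun t => (h.lik_bounds _ θ t _).1
    have hH₁ := h.weightFine_bounds l θ (bmPath T W (l + 1) ω)
    have hsub : |m.weightFine l θ (bmPath T W (l + 1) ω) - m.weightCoarse l θ (bmPath T W (l + 1) ω)| ≤
        (∑ t, |m.obsLik (l + 1) θ t (bmPath T W (l + 1) ω) - m.obsLik l θ t (bmPath T W l ω)|) / A := by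
      simp only [weightFine, weightCoarse, dpfPotential, coarsen_bmPath]
      exact hw
    have hBA : 0 ≤ (A / B) ^ T := pow_nonneg (div_nonneg hA.le (zero_le_one.trans h.B_ge)) T
    set S₁ := ∑ t, |m.skeleton (l + 1) θ (bmPath T W (l + 1) ω) t - m.skeleton l θ (bmPath T W l ω) t|
    set S₂ := ∑ t, |m.obsLik (l + 1) θ t (bmPath T W (l + 1) ω) - m.obsLik l θ t (bmPath T W l ω)|
    set r := |m.postExp (l + 1) φ - m.postExp l φ| with hr
    have hS₁ : 0 ≤ S₁ := Finset.sum_nonneg fun _ _ => abs_nonneg _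
    have hS₂ : 0 ≤ S₂ := Finset.sum_nonneg fun _ _ => abs_nonneg _
    have hr0 : 0 ≤ r := abs_nonneg _
    rcases hF with hF | hF
    · rw [hF]
      simp only [centredFine, centredCoarse, coarsen_bmPath]
      set x := m.weightFine l θ (bmPath T W (l + 1) ω)
      set y := m.weightCoarse l θ (bmPath T W (l + 1) ω)
      set a := φ θ (m.skeleton (l + 1) θ (bmPath T W (l + 1) ω))
      set b := φ θ (m.skeleton l θ (bmPath T W l ω))
      -- The centred test functions differ by a Lipschitz term and the bias difference, multiplied
      -- by a weight at most one; the weights differ by the likelihoods, multiplied by a bounded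
      -- function.
      have e1 : (a - m.postExp (l + 1) φ) * x - (b - m.postExp l φ) * y =
          ((a - b) - (m.postExp (l + 1) φ - m.postExp l φ)) * x +
            (b - m.postExp l φ) * (x - y) := by ring
      have hb : |b - m.postExp l φ| ≤ R + R := (abs_sub _ _).trans
        (add_le_add (hR _ _) (h.abs_postExp_le hm h₁ hR l))
      have hx : |x| ≤ 1 := abs_le.2 ⟨by linarith [hH₁.1], hH₁.2⟩
      have hab : |(a - b) - (m.postExp (l + 1) φ - m.postExp l φ)| ≤ R * S₁ + r :=
        (abs_sub _ _).trans (add_le_add (hRL _ _ _) le_rfl)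
      have hA1 : 1 ≤ A⁻¹ := (one_le_inv₀ hA).2 h.A_le
      rw [e1]
      calc _ ≤ |(a - b) - (m.postExp (l + 1) φ - m.postExp l φ)| * |x| +
            |b - m.postExp l φ| * |x - y| := by
            rw [← abs_mul, ← abs_mul]; exact abs_add_le _ _
        _ ≤ (R * S₁ + r) * 1 + (R + R) * (S₂ / A) := by gcongr
        _ ≤ ((2 * R + 1) * S₁ + (2 * R + 1) * r) * A⁻¹ + (2 * R + 1) * (S₂ / A) := by
            have h1 : (R * S₁ + r) * 1 ≤ (2 * R + 1) * S₁ + (2 * R + 1) * r := by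
              nlinarith [mul_nonneg hR0 hS₁, mul_nonneg hR0 hr0]
            have h2 : 0 ≤ S₂ / A := by positivity
            exact add_le_add (h1.trans (le_mul_of_one_le_right (by positivity) hA1)) (by linarith)
        _ = _ := by field_simp; ring
    · rw [hF, abs_sub_comm]
      refine hsub.trans ?_
      rw [div_mul_eq_mul_div]
      gcongr
      nlinarith [mul_nonneg hR0 hS₁, mul_nonneg hR0 hr0, mul_nonneg hR0 hS₂]
  · congr 1
    simp only [Finset.card_univ, Fintype.card_sum, Fintype.card_fin, Fintype.card_unit]
    push_cast
    ring

end StrongApprox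

end Model

namespace Model

variable {d T : ℕ} {Y : Type*} {m : Model d T Y} {Ω : Type*} {mΩ : MeasurableSpace Ω}
  {P : Measure Ω} {W : ℝ≥0 → Ω → ℝ} {v : m.Θ → Ω → Fin T → ℝ} {e : m.Θ → Fin T → Ω → ℝ}
  {A B C D β : ℝ} {φ : m.Θ → (Fin T → ℝ) → ℝ}

lemma measurable_output {l : ℕ} : Measurable fun x : m.State l => (x.1, pfOutput x.2) :=
  measurable_fst.prodMk (measurable_pfOutput.comp measurable_snd)

lemma measurable_comp_output {l : ℕ} {F : m.Θ × Path T l → ℝ} (hF : Measurable F) :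
    Measurable fun x : m.State l => F (x.1, pfOutput x.2) :=
  hF.comp measurable_output

lemma pmcmcEst_eq_chainAvg {Ω' : Type*} (l M : ℕ) (Z : ℕ → Ω' → m.State l) (ω : Ω') :
    m.pmcmcEst φ l M (fun k => Z k ω) =
      chainAvg Z (fun x => φ x.1 (m.skeleton l x.1 (pfOutput x.2))) M ω := rfl

namespace StrongApprox

variable (h : m.StrongApprox P W v e A B C β)
include h

/-- Subtracting a constant from a self-normalized average amounts to centring the test function in
its numerator. After this both numerators have mean zero, as the bias estimate for ratios requires.
-/
lemma incrEst_sub_eq (φ : m.Θ → (Fin T → ℝ) → ℝ) {Ω' : Type*} (l M : ℕ)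
    (X : ℕ → Ω' → m.State (l + 1)) (ω : Ω') :
    m.incrEst φ l M (fun k => X k ω) - (m.postExp (l + 1) φ - m.postExp l φ) =
      chainAvg X (fun x => m.centredFine φ l (x.1, pfOutput x.2)) M ω /
          chainAvg X (fun x => m.weightFine l x.1 (pfOutput x.2)) M ω -
        chainAvg X (fun x => m.centredCoarse φ l (x.1, pfOutput x.2)) M ω /
          chainAvg X (fun x => m.weightCoarse l x.1 (pfOutput x.2)) M ω := by
  have hc : 0 < (A / B) ^ T := pow_pos (div_pos h.A_pos (zero_lt_one.trans_le h.B_ge)) T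
  have hpos : ∀ {f : m.State (l + 1) → ℝ}, (∀ x, (A / B) ^ T ≤ f x) → 0 < chainAvg X f M ω := by
    intro f hf
    have := chainAvg_mono (X := X) hf M ω
    rw [chainAvg_const] at this
    exact hc.trans_le this
  have h1 := hpos fun x : m.State (l + 1) => (h.weightFine_bounds l x.1 (pfOutput x.2)).1
  have h2 := hpos fun x : m.State (l + 1) => (h.weightCoarse_bounds l x.1 (pfOutput x.2)).1
  simp only [centredFine, centredCoarse, sub_mul, chainAvg_sub, chainAvg_const_mul]
  rw [sub_div, sub_div, mul_div_cancel_right₀ _ h1.ne', mul_div_cancel_right₀ _ h2.ne']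
  unfold incrEst chainAvg
  ring

/-- Second moments under the stationary law are comparable with those under the prior model. -/
lemma integral_output_sq_le (hm : m.Standing) (h₁ : m.Assumption1) {l : ℕ} {ξ : ℝ} (hξ₀ : 0 < ξ)
    (hξ₁ : ξ < 1) (hmin : Minorized (m.coupledKernel l) ξ) {Ω' : Type*} [MeasurableSpace Ω']
    {μ : Measure Ω'} [IsProbabilityMeasure μ] {X : ℕ → Ω' → m.State (l + 1)}
    (hX : IsStationaryChain μ (m.coupledKernel l) X) {F : m.Θ × Path T (l + 1) → ℝ}
    (hF : Measurable F) {R : ℝ} (hR : ∀ p, |F p| ≤ R) :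
    ∫ x, F (x.1, pfOutput x.2) ^ 2 ∂(μ.map (X 0)) ≤
      (B / A) ^ T * ∫ p, F p ^ 2 ∂(m.priorLaw.prod (pathLaw T (l + 1))) := by
  have := hm.priorLaw_isProbability
  have hA := h.A_pos
  have hG := goodPotential_dpfPotential hm h₁ l
  rw [integral_stationary_output hm hG hξ₀ hξ₁ hmin hX (hF.pow_const 2)]
  -- The coupled potentials lie in `[A, B]`, hence the stationary law of the output has a density at
  -- most `(B / A) ^ T` with respect to the prior model.
  have hb : ∀ θ t (w : Path T (l + 1)), A ≤ m.dpfPotential l θ t w ∧ m.dpfPotential l θ t w ≤ B :=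
    fun θ t w => ⟨(h.lik_bounds (l + 1) θ t w).1.trans (le_max_left _ _),
      max_le (h.lik_bounds _ θ t _).2 (h.lik_bounds _ θ t _).2⟩
  have hBT : ∀ p : m.Θ × Path T (l + 1), |∏ t, m.dpfPotential l p.1 t p.2| ≤ B ^ T := fun p => by
    have := h.integrand_bound (φ := fun _ _ => 1) (R := 1) (by simp) p.1 0
      (o := fun t => m.dpfPotential l p.1 t p.2) fun t => hb p.1 t p.2
    simpa using this
  have hden : A ^ T ≤ ∫ p, ∏ t, m.dpfPotential l p.1 t p.2
      ∂(m.priorLaw.prod (pathLaw T (l + 1))) :=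
    le_integral_of_forall _ (integrable_of_bounded _ hG.measurable_prod hBT) fun p => by
      simpa using pow_le_prod Finset.univ hA.le fun t => (hb p.1 t p.2).1
  have hsq : ∀ p, |F p ^ 2| ≤ R ^ 2 := fun p => sq_le_sq_of_abs_le (hR p)
  have hnum : ∫ p, F p ^ 2 * ∏ t, m.dpfPotential l p.1 t p.2
      ∂(m.priorLaw.prod (pathLaw T (l + 1))) ≤
      B ^ T * ∫ p, F p ^ 2 ∂(m.priorLaw.prod (pathLaw T (l + 1))) := by
    rw [← integral_const_mul]
    refine integral_mono (integrable_of_bounded _ ((hF.pow_const 2).mul hG.measurable_prod)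
      fun p => abs_mul_le_of_abs_le (hsq p) (hBT p))
      ((integrable_of_bounded _ (hF.pow_const 2) hsq).const_mul _) fun p => ?_
    change F p ^ 2 * _ ≤ B ^ T * F p ^ 2
    rw [mul_comm]
    exact mul_le_mul_of_nonneg_right ((le_abs_self _).trans (hBT p)) (sq_nonneg _)
  have hnn : 0 ≤ ∫ p, F p ^ 2 ∂(m.priorLaw.prod (pathLaw T (l + 1))) :=
    integral_nonneg fun p => sq_nonneg _
  have hB0 : 0 ≤ B := zero_le_one.trans h.B_ge
  rw [div_pow, div_mul_eq_mul_div]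
  exact div_le_div₀ (by positivity) hnum (pow_pos hA T) hden

/-- The second moment and the bias of an increment. -/
lemma exists_increment_bounds [IsProbabilityMeasure P] (hm : m.Standing) (h₁ : m.Assumption1)
    (hβ₀ : 0 < β) (hφ : m.IsTestFunction φ) (hD0 : 0 ≤ D)
    (hD : ∀ l, |m.postExp (l + 1) φ - m.postExp l φ| ≤ D * (stepSize l : ℝ) ^ β) {ξ : ℝ}
    (hξ₀ : 0 < ξ) (hξ₁ : ξ < 1) : ∃ E : ℝ, 0 ≤ E ∧ ∀ (l : ℕ), Minorized (m.coupledKernel l) ξ →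
      ∀ {Ω' : Type*} [MeasurableSpace Ω'] (μ : Measure Ω') [IsProbabilityMeasure μ]
        (X : ℕ → Ω' → m.State (l + 1)), IsStationaryChain μ (m.coupledKernel l) X → ∀ M : ℕ,
      ∫ ω, (m.incrEst φ l M (fun k => X k ω) - (m.postExp (l + 1) φ - m.postExp l φ)) ^ 2 ∂μ ≤
          E * (((stepSize l : ℝ) ^ β) ^ 2 / (M + 1)) ∧
        |∫ ω, (m.incrEst φ l M (fun k => X k ω) - (m.postExp (l + 1) φ - m.postExp l φ)) ∂μ| ≤
          E * ((stepSize l : ℝ) ^ β / (M + 1)) := by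
  obtain ⟨R, hR0, hR, hRL⟩ := hφ.exists_bounds
  have hA := h.A_pos
  have hB0 : 0 < B := zero_lt_one.trans_le h.B_ge
  have hC0 := h.C_nonneg
  have hc : 0 < (A / B) ^ T := pow_pos (div_pos hA hB0) T
  have hAB : A ≤ B := h.A_le.trans h.B_ge
  have hc1 : (A / B) ^ T ≤ 1 := pow_le_one₀ (div_pos hA hB0).le ((div_le_one hB0).2 hAB)
  have hκ1 : 1 ≤ (B / A) ^ T := one_le_pow₀ ((one_le_div hA).2 hAB)
  set c := (A / B) ^ T with hcdef
  set κ := (B / A) ^ T with hκdef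
  set K := (2 * R + 1) / A * ((2 * T + 1 : ℕ) * (2 * C + D)) with hK
  have hK0 : 0 ≤ K := by positivity
  have hΓ := mixConst_pos hξ₀
  set E₁ := 9 * (2 * R + 1) ^ 2 / c ^ 4 * ((κ * K) ^ 2 * mixConst ξ) with hE₁
  set E₂ := 4 * (2 * R + 1) / c ^ 4 * (κ * K * mixConst ξ) with hE₂
  have hE₁0 : 0 ≤ E₁ := by positivity
  have hE₂0 : 0 ≤ E₂ := by positivity
  refine ⟨E₁ + E₂, by positivity, fun l hmin Ω' _ μ _ X hX M => ?_⟩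
  have hprior := hm.priorLaw_isProbability
  have hG := goodPotential_dpfPotential hm h₁ l
  have hmk := stepKernel_isMarkov hm hG
  have hΔβ : 0 ≤ (stepSize l : ℝ) ^ β := Real.rpow_nonneg (coe_stepSize_pos l).le β
  have hcen : ∀ (l' : ℕ) {a w : ℝ}, |a| ≤ R → c ≤ w ∧ w ≤ 1 → |(a - m.postExp l' φ) * w| ≤ 2 * R + 1 := by
    intro l' a w ha hw
    have hw' : |w| ≤ 1 := abs_le.2 ⟨by linarith [hw.1], hw.2⟩
    have h1 : |a - m.postExp l' φ| ≤ R + R :=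
      (abs_sub _ _).trans (add_le_add ha (h.abs_postExp_le hm h₁ hR l'))
    have := abs_mul_le_of_abs_le h1 hw'
    linarith
  have hfine : ∀ p, |m.centredFine φ l p| ≤ 2 * R + 1 := fun p =>
    hcen (l + 1) (hR _ _) (h.weightFine_bounds l p.1 p.2)
  have hcoarse : ∀ p, |m.centredCoarse φ l p| ≤ 2 * R + 1 := fun p =>
    hcen l (hR _ _) (h.weightCoarse_bounds l p.1 p.2)
  have hmf := measurable_centredFine hm h₁ l hφ
  have hmc := measurable_centredCoarse hm h₁ l hφ
  have hwf := measurable_weightFine hm h₁ l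
  have hwc := measurable_weightCoarse hm h₁ l
  -- A stationary expectation is a quotient whose numerator carries the coupled potentials; it
  -- suffices that the numerator vanishes.
  have hzero : ∀ {F : m.Θ × Path T (l + 1) → ℝ}, Measurable F →
      ∫ p, F p * ∏ t, m.dpfPotential l p.1 t p.2 ∂(m.priorLaw.prod (pathLaw T (l + 1))) = 0 →
      ∫ x, F (x.1, pfOutput x.2) ∂(μ.map (X 0)) = 0 := fun hF h0 => by
    rw [integral_stationary_output hm hG hξ₀ hξ₁ hmin hX hF, h0, zero_div]
  have hsq : ∀ {F : m.Θ × Path T (l + 1) → ℝ} {S : ℝ}, Measurable F → (∀ p, |F p| ≤ S) →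
      (∀ θ, eLpNorm (fun ω => F (θ, bmPath T W (l + 1) ω)) 2 P ≤
        ENNReal.ofReal (K * (stepSize l : ℝ) ^ β)) →
      ∫ x, F (x.1, pfOutput x.2) ^ 2 ∂(μ.map (X 0)) ≤ (κ * K * (stepSize l : ℝ) ^ β) ^ 2 := by
    intro F S hF hS hFP
    refine (h.integral_output_sq_le hm h₁ hξ₀ hξ₁ hmin hX hF hS).trans ?_
    have h1 := h.integral_prior_path_sq_le hm (l + 1) hF hS (by positivity) hFP
    calc _ ≤ κ * (K * (stepSize l : ℝ) ^ β) ^ 2 := mul_le_mul_of_nonneg_left h1 (by linarith)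
      -- Since `1 ≤ κ`, the constant may be squared, which makes the bound a perfect square.
      _ ≤ κ ^ 2 * (K * (stepSize l : ℝ) ^ β) ^ 2 :=
          mul_le_mul_of_nonneg_right (by nlinarith) (sq_nonneg _)
      _ = _ := by ring
  have hnorm := h.eLpNorm_centred_sub_le hm h₁ hβ₀ hD0 hR0 hR hRL (hD l)
  have hmf' : Measurable fun x : m.State (l + 1) => m.centredFine φ l (x.1, pfOutput x.2) :=
    measurable_comp_output hmf
  have hmc' : Measurable fun x : m.State (l + 1) => m.centredCoarse φ l (x.1, pfOutput x.2) :=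
    measurable_comp_output hmc
  have hwf' : Measurable fun x : m.State (l + 1) => m.weightFine l x.1 (pfOutput x.2) :=
    measurable_comp_output hwf
  have hwc' : Measurable fun x : m.State (l + 1) => m.weightCoarse l x.1 (pfOutput x.2) :=
    measurable_comp_output hwc
  have hf0 : ∫ x, m.centredFine φ l (x.1, pfOutput x.2) ∂(μ.map (X 0)) = 0 := by
    refine hzero hmf ?_
    simp only [centredFine, mul_assoc, h.weightFine_mul_prod]
    exact h.integral_centred hm h₁ hφ (l + 1)
  have hc0 : ∫ x, m.centredCoarse φ l (x.1, pfOutput x.2) ∂(μ.map (X 0)) = 0 := by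
    refine hzero hmc ?_
    simp only [centredCoarse, mul_assoc, h.weightCoarse_mul_prod]
    -- Once the weight has cancelled the coupled potentials, the integrand depends on the coarsened
    -- increments only, so it can be integrated under the coarse law.
    rw [← h.integral_centred hm h₁ hφ l]
    refine h.integral_coarsen hm l (F := fun p => (φ p.1 (m.skeleton l p.1 p.2) - m.postExp l φ) *
      ∏ t, m.obsLik l p.1 t p.2) ?_
    exact ((hφ.measurable.comp (measurable_fst.prodMk (measurable_skeleton hm l measurable_fst
      measurable_snd))).sub_const _).mul (goodPotential_pfPotential hm h₁ l).measurable_prod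
  have hfd := hsq (F := fun p => m.centredFine φ l p - m.centredCoarse φ l p) (hmf.sub hmc)
      (fun p => (abs_sub _ _).trans (add_le_add (hfine p) (hcoarse p)))
      fun θ => hnorm θ (F := fun w => m.centredFine φ l (θ, w) - m.centredCoarse φ l (θ, w))
        (Or.inl fun w => rfl)
  have hwd := hsq (F := fun p => m.weightCoarse l p.1 p.2 - m.weightFine l p.1 p.2) (S := 1)
    (hwc.sub hwf) (fun p => abs_le.2
      ⟨by linarith [(h.weightFine_bounds l p.1 p.2).2, (h.weightCoarse_bounds l p.1 p.2).1],
        by linarith [(h.weightFine_bounds l p.1 p.2).1, (h.weightCoarse_bounds l p.1 p.2).2]⟩)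
    fun θ => hnorm θ (F := fun w => m.weightCoarse l θ w - m.weightFine l θ w)
        (Or.inr fun w => rfl)
  have key := IsStationaryChain.ratio_bounds (κ := stepKernel hm hG) hξ₀ hξ₁ hmin hX hmf' hmc' hwf'
    hwc' hc hc1 (by linarith) (by positivity) (fun x => hfine _) (fun x => hcoarse _)
    (fun x => h.weightFine_bounds l _ _) (fun x => h.weightCoarse_bounds l _ _) hf0 hc0 hfd hwd M
  simp_rw [h.incrEst_sub_eq φ l M X]
  refine ⟨key.1.trans ?_, key.2.trans ?_⟩
  · calc _ = E₁ * (((stepSize l : ℝ) ^ β) ^ 2 / (M + 1)) := by rw [hE₁]; ring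
      _ ≤ _ := by gcongr; linarith
  · calc _ = E₂ * ((stepSize l : ℝ) ^ β / (M + 1)) := by rw [hE₂]; ring
      _ ≤ _ := by gcongr; linarith

end StrongApprox

/-- The mean square error of a single level. -/
lemma exists_average_bounds (hm : m.Standing) (h₁ : m.Assumption1)
    (hφ : m.IsTestFunction φ) {ξ : ℝ} (hξ₀ : 0 < ξ) (hξ₁ : ξ < 1) : ∃ E : ℝ, 0 ≤ E ∧ ∀ (l : ℕ),
      Minorized (m.pmcmcKernel l) ξ →
      ∀ {Ω' : Type*} [MeasurableSpace Ω'] (μ : Measure Ω') [IsProbabilityMeasure μ]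
        (Z : ℕ → Ω' → m.State l), IsStationaryChain μ (m.pmcmcKernel l) Z → ∀ M : ℕ,
      ∫ ω, (m.pmcmcEst φ l M (fun k => Z k ω) - m.postExp l φ) ^ 2 ∂μ ≤ E * (1 / (M + 1)) ∧
        ∫ ω, (m.pmcmcEst φ l M (fun k => Z k ω) - m.postExp l φ) ∂μ = 0 := by
  obtain ⟨R, hR0, hR, hRL⟩ := hφ.exists_bounds
  have hΓ := mixConst_pos hξ₀
  refine ⟨4 * R ^ 2 * mixConst ξ, by positivity, fun l hmin Ω' _ μ _ Z hZ M => ?_⟩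
  have hG := goodPotential_pfPotential hm h₁ l
  have hmk := stepKernel_isMarkov hm hG
  have hmeas : Measurable fun p : m.Θ × Path T l => φ p.1 (m.skeleton l p.1 p.2) :=
    hφ.measurable.comp (measurable_fst.prodMk (measurable_skeleton hm l measurable_fst
      measurable_snd))
  have key := IsStationaryChain.average_bounds (κ := stepKernel hm hG) hξ₀ hξ₁ hmin hZ
    (f := fun x => φ x.1 (m.skeleton l x.1 (pfOutput x.2))) (measurable_comp_output hmeas)
    (fun x => hR _ _) (integral_stationary_output hm hG hξ₀ hξ₁ hmin hZ hmeas) M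
  simp_rw [pmcmcEst_eq_chainAvg]
  refine ⟨key.1.trans_eq ?_, key.2⟩
  ring

end Model

/-! ## The mean square error of the multilevel estimator -/

/-- By independence the cross terms are products of means. Small biases therefore suffice for them,
although the variables need not be centred. -/
lemma integral_sum_sq_of_indep {Ω : Type*} {mΩ : MeasurableSpace Ω} {μ : Measure Ω}
    [IsProbabilityMeasure μ] {ι : Type*} [DecidableEq ι] (s : Finset ι) {e : ι → Ω → ℝ}
    (he : ∀ i, MemLp (e i) 2 μ) (hind : ∀ i j, i ≠ j → IndepFun (e i) (e j) μ) :
    ∫ ω, (∑ i ∈ s, e i ω) ^ 2 ∂μ = ∑ i ∈ s, ∫ ω, e i ω ^ 2 ∂μ +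
      ∑ i ∈ s, ∑ j ∈ s.erase i, (∫ ω, e i ω ∂μ) * ∫ ω, e j ω ∂μ := by
  have hij : ∀ i j, Integrable (fun ω => e i ω * e j ω) μ := fun i j => (he i).integrable_mul (he j)
  simp_rw [sq, Finset.sum_mul_sum]
  rw [integral_finsetSum _ fun i _ => integrable_finsetSum _ fun j _ => hij i j,
    ← Finset.sum_add_distrib]
  refine Finset.sum_congr rfl fun i hi => ?_
  rw [integral_finsetSum _ fun j _ => hij i j, ← Finset.add_sum_erase _ _ hi]
  congr 1
  refine Finset.sum_congr rfl fun j hj => ?_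
  exact (hind i j (Finset.ne_of_mem_erase hj).symm).integral_fun_mul_eq_mul_integral
    (he i).aestronglyMeasurable (he j).aestronglyMeasurable

lemma integral_sum_sq_le_of_indep {Ω : Type*} {mΩ : MeasurableSpace Ω} {μ : Measure Ω}
    [IsProbabilityMeasure μ] {ι : Type*} [DecidableEq ι] (s : Finset ι) {e : ι → Ω → ℝ}
    (he : ∀ i, MemLp (e i) 2 μ) (hind : ∀ i j, i ≠ j → IndepFun (e i) (e j) μ) {p q : ι → ℝ} {E : ℝ}
    (hE : 0 ≤ E) (hq : ∀ i ∈ s, 0 ≤ q i) (hsq : ∀ i ∈ s, ∫ ω, e i ω ^ 2 ∂μ ≤ E * p i)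
    (hb : ∀ i ∈ s, |∫ ω, e i ω ∂μ| ≤ E * q i) :
    ∫ ω, (∑ i ∈ s, e i ω) ^ 2 ∂μ ≤ E * ∑ i ∈ s, p i + E ^ 2 * ∑ i ∈ s, ∑ j ∈ s.erase i, q i * q j := by
  rw [integral_sum_sq_of_indep s he hind, Finset.mul_sum, Finset.mul_sum]
  refine add_le_add (Finset.sum_le_sum hsq) (Finset.sum_le_sum fun i hi => ?_)
  rw [Finset.mul_sum]
  refine Finset.sum_le_sum fun j hj => ?_
  have hj := Finset.mem_of_mem_erase hj
  refine (le_abs_self _).trans ?_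
  rw [abs_mul]
  calc _ ≤ (E * q i) * (E * q j) :=
        mul_le_mul (hb i hi) (hb j hj) (abs_nonneg _) (mul_nonneg hE (hq i hi))
    _ = _ := by ring

lemma mse_eq_ofReal {Ω : Type*} [MeasurableSpace Ω] {μ : Measure Ω} [IsProbabilityMeasure μ]
    {X : Ω → ℝ} (hX : MemLp X 2 μ) (a : ℝ) :
    mse μ X a = ENNReal.ofReal (∫ ω, (X ω - a) ^ 2 ∂μ) := by
  exact (ofReal_integral_eq_lintegral_ofReal (hX.sub (memLp_const a)).integrable_sq
    (ae_of_all _ fun ω => sq_nonneg _)).symm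

/-- Changing the target of a mean square error. -/
lemma integral_sub_sq_le {Ω : Type*} {mΩ : MeasurableSpace Ω} {μ : Measure Ω}
    [IsProbabilityMeasure μ] {X : Ω → ℝ} (hX : MemLp X 2 μ) (a b : ℝ) :
    ∫ ω, (X ω - b) ^ 2 ∂μ ≤ 2 * ∫ ω, (X ω - a) ^ 2 ∂μ + 2 * (a - b) ^ 2 := by
  have hi : ∀ a, Integrable (fun ω => (X ω - a) ^ 2) μ := fun a =>
    (hX.sub (memLp_const a)).integrable_sq
  have hr : Integrable (fun ω => 2 * (X ω - a) ^ 2 + 2 * (a - b) ^ 2) μ :=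
    ((hi a).const_mul 2).add (integrable_const _)
  refine (integral_mono (hi b) hr fun ω => ?_).trans_eq ?_
  · change (X ω - b) ^ 2 ≤ 2 * (X ω - a) ^ 2 + 2 * (a - b) ^ 2
    nlinarith [sq_nonneg (X ω - a - (a - b))]
  · rw [integral_add ((hi a).const_mul 2) (integrable_const _), integral_const_mul]
    simp

lemma measurable_levelSigma_zero {Ω S₀ : Type*} {S : ℕ → Type*} [MeasurableSpace S₀]
    [∀ l, MeasurableSpace (S l)] (Z : ℕ → Ω → S₀) (X : ∀ l, ℕ → Ω → S l) (k : ℕ) :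
    Measurable[levelSigma Z X 0] (Z k) :=
  measurable_iff_comap_le.2 (le_iSup (fun k => MeasurableSpace.comap (Z k) inferInstance) k)

lemma measurable_levelSigma_succ {Ω S₀ : Type*} {S : ℕ → Type*} [MeasurableSpace S₀]
    [∀ l, MeasurableSpace (S l)] (Z : ℕ → Ω → S₀) (X : ∀ l, ℕ → Ω → S l) (l k : ℕ) :
    Measurable[levelSigma Z X (l + 1)] (X l k) :=
  measurable_iff_comap_le.2 (le_iSup (fun k => MeasurableSpace.comap (X l k) inferInstance) k)

namespace Model

variable {d T : ℕ} {Y : Type*} {m : Model d T Y} {φ : m.Θ → (Fin T → ℝ) → ℝ}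

lemma measurable_pmcmcEst (hm : m.Standing) (hφ : m.IsTestFunction φ) {Ω : Type*}
    [MeasurableSpace Ω] {l : ℕ} {Z : ℕ → Ω → m.State l} (hZ : ∀ k, Measurable (Z k)) (M : ℕ) :
    Measurable fun ω => m.pmcmcEst φ l M (fun k => Z k ω) := by
  have h0 : Measurable fun p : m.Θ × Path T l => φ p.1 (m.skeleton l p.1 p.2) :=
    hφ.measurable.comp (measurable_fst.prodMk (measurable_skeleton hm l measurable_fst
      measurable_snd))
  exact measurable_chainAvg hZ (measurable_comp_output h0) M

lemma measurable_incrEst (hm : m.Standing) (h₁ : m.Assumption1) (hφ : m.IsTestFunction φ)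
    {Ω : Type*} [MeasurableSpace Ω] {l : ℕ} {X : ℕ → Ω → m.State (l + 1)}
    (hX : ∀ k, Measurable (X k)) (M : ℕ) :
    Measurable fun ω => m.incrEst φ l M (fun k => X k ω) := by
  have hf : Measurable fun p : m.Θ × Path T (l + 1) =>
      φ p.1 (m.skeleton (l + 1) p.1 p.2) * m.weightFine l p.1 p.2 :=
    (hφ.measurable.comp (measurable_fst.prodMk (measurable_skeleton hm (l + 1) measurable_fst
      measurable_snd))).mul (measurable_weightFine hm h₁ l)
  have hc : Measurable fun p : m.Θ × Path T (l + 1) =>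
      φ p.1 (m.skeleton l p.1 p.2.coarsen) * m.weightCoarse l p.1 p.2 :=
    (hφ.measurable.comp (measurable_fst.prodMk (measurable_skeleton hm l measurable_fst
      ((measurable_coarsen l).comp measurable_snd)))).mul (measurable_weightCoarse hm h₁ l)
  exact ((measurable_chainAvg hX (measurable_comp_output hf) M).div
    (measurable_chainAvg hX (measurable_comp_output (measurable_weightFine hm h₁ l)) M)).sub
    ((measurable_chainAvg hX (measurable_comp_output hc) M).div
      (measurable_chainAvg hX (measurable_comp_output (measurable_weightCoarse hm h₁ l)) M))

lemma abs_pmcmcEst_le {R : ℝ} (hR : ∀ θ v, |φ θ v| ≤ R) (l M : ℕ) (z : ℕ → m.State l) :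
    |m.pmcmcEst φ l M z| ≤ R :=
  abs_chainAvg_le (X := fun k (_ : Unit) => z k)
    (f := fun x : m.State l => φ x.1 (m.skeleton l x.1 (pfOutput x.2))) (fun _ => hR _ _) M ()

variable {Ω : Type*} {mΩ : MeasurableSpace Ω} {P : Measure Ω} {W : ℝ≥0 → Ω → ℝ}
  {v : m.Θ → Ω → Fin T → ℝ} {e : m.Θ → Fin T → Ω → ℝ} {A B C D β : ℝ}

lemma StrongApprox.abs_incrEst_le (h : m.StrongApprox P W v e A B C β) {R : ℝ}
    (hR : ∀ θ v, |φ θ v| ≤ R) (l M : ℕ) (x : ℕ → m.State (l + 1)) :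
    |m.incrEst φ l M x| ≤ R / (A / B) ^ T + R / (A / B) ^ T := by
  have hc : 0 < (A / B) ^ T := pow_pos (div_pos h.A_pos (zero_lt_one.trans_le h.B_ge)) T
  have hR0 : 0 ≤ R := (abs_nonneg _).trans (hR (x 0).1 0)
  have key : ∀ {f w : m.State (l + 1) → ℝ}, (∀ x, |f x| ≤ R) → (∀ x, (A / B) ^ T ≤ w x ∧ w x ≤ 1) →
      |chainAvg (fun k (_ : Unit) => x k) (fun x => f x * w x) M () /
        chainAvg (fun k (_ : Unit) => x k) w M ()| ≤ R / (A / B) ^ T := by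
    intro f w hf hw
    have h1 := chainAvg_mono (X := fun k (_ : Unit) => x k) (fun x => (hw x).1) M ()
    rw [chainAvg_const] at h1
    have h2 : |chainAvg (fun k (_ : Unit) => x k) (fun x => f x * w x) M ()| ≤ R :=
      abs_chainAvg_le (fun x => by
        have := abs_mul_le_of_abs_le (hf x) (b := w x) (B := 1)
          (abs_le.2 ⟨by linarith [(hw x).1], (hw x).2⟩)
        linarith) M ()
    rw [abs_div, abs_of_pos (hc.trans_le h1)]
    exact div_le_div₀ hR0 h2 hc h1
  exact (abs_sub _ _).trans (add_le_add
    (key (f := fun x : m.State (l + 1) => φ x.1 (m.skeleton (l + 1) x.1 (pfOutput x.2)))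
      (w := fun x => m.weightFine l x.1 (pfOutput x.2)) (fun x => hR _ _)
      fun x => h.weightFine_bounds l _ _)
    (key (f := fun x : m.State (l + 1) => φ x.1 (m.skeleton l x.1 (pfOutput x.2).coarsen))
      (w := fun x => m.weightCoarse l x.1 (pfOutput x.2)) (fun x => hR _ _)
      fun x => h.weightCoarse_bounds l _ _))

/-- The error of the estimate at one level of the multilevel estimator. -/
noncomputable def levelError (m : Model d T Y) (φ : m.Θ → (Fin T → ℝ) → ℝ) {Ω : Type*} (M : ℕ → ℕ)
    (Z : ℕ → Ω → m.State 0) (X : ∀ l, ℕ → Ω → m.State (l + 1)) : ℕ → Ω → ℝ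
  | 0, ω => m.pmcmcEst φ 0 (M 0) (fun k => Z k ω) - m.postExp 0 φ
  | l + 1, ω => m.incrEst φ l (M (l + 1)) (fun k => X l k ω) - (m.postExp (l + 1) φ - m.postExp l φ)

/-- The increments of the posterior expectations telescope to the value at level `L`. -/
lemma sum_levelError {Ω : Type*} (L : ℕ) (M : ℕ → ℕ) (Z : ℕ → Ω → m.State 0)
    (X : ∀ l, ℕ → Ω → m.State (l + 1)) (ω : Ω) :
    ∑ l ∈ Finset.range (L + 1), m.levelError φ M Z X l ω =
      m.mlEst φ L M (fun k => Z k ω) (fun l k => X l k ω) - m.postExp L φ := by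
  rw [Finset.sum_range_succ']
  simp only [levelError, mlEst, Finset.sum_sub_distrib]
  rw [← Finset.sum_sub_distrib, Finset.sum_range_sub fun l => m.postExp l φ]
  ring

section Level

variable {Ω' : Type*} [MeasurableSpace Ω'] {μ : Measure Ω'}
  {Z : ℕ → Ω' → m.State 0} {X : ∀ l, ℕ → Ω' → m.State (l + 1)}

/-- Each error is measurable with respect to the σ-algebra of its own chain, and these are
independent. -/
lemma indepFun_levelError (hm : m.Standing) (h₁ : m.Assumption1) (hφ : m.IsTestFunction φ)
    (hind : iIndep (levelSigma Z X) μ) (M : ℕ → ℕ) {i j : ℕ} (hij : i ≠ j) :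
    IndepFun (m.levelError φ M Z X i) (m.levelError φ M Z X j) μ := by
  have hmeas : ∀ i, Measurable[levelSigma Z X i] (m.levelError φ M Z X i) := by
    rintro (_ | l)
    · let _ := levelSigma Z X 0
      exact (measurable_pmcmcEst hm hφ (measurable_levelSigma_zero Z X) (M 0)).sub_const _
    · let _ := levelSigma Z X (l + 1)
      exact (measurable_incrEst hm h₁ hφ (measurable_levelSigma_succ Z X l) (M (l + 1))).sub_const _
  have := hind.indep hij
  exact (indep_of_indep_of_le_left (indep_of_indep_of_le_right this
    (measurable_iff_comap_le.1 (hmeas j))) (measurable_iff_comap_le.1 (hmeas i)))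

lemma memLp_levelError [IsProbabilityMeasure μ] (h : m.StrongApprox P W v e A B C β) (hm : m.Standing) (h₁ : m.Assumption1)
    (hφ : m.IsTestFunction φ) (hZ : ∀ k, Measurable (Z k)) (hX : ∀ l k, Measurable (X l k))
    (M : ℕ → ℕ) (l : ℕ) : MemLp (m.levelError φ M Z X l) 2 μ := by
  obtain ⟨R, -, hR, -⟩ := hφ.exists_bounds
  rcases l with _ | l
  · exact (memLp_of_bounded μ (measurable_pmcmcEst hm hφ hZ (M 0))
      (fun ω => abs_pmcmcEst_le hR 0 (M 0) _) 2).sub (memLp_const _)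
  · exact (memLp_of_bounded μ (measurable_incrEst hm h₁ hφ (hX l) (M (l + 1)))
      (fun ω => h.abs_incrEst_le hR l (M (l + 1)) _) 2).sub (memLp_const _)

lemma memLp_mlEst [IsProbabilityMeasure μ] (h : m.StrongApprox P W v e A B C β) (hm : m.Standing) (h₁ : m.Assumption1)
    (hφ : m.IsTestFunction φ) (hZ : ∀ k, Measurable (Z k)) (hX : ∀ l k, Measurable (X l k)) (L : ℕ)
    (M : ℕ → ℕ) : MemLp (fun ω => m.mlEst φ L M (fun k => Z k ω) (fun l k => X l k ω)) 2 μ := by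
  have h1 := (memLp_finsetSum (Finset.range (L + 1)) fun l _ =>
    memLp_levelError (μ := μ) h hm h₁ hφ hZ hX M l).add (memLp_const (m.postExp L φ))
  refine h1.congr_norm ?_ (ae_of_all _ fun ω => ?_)
  · exact ((measurable_pmcmcEst hm hφ hZ (M 0)).add (Finset.measurable_sum _ fun l _ =>
      measurable_incrEst hm h₁ hφ (hX l) (M (l + 1)))).aestronglyMeasurable
  · congr 1
    change ∑ l ∈ Finset.range (L + 1), m.levelError φ M Z X l ω + m.postExp L φ = _
    rw [sum_levelError]
    ring

end Level

/-- The mean square error of the multilevel estimator. -/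
lemma StrongApprox.exists_mlEst_bound [IsProbabilityMeasure P] (h : m.StrongApprox P W v e A B C β)
    (hm : m.Standing) (h₁ : m.Assumption1) (hβ₀ : 0 < β) (hφ : m.IsTestFunction φ) (hD0 : 0 ≤ D)
    (hD : ∀ l, |m.postExp (l + 1) φ - m.postExp l φ| ≤ D * (stepSize l : ℝ) ^ β)
    (h₃ : m.Assumption3) : ∃ E : ℝ, 0 ≤ E ∧ ∀ {Ω' : Type*} [MeasurableSpace Ω'] (μ : Measure Ω')
      [IsProbabilityMeasure μ] (Z : ℕ → Ω' → m.State 0) (X : ∀ l, ℕ → Ω' → m.State (l + 1)),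
      IsStationaryChain μ (m.pmcmcKernel 0) Z → (∀ l, IsStationaryChain μ (m.coupledKernel l) (X l)) →
      iIndep (levelSigma Z X) μ → ∀ (L : ℕ) (M : ℕ → ℕ), (∀ l, l ≤ L → 1 ≤ M l) →
      ∫ ω, (m.mlEst φ L M (fun k => Z k ω) (fun l k => X l k ω) - m.postExp L φ) ^ 2 ∂μ ≤
        E * mseRate β L M := by
  obtain ⟨ξ, hξ₀, hξ₁, hmin₀, hmin⟩ := h₃
  obtain ⟨E₀, hE₀, h0⟩ := exists_average_bounds hm h₁ hφ hξ₀ hξ₁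
  obtain ⟨E₁, hE₁, h1⟩ := h.exists_increment_bounds hm h₁ hβ₀ hφ hD0 hD hξ₀ hξ₁
  -- The increment attached to level `l + 1` is bounded through `Δ_l = 2 Δ_{l+1}`, while the rate is
  -- stated with `Δ_{l+1}`; the factors `2 ^ β` and `(2 ^ β) ^ 2` make up for this in the bias and
  -- in the mean square.
  set E := E₀ + E₁ * (2 : ℝ) ^ β + E₁ * ((2 : ℝ) ^ β) ^ 2 with hE
  have h2β : 0 < (2 : ℝ) ^ β := Real.rpow_pos_of_pos two_pos β
  have hE0 : 0 ≤ E := by positivity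
  refine ⟨E + E ^ 2, by positivity, fun μ _ Z X hZ hX hind L M hM => ?_⟩
  have hΔ : ∀ l, 0 ≤ (stepSize l : ℝ) ^ β := fun l => Real.rpow_nonneg (coe_stepSize_pos l).le β
  have hstep : ∀ l, (stepSize l : ℝ) ^ β = 2 ^ β * (stepSize (l + 1) : ℝ) ^ β := fun l => by
    rw [← Real.mul_rpow zero_le_two (coe_stepSize_pos _).le, ← stepSize_add_mul l 1]
    push_cast
    rw [pow_one]
  have hinv : ∀ l ≤ L, 1 / ((M l : ℝ) + 1) ≤ 1 / M l := fun l hl => by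
    have : (1 : ℝ) ≤ M l := by exact_mod_cast hM l hl
    exact one_div_le_one_div_of_le (by linarith) (by linarith)
  have hsq : ∀ l ∈ Finset.range (L + 1), ∫ ω, m.levelError φ M Z X l ω ^ 2 ∂μ ≤
      E * ((stepSize l : ℝ) ^ (2 * β) / M l) := by
    intro l hl
    have hl := Nat.lt_succ_iff.1 (Finset.mem_range.1 hl)
    have e2 : (stepSize l : ℝ) ^ (2 * β) = ((stepSize l : ℝ) ^ β) ^ 2 := by
      rw [mul_comm, Real.rpow_mul (coe_stepSize_pos l).le, Real.rpow_two]
    rw [e2]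
    rcases l with _ | l
    · refine (h0 0 hmin₀ μ Z hZ (M 0)).1.trans ?_
      have : ((stepSize 0 : ℝ) ^ β) ^ 2 = 1 := by simp [stepSize]
      rw [this]
      have : E₀ ≤ E := by rw [hE]; linarith [mul_nonneg hE₁ h2β.le, mul_nonneg hE₁ (sq_nonneg ((2:ℝ) ^ β))]
      exact mul_le_mul this (hinv 0 hl) (by positivity) hE0
    · refine (h1 l (hmin l) μ (X l) (hX l) (M (l + 1))).1.trans ?_
      rw [hstep, mul_pow, mul_div_assoc, ← mul_assoc]
      refine mul_le_mul ?_ ?_ (by positivity) hE0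
      · rw [hE]; linarith [mul_nonneg hE₁ h2β.le]
      · rw [div_eq_mul_one_div, div_eq_mul_one_div _ (M (l + 1) : ℝ)]
        exact mul_le_mul_of_nonneg_left (hinv _ hl) (sq_nonneg _)
  have hb : ∀ l ∈ Finset.range (L + 1), |∫ ω, m.levelError φ M Z X l ω ∂μ| ≤
      E * ((stepSize l : ℝ) ^ β / M l) := by
    intro l hl
    have hl := Nat.lt_succ_iff.1 (Finset.mem_range.1 hl)
    rcases l with _ | l
    -- The average at level zero is unbiased because the chain is stationary.
    · have := (h0 0 hmin₀ μ Z hZ (M 0)).2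
      change |∫ ω, (m.pmcmcEst φ 0 (M 0) (fun k => Z k ω) - m.postExp 0 φ) ∂μ| ≤ _
      rw [this, abs_zero]
      exact mul_nonneg hE0 (div_nonneg (hΔ 0) (Nat.cast_nonneg _))
    · refine (h1 l (hmin l) μ (X l) (hX l) (M (l + 1))).2.trans ?_
      rw [hstep, mul_div_assoc, ← mul_assoc]
      refine mul_le_mul ?_ ?_ (div_nonneg (hΔ _) (by positivity)) hE0
      · rw [hE]; linarith [mul_nonneg hE₁ (sq_nonneg ((2:ℝ) ^ β))]
      · rw [div_eq_mul_one_div, div_eq_mul_one_div _ (M (l + 1) : ℝ)]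
        exact mul_le_mul_of_nonneg_left (hinv _ hl) (hΔ _)
  simp_rw [← sum_levelError]
  refine (integral_sum_sq_le_of_indep _ (memLp_levelError h hm h₁ hφ hZ.meas (fun l => (hX l).meas) M)
    (fun i j => indepFun_levelError hm h₁ hφ hind M) hE0
    (fun l _ => div_nonneg (hΔ l) (Nat.cast_nonneg _)) hsq hb).trans ?_
  unfold mseRate
  have hp : 0 ≤ ∑ l ∈ Finset.range (L + 1), (stepSize l : ℝ) ^ (2 * β) / M l :=
    Finset.sum_nonneg fun l _ => by positivity
  have hq : 0 ≤ ∑ l ∈ Finset.range (L + 1), ∑ q ∈ (Finset.range (L + 1)).erase l,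
      ((stepSize l : ℝ) ^ β / M l) * ((stepSize q : ℝ) ^ β / M q) :=
    Finset.sum_nonneg fun l _ => Finset.sum_nonneg fun q _ => by positivity
  nlinarith [mul_nonneg hE0 hq, mul_nonneg (sq_nonneg E) hp]

end Model

/-! ## Cost -/

/-- Each of the `2 ^ l` new values of the Volterra scheme is a sum over its whole past, up to `T * 2
^ l` terms. This is why the cost is quadratic in the inverse step size. -/
lemma stepCost_le {T l t : ℕ} (ht : t < T) : stepCost l t ≤ (T + 3) * 4 ^ l := by
  have h1 : ∑ k ∈ Finset.range (2 ^ l), (t * 2 ^ l + k + 1) ≤ 2 ^ l * (T * 2 ^ l) := by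
    have := Finset.sum_le_card_nsmul (Finset.range (2 ^ l)) (fun k => t * 2 ^ l + k + 1) (T * 2 ^ l)
      fun k hk => by
        have hk := Finset.mem_range.1 hk
        calc t * 2 ^ l + k + 1 ≤ (t + 1) * 2 ^ l := by rw [add_mul, one_mul]; omega
          _ ≤ T * 2 ^ l := Nat.mul_le_mul_right _ ht
    simpa using this
  have h2 : (2 : ℕ) ^ l ≤ 4 ^ l := Nat.pow_le_pow_left (by norm_num) l
  have h3 : 1 ≤ (4 : ℕ) ^ l := Nat.one_le_pow _ _ (by norm_num)
  have h4 : (2 : ℕ) ^ l * (T * 2 ^ l) = T * 4 ^ l := by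
    rw [show (4 : ℕ) = 2 * 2 by norm_num, mul_pow]; ring
  unfold stepCost
  rw [add_mul]
  omega

/-- The constant in the bounds for the cost of one iteration. -/
def costConst (d N T : ℕ) : ℕ := T * (N * (4 * T + N + 12)) + (8 + d + 4 * T)

lemma pmcmcCost_le (d N T l M : ℕ) : pmcmcCost d N T l M ≤ costConst d N T * ((M + 1) * 4 ^ l) := by
  have h2 : (2 : ℕ) ^ l ≤ 4 ^ l := Nat.pow_le_pow_left (by norm_num) l
  have h3 : 1 ≤ (4 : ℕ) ^ l := Nat.one_le_pow _ _ (by norm_num)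
  have hpf : pfCost N T l ≤ T * (N * (4 * T + N + 12)) * 4 ^ l := by
    have := Finset.sum_le_card_nsmul (Finset.range T) (fun t => N * (2 ^ l + stepCost l t) + 2 * N +
      N * (1 + N + (t + 1) * 2 ^ l)) (N * (4 * T + N + 12) * 4 ^ l) fun t ht => by
        have ht := Finset.mem_range.1 ht
        have hs := stepCost_le (l := l) ht
        have h5 : (t + 1) * 2 ^ l ≤ T * 4 ^ l := Nat.mul_le_mul ht h2
        have h6 : (1 + N + 2) * 1 ≤ (1 + N + 2) * 4 ^ l := Nat.mul_le_mul_left _ h3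
        calc _ = N * (2 ^ l + stepCost l t + (1 + N + 2) * 1 + (t + 1) * 2 ^ l) := by ring
          _ ≤ N * (4 ^ l + (T + 3) * 4 ^ l + (1 + N + 2) * 4 ^ l + T * 4 ^ l) := by gcongr
          _ = N * (2 * T + N + 7) * 4 ^ l := by ring
          _ ≤ _ := by gcongr <;> omega
    simpa [pfCost, mul_assoc] using this
  unfold pmcmcCost
  calc _ ≤ (M + 1) * (T * (N * (4 * T + N + 12)) * 4 ^ l + (7 + d) * 4 ^ l + T * 4 ^ l) := by
        refine Nat.mul_le_mul_left _ ?_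
        have h6 : (7 + d) * 1 ≤ (7 + d) * 4 ^ l := Nat.mul_le_mul_left _ h3
        have h7 : T * 2 ^ l ≤ T * 4 ^ l := Nat.mul_le_mul_left _ h2
        omega
    _ = (T * (N * (4 * T + N + 12)) + (7 + d + T)) * ((M + 1) * 4 ^ l) := by ring
    _ ≤ _ := by unfold costConst; gcongr <;> omega

lemma coupledCost_le (d N T l M : ℕ) :
    coupledCost d N T l M ≤ costConst d N T * ((M + 1) * 4 ^ (l + 1)) := by
  have h2 : (2 : ℕ) ^ (l + 1) ≤ 4 ^ (l + 1) := Nat.pow_le_pow_left (by norm_num) _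
  have h2' : (2 : ℕ) ^ l ≤ 4 ^ (l + 1) :=
    (Nat.pow_le_pow_right (by norm_num) (Nat.le_succ l)).trans h2
  have h4 : (4 : ℕ) ^ l ≤ 4 ^ (l + 1) := Nat.pow_le_pow_right (by norm_num) (Nat.le_succ l)
  have h3 : 1 ≤ (4 : ℕ) ^ (l + 1) := Nat.one_le_pow _ _ (by norm_num)
  have hpf : dpfCost N T l ≤ T * (N * (4 * T + N + 12)) * 4 ^ (l + 1) := by
    have := Finset.sum_le_card_nsmul (Finset.range T) (fun t =>
      N * (2 ^ (l + 1) + 2 ^ l + stepCost (l + 1) t + stepCost l t + 1) + 2 * N +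
        N * (1 + N + (t + 1) * (2 ^ (l + 1) + 2 ^ l))) (N * (4 * T + N + 12) * 4 ^ (l + 1))
      fun t ht => by
        have ht := Finset.mem_range.1 ht
        have hs := stepCost_le (l := l + 1) ht
        have hs' := (stepCost_le (l := l) ht).trans (Nat.mul_le_mul_left _ h4)
        have h5 : (t + 1) * (2 ^ (l + 1) + 2 ^ l) ≤ T * (4 ^ (l + 1) + 4 ^ (l + 1)) :=
          Nat.mul_le_mul ht (add_le_add h2 h2')
        have h6 : (2 + N + 2) * 1 ≤ (2 + N + 2) * 4 ^ (l + 1) := Nat.mul_le_mul_left _ h3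
        calc _ = N * (2 ^ (l + 1) + 2 ^ l + stepCost (l + 1) t + stepCost l t + (2 + N + 2) * 1 +
              (t + 1) * (2 ^ (l + 1) + 2 ^ l)) := by ring
          _ ≤ N * (4 ^ (l + 1) + 4 ^ (l + 1) + (T + 3) * 4 ^ (l + 1) + (T + 3) * 4 ^ (l + 1) +
              (2 + N + 2) * 4 ^ (l + 1) + T * (4 ^ (l + 1) + 4 ^ (l + 1))) := by gcongr
          _ = _ := by ring
    simpa [dpfCost, mul_assoc] using this
  unfold coupledCost
  calc _ ≤ (M + 1) * (T * (N * (4 * T + N + 12)) * 4 ^ (l + 1) + (8 + d + 2 * T) * 4 ^ (l + 1) +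
        T * (4 ^ (l + 1) + 4 ^ (l + 1))) := by
        refine Nat.mul_le_mul_left _ ?_
        have h6 : (8 + d + 2 * T) * 1 ≤ (8 + d + 2 * T) * 4 ^ (l + 1) := Nat.mul_le_mul_left _ h3
        have h7 : T * (2 ^ (l + 1) + 2 ^ l) ≤ T * (4 ^ (l + 1) + 4 ^ (l + 1)) :=
          Nat.mul_le_mul_left _ (add_le_add h2 h2')
        omega
    _ = _ := by unfold costConst; ring

lemma stepSize_rpow_neg_two (l : ℕ) : (stepSize l : ℝ) ^ (-2 : ℝ) = 4 ^ l := by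
  rw [coe_stepSize, Real.rpow_neg (by positivity), Real.inv_rpow (by positivity), inv_inv,
    Real.rpow_two, ← pow_mul, mul_comm, pow_mul]
  norm_num

/-- The factor two absorbs the initial state of each chain, `M_l + 1 ≤ 2 M_l`; this is where at
least one iteration per level is needed. -/
lemma mlCost_le (d N T L : ℕ) (M : ℕ → ℕ) (hM : ∀ l, l ≤ L → 1 ≤ M l) :
    (mlCost d N T L M : ℝ) ≤ 2 * costConst d N T *
      ∑ l ∈ Finset.range (L + 1), (stepSize l : ℝ) ^ (-2 : ℝ) * M l := by
  have h : mlCost d N T L M ≤ costConst d N T * ∑ l ∈ Finset.range (L + 1), (M l + 1) * 4 ^ l := by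
    rw [Finset.sum_range_succ', add_comm, mul_add, Finset.mul_sum]
    exact add_le_add (pmcmcCost_le _ _ _ _ _) (Finset.sum_le_sum fun l _ => coupledCost_le _ _ _ _ _)
  have h2 : ∑ l ∈ Finset.range (L + 1), (M l + 1) * 4 ^ l ≤
      2 * ∑ l ∈ Finset.range (L + 1), 4 ^ l * M l := by
    rw [Finset.mul_sum]
    refine Finset.sum_le_sum fun l hl => ?_
    have := hM l (Nat.lt_succ_iff.1 (Finset.mem_range.1 hl))
    calc (M l + 1) * 4 ^ l ≤ (M l + M l) * 4 ^ l := by gcongr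
      _ = _ := by ring
  have h3 := h.trans (Nat.mul_le_mul_left _ h2)
  simp_rw [stepSize_rpow_neg_two]
  have h4 : (mlCost d N T L M : ℝ) ≤
      costConst d N T * (2 * ∑ l ∈ Finset.range (L + 1), (4 : ℝ) ^ l * M l) := by
    exact_mod_cast h3
  linarith

/-! ## The choice of the parameters -/

/-- Negative powers of the step sizes grow geometrically, so the last term dominates; the constant
is chosen so that the induction closes with equality. -/
lemma sum_stepSize_rpow_neg_le {a : ℝ} (ha : 0 < a) (L : ℕ) :
    ∑ l ∈ Finset.range (L + 1), (stepSize l : ℝ) ^ (-a) ≤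
      (1 - (2 : ℝ) ^ (-a))⁻¹ * (stepSize L : ℝ) ^ (-a) := by
  have hq : (2 : ℝ) ^ (-a) < 1 := Real.rpow_lt_one_of_one_lt_of_neg one_lt_two (by linarith)
  have hq0 : 0 < (2 : ℝ) ^ (-a) := Real.rpow_pos_of_pos two_pos _
  have hpos : 0 < 1 - (2 : ℝ) ^ (-a) := by linarith
  induction L with
  | zero =>
    simp only [zero_add, Finset.sum_range_one]
    refine le_mul_of_one_le_left (Real.rpow_nonneg (coe_stepSize_pos 0).le _) ?_
    exact (one_le_inv₀ hpos).2 (by linarith)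
  | succ L ih =>
    rw [Finset.sum_range_succ]
    have e : (stepSize L : ℝ) ^ (-a) = 2 ^ (-a) * (stepSize (L + 1) : ℝ) ^ (-a) := by
      rw [← Real.mul_rpow zero_le_two (coe_stepSize_pos _).le, ← stepSize_add_mul L 1]
      push_cast
      rw [pow_one]
    rw [e] at ih
    refine (add_le_add ih le_rfl).trans_eq ?_
    field_simp
    ring

/-- Rounding the level up decreases the step size by a factor of at most two. -/
lemma stepSize_levelChoice {H ε : ℝ} (hH : 0 ≤ H) (hε₀ : 0 < ε) (hε₁ : ε < 1) :
    (stepSize (levelChoice H ε) : ℝ) ≤ ε ^ (2 / (2 * H + 1)) ∧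
      ε ^ (2 / (2 * H + 1)) ≤ 2 * stepSize (levelChoice H ε) := by
  have hH1 : 0 < 2 * H + 1 := by linarith
  set x := 2 * Real.logb 2 (1 / ε) / (2 * H + 1) with hx
  have hlog : 0 < Real.logb 2 (1 / ε) := Real.logb_pos one_lt_two (by rw [one_div]; exact (one_lt_inv₀ hε₀).2 hε₁)
  have hx0 : 0 ≤ x := by positivity
  have e : ε ^ (2 / (2 * H + 1)) = (2 : ℝ) ^ (-x) := by
    have h1 : (2 : ℝ) ^ (-Real.logb 2 (1 / ε)) = ε := by
      rw [Real.rpow_neg zero_le_two, Real.rpow_logb two_pos (by norm_num) (by positivity)]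
      simp
    nth_rw 1 [← h1]
    rw [← Real.rpow_mul zero_le_two, hx]
    congr 1
    ring
  have hL : (stepSize (levelChoice H ε) : ℝ) = (2 : ℝ) ^ (-(levelChoice H ε : ℝ)) := by
    rw [coe_stepSize, Real.rpow_neg zero_le_two, Real.rpow_natCast]
  rw [e, hL]
  constructor
  · exact Real.rpow_le_rpow_of_exponent_le one_le_two (neg_le_neg (Nat.le_ceil x))
  · have : (levelChoice H ε : ℝ) < x + 1 := Nat.ceil_lt_add_one hx0
    calc (2 : ℝ) ^ (-x) ≤ 2 ^ (1 + -(levelChoice H ε : ℝ)) :=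
          Real.rpow_le_rpow_of_exponent_le one_le_two (by linarith)
      _ = _ := by rw [Real.rpow_add two_pos, Real.rpow_one]

/-- Negative powers of the finest step size. -/
lemma stepSize_levelChoice_rpow_neg_le {H ε a : ℝ} (hH : 0 ≤ H) (hε₀ : 0 < ε) (hε₁ : ε < 1)
    (ha : 0 ≤ a) : (stepSize (levelChoice H ε) : ℝ) ^ (-a) ≤
      2 ^ a * ε ^ (-(2 * a / (2 * H + 1))) := by
  have h := (stepSize_levelChoice hH hε₀ hε₁).2
  have hD := coe_stepSize_pos (levelChoice H ε)
  set D := (stepSize (levelChoice H ε) : ℝ)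
  have h1 : (ε ^ (2 / (2 * H + 1)) / 2) ^ a ≤ D ^ a :=
    Real.rpow_le_rpow (by positivity) (by linarith) ha
  rw [Real.div_rpow (by positivity) zero_le_two, ← Real.rpow_mul hε₀.le] at h1
  have hp : 0 < ε ^ (2 / (2 * H + 1) * a) / 2 ^ a := by positivity
  have h2 := inv_anti₀ hp h1
  rw [Real.rpow_neg hD.le]
  refine h2.trans_eq ?_
  rw [inv_div, Real.rpow_neg hε₀.le, div_eq_mul_inv]
  congr 3
  ring

lemma stepSize_levelChoice_rpow_le {H ε : ℝ} (hH : 0 ≤ H) (hε₀ : 0 < ε) (hε₁ : ε < 1) :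
    (stepSize (levelChoice H ε) : ℝ) ^ (2 * (H + 1 / 2)) ≤ ε ^ 2 := by
  have h := Real.rpow_le_rpow (coe_stepSize_pos _).le (stepSize_levelChoice hH hε₀ hε₁).1
    (show 0 ≤ 2 * (H + 1 / 2) by linarith)
  rw [← Real.rpow_mul hε₀.le] at h
  refine h.trans_eq ?_
  rw [← Real.rpow_two]
  congr 1
  have : 2 * H + 1 ≠ 0 := by linarith
  field_simp

section Choice

variable {H ε : ℝ} (hH : 0 ≤ H) (hH' : H < 1 / 2) (hε₀ : 0 < ε) (hε₁ : ε < 1)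

lemma le_iterChoice (l : ℕ) : ε ^ (-2 : ℝ) * (stepSize l : ℝ) ^ ((2 * H + 3) / 2) *
    (stepSize (levelChoice H ε) : ℝ) ^ (H - 1 / 2) ≤ iterChoice H ε l := Nat.le_ceil _

include hε₀

lemma iterChoice_base_pos (l : ℕ) : 0 < ε ^ (-2 : ℝ) * (stepSize l : ℝ) ^ ((2 * H + 3) / 2) *
    (stepSize (levelChoice H ε) : ℝ) ^ (H - 1 / 2) := by
  have h1 := coe_stepSize_pos l
  have h2 := coe_stepSize_pos (levelChoice H ε)
  positivity

lemma one_le_iterChoice (l : ℕ) : 1 ≤ iterChoice H ε l :=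
  Nat.ceil_pos.2 (iterChoice_base_pos hε₀ l)

/-- Rounding up only helps in a denominator. The exponents `p = 2H + 1` and `p = H + 1/2` produce
the diagonal and the cross terms of the error. -/
lemma stepSize_rpow_div_iterChoice_le (l : ℕ) (p : ℝ) :
    (stepSize l : ℝ) ^ p / iterChoice H ε l ≤ ε ^ 2 *
      (stepSize (levelChoice H ε) : ℝ) ^ (1 / 2 - H) * (stepSize l : ℝ) ^ (p - (H + 3 / 2)) := by
  have h1 := coe_stepSize_pos l
  have h2 := coe_stepSize_pos (levelChoice H ε)
  refine (div_le_div_of_nonneg_left (by positivity) (iterChoice_base_pos hε₀ l)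
    (le_iterChoice l)).trans_eq ?_
  rw [Real.rpow_neg hε₀.le, Real.rpow_two, Real.rpow_sub h1,
    show H - 1 / 2 = -(1 / 2 - H) by ring, Real.rpow_neg h2.le,
    show (2 * H + 3) / 2 = H + 3 / 2 by ring]
  have := Real.rpow_pos_of_pos h2 (1 / 2 - H)
  have := Real.rpow_pos_of_pos h1 (H + 3 / 2)
  field_simp

include hH hH' hε₁

/-- The diagonal sum is geometric with ratio `2 ^ (1/2 - H)`, and its last term cancels the power of
`Δ_L` built into the choice. The sum of the biases is of order `ε ^ 2 Δ_L ^ (-(H + 1/2))`, hence of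
order `ε`, and the cross terms are at most its square. -/
lemma mseRate_iterChoice_le : mseRate (H + 1 / 2) (levelChoice H ε) (iterChoice H ε) ≤
    ((1 - (2 : ℝ) ^ (-(1 / 2 - H)))⁻¹ + 16) * ε ^ 2 := by
  set L := levelChoice H ε
  have hL := coe_stepSize_pos L
  have ha : 0 < 1 / 2 - H := by linarith
  have hDa : (stepSize L : ℝ) ^ (1 / 2 - H) * (stepSize L : ℝ) ^ (-(1 / 2 - H)) = 1 := by
    rw [← Real.rpow_add hL, add_neg_cancel, Real.rpow_zero]
  have h1 : ∑ l ∈ Finset.range (L + 1), (stepSize l : ℝ) ^ (2 * (H + 1 / 2)) / iterChoice H ε l ≤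
      (1 - (2 : ℝ) ^ (-(1 / 2 - H)))⁻¹ * ε ^ 2 := by
    calc _ ≤ ∑ l ∈ Finset.range (L + 1), ε ^ 2 * (stepSize L : ℝ) ^ (1 / 2 - H) *
          (stepSize l : ℝ) ^ (-(1 / 2 - H)) := Finset.sum_le_sum fun l _ => by
            refine (stepSize_rpow_div_iterChoice_le hε₀ l _).trans_eq ?_
            congr 2
            ring
      _ ≤ ε ^ 2 * (stepSize L : ℝ) ^ (1 / 2 - H) *
          ((1 - (2 : ℝ) ^ (-(1 / 2 - H)))⁻¹ * (stepSize L : ℝ) ^ (-(1 / 2 - H))) := by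
            rw [← Finset.mul_sum]
            exact mul_le_mul_of_nonneg_left (sum_stepSize_rpow_neg_le ha L) (by positivity)
      _ = (1 - (2 : ℝ) ^ (-(1 / 2 - H)))⁻¹ * ε ^ 2 *
          ((stepSize L : ℝ) ^ (1 / 2 - H) * (stepSize L : ℝ) ^ (-(1 / 2 - H))) := by ring
      _ = _ := by rw [hDa, mul_one]
  have hs0 : ∀ l, 0 ≤ (stepSize l : ℝ) ^ (H + 1 / 2) / iterChoice H ε l := fun l =>
    div_nonneg (Real.rpow_nonneg (coe_stepSize_pos l).le _) (Nat.cast_nonneg _)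
  set S := ∑ l ∈ Finset.range (L + 1), (stepSize l : ℝ) ^ (H + 1 / 2) / iterChoice H ε l with hS
  have hSb : S ≤ 2 * ε ^ 2 * (stepSize L : ℝ) ^ (-(H + 1 / 2)) := by
    calc S ≤ ∑ l ∈ Finset.range (L + 1), ε ^ 2 * (stepSize L : ℝ) ^ (1 / 2 - H) *
          (stepSize l : ℝ) ^ (-(1 : ℝ)) := Finset.sum_le_sum fun l _ => by
            refine (stepSize_rpow_div_iterChoice_le hε₀ l _).trans_eq ?_
            congr 2
            ring
      _ ≤ ε ^ 2 * (stepSize L : ℝ) ^ (1 / 2 - H) *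
          ((1 - (2 : ℝ) ^ (-(1 : ℝ)))⁻¹ * (stepSize L : ℝ) ^ (-(1 : ℝ))) := by
            rw [← Finset.mul_sum]
            exact mul_le_mul_of_nonneg_left (sum_stepSize_rpow_neg_le one_pos L) (by positivity)
      _ = 2 * ε ^ 2 * ((stepSize L : ℝ) ^ (1 / 2 - H) * (stepSize L : ℝ) ^ (-(1 : ℝ))) := by
            rw [Real.rpow_neg_one 2]
            ring
      _ = _ := by
            rw [← Real.rpow_add hL]
            congr 2
            ring
  have hS0 : 0 ≤ S := Finset.sum_nonneg fun l _ => hs0 l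
  -- Adding the nonnegative diagonal completes the cross sum to a square.
  have hcross : ∑ l ∈ Finset.range (L + 1), ∑ q ∈ (Finset.range (L + 1)).erase l,
      ((stepSize l : ℝ) ^ (H + 1 / 2) / iterChoice H ε l) *
        ((stepSize q : ℝ) ^ (H + 1 / 2) / iterChoice H ε q) ≤ S ^ 2 := by
    rw [sq, hS, Finset.sum_mul_sum]
    exact Finset.sum_le_sum fun l _ => Finset.sum_le_sum_of_subset_of_nonneg
      (Finset.erase_subset _ _) fun q _ _ => mul_nonneg (hs0 l) (hs0 q)
  have hS2 : S ^ 2 ≤ 16 * ε ^ 2 := by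
    have hD := stepSize_levelChoice_rpow_neg_le (a := 2 * (H + 1 / 2)) hH hε₀ hε₁ (by linarith)
    have hx : 2 * (2 * (H + 1 / 2)) / (2 * H + 1) = 2 := by
      have : 2 * H + 1 ≠ 0 := by linarith
      field_simp
    rw [hx, Real.rpow_neg hε₀.le, Real.rpow_two] at hD
    have h4 : (2 : ℝ) ^ (2 * (H + 1 / 2)) ≤ 4 := by
      calc (2 : ℝ) ^ (2 * (H + 1 / 2)) ≤ 2 ^ (2 : ℝ) :=
            Real.rpow_le_rpow_of_exponent_le one_le_two (by linarith)
        _ = 4 := by norm_num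
    have hsqD : ((stepSize L : ℝ) ^ (-(H + 1 / 2))) ^ 2 = (stepSize L : ℝ) ^ (-(2 * (H + 1 / 2))) := by
      rw [← Real.rpow_two, ← Real.rpow_mul hL.le]
      congr 1
      ring
    calc S ^ 2 ≤ (2 * ε ^ 2 * (stepSize L : ℝ) ^ (-(H + 1 / 2))) ^ 2 := pow_le_pow_left₀ hS0 hSb 2
      _ = 4 * ε ^ 4 * (stepSize L : ℝ) ^ (-(2 * (H + 1 / 2))) := by rw [mul_pow, hsqD]; ring
      _ ≤ 4 * ε ^ 4 * (4 * (ε ^ 2)⁻¹) := by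
          refine mul_le_mul_of_nonneg_left (hD.trans ?_) (by positivity)
          exact mul_le_mul_of_nonneg_right h4 (by positivity)
      _ = _ := by field_simp; ring
  unfold mseRate
  rw [add_mul]
  exact add_le_add h1 (hcross.trans hS2)

/-- Rounding up adds `∑ Δ_l ^ (-2)`, of order `Δ_L ^ (-2)`; the main part is of order `ε ^ (-2) Δ_L
^ (-(1 - 2H))`. Since `2 + 2 (1 - 2H) / (2H + 1) = 4 / (2H + 1)`, both are of the same order `ε ^
(-4 / (2H + 1))`. -/
lemma cost_iterChoice_le : ∑ l ∈ Finset.range (levelChoice H ε + 1),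
    (stepSize l : ℝ) ^ (-2 : ℝ) * iterChoice H ε l ≤
      (4 * (1 - (2 : ℝ) ^ (-(2 : ℝ)))⁻¹ + 2 * (1 - (2 : ℝ) ^ (-(1 / 2 - H)))⁻¹) *
        ε ^ (-(4 / (2 * H + 1))) := by
  set L := levelChoice H ε
  have hL := coe_stepSize_pos L
  have ha : 0 < 1 / 2 - H := by linarith
  have hH1 : 2 * H + 1 ≠ 0 := by linarith
  have hc : 0 < (1 - (2 : ℝ) ^ (-(1 / 2 - H)))⁻¹ := by
    have : (2 : ℝ) ^ (-(1 / 2 - H)) < 1 :=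
      Real.rpow_lt_one_of_one_lt_of_neg one_lt_two (by linarith)
    exact inv_pos.2 (by linarith)
  have hc2 : 0 < (1 - (2 : ℝ) ^ (-(2 : ℝ)))⁻¹ := by
    have : (2 : ℝ) ^ (-(2 : ℝ)) < 1 := Real.rpow_lt_one_of_one_lt_of_neg one_lt_two (by norm_num)
    exact inv_pos.2 (by linarith)
  have h1 : ∀ l, (stepSize l : ℝ) ^ (-2 : ℝ) * iterChoice H ε l ≤ (stepSize l : ℝ) ^ (-(2 : ℝ)) +
      ε ^ (-2 : ℝ) * (stepSize L : ℝ) ^ (-(1 / 2 - H)) * (stepSize l : ℝ) ^ (-(1 / 2 - H)) := by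
    intro l
    have hl := coe_stepSize_pos l
    have h : (iterChoice H ε l : ℝ) ≤ _ :=
      (Nat.ceil_lt_add_one (iterChoice_base_pos (H := H) hε₀ l).le).le
    refine (mul_le_mul_of_nonneg_left h (by positivity)).trans_eq ?_
    have e : (stepSize l : ℝ) ^ (-2 : ℝ) * (stepSize l : ℝ) ^ ((2 * H + 3) / 2) =
        (stepSize l : ℝ) ^ (-(1 / 2 - H)) := by
      rw [← Real.rpow_add hl]
      congr 1
      ring
    rw [← e, show H - 1 / 2 = -(1 / 2 - H) by ring]
    ring
  have hD2 := stepSize_levelChoice_rpow_neg_le (a := 2) hH hε₀ hε₁ zero_le_two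
  have hDa := stepSize_levelChoice_rpow_neg_le (a := 2 * (1 / 2 - H)) hH hε₀ hε₁ (by linarith)
  have h22 : (2 : ℝ) ^ (2 : ℝ) = 4 := by norm_num
  rw [h22, show (2 : ℝ) * 2 = 4 by norm_num] at hD2
  have h2a : (2 : ℝ) ^ (2 * (1 / 2 - H)) ≤ 2 := by
    calc (2 : ℝ) ^ (2 * (1 / 2 - H)) ≤ 2 ^ (1 : ℝ) :=
          Real.rpow_le_rpow_of_exponent_le one_le_two (by linarith)
      _ = 2 := Real.rpow_one 2
  have heps : ε ^ (-2 : ℝ) * ε ^ (-(2 * (2 * (1 / 2 - H)) / (2 * H + 1))) =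
      ε ^ (-(4 / (2 * H + 1))) := by
    rw [← Real.rpow_add hε₀]
    congr 1
    field_simp
    ring
  have hsqD : (stepSize L : ℝ) ^ (-(1 / 2 - H)) * (stepSize L : ℝ) ^ (-(1 / 2 - H)) =
      (stepSize L : ℝ) ^ (-(2 * (1 / 2 - H))) := by
    rw [← Real.rpow_add hL]
    congr 1
    ring
  calc _ ≤ ∑ l ∈ Finset.range (L + 1), ((stepSize l : ℝ) ^ (-(2 : ℝ)) +
        ε ^ (-2 : ℝ) * (stepSize L : ℝ) ^ (-(1 / 2 - H)) * (stepSize l : ℝ) ^ (-(1 / 2 - H))) :=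
        Finset.sum_le_sum fun l _ => h1 l
    _ ≤ (1 - (2 : ℝ) ^ (-(2 : ℝ)))⁻¹ * (stepSize L : ℝ) ^ (-(2 : ℝ)) +
        ε ^ (-2 : ℝ) * (stepSize L : ℝ) ^ (-(1 / 2 - H)) *
          ((1 - (2 : ℝ) ^ (-(1 / 2 - H)))⁻¹ * (stepSize L : ℝ) ^ (-(1 / 2 - H))) := by
        rw [Finset.sum_add_distrib, ← Finset.mul_sum]
        exact add_le_add (sum_stepSize_rpow_neg_le two_pos L)
          (mul_le_mul_of_nonneg_left (sum_stepSize_rpow_neg_le ha L) (by positivity))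
    _ = (1 - (2 : ℝ) ^ (-(2 : ℝ)))⁻¹ * (stepSize L : ℝ) ^ (-(2 : ℝ)) +
        (1 - (2 : ℝ) ^ (-(1 / 2 - H)))⁻¹ * (ε ^ (-2 : ℝ) *
          (stepSize L : ℝ) ^ (-(2 * (1 / 2 - H)))) := by rw [← hsqD]; ring
    _ ≤ (1 - (2 : ℝ) ^ (-(2 : ℝ)))⁻¹ * (4 * ε ^ (-(4 / (2 * H + 1)))) +
        (1 - (2 : ℝ) ^ (-(1 / 2 - H)))⁻¹ * (2 * ε ^ (-(4 / (2 * H + 1)))) := by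
        refine add_le_add (mul_le_mul_of_nonneg_left hD2 hc2.le)
          (mul_le_mul_of_nonneg_left ?_ hc.le)
        rw [← heps]
        calc _ ≤ ε ^ (-2 : ℝ) * (2 * ε ^ (-(2 * (2 * (1 / 2 - H)) / (2 * H + 1)))) := by
              refine mul_le_mul_of_nonneg_left (hDa.trans ?_) (by positivity)
              exact mul_le_mul_of_nonneg_right h2a (by positivity)
          _ = _ := by ring
    _ = _ := by ring

omit hH' in
lemma pmcmcCost_iterChoiceSingle_le (d N T : ℕ) :
    (pmcmcCost d N T (levelChoice H ε) (iterChoiceSingle ε) : ℝ) ≤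
      12 * costConst d N T * ε ^ (-(2 * (2 * H + 3) / (2 * H + 1))) := by
  have hH1 : 2 * H + 1 ≠ 0 := by linarith
  have h : (pmcmcCost d N T (levelChoice H ε) (iterChoiceSingle ε) : ℝ) ≤
      costConst d N T * ((iterChoiceSingle ε + 1) * 4 ^ levelChoice H ε) := by
    exact_mod_cast pmcmcCost_le d N T (levelChoice H ε) (iterChoiceSingle ε)
  have hD2 := stepSize_levelChoice_rpow_neg_le (a := 2) hH hε₀ hε₁ zero_le_two
  have h22 : (2 : ℝ) ^ (2 : ℝ) = 4 := by norm_num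
  rw [stepSize_rpow_neg_two, h22, show (2 : ℝ) * 2 = 4 by norm_num] at hD2
  have h1 : 1 ≤ ε ^ (-2 : ℝ) := Real.one_le_rpow_of_pos_of_le_one_of_nonpos hε₀ hε₁.le (by norm_num)
  have hM : (iterChoiceSingle ε : ℝ) + 1 ≤ 3 * ε ^ (-2 : ℝ) := by
    have := Nat.ceil_lt_add_one (Real.rpow_nonneg hε₀.le (-2 : ℝ))
    unfold iterChoiceSingle
    linarith
  have heps : ε ^ (-2 : ℝ) * ε ^ (-(4 / (2 * H + 1))) = ε ^ (-(2 * (2 * H + 3) / (2 * H + 1))) := by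
    rw [← Real.rpow_add hε₀]
    congr 1
    field_simp
    ring
  refine h.trans ?_
  rw [← heps]
  calc _ ≤ costConst d N T * ((3 * ε ^ (-2 : ℝ)) * (4 * ε ^ (-(4 / (2 * H + 1))))) := by gcongr
    _ = _ := by ring

end Choice

/-! ### Assembly of bias, mean square error and cost -/

namespace Model

variable {d T : ℕ} {Y : Type*} {m : Model d T Y} {φ : m.Θ → (Fin T → ℝ) → ℝ}
  {Ω : Type*} {mΩ : MeasurableSpace Ω} {P : Measure Ω} {ℱ : Filtration ℝ≥0 mΩ}
  {W : ℝ≥0 → Ω → ℝ} {V : m.Θ → ℝ≥0 → Ω → ℝ} {A B C β : ℝ}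

lemma sq_le_of_abs_le_stepSize {x D : ℝ} {l : ℕ} (h : |x| ≤ D * (stepSize l : ℝ) ^ β) :
    x ^ 2 ≤ D ^ 2 * (stepSize l : ℝ) ^ (2 * β) := by
  rw [mul_comm 2 β, Real.rpow_mul (coe_stepSize_pos l).le, Real.rpow_two, ← mul_pow]
  exact (le_abs_self _).trans (sq_le_sq_of_abs_le h)

/-- Both posterior expectations are compared with the same limit `a`; the coarser step size bounds
both errors. -/
lemma abs_postExp_succ_sub_le {a D : ℝ} (hβ₀ : 0 < β) (hD0 : 0 ≤ D)
    (hD : ∀ l, |m.postExp l φ - a| ≤ D * (stepSize l : ℝ) ^ β) (l : ℕ) :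
    |m.postExp (l + 1) φ - m.postExp l φ| ≤ 2 * D * (stepSize l : ℝ) ^ β := by
  have h1 := (hD (l + 1)).trans (mul_le_mul_of_nonneg_left (stepSize_rpow_antitone hβ₀.le l 1) hD0)
  have h2 := hD l
  rw [abs_sub_comm] at h2
  have := abs_sub_le (m.postExp (l + 1) φ) a (m.postExp l φ)
  linarith

end Model

end VolterraPMCMC

theorem mainTheorem3 {d T : ℕ} {Y : Type*} (m : VolterraPMCMC.Model d T Y)
    (hm : m.Standing) (h₁ : m.Assumption1)
    {Ω' : Type*} {mΩ' : MeasurableSpace Ω'} (P : MeasureTheory.Measure Ω')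
    [MeasureTheory.IsProbabilityMeasure P] (ℱ : MeasureTheory.Filtration ℝ≥0 mΩ')
    (W : ℝ≥0 → Ω' → ℝ) (hW : VolterraPMCMC.IsFilteredBrownian P ℱ W)
    (V : m.Θ → ℝ≥0 → Ω' → ℝ) (hV : m.IsSolution P ℱ W V)
    (β : ℝ) (hβ₀ : 0 < β) (hβ : β ≤ m.H + 1 / 2) (h₂ : m.Assumption2 P W V β)
    (φ : m.Θ → (Fin T → ℝ) → ℝ) (hφ : m.IsTestFunction φ) :
    -- the multilevel method
    (m.Assumption3 → ∃ C : ℝ, 0 < C ∧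
      -- the squared bias
      (∀ L : ℕ, (m.postExp L φ - m.exactPostExp P ℱ W V φ) ^ 2 ≤
        C * (VolterraPMCMC.stepSize L : ℝ) ^ (2 * β)) ∧
      -- the cost
      (∀ (L : ℕ) (M : ℕ → ℕ), (∀ l, l ≤ L → 1 ≤ M l) →
        (VolterraPMCMC.mlCost d m.N T L M : ℝ) ≤
          C * ∑ l ∈ Finset.range (L + 1), (VolterraPMCMC.stepSize l : ℝ) ^ (-2 : ℝ) * M l) ∧
      ∀ {Ω : Type*} [MeasurableSpace Ω] (μ : MeasureTheory.Measure Ω)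
        [MeasureTheory.IsProbabilityMeasure μ]
        (Z : ℕ → Ω → m.State 0) (X : ∀ l, ℕ → Ω → m.State (l + 1)),
        VolterraPMCMC.IsStationaryChain μ (m.pmcmcKernel 0) Z →
        (∀ l, VolterraPMCMC.IsStationaryChain μ (m.coupledKernel l) (X l)) →
        ProbabilityTheory.iIndep (VolterraPMCMC.levelSigma Z X) μ →
        -- mean square errors for arbitrary numbers of iterations
        (∀ (L : ℕ) (M : ℕ → ℕ), (∀ l, l ≤ L → 1 ≤ M l) →
          VolterraPMCMC.mse μ (fun ω => m.mlEst φ L M (fun k => Z k ω) (fun l k => X l k ω))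
              (m.postExp L φ) ≤ ENNReal.ofReal (C * VolterraPMCMC.mseRate β L M) ∧
          VolterraPMCMC.mse μ (fun ω => m.mlEst φ L M (fun k => Z k ω) (fun l k => X l k ω))
              (m.exactPostExp P ℱ W V φ) ≤
            ENNReal.ofReal (C * (VolterraPMCMC.mseRate β L M +
              (VolterraPMCMC.stepSize L : ℝ) ^ (2 * β)))) ∧
        -- the complexity
        (β = m.H + 1 / 2 → ∀ ε : ℝ, 0 < ε → ε < 1 →
          VolterraPMCMC.mse μ (fun ω => m.mlEst φ (VolterraPMCMC.levelChoice m.H ε)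
              (VolterraPMCMC.iterChoice m.H ε) (fun k => Z k ω) (fun l k => X l k ω))
              (m.exactPostExp P ℱ W V φ) ≤ ENNReal.ofReal (C * ε ^ 2) ∧
          (VolterraPMCMC.mlCost d m.N T (VolterraPMCMC.levelChoice m.H ε)
              (VolterraPMCMC.iterChoice m.H ε) : ℝ) ≤ C * ε ^ (-(4 / (2 * m.H + 1))))) ∧
    -- the single-level method
    (m.Assumption3Single → β = m.H + 1 / 2 → ∃ C : ℝ, 0 < C ∧
      ∀ {Ω : Type*} [MeasurableSpace Ω] (μ : MeasureTheory.Measure Ω)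
        [MeasureTheory.IsProbabilityMeasure μ] (Z : ∀ l, ℕ → Ω → m.State l),
        (∀ l, VolterraPMCMC.IsStationaryChain μ (m.pmcmcKernel l) (Z l)) →
        ∀ ε : ℝ, 0 < ε → ε < 1 →
          VolterraPMCMC.mse μ (fun ω => m.pmcmcEst φ (VolterraPMCMC.levelChoice m.H ε)
              (VolterraPMCMC.iterChoiceSingle ε)
              (fun k => Z (VolterraPMCMC.levelChoice m.H ε) k ω))
              (m.exactPostExp P ℱ W V φ) ≤ ENNReal.ofReal (C * ε ^ 2) ∧
          (VolterraPMCMC.pmcmcCost d m.N T (VolterraPMCMC.levelChoice m.H ε)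
              (VolterraPMCMC.iterChoiceSingle ε) : ℝ) ≤
            C * ε ^ (-(2 * (2 * m.H + 3) / (2 * m.H + 1)))) ∧
    -- the exponents at `H = 0.4`
    (m.H = 2 / 5 → 4 / (2 * m.H + 1) = 20 / 9 ∧
      2 * (2 * m.H + 3) / (2 * m.H + 1) = 38 / 9) := by
  obtain ⟨A, B, C₀, h⟩ := VolterraPMCMC.Model.exists_strongApprox hm h₁ hW hV hβ₀ hβ h₂
  obtain ⟨D, hD0, hD⟩ := h.exists_bias_bound hβ₀ hm h₁ hφ
  have hbias : ∀ L, (m.postExp L φ - m.exactPostExp P ℱ W V φ) ^ 2 ≤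
      D ^ 2 * (VolterraPMCMC.stepSize L : ℝ) ^ (2 * β) := fun L =>
    VolterraPMCMC.Model.sq_le_of_abs_le_stepSize (hD L)
  have hΔ : ∀ L, 0 ≤ (VolterraPMCMC.stepSize L : ℝ) ^ (2 * β) := fun L =>
    Real.rpow_nonneg (VolterraPMCMC.coe_stepSize_pos L).le _
  have hH := hm.H_nonneg
  have hH' := hm.H_lt
  set κ : ℝ := (VolterraPMCMC.costConst d m.N T : ℝ)
  have hκ0 : 0 ≤ κ := Nat.cast_nonneg _
  refine ⟨fun h₃ => ?_, fun h₃ hβH => ?_, fun hH => ?_⟩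
  · obtain ⟨E, hE0, hE⟩ := h.exists_mlEst_bound hm h₁ hβ₀ hφ (by positivity)
      (VolterraPMCMC.Model.abs_postExp_succ_sub_le hβ₀ hD0 hD) h₃
    have hg₁ : 0 < (1 - (2 : ℝ) ^ (-(1 / 2 - m.H)))⁻¹ := by
      have : (2 : ℝ) ^ (-(1 / 2 - m.H)) < 1 :=
        Real.rpow_lt_one_of_one_lt_of_neg one_lt_two (by linarith)
      exact inv_pos.2 (by linarith)
    have hg₂ : 0 < (1 - (2 : ℝ) ^ (-(2 : ℝ)))⁻¹ := by
      have : (2 : ℝ) ^ (-(2 : ℝ)) < 1 := Real.rpow_lt_one_of_one_lt_of_neg one_lt_two (by norm_num)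
      exact inv_pos.2 (by linarith)
    set G₁ := (1 - (2 : ℝ) ^ (-(1 / 2 - m.H)))⁻¹ + 16
    set G₂ := 4 * (1 - (2 : ℝ) ^ (-(2 : ℝ)))⁻¹ + 2 * (1 - (2 : ℝ) ^ (-(1 / 2 - m.H)))⁻¹
    have hG₁ : 1 ≤ G₁ := by linarith
    have hG₂ : 0 < G₂ := add_pos (mul_pos four_pos hg₂) (mul_pos two_pos hg₁)
    have hEG : E ≤ E * G₁ := le_mul_of_one_le_right hE0 hG₁
    have hκG : 0 ≤ κ * G₂ := by positivity
    -- One constant has to serve all claims, so the constants of the bias, the cost, the mean square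
    -- error and the two complexity bounds are added up.
    refine ⟨1 + 2 * D ^ 2 + 2 * κ + 2 * (E * G₁) + 2 * (κ * G₂), by positivity, fun L => ?_,
      fun L M hM => ?_, fun {Ω} _ μ _ Z X hZ hX hind => ?_⟩
    · exact (hbias L).trans (mul_le_mul_of_nonneg_right (by nlinarith) (hΔ L))
    · refine (VolterraPMCMC.mlCost_le d m.N T L M hM).trans (mul_le_mul_of_nonneg_right
        (by nlinarith) (Finset.sum_nonneg fun l _ => ?_))
      exact mul_nonneg (Real.rpow_nonneg (VolterraPMCMC.coe_stepSize_pos l).le _)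
        (Nat.cast_nonneg _)
    · have hL2 := fun L M => VolterraPMCMC.Model.memLp_mlEst (μ := μ) h hm h₁ hφ hZ.meas
        (fun l => (hX l).meas) L M
      have hR0 : ∀ L M, 0 ≤ VolterraPMCMC.mseRate β L M := fun L M => by
        have hs : ∀ (l : ℕ) (p : ℝ), 0 ≤ (VolterraPMCMC.stepSize l : ℝ) ^ p / M l := fun l p =>
          div_nonneg (Real.rpow_nonneg (VolterraPMCMC.coe_stepSize_pos l).le _) (Nat.cast_nonneg _)
        exact add_nonneg (Finset.sum_nonneg fun l _ => hs l _) (Finset.sum_nonneg fun l _ =>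
          Finset.sum_nonneg fun q _ => mul_nonneg (hs l _) (hs q _))
      have hexact : ∀ (L : ℕ) (M : ℕ → ℕ), (∀ l, l ≤ L → 1 ≤ M l) →
          ∫ ω, (m.mlEst φ L M (fun k => Z k ω) (fun l k => X l k ω) -
            m.exactPostExp P ℱ W V φ) ^ 2 ∂μ ≤ 2 * E * VolterraPMCMC.mseRate β L M +
              2 * D ^ 2 * (VolterraPMCMC.stepSize L : ℝ) ^ (2 * β) := fun L M hM => by
        have h1 := VolterraPMCMC.integral_sub_sq_le (hL2 L M) (m.postExp L φ)
          (m.exactPostExp P ℱ W V φ)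
        have h2 := hE μ Z X hZ hX hind L M hM
        have h3 := hbias L
        linarith
      refine ⟨fun L M hM => ⟨?_, ?_⟩, fun hβH ε hε₀ hε₁ => ⟨?_, ?_⟩⟩
      · rw [VolterraPMCMC.mse_eq_ofReal (hL2 L M)]
        refine ENNReal.ofReal_le_ofReal ((hE μ Z X hZ hX hind L M hM).trans ?_)
        exact mul_le_mul_of_nonneg_right (by nlinarith) (hR0 L M)
      · rw [VolterraPMCMC.mse_eq_ofReal (hL2 L M)]
        refine ENNReal.ofReal_le_ofReal ((hexact L M hM).trans ?_)
        rw [mul_add]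
        exact add_le_add (mul_le_mul_of_nonneg_right (by nlinarith) (hR0 L M))
          (mul_le_mul_of_nonneg_right (by nlinarith) (hΔ L))
      · rw [VolterraPMCMC.mse_eq_ofReal (hL2 _ _)]
        refine ENNReal.ofReal_le_ofReal ((hexact _ _ fun l _ =>
          VolterraPMCMC.one_le_iterChoice hε₀ l).trans ?_)
        have h1 := VolterraPMCMC.mseRate_iterChoice_le hH hH' hε₀ hε₁
        have h2 := VolterraPMCMC.stepSize_levelChoice_rpow_le hH hε₀ hε₁
        rw [← hβH] at h1 h2
        calc _ ≤ 2 * E * (G₁ * ε ^ 2) + 2 * D ^ 2 * ε ^ 2 := by gcongr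
          _ = (2 * D ^ 2 + 2 * (E * G₁)) * ε ^ 2 := by ring
          _ ≤ _ := mul_le_mul_of_nonneg_right (by linarith) (sq_nonneg ε)
      · refine (VolterraPMCMC.mlCost_le d m.N T _ _ fun l _ =>
          VolterraPMCMC.one_le_iterChoice hε₀ l).trans ?_
        have h1 := VolterraPMCMC.cost_iterChoice_le hH hH' hε₀ hε₁
        calc _ ≤ 2 * κ * (G₂ * ε ^ (-(4 / (2 * m.H + 1)))) :=
              mul_le_mul_of_nonneg_left h1 (by positivity)
          _ = (2 * (κ * G₂)) * ε ^ (-(4 / (2 * m.H + 1))) := by ring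
          _ ≤ _ := mul_le_mul_of_nonneg_right (by nlinarith) (Real.rpow_nonneg hε₀.le _)
  · obtain ⟨ξ, hξ₀, hξ₁, hmin⟩ := h₃
    obtain ⟨E, hE0, hE⟩ := VolterraPMCMC.Model.exists_average_bounds hm h₁ hφ hξ₀ hξ₁
    obtain ⟨R, -, hR, -⟩ := hφ.exists_bounds
    refine ⟨1 + 2 * E + 2 * D ^ 2 + 12 * κ, by positivity, fun {Ω} _ μ _ Z hZ ε hε₀ hε₁ => ⟨?_, ?_⟩⟩
    · have hL2 := VolterraPMCMC.memLp_of_bounded μ (VolterraPMCMC.Model.measurable_pmcmcEst hm hφ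
        (hZ (VolterraPMCMC.levelChoice m.H ε)).meas (VolterraPMCMC.iterChoiceSingle ε))
        (fun ω => VolterraPMCMC.Model.abs_pmcmcEst_le hR _ _ _) 2
      rw [VolterraPMCMC.mse_eq_ofReal hL2]
      refine ENNReal.ofReal_le_ofReal ?_
      have h1 := VolterraPMCMC.integral_sub_sq_le hL2
        (m.postExp (VolterraPMCMC.levelChoice m.H ε) φ) (m.exactPostExp P ℱ W V φ)
      have h2 := (hE _ (hmin _) μ _ (hZ (VolterraPMCMC.levelChoice m.H ε))
        (VolterraPMCMC.iterChoiceSingle ε)).1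
      have h3 := hbias (VolterraPMCMC.levelChoice m.H ε)
      have h4 := VolterraPMCMC.stepSize_levelChoice_rpow_le hH hε₀ hε₁
      rw [← hβH] at h4
      -- At least `ε ^ (-2)` iterations bring the variance down to the order `ε ^ 2`, which the
      -- squared bias has already reached by the choice of the level.
      have h5 : 1 / ((VolterraPMCMC.iterChoiceSingle ε : ℝ) + 1) ≤ ε ^ 2 := by
        have : ε ^ (-2 : ℝ) ≤ VolterraPMCMC.iterChoiceSingle ε := Nat.le_ceil _
        rw [Real.rpow_neg hε₀.le, Real.rpow_two] at this
        rw [one_div]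
        exact inv_le_of_inv_le₀ (by positivity) (by linarith)
      have h6 := mul_le_mul_of_nonneg_left h5 hE0
      have h7 := mul_le_mul_of_nonneg_left h4 (sq_nonneg D)
      have h8 : 0 ≤ (1 + 12 * κ) * ε ^ 2 := by positivity
      linarith
    · refine (VolterraPMCMC.pmcmcCost_iterChoiceSingle_le hH hε₀ hε₁ d m.N T).trans ?_
      exact mul_le_mul_of_nonneg_right (by nlinarith) (Real.rpow_nonneg hε₀.le _)
  · rw [hH]
    norm_num
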